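/- **Setting.** Fix $n\in\mathbb{N}$ and $\lambda\in\mathbb{R}$. Write $e(t)=e^{2\pi i t}$, $\bar e(t)=e^{-2\pi it}$, let $\beta$ be the usual inner product on $\mathbb{R}^n$, and $\eta_\lambda(r)=\frac{e^{2\lambda r}-1}{2\lambda}$ (with $\eta_0(r)=r$). Let $\mathcal H=L^2(\mathbb{R}^n\times\mathbb{R}^n\times\mathbb{R})$ with variables $(x,y,r)$, and realize $\mathcal H^{\otimes k}$ as $L^2$ of the $k$-fold product. On $\mathcal H\otimes\mathcal H$ and $\mathcal H$ consider the unitaries $$U_A\xi(x,y,r;x',y',r')=(e^{-\lambda r'})^n\,\bar e\bigl[\eta_\lambda(r')\beta(e^{-\lambda r'}x,y'-e^{-\lambda r'}y)\bigr]\,\xi(e^{-\lambda r'}x,e^{-\lambda r'}y,r+r';x'-e^{-\lambda r'}x,y'-e^{-\lambda r'}y,r'),$$ $$j\xi(x,y,r)=(e^{\lambda r})^n\,\bar e[\eta_\lambda(r)\beta(x,y)]\,\xi(-e^{\lambda r}x,-e^{\lambda r}y,-r).$$ Let $\Sigma$ be the flip, $Y=\Sigma(j\otimes1)U_A(j\otimes1)\Sigma$,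 $X=\Sigma Y^*\Sigma$, $Z=Y^*(j\otimes j)Y(j\otimes j)$, and, in leg notation on $\mathcal H^{\otimes4}$, $V_D=Z_{12}Y_{24}Z_{12}^*X_{13}$. Let $A$, $\hat A^{\rm op}\subseteq\mathcal B(\mathcal H)$ and $A_D\subseteq\mathcal B(\mathcal H\otimes\mathcal H)$ be the $C^*$-algebras generated by the slices $(\omega\otimes\mathrm{id})(U_A)$, $(\mathrm{id}\otimes\omega)(X)$ ($\omega\in\mathcal B(\mathcal H)_*$) and $(\mathrm{id}\otimes\mathrm{id}\otimes\Omega)(V_D)$ ($\Omega\in\mathcal B(\mathcal H\otimes\mathcal H)_*$), respectively, with comultiplications $$\Delta(a)=U_A(a\otimes1)U_A^*,\qquad \hat\Delta(b)=X^*(1\otimes b)X,\qquad \Delta_D(x)=V_D^*(1\otimes1\otimes x)V_D ,$$ the last formula also defining $\Delta_D$ on the multiplier algebra $M(A_D)$. Tensor products of $C^*$-algebras are minimal, and multiplier algebras are realized on the same Hilbert spaces. Put $\pi(a)=Z(1\otimes a)Z^*$ for $a\in A$ and $\pi'(b)=b\otimes1$ for $b\in\hat A^{\rm op}$. Let $\mathcal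 A=\hat{\mathcal A}$ be the space of Schwartz functions of $(x,y,r)$ with compact support in $r$, represented on $\mathcal H$ by $$(L_f\xi)(x,y,r)=\int f(\tilde x,\tilde y,r)\,\bar e[\eta_\lambda(r)\beta(\tilde x,y-\tilde y)]\,\xi(x-\tilde x,y-\tilde y,r)\,d\tilde x\,d\tilde y,$$ $$(\lambda_\phi\xi)(x,y,r)=\int\phi(e^{\lambda\tilde r}x,e^{\lambda\tilde r}y,r-\tilde r)\,\xi(x,y,\tilde r)\,d\tilde r,$$ and let $\Pi:\hat{\mathcal A}\otimes\mathcal A\to\mathcal B(\mathcal H\otimes\mathcal H)$ (algebraic tensor product) be the linear map $\Pi(\phi\otimes f)=\pi'(\lambda_\phi)\pi(L_f)$. Write $\Delta f=\Delta(L_f)$ and $\hat\Delta\phi=\hat\Delta(\lambda_\phi)$. **Proposition.** 1. The maps $\pi:A\to M(A_D)$ and $\pi':\hat A^{\rm op}\to M(A_D)$ are $C^*$-bialgebra homomorphisms: they are nondegenerate ${}^*$-homomorphisms into $M(A_D)$, $\Delta$ and $\hat\Delta$ take values in $M(A\otimes A)$ and $M(\hat A^{\rm op}\otimes\hat A^{\rm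 op})$, and $$(\pi\otimes\pi)\circ\Delta=\Delta_D\circ\pi,\qquad(\pi'\otimes\pi')\circ\hat\Delta=\Delta_D\circ\pi',$$ where $\pi\otimes\pi:M(A\otimes A)\to M(A_D\otimes A_D)$ and $\pi'\otimes\pi':M(\hat A^{\rm op}\otimes\hat A^{\rm op})\to M(A_D\otimes A_D)$ are the (unique) extensions to unital ${}^*$-homomorphisms of the multiplier algebras. 2. For all $\phi\in\hat{\mathcal A}$ and $f\in\mathcal A$ one has $\lambda_\phi\in\hat A^{\rm op}$, $L_f\in A$, and $$\Delta_D\bigl(\Pi(\phi\otimes f)\bigr)=\bigl[(\pi'\otimes\pi')(\hat\Delta\phi)\bigr]\bigl[(\pi\otimes\pi)(\Delta f)\bigr].$$ 3. Moreover $\Delta_D(\Pi(\phi\otimes f))=(\Pi\otimes\Pi)\bigl(\sum\phi_{(1)}\otimes f_{(1)}\otimes\phi_{(2)}\otimes f_{(2)}\bigr)$, that is, $\Delta_D$ is the untwisted tensor product comultiplication, in the following sense. There are nets $t_i\in\hat{\mathcal A}\otimes\hat{\mathcal A}$ and $s_i\in\mathcal A\otimes\mathcal A$ (algebraic tensor products)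 such that $(\lambda\otimes\lambda)(t_i)$ and $(L\otimes L)(s_i)$ are bounded and converge strictly to $\hat\Delta\phi$ in $M(\hat A^{\rm op}\otimes\hat A^{\rm op})$ and to $\Delta f$ in $M(A\otimes A)$, respectively; and for all such nets, $(\Pi\otimes\Pi)(\sigma(t_i\otimes s_i))$ converges strictly to $\Delta_D(\Pi(\phi\otimes f))$ with respect to $A_D\otimes A_D$, where $\sigma(\phi_1\otimes\phi_2\otimes f_1\otimes f_2)=\phi_1\otimes f_1\otimes\phi_2\otimes f_2$. -/

import Mathlib

set_option linter.unusedSectionVars false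

open MeasureTheory Filter
open scoped TensorProduct ENNReal InnerProductSpace

namespace QDouble

/-- The complex Hilbert space `L²(α)`. -/
abbrev L2 (α : Type) [MeasureSpace α] : Type := Lp ℂ 2 (volume : Measure α)

/-- Bounded operators on a Hilbert space. -/
abbrev Op (H : Type) [NormedAddCommGroup H] [InnerProductSpace ℂ H] : Type := H →L[ℂ] H

section Tensor

variable {α β : Type} [MeasureSpace α] [MeasureSpace β]

theorem ae_fst {p : α → Prop} (h : ∀ᵐ a, p a) : ∀ᵐ q : α × β, p q.1 :=
  Measure.quasiMeasurePreserving_fst.ae h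

theorem ae_snd {p : β → Prop} (h : ∀ᵐ a, p a) : ∀ᵐ q : α × β, p q.2 :=
  Measure.quasiMeasurePreserving_snd.ae h

theorem memLp_tmul (ξ : L2 α) (η : L2 β) :
    MemLp (fun p : α × β => ξ p.1 * η p.2) 2 volume := by
  have h1 : AEStronglyMeasurable (fun p : α × β => ξ p.1 * η p.2) volume :=
    ((Lp.stronglyMeasurable ξ).comp_measurable measurable_fst).aestronglyMeasurable.mul
      ((Lp.stronglyMeasurable η).comp_measurable measurable_snd).aestronglyMeasurable
  rw [memLp_two_iff_integrable_sq_norm h1]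
  have := ((memLp_two_iff_integrable_sq_norm (Lp.aestronglyMeasurable ξ)).1 (Lp.memLp ξ)).mul_prod
    ((memLp_two_iff_integrable_sq_norm (Lp.aestronglyMeasurable η)).1 (Lp.memLp η))
  simp only [norm_mul, mul_pow]
  exact this

/-- The elementary tensor `(ξ ⊗ η)(a, b) = ξ(a) η(b)` in `L²(α) ⊗ L²(β) = L²(α × β)`. -/
noncomputable def tmul (ξ : L2 α) (η : L2 β) : L2 (α × β) :=
  (memLp_tmul ξ η).toLp _

theorem tmul_ae (ξ : L2 α) (η : L2 β) :
    tmul ξ η =ᵐ[volume] fun p : α × β => ξ p.1 * η p.2 := MemLp.coeFn_toLp _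

variable [SigmaFinite (volume : Measure α)] [SigmaFinite (volume : Measure β)]

theorem inner_tmul (ξ ξ' : L2 α) (η η' : L2 β) :
    ⟪tmul ξ η, tmul ξ' η'⟫_ℂ = ⟪ξ, ξ'⟫_ℂ * ⟪η, η'⟫_ℂ := by
  rw [L2.inner_def, L2.inner_def, L2.inner_def, ← integral_prod_mul]
  refine integral_congr_ae ?_
  filter_upwards [tmul_ae ξ η, tmul_ae ξ' η'] with p h1 h2
  simp [h1, h2]
  ring

/-- The canonical map of the algebraic tensor product into `L²(α × β)`. -/
noncomputable def tensorMap : L2 α ⊗[ℂ] L2 β →ₗ[ℂ] L2 (α × β) :=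
  TensorProduct.lift <| LinearMap.mk₂ ℂ tmul
    (fun ξ ξ' η => by
      apply Lp.ext
      filter_upwards [tmul_ae (ξ + ξ') η, tmul_ae ξ η, tmul_ae ξ' η,
        Lp.coeFn_add (tmul ξ η) (tmul ξ' η), ae_fst (Lp.coeFn_add ξ ξ')] with p h1 h2 h3 h4 h5
      rw [h1, h4, Pi.add_apply, h2, h3, h5, Pi.add_apply, add_mul])
    (fun c ξ η => by
      apply Lp.ext
      filter_upwards [tmul_ae (c • ξ) η, tmul_ae ξ η,
        Lp.coeFn_smul c (tmul ξ η), ae_fst (Lp.coeFn_smul c ξ)] with p h1 h2 h4 h5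
      simp [h1, h2, h4, h5, mul_assoc])
    (fun ξ η η' => by
      apply Lp.ext
      filter_upwards [tmul_ae ξ (η + η'), tmul_ae ξ η, tmul_ae ξ η',
        Lp.coeFn_add (tmul ξ η) (tmul ξ η'), ae_snd (Lp.coeFn_add η η')] with p h1 h2 h3 h4 h5
      rw [h1, h4, Pi.add_apply, h2, h3, h5, Pi.add_apply, mul_add])
    (fun c ξ η => by
      apply Lp.ext
      filter_upwards [tmul_ae ξ (c • η), tmul_ae ξ η,
        Lp.coeFn_smul c (tmul ξ η), ae_snd (Lp.coeFn_smul c η)] with p h1 h2 h4 h5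
      simp [h1, h2, h4, h5]
      ring)

@[simp] theorem tensorMap_tmul (ξ : L2 α) (η : L2 β) :
    tensorMap (ξ ⊗ₜ[ℂ] η) = tmul ξ η := rfl

theorem inner_tensorMap (z w : L2 α ⊗[ℂ] L2 β) :
    ⟪tensorMap z, tensorMap w⟫_ℂ = ⟪z, w⟫_ℂ := by
  induction z using TensorProduct.induction_on with
  | zero => simp
  | add z z' h h' => simp [inner_add_left, h, h']
  | tmul ξ η =>
    induction w using TensorProduct.induction_on with
    | zero => simp
    | add w w' h h' => simp only [map_add, inner_add_right, h, h']
    | tmul ξ' η' => simp [inner_tmul]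

theorem norm_tensorMap (z : L2 α ⊗[ℂ] L2 β) : ‖tensorMap z‖ = ‖z‖ := by
  rw [@norm_eq_sqrt_re_inner ℂ, @norm_eq_sqrt_re_inner ℂ _ _ _ _ z, inner_tensorMap]

theorem denseRange_tensorMap :
    DenseRange (tensorMap : L2 α ⊗[ℂ] L2 β →ₗ[ℂ] L2 (α × β)) := by
  have key : (LinearMap.range (tensorMap : L2 α ⊗[ℂ] L2 β →ₗ[ℂ] L2 (α × β))).topologicalClosure
      = ⊤ := by
    rw [Submodule.topologicalClosure_eq_top_iff, Submodule.eq_bot_iff]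
    intro h hh
    have hh0 : ∀ ξ η, ⟪tmul ξ η, h⟫_ℂ = 0 := fun ξ η =>
      (Submodule.mem_orthogonal _ _).1 hh _ ⟨ξ ⊗ₜ η, rfl⟩
    have rect : ∀ (s : Set α) (t : Set β), MeasurableSet s → MeasurableSet t →
        volume s ≠ ∞ → volume t ≠ ∞ → ∫ p in s ×ˢ t, h p = 0 := by
      intro s t hs ht hs' ht'
      have := hh0 (indicatorConstLp 2 hs hs' 1) (indicatorConstLp 2 ht ht' 1)
      rw [L2.inner_def] at this
      rw [← integral_indicator (hs.prod ht), ← this]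
      refine integral_congr_ae ?_
      filter_upwards [tmul_ae (indicatorConstLp 2 hs hs' (1 : ℂ)) (indicatorConstLp 2 ht ht' 1),
        ae_fst (indicatorConstLp_coeFn (p := 2) (hs := hs) (hμs := hs') (c := (1 : ℂ))),
        ae_snd (indicatorConstLp_coeFn (p := 2) (hs := ht) (hμs := ht') (c := (1 : ℂ)))]
        with p h1 h2 h3
      by_cases hp1 : p.1 ∈ s <;> by_cases hp2 : p.2 ∈ t <;>
        simp [h1, h2, h3, Set.indicator, hp1, hp2, Set.mem_prod]
    have hint : ∀ s : Set (α × β), MeasurableSet s → volume s < ∞ → IntegrableOn h s :=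
      fun s _ hs' => integrableOn_Lp_of_measure_ne_top h (by norm_num) hs'.ne
    let S := spanningSets (volume : Measure α)
    let T := spanningSets (volume : Measure β)
    let R : ℕ → Set (α × β) := fun n => S n ×ˢ T n
    have hRm : ∀ n, MeasurableSet (R n) := fun n =>
      (measurableSet_spanningSets _ n).prod (measurableSet_spanningSets _ n)
    have hRf : ∀ n, volume (R n) < ∞ := fun n => by
      rw [Measure.volume_eq_prod, Measure.prod_prod]
      exact ENNReal.mul_lt_top (measure_spanningSets_lt_top _ n) (measure_spanningSets_lt_top _ n)
    have hRmono : Monotone R := fun m n hmn =>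
      Set.prod_mono (monotone_spanningSets _ hmn) (monotone_spanningSets _ hmn)
    have hRu : ⋃ n, R n = Set.univ := by
      ext ⟨a, b⟩
      simp only [Set.mem_iUnion, Set.mem_univ, iff_true]
      refine ⟨max (spanningSetsIndex volume a) (spanningSetsIndex volume b), ?_, ?_⟩
      · exact monotone_spanningSets _ (le_max_left _ _) (mem_spanningSetsIndex _ a)
      · exact monotone_spanningSets _ (le_max_right _ _) (mem_spanningSetsIndex _ b)
    have hall : ∀ (n : ℕ) (s : Set (α × β)), MeasurableSet s → ∫ p in s ∩ R n, h p = 0 := by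
      intro n
      have hI : IntegrableOn h (R n) := hint _ (hRm n) (hRf n)
      refine MeasurableSpace.induction_on_inter generateFrom_prod.symm isPiSystem_prod
        (by simp) ?_ ?_ ?_
      · rintro _ ⟨s, hs, t, ht, rfl⟩
        rw [Set.prod_inter_prod]
        exact rect _ _ (MeasurableSet.inter hs (measurableSet_spanningSets _ n))
          (MeasurableSet.inter ht (measurableSet_spanningSets _ n))
          ((measure_mono Set.inter_subset_right).trans_lt (measure_spanningSets_lt_top _ n)).ne
          ((measure_mono Set.inter_subset_right).trans_lt (measure_spanningSets_lt_top _ n)).ne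
      · intro t ht h0
        have h1 : ∫ p in R n, h p = 0 :=
          rect _ _ (measurableSet_spanningSets _ n) (measurableSet_spanningSets _ n)
            (measure_spanningSets_lt_top _ n).ne (measure_spanningSets_lt_top _ n).ne
        have h2 := integral_inter_add_sdiff (s := R n) ht hI
        rw [Set.inter_comm, h0, h1, zero_add] at h2
        rwa [Set.inter_comm, ← Set.sdiff_eq]
      · intro f hd hm h0
        rw [Set.iUnion_inter, integral_iUnion (fun i => (hm i).inter (hRm n))
          (fun i j hij => (hd hij).mono Set.inter_subset_left Set.inter_subset_left)
          (hI.mono_set (Set.iUnion_subset fun i => Set.inter_subset_right))]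
        simp [h0]
    have : h =ᵐ[volume] 0 := by
      refine Lp.ae_eq_zero_of_forall_setIntegral_eq_zero h (by norm_num) (by norm_num) hint ?_
      intro s hs hs'
      have hlim := tendsto_setIntegral_of_monotone (μ := volume) (f := h)
        (s := fun n => s ∩ R n) (fun n => hs.inter (hRm n))
        (fun m n hmn => Set.inter_subset_inter_right _ (hRmono hmn))
        ((hint s hs hs').mono_set (Set.iUnion_subset fun i => Set.inter_subset_left))
      rw [← Set.inter_iUnion, hRu, Set.inter_univ] at hlim
      exact tendsto_nhds_unique hlim (by simp [hall _ s hs])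
    exact (Lp.eq_zero_iff_ae_eq_zero).2 this
  rw [DenseRange, ← LinearMap.coe_range, Submodule.dense_iff_topologicalClosure_eq_top, key]

end Tensor

section Bound

variable {E F G : Type} [NormedAddCommGroup E] [InnerProductSpace ℂ E] [CompleteSpace E]
  [NormedAddCommGroup F] [InnerProductSpace ℂ F] [CompleteSpace F]

theorem inner_map_adjoint (T : Op E) (S : Op F) (z w : E ⊗[ℂ] F) :
    ⟪TensorProduct.map T.toLinearMap S.toLinearMap z, w⟫_ℂ =
      ⟪z, TensorProduct.map (star T).toLinearMap (star S).toLinearMap w⟫_ℂ := by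
  induction z using TensorProduct.induction_on with
  | zero => simp
  | add z z' h h' => simp only [map_add, inner_add_left, h, h']
  | tmul ξ η =>
    induction w using TensorProduct.induction_on with
    | zero => simp
    | add w w' h h' => simp only [map_add, inner_add_right, h, h']
    | tmul ξ' η' =>
      simp [ContinuousLinearMap.star_eq_adjoint, ContinuousLinearMap.adjoint_inner_right]

theorem norm_map_id_sq (V : Op F) (z : E ⊗[ℂ] F) :
    ((‖TensorProduct.map (1 : Op E).toLinearMap V.toLinearMap z‖ ^ 2 : ℝ) : ℂ) =
      ⟪z, TensorProduct.map (1 : Op E).toLinearMap (star V * V).toLinearMap z⟫_ℂ := by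
  have h1 := inner_map_adjoint (1 : Op E) V z
      (TensorProduct.map (1 : Op E).toLinearMap V.toLinearMap z)
  have h2 := inner_self_eq_norm_sq_to_K (𝕜 := ℂ)
      (TensorProduct.map (1 : Op E).toLinearMap V.toLinearMap z)
  push_cast
  refine h2.symm.trans (h1.trans ?_)
  rw [← LinearMap.comp_apply, ← TensorProduct.map_comp, star_one]
  rfl

theorem norm_map_id_le (S : Op F) (z : E ⊗[ℂ] F) :
    ‖TensorProduct.map (1 : Op E).toLinearMap S.toLinearMap z‖ ≤ ‖S‖ * ‖z‖ := by
  have h1 : star S * S ≤ algebraMap ℝ (Op F) (‖S‖ ^ 2) := by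
    have := IsSelfAdjoint.le_algebraMap_norm_self (a := star S * S) (IsSelfAdjoint.star_mul_self S)
    rwa [CStarRing.norm_star_mul_self, ← sq] at this
  obtain ⟨R, hR⟩ := CStarAlgebra.nonneg_iff_eq_star_mul_self.1 (sub_nonneg.2 h1)
  have e1 := norm_map_id_sq (E := E) R z
  have e2 : TensorProduct.map (1 : Op E).toLinearMap (star R * R).toLinearMap z +
        TensorProduct.map (1 : Op E).toLinearMap (star S * S).toLinearMap z =
      ((‖S‖ ^ 2 : ℝ) : ℂ) • z := by
    rw [← LinearMap.add_apply, ← TensorProduct.map_add_right]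
    have : (star R * R).toLinearMap + (star S * S).toLinearMap =
        ((‖S‖ ^ 2 : ℝ) : ℂ) • LinearMap.id := by
      rw [← hR]
      ext v
      simp [Algebra.algebraMap_eq_smul_one]
      rw [← Complex.ofReal_pow, Complex.coe_smul]
    rw [this, TensorProduct.map_smul_right, LinearMap.smul_apply]
    congr 1
    have : (1 : Op E).toLinearMap = LinearMap.id := rfl
    rw [this, TensorProduct.map_id]; rfl
  have e3 := congrArg (fun w => ⟪z, w⟫_ℂ) e2
  have e4 := norm_map_id_sq (E := E) S z
  have e5 := inner_self_eq_norm_sq_to_K (𝕜 := ℂ) z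
  have e6 : ⟪z, ((‖S‖ ^ 2 : ℝ) : ℂ) • z⟫_ℂ = ((‖S‖ ^ 2 : ℝ) : ℂ) * ((‖z‖ ^ 2 : ℝ) : ℂ) := by
    refine (inner_smul_right z z _).trans ?_
    rw [e5]; push_cast; rfl
  have e7 : ‖TensorProduct.map (1 : Op E).toLinearMap R.toLinearMap z‖ ^ 2 +
      ‖TensorProduct.map (1 : Op E).toLinearMap S.toLinearMap z‖ ^ 2 = ‖S‖ ^ 2 * ‖z‖ ^ 2 := by
    have := (inner_add_right (𝕜 := ℂ) z _ _).symm.trans (e3.trans e6)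
    rw [← Complex.ofReal_inj]
    push_cast at this e1 e4 ⊢
    rw [e1, e4]
    exact this
  refine le_of_sq_le_sq ?_ (by positivity)
  nlinarith [sq_nonneg ‖TensorProduct.map (1 : Op E).toLinearMap R.toLinearMap z‖]

theorem norm_map_le (T : Op E) (S : Op F) (z : E ⊗[ℂ] F) :
    ‖TensorProduct.map T.toLinearMap S.toLinearMap z‖ ≤ ‖T‖ * ‖S‖ * ‖z‖ := by
  have h1 : TensorProduct.map T.toLinearMap S.toLinearMap z =
      TensorProduct.comm ℂ F E (TensorProduct.map (1 : Op F).toLinearMap T.toLinearMap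
        (TensorProduct.comm ℂ E F
          (TensorProduct.map (1 : Op E).toLinearMap S.toLinearMap z))) := by
    induction z using TensorProduct.induction_on with
    | zero => simp
    | add z z' h h' => simp only [map_add, h, h']
    | tmul ξ η => simp
  rw [h1, TensorProduct.norm_comm, mul_assoc]
  refine (norm_map_id_le T _).trans ?_
  rw [TensorProduct.norm_comm]
  exact mul_le_mul_of_nonneg_left (norm_map_id_le S z) (norm_nonneg T)

end Bound

section OpTensor

variable {α β : Type} [MeasureSpace α] [MeasureSpace β]
  [SigmaFinite (volume : Measure α)] [SigmaFinite (volume : Measure β)]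

/-- The tensor product `T ⊗ S` of bounded operators, as a bounded operator on `L²(α × β)`:
the continuous extension of `ξ ⊗ η ↦ T ξ ⊗ S η`. -/
noncomputable def opTensor (T : Op (L2 α)) (S : Op (L2 β)) : Op (L2 (α × β)) :=
  (tensorMap ∘ₗ TensorProduct.map T.toLinearMap S.toLinearMap).extendOfNorm tensorMap

theorem opTensor_tmul (T : Op (L2 α)) (S : Op (L2 β)) (ξ : L2 α) (η : L2 β) :
    opTensor T S (tmul ξ η) = tmul (T ξ) (S η) := by
  refine (LinearMap.extendOfNorm_eq denseRange_tensorMap ⟨‖T‖ * ‖S‖, fun z => ?_⟩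
    (ξ ⊗ₜ[ℂ] η)).trans ?_
  · rw [LinearMap.comp_apply, norm_tensorMap, norm_tensorMap]
    exact norm_map_le T S z
  · simp

theorem op_ext {T S : Op (L2 (α × β))} (h : ∀ ξ η, T (tmul ξ η) = S (tmul ξ η)) : T = S := by
  refine ContinuousLinearMap.coeFn_injective
    (denseRange_tensorMap.equalizer T.continuous S.continuous (funext fun z => ?_))
  simp only [Function.comp_apply]
  induction z using TensorProduct.induction_on with
  | zero => simp
  | add z z' h h' => simp only [map_add, h, h']
  | tmul ξ η => exact h ξ η

theorem tmul_add_left (ξ ξ' : L2 α) (η : L2 β) : tmul (ξ + ξ') η = tmul ξ η + tmul ξ' η := by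
  simp only [← tensorMap_tmul, TensorProduct.add_tmul, map_add]

theorem tmul_add_right (ξ : L2 α) (η η' : L2 β) : tmul ξ (η + η') = tmul ξ η + tmul ξ η' := by
  simp only [← tensorMap_tmul, TensorProduct.tmul_add, map_add]

theorem tmul_smul_left (c : ℂ) (ξ : L2 α) (η : L2 β) : tmul (c • ξ) η = c • tmul ξ η := by
  rw [← tensorMap_tmul, ← TensorProduct.smul_tmul', map_smul, tensorMap_tmul]

theorem tmul_smul_right (c : ℂ) (ξ : L2 α) (η : L2 β) : tmul ξ (c • η) = c • tmul ξ η := by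
  simp only [← tensorMap_tmul, TensorProduct.tmul_smul, map_smul]

/-- `opTensor` as a bilinear map. -/
noncomputable def opTensorₗ : Op (L2 α) →ₗ[ℂ] Op (L2 β) →ₗ[ℂ] Op (L2 (α × β)) :=
  LinearMap.mk₂ ℂ opTensor
    (fun _ _ _ => op_ext fun _ _ => by simp [opTensor_tmul, tmul_add_left])
    (fun _ _ _ => op_ext fun _ _ => by simp [opTensor_tmul, tmul_smul_left])
    (fun _ _ _ => op_ext fun _ _ => by simp [opTensor_tmul, tmul_add_right])
    (fun _ _ _ => op_ext fun _ _ => by simp [opTensor_tmul, tmul_smul_right])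

/-- For linear maps `R : M → B(L²(α))` and `S : N → B(L²(β))`, the linear map `R ⊗ S` on the
algebraic tensor product `M ⊗ N`, with values in `B(L²(α × β))`. -/
noncomputable def tensorRep {M N : Type} [AddCommGroup M] [Module ℂ M] [AddCommGroup N]
    [Module ℂ N] (R : M →ₗ[ℂ] Op (L2 α)) (S : N →ₗ[ℂ] Op (L2 β)) :
    M ⊗[ℂ] N →ₗ[ℂ] Op (L2 (α × β)) :=
  TensorProduct.lift (opTensorₗ.compl₁₂ R S)

end OpTensor

section Formula

variable {α : Type} [MeasureSpace α]

/-- The bounded operator on `L²(α)` given by a pointwise formula. -/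
noncomputable def opOfFormula (F : (α → ℂ) → α → ℂ)
    (h : ∃ T : Op (L2 α), ∀ ξ : L2 α, T ξ =ᵐ[volume] F ξ) : Op (L2 α) :=
  h.choose

theorem opOfFormula_ae (F : (α → ℂ) → α → ℂ)
    (h : ∃ T : Op (L2 α), ∀ ξ : L2 α, T ξ =ᵐ[volume] F ξ) (ξ : L2 α) :
    opOfFormula F h ξ =ᵐ[volume] F ξ := h.choose_spec ξ

/-- A weighted composition `ξ ↦ w · (ξ ∘ T)` that preserves `L²`-norms is a bounded operator. -/
theorem exists_wcomp (w : α → ℂ) (T : α → α) (hw : Measurable w) (hT : Measurable T)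
    (hn : ∀ g : α → ℝ≥0∞, Measurable g → ∫⁻ p, ‖w p‖ₑ ^ 2 * g (T p) = ∫⁻ p, g p)
    (hw0 : ∀ p, w p ≠ 0) :
    ∃ V : Op (L2 α), ∀ ξ : L2 α, V ξ =ᵐ[volume] fun p => w p * ξ (T p) := by
  have hnull : Measure.QuasiMeasurePreserving T volume volume := by
    refine ⟨hT, Measure.AbsolutelyContinuous.mk fun s hs h0 => ?_⟩
    rw [Measure.map_apply hT hs]
    have h1 := hn (s.indicator 1) (measurable_one.indicator hs)
    have hm : Measurable fun p => ‖w p‖ₑ ^ 2 * s.indicator (1 : α → ℝ≥0∞) (T p) :=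
      (hw.enorm.pow_const 2).mul ((measurable_one.indicator hs).comp hT)
    rw [lintegral_indicator_one hs, h0, lintegral_eq_zero_iff hm] at h1
    refine measure_mono_null (fun p hp => ?_) (ae_iff.1 h1)
    simp only [Set.mem_ofPred_eq, Pi.zero_apply, mul_eq_zero, not_or]
    refine ⟨pow_ne_zero 2 (enorm_ne_zero.2 (hw0 p)), ?_⟩
    simp [Set.indicator_of_mem (show T p ∈ s from hp)]
  have hsm : ∀ ξ : L2 α, AEStronglyMeasurable (fun p => w p * ξ (T p)) volume := fun ξ =>
    hw.aestronglyMeasurable.mul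
      ((Lp.stronglyMeasurable ξ).comp_measurable hT).aestronglyMeasurable
  have hnorm : ∀ ξ : L2 α, eLpNorm (fun p => w p * ξ (T p)) 2 volume = eLpNorm ξ 2 volume := by
    intro ξ
    rw [eLpNorm_eq_lintegral_rpow_enorm_toReal (by norm_num) (by norm_num),
      eLpNorm_eq_lintegral_rpow_enorm_toReal (by norm_num) (by norm_num)]
    congr 1
    have := hn (fun p => ‖ξ p‖ₑ ^ 2) ((Lp.stronglyMeasurable ξ).measurable.enorm.pow_const 2)
    simpa [enorm_mul, mul_pow] using this
  have hm : ∀ ξ : L2 α, MemLp (fun p => w p * ξ (T p)) 2 volume := fun ξ =>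
    ⟨hsm ξ, by rw [hnorm]; exact Lp.eLpNorm_lt_top ξ⟩
  refine ⟨LinearMap.mkContinuous ⟨⟨fun ξ => (hm ξ).toLp _, fun ξ η => ?_⟩, fun c ξ => ?_⟩ 1
    fun ξ => ?_, fun ξ => (hm ξ).coeFn_toLp⟩
  · apply Lp.ext
    filter_upwards [(hm (ξ + η)).coeFn_toLp, (hm ξ).coeFn_toLp, (hm η).coeFn_toLp,
      Lp.coeFn_add ((hm ξ).toLp _) ((hm η).toLp _), hnull.ae (Lp.coeFn_add ξ η)]
      with p h1 h2 h3 h4 h5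
    rw [h1, h4, Pi.add_apply, h2, h3, h5, Pi.add_apply, mul_add]
  · apply Lp.ext
    filter_upwards [(hm (c • ξ)).coeFn_toLp, (hm ξ).coeFn_toLp,
      Lp.coeFn_smul c ((hm ξ).toLp _), hnull.ae (Lp.coeFn_smul c ξ)] with p h1 h2 h3 h4
    simp only [RingHom.id_apply]
    rw [h1, h3, Pi.smul_apply, h2, h4, Pi.smul_apply, smul_eq_mul, smul_eq_mul]
    ring
  · simp only [LinearMap.coe_mk, AddHom.coe_mk, one_mul]
    rw [Lp.norm_toLp, hnorm, Lp.norm_def]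

variable [SigmaFinite (volume : Measure α)] {G : Type} [MeasureSpace G]
  [SigmaFinite (volume : Measure G)]

theorem lintegral_sq_le (k : α → G → ℂ) (T : α → G → α) (h : G → ℝ)
    (hT : Measurable (Function.uncurry T))
    (hT' : ∀ g, MeasurePreserving (fun p => T p g) volume volume)
    (hh : Integrable h) (hkh : ∀ p g, ‖k p g‖ ≤ h g) (ξ : L2 α) :
    ∫⁻ p, (∫⁻ g, ‖k p g * ξ (T p g)‖ₑ) ^ 2 ≤
      (∫⁻ g, ‖h g‖ₑ) ^ 2 * ∫⁻ p, ‖ξ p‖ₑ ^ 2 := by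
  set u : α → ℝ≥0∞ := fun p => ‖ξ p‖ₑ with hu
  have hum : Measurable u := (Lp.stronglyMeasurable ξ).measurable.enorm
  set H : G → ℝ≥0∞ := fun g => ‖hh.aestronglyMeasurable.mk h g‖ₑ with hH
  have hHm : Measurable H := hh.aestronglyMeasurable.stronglyMeasurable_mk.measurable.enorm
  have hHe : ∀ᵐ g, ‖h g‖ₑ = H g := by
    filter_upwards [hh.aestronglyMeasurable.ae_eq_mk] with g hg
    simp only [hH, ← hg]
  have hTp : ∀ p, Measurable (fun g => T p g) := fun p => hT.comp measurable_prodMk_left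
  have step : ∀ p, (∫⁻ g, ‖k p g * ξ (T p g)‖ₑ) ^ 2 ≤
      (∫⁻ g, H g) * ∫⁻ g, H g * u (T p g) ^ 2 := by
    intro p
    have h1 : ∫⁻ g, ‖k p g * ξ (T p g)‖ₑ ≤ ∫⁻ g, (H g) ^ (1 / 2 : ℝ) *
        ((H g) ^ (1 / 2 : ℝ) * u (T p g)) := by
      refine lintegral_mono_ae ?_
      filter_upwards [hHe] with g hg
      rw [enorm_mul, ← mul_assoc, ← ENNReal.rpow_add_of_nonneg _ _ (by norm_num) (by norm_num)]
      norm_num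
      gcongr
      rw [← hg, enorm_le_iff_norm_le]
      exact (hkh p g).trans (le_abs_self _)
    have h2 := ENNReal.lintegral_mul_le_Lp_mul_Lq (volume : Measure G)
      Real.HolderConjugate.two_two
      (f := fun g => (H g) ^ (1 / 2 : ℝ)) (g := fun g => (H g) ^ (1 / 2 : ℝ) * u (T p g))
      (hHm.pow_const _).aemeasurable
      ((hHm.pow_const _).mul (hum.comp (hTp p))).aemeasurable
    have h3 := pow_le_pow_left' (h1.trans h2) 2
    refine h3.trans (le_of_eq ?_)
    rw [mul_pow, ← ENNReal.rpow_natCast, ← ENNReal.rpow_natCast, ← ENNReal.rpow_mul,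
      ← ENNReal.rpow_mul]
    norm_num
    congr 1
    · congr 1
      funext g
      rw [← ENNReal.rpow_natCast, ← ENNReal.rpow_mul]
      norm_num
    · congr 1
      funext g
      rw [mul_pow]
      congr 1
      rw [← ENNReal.rpow_natCast, ← ENNReal.rpow_mul]
      norm_num
  have hmeas : Measurable (Function.uncurry fun (p : α) (g : G) => H g * u (T p g) ^ 2) :=
    (hHm.comp measurable_snd).mul ((hum.comp hT).pow_const 2)
  calc ∫⁻ p, (∫⁻ g, ‖k p g * ξ (T p g)‖ₑ) ^ 2
      ≤ ∫⁻ p, (∫⁻ g, H g) * ∫⁻ g, H g * u (T p g) ^ 2 := lintegral_mono step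
    _ = (∫⁻ g, H g) * ∫⁻ p, ∫⁻ g, H g * u (T p g) ^ 2 :=
        lintegral_const_mul _ hmeas.lintegral_prod_right
    _ = (∫⁻ g, H g) * ∫⁻ g, ∫⁻ p, H g * u (T p g) ^ 2 := by
        rw [lintegral_lintegral_swap hmeas.aemeasurable]
    _ = (∫⁻ g, H g) * ∫⁻ g, H g * ∫⁻ p, u p ^ 2 := by
        congr 2
        funext g
        have hmg : Measurable fun p => u (T p g) ^ 2 :=
          (hum.comp (hT' g).measurable).pow_const 2
        rw [lintegral_const_mul _ hmg]
        congr 1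
        exact (hT' g).lintegral_comp (hum.pow_const 2)
    _ = (∫⁻ g, ‖h g‖ₑ) ^ 2 * ∫⁻ p, u p ^ 2 := by
        rw [lintegral_mul_const _ hHm, lintegral_congr_ae hHe]
        ring

theorem integrable_slice (k : α → G → ℂ) (T : α → G → α) (h : G → ℝ)
    (hk : Measurable (Function.uncurry k)) (hT : Measurable (Function.uncurry T))
    (hT' : ∀ g, MeasurePreserving (fun p => T p g) volume volume)
    (hh : Integrable h) (hkh : ∀ p g, ‖k p g‖ ≤ h g) (ξ : L2 α) :
    ∀ᵐ p, Integrable fun g => k p g * ξ (T p g) := by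
  have h1 := lintegral_sq_le k T h hT hT' hh hkh ξ
  have hξ : ∫⁻ p, ‖ξ p‖ₑ ^ 2 < ∞ := by
    have := (lintegral_rpow_enorm_lt_top_of_eLpNorm_lt_top (p := 2) (by norm_num) (by norm_num)
      (Lp.eLpNorm_lt_top ξ))
    simpa using this
  have h2 : (∫⁻ g, ‖h g‖ₑ) ^ 2 * ∫⁻ p, ‖ξ p‖ₑ ^ 2 < ∞ :=
    ENNReal.mul_lt_top (ENNReal.pow_lt_top hh.2) hξ
  have hmeas : Measurable fun q : α × G => k q.1 q.2 * ξ (T q.1 q.2) :=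
    hk.mul ((Lp.stronglyMeasurable ξ).measurable.comp hT)
  have h3 := ae_lt_top (μ := (volume : Measure α))
    (f := fun p => (∫⁻ g, ‖k p g * ξ (T p g)‖ₑ) ^ 2)
    ((hmeas.enorm.lintegral_prod_right').pow_const 2) (h1.trans_lt h2).ne
  filter_upwards [h3] with p hp
  refine ⟨(hmeas.comp measurable_prodMk_left).aestronglyMeasurable, ?_⟩
  by_contra hcon
  rw [hasFiniteIntegral_iff_enorm, not_lt, top_le_iff] at hcon
  rw [hcon] at hp
  simp at hp

/-- Integral operators `(V ξ)(p) = ∫ k(p, g) ξ(T(p, g)) dg` with measure preserving maps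
`T(·, g)` and a kernel dominated by an integrable function of `g` are bounded. -/
theorem exists_integralOp (k : α → G → ℂ) (T : α → G → α) (h : G → ℝ)
    (hk : Measurable (Function.uncurry k)) (hT : Measurable (Function.uncurry T))
    (hT' : ∀ g, MeasurePreserving (fun p => T p g) volume volume)
    (hh : Integrable h) (hkh : ∀ p g, ‖k p g‖ ≤ h g) :
    ∃ V : Op (L2 α), ∀ ξ : L2 α, V ξ =ᵐ[volume] fun p => ∫ g, k p g * ξ (T p g) := by
  have hsl := integrable_slice k T h hk hT hT' hh hkh
  have hmeas : ∀ ξ : L2 α, StronglyMeasurable fun q : α × G => k q.1 q.2 * ξ (T q.1 q.2) :=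
    fun ξ => (hk.mul ((Lp.stronglyMeasurable ξ).measurable.comp hT)).stronglyMeasurable
  have hsm : ∀ ξ : L2 α, AEStronglyMeasurable (fun p => ∫ g, k p g * ξ (T p g)) volume :=
    fun ξ => (hmeas ξ).integral_prod_right'.aestronglyMeasurable
  have hae : ∀ {P : α → Prop}, MeasurableSet {a | P a} → (∀ᵐ a, P a) →
      ∀ᵐ p : α, ∀ᵐ g : G, P (T p g) := by
    intro P hP h
    have : ∀ᵐ g : G, ∀ᵐ p : α, P (T p g) := ae_of_all _ fun g => (hT' g).quasiMeasurePreserving.ae h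
    exact (Measure.ae_ae_comm (p := fun p g => P (T p g)) (hT hP)).2 this
  have hnorm : ∀ ξ : L2 α, eLpNorm (fun p => ∫ g, k p g * ξ (T p g)) 2 volume ≤
      (∫⁻ g, ‖h g‖ₑ) * eLpNorm ξ 2 volume := by
    intro ξ
    rw [eLpNorm_eq_lintegral_rpow_enorm_toReal (by norm_num) (by norm_num),
      eLpNorm_eq_lintegral_rpow_enorm_toReal (by norm_num) (by norm_num)]
    have h1 : ∫⁻ p, ‖∫ g, k p g * ξ (T p g)‖ₑ ^ 2 ≤
        (∫⁻ g, ‖h g‖ₑ) ^ 2 * ∫⁻ p, ‖ξ p‖ₑ ^ 2 :=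
      (lintegral_mono fun p => pow_le_pow_left' (enorm_integral_le_lintegral_enorm _) 2).trans
        (lintegral_sq_le k T h hT hT' hh hkh ξ)
    have h2 := ENNReal.rpow_le_rpow h1 (z := 1 / 2) (by norm_num)
    rw [ENNReal.mul_rpow_of_nonneg _ _ (by norm_num)] at h2
    have h3 : ((∫⁻ g, ‖h g‖ₑ) ^ 2) ^ (1 / 2 : ℝ) = ∫⁻ g, ‖h g‖ₑ := by
      rw [← ENNReal.rpow_natCast, ← ENNReal.rpow_mul]; norm_num
    rw [h3] at h2
    simpa using h2
  have hfin : (∫⁻ g, ‖h g‖ₑ) < ∞ := hh.2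
  have hm : ∀ ξ : L2 α, MemLp (fun p => ∫ g, k p g * ξ (T p g)) 2 volume := fun ξ =>
    ⟨hsm ξ, (hnorm ξ).trans_lt (ENNReal.mul_lt_top hfin (Lp.eLpNorm_lt_top ξ))⟩
  refine ⟨LinearMap.mkContinuous ⟨⟨fun ξ => (hm ξ).toLp _, fun ξ η => ?_⟩, fun c ξ => ?_⟩
    (∫⁻ g, ‖h g‖ₑ).toReal fun ξ => ?_, fun ξ => (hm ξ).coeFn_toLp⟩
  · apply Lp.ext
    have hset : MeasurableSet {a | (ξ + η : L2 α) a = ξ a + η a} :=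
      measurableSet_eq_fun (Lp.stronglyMeasurable _).measurable
        ((Lp.stronglyMeasurable _).measurable.add (Lp.stronglyMeasurable _).measurable)
    filter_upwards [(hm (ξ + η)).coeFn_toLp, (hm ξ).coeFn_toLp, (hm η).coeFn_toLp,
      Lp.coeFn_add ((hm ξ).toLp _) ((hm η).toLp _), hae hset (Lp.coeFn_add ξ η), hsl ξ, hsl η]
      with p h1 h2 h3 h4 h5 h6 h7
    rw [h1, h4, Pi.add_apply, h2, h3, ← integral_add h6 h7]
    refine integral_congr_ae ?_
    filter_upwards [h5] with g hg
    rw [hg, mul_add]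
  · apply Lp.ext
    have hset : MeasurableSet {a | (c • ξ : L2 α) a = c * ξ a} :=
      measurableSet_eq_fun (Lp.stronglyMeasurable _).measurable
        ((Lp.stronglyMeasurable _).measurable.const_mul c)
    filter_upwards [(hm (c • ξ)).coeFn_toLp, (hm ξ).coeFn_toLp,
      Lp.coeFn_smul c ((hm ξ).toLp _), hae hset (Lp.coeFn_smul c ξ)] with p h1 h2 h3 h4
    simp only [RingHom.id_apply]
    rw [h1, h3, Pi.smul_apply, h2, smul_eq_mul, ← integral_const_mul]
    refine integral_congr_ae ?_
    filter_upwards [h4] with g hg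
    rw [hg]
    ring
  · simp only [LinearMap.coe_mk, AddHom.coe_mk]
    rw [Lp.norm_toLp, Lp.norm_def, ← ENNReal.toReal_mul]
    exact ENNReal.toReal_mono (ENNReal.mul_lt_top hfin (Lp.eLpNorm_lt_top ξ)).ne (hnorm ξ)

end Formula

section Concrete

/-- The space of points `(x, y, r)` with `x, y ∈ ℝⁿ` and `r ∈ ℝ`; its Hilbert space is
`ℋ = L²(Pt n)`. -/
abbrev Pt (n : ℕ) : Type := EuclideanSpace ℝ (Fin n) × EuclideanSpace ℝ (Fin n) × ℝ

noncomputable instance instMeasureSpacePt (n : ℕ) : MeasureSpace (Pt n) :=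
  Measure.prod.measureSpace

noncomputable instance instMeasureSpacePair (n : ℕ) : MeasureSpace (Pt n × Pt n) :=
  Measure.prod.measureSpace

instance instSigmaFinitePt (n : ℕ) : SigmaFinite (volume : Measure (Pt n)) := inferInstance

instance instSigmaFinitePair (n : ℕ) : SigmaFinite (volume : Measure (Pt n × Pt n)) :=
  inferInstance

/-- `e(t) = e^{2πit}`; the conjugate `ē(t)` is written `e (-t)`. -/
noncomputable def e (t : ℝ) : ℂ := Complex.exp (2 * Real.pi * t * Complex.I)

/-- `η_λ(r) = (e^{2λr} - 1) / (2λ)`, and `η_0(r) = r`. -/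
noncomputable def eta (lam r : ℝ) : ℝ :=
  if lam = 0 then r else (Real.exp (2 * lam * r) - 1) / (2 * lam)

theorem measurable_e : Measurable e := by
  unfold e; fun_prop

theorem norm_e (t : ℝ) : ‖e t‖ = 1 := by
  have : (2 * Real.pi * t * Complex.I : ℂ) = ((2 * Real.pi * t : ℝ) : ℂ) * Complex.I := by
    push_cast; ring
  rw [e, this, Complex.norm_exp_ofReal_mul_I]

theorem measurable_eta (lam : ℝ) : Measurable (eta lam) := by
  unfold eta
  split_ifs <;> fun_prop

instance instHaarPair (n : ℕ) : Measure.IsAddHaarMeasure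
    (volume : Measure (EuclideanSpace ℝ (Fin n) × EuclideanSpace ℝ (Fin n))) :=
  inferInstanceAs (Measure.IsAddHaarMeasure (Measure.prod volume volume))

instance instHaarLine (n : ℕ) : Measure.IsAddHaarMeasure
    (volume : Measure (EuclideanSpace ℝ (Fin n) × ℝ)) :=
  inferInstanceAs (Measure.IsAddHaarMeasure (Measure.prod volume volume))

instance instHaarPt (n : ℕ) : Measure.IsAddHaarMeasure (volume : Measure (Pt n)) :=
  Measure.prod.instIsAddHaarMeasure (volume : Measure (EuclideanSpace ℝ (Fin n)))
    (volume : Measure (EuclideanSpace ℝ (Fin n) × ℝ))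

theorem lintegral_triple {n : ℕ} (g : Pt n → ℝ≥0∞) (hg : Measurable g) :
    ∫⁻ p, g p = ∫⁻ r, ∫⁻ x, ∫⁻ y, g (x, y, r) := by
  rw [Measure.volume_eq_prod, lintegral_prod _ hg.aemeasurable]
  have h1 : ∀ x : EuclideanSpace ℝ (Fin n),
      ∫⁻ q : EuclideanSpace ℝ (Fin n) × ℝ, g (x, q) = ∫⁻ r, ∫⁻ y, g (x, y, r) := fun x => by
    rw [Measure.volume_eq_prod, lintegral_prod_symm _ (by fun_prop)]
  simp_rw [h1]
  refine lintegral_lintegral_swap (Measurable.aemeasurable ?_)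
  refine Measurable.lintegral_prod_right' (f := fun q :
    (EuclideanSpace ℝ (Fin n) × ℝ) × EuclideanSpace ℝ (Fin n) => g (q.1.1, q.2, q.1.2)) ?_
  fun_prop

theorem lintegral_scale {n : ℕ} (c : ℝ) (hc : c ≠ 0) (g : EuclideanSpace ℝ (Fin n) → ℝ≥0∞)
    (hg : Measurable g) :
    ENNReal.ofReal (|c| ^ n) * ∫⁻ x, g (c • x) = ∫⁻ x, g x := by
  have h1 := lintegral_map (μ := (volume : Measure (EuclideanSpace ℝ (Fin n)))) hg
    (measurable_const_smul c)
  rw [Measure.map_addHaar_smul _ hc, lintegral_smul_measure] at h1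
  rw [← h1, smul_eq_mul, ← mul_assoc, ← ENNReal.ofReal_mul (by positivity)]
  have hc' : |c| ≠ 0 := abs_ne_zero.2 hc
  have : |c| ^ n * |(c ^ Module.finrank ℝ (EuclideanSpace ℝ (Fin n)))⁻¹| = 1 := by
    rw [finrank_euclideanSpace_fin, abs_inv, abs_pow]
    exact mul_inv_cancel₀ (pow_ne_zero _ hc')
  rw [this]
  simp

theorem lintegral_dilation {n : ℕ} (c τ : ℝ → ℝ) (hc : Measurable c) (hc0 : ∀ r, c r ≠ 0)
    (hτ : MeasurePreserving τ volume volume) (g : Pt n → ℝ≥0∞) (hg : Measurable g) :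
    ∫⁻ p : Pt n, ENNReal.ofReal (|c p.2.2| ^ n) ^ 2 *
      g (c p.2.2 • p.1, c p.2.2 • p.2.1, τ p.2.2) = ∫⁻ p, g p := by
  have hτm := hτ.measurable
  rw [lintegral_triple _ (by fun_prop), lintegral_triple g hg,
    ← hτ.lintegral_comp (f := fun r => ∫⁻ x, ∫⁻ y, g (x, y, r))]
  · refine lintegral_congr fun r => ?_
    simp only
    rw [← lintegral_scale (c r) (hc0 r) (fun x => ∫⁻ y, g (x, y, τ r))]
    · rw [← lintegral_const_mul]
      · refine lintegral_congr fun x => ?_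
        rw [← lintegral_scale (c r) (hc0 r) (fun y => g (c r • x, y, τ r)) (by fun_prop),
          lintegral_const_mul _ (by fun_prop)]
        ring
      · refine Measurable.lintegral_prod_right' (f := fun q : EuclideanSpace ℝ (Fin n) ×
          EuclideanSpace ℝ (Fin n) => g (c r • q.1, q.2, τ r)) ?_
        fun_prop
    · refine Measurable.lintegral_prod_right' (f := fun q : EuclideanSpace ℝ (Fin n) ×
          EuclideanSpace ℝ (Fin n) => g (q.1, q.2, τ r)) ?_
      fun_prop
  · refine Measurable.lintegral_prod_right' (f := fun q : ℝ × EuclideanSpace ℝ (Fin n) =>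
      ∫⁻ y, g (q.2, y, q.1)) ?_
    refine Measurable.lintegral_prod_right' (f := fun q : (ℝ × EuclideanSpace ℝ (Fin n)) ×
      EuclideanSpace ℝ (Fin n) => g (q.1.2, q.2, q.1.1)) ?_
    fun_prop

/-- The multiplicative unitary
`(U ξ)(x, y, r; x', y', r') = (e^{-λr'})ⁿ ē[η_λ(r') β(e^{-λr'}x, y' - e^{-λr'}y)]
  ξ(e^{-λr'}x, e^{-λr'}y, r + r'; x' - e^{-λr'}x, y' - e^{-λr'}y, r')`. -/
noncomputable def unitaryFormula (n : ℕ) (lam : ℝ) (ξ : Pt n × Pt n → ℂ) (p : Pt n × Pt n) : ℂ :=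
  let x := p.1.1; let y := p.1.2.1; let r := p.1.2.2
  let x' := p.2.1; let y' := p.2.2.1; let r' := p.2.2.2
  let c := Real.exp (-(lam * r'))
  ((c ^ n : ℝ) : ℂ) * e (-(eta lam r' * ⟪c • x, y' - c • y⟫_ℝ)) *
    ξ ((c • x, c • y, r + r'), (x' - c • x, y' - c • y, r'))

theorem exists_unitary (n : ℕ) (lam : ℝ) : ∃ T : Op (L2 (Pt n × Pt n)),
    ∀ ξ : L2 (Pt n × Pt n), T ξ =ᵐ[volume] unitaryFormula n lam ξ := by
  have he := measurable_e
  have ht := measurable_eta lam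
  refine exists_wcomp
    (fun p : Pt n × Pt n => (((Real.exp (-(lam * p.2.2.2))) ^ n : ℝ) : ℂ) *
      e (-(eta lam p.2.2.2 * ⟪Real.exp (-(lam * p.2.2.2)) • p.1.1,
        p.2.2.1 - Real.exp (-(lam * p.2.2.2)) • p.1.2.1⟫_ℝ)))
    (fun p => ((Real.exp (-(lam * p.2.2.2)) • p.1.1, Real.exp (-(lam * p.2.2.2)) • p.1.2.1,
      p.1.2.2 + p.2.2.2), (p.2.1 - Real.exp (-(lam * p.2.2.2)) • p.1.1,
      p.2.2.1 - Real.exp (-(lam * p.2.2.2)) • p.1.2.1, p.2.2.2)))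
    (by fun_prop) (by fun_prop) ?_ ?_
  · intro g hg
    have hw : ∀ p : Pt n × Pt n, ‖(((Real.exp (-(lam * p.2.2.2))) ^ n : ℝ) : ℂ) *
        e (-(eta lam p.2.2.2 * ⟪Real.exp (-(lam * p.2.2.2)) • p.1.1,
        p.2.2.1 - Real.exp (-(lam * p.2.2.2)) • p.1.2.1⟫_ℝ))‖ₑ =
        ENNReal.ofReal (|Real.exp (-(lam * p.2.2.2))| ^ n) := by
      intro p
      rw [← ofReal_norm, norm_mul, norm_e, mul_one, Complex.norm_real, norm_pow, Real.norm_eq_abs]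
    simp_rw [hw]
    rw [Measure.volume_eq_prod, lintegral_prod_symm _ (by fun_prop)]
    have h1 : ∀ b : Pt n, ∫⁻ a : Pt n, ENNReal.ofReal (|Real.exp (-(lam * b.2.2))| ^ n) ^ 2 *
        g ((Real.exp (-(lam * b.2.2)) • a.1, Real.exp (-(lam * b.2.2)) • a.2.1, a.2.2 + b.2.2),
          (b.1 - Real.exp (-(lam * b.2.2)) • a.1, b.2.1 - Real.exp (-(lam * b.2.2)) • a.2.1,
            b.2.2)) =
        ∫⁻ a : Pt n, g ((a.1, a.2.1, a.2.2 + b.2.2), (b.1 - a.1, b.2.1 - a.2.1, b.2.2)) := by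
      intro b
      exact lintegral_dilation (fun _ => Real.exp (-(lam * b.2.2))) id measurable_const
        (fun _ => (Real.exp_pos _).ne') (MeasurePreserving.id _)
        (fun a => g ((a.1, a.2.1, a.2.2 + b.2.2), (b.1 - a.1, b.2.1 - a.2.1, b.2.2)))
        (by fun_prop)
    simp only [h1]
    rw [lintegral_lintegral_swap (by fun_prop)]
    have h2 : ∀ a : Pt n, ∫⁻ b : Pt n, g ((a.1, a.2.1, a.2.2 + b.2.2),
        (b.1 - a.1, b.2.1 - a.2.1, b.2.2)) =
        ∫⁻ b : Pt n, g ((a.1, a.2.1, a.2.2 + b.2.2), b) := by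
      intro a
      rw [← lintegral_sub_right_eq_self (fun b : Pt n => g ((a.1, a.2.1, a.2.2 + b.2.2), b))
        (a.1, a.2.1, 0)]
      refine lintegral_congr fun b => ?_
      rw [show b - (a.1, a.2.1, (0 : ℝ)) = (b.1 - a.1, b.2.1 - a.2.1, b.2.2) by
        simp [Prod.ext_iff]]
    simp only [h2]
    rw [lintegral_lintegral_swap (by fun_prop)]
    have h3 : ∀ b : Pt n, ∫⁻ a : Pt n, g ((a.1, a.2.1, a.2.2 + b.2.2), b) =
        ∫⁻ a : Pt n, g (a, b) := by
      intro b
      rw [← lintegral_add_right_eq_self (fun a : Pt n => g (a, b)) (0, 0, b.2.2)]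
      refine lintegral_congr fun a => ?_
      rw [show a + (0, 0, b.2.2) = (a.1, a.2.1, a.2.2 + b.2.2) by simp [Prod.ext_iff]]
    simp only [h3]
    rw [lintegral_prod_symm _ hg.aemeasurable]
  · intro p
    refine mul_ne_zero (by exact_mod_cast (pow_pos (Real.exp_pos _) n).ne') ?_
    rw [← norm_ne_zero_iff, norm_e]
    norm_num

/-- The multiplicative unitary `U_A` on `ℋ ⊗ ℋ = L²(Pt n × Pt n)`. -/
noncomputable def UA (n : ℕ) (lam : ℝ) : Op (L2 (Pt n × Pt n)) :=
  opOfFormula (unitaryFormula n lam) (exists_unitary n lam)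

/-- `(j ξ)(x, y, r) = (e^{λr})ⁿ ē[η_λ(r) β(x, y)] ξ(-e^{λr}x, -e^{λr}y, -r)`. -/
noncomputable def jFormula (n : ℕ) (lam : ℝ) (ξ : Pt n → ℂ) (p : Pt n) : ℂ :=
  let x := p.1; let y := p.2.1; let r := p.2.2
  let c := Real.exp (lam * r)
  ((c ^ n : ℝ) : ℂ) * e (-(eta lam r * ⟪x, y⟫_ℝ)) * ξ (-(c • x), -(c • y), -r)

theorem exists_j (n : ℕ) (lam : ℝ) : ∃ T : Op (L2 (Pt n)),
    ∀ ξ : L2 (Pt n), T ξ =ᵐ[volume] jFormula n lam ξ := by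
  have he := measurable_e
  have ht := measurable_eta lam
  refine exists_wcomp
    (fun p : Pt n => ((Real.exp (lam * p.2.2) ^ n : ℝ) : ℂ) * e (-(eta lam p.2.2 * ⟪p.1, p.2.1⟫_ℝ)))
    (fun p => (-(Real.exp (lam * p.2.2) • p.1), -(Real.exp (lam * p.2.2) • p.2.1), -p.2.2))
    (by fun_prop) (by fun_prop) ?_ ?_
  · intro g hg
    rw [← lintegral_dilation (fun r => -Real.exp (lam * r)) (fun r => -r) (by fun_prop)
      (fun r => neg_ne_zero.2 (Real.exp_pos _).ne') (Measure.measurePreserving_neg volume) g hg]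
    refine lintegral_congr fun p => ?_
    rw [← ofReal_norm, norm_mul, norm_e, mul_one, Complex.norm_real, norm_pow, Real.norm_eq_abs,
      abs_neg, neg_smul, neg_smul]
  · intro p
    refine mul_ne_zero (by exact_mod_cast (pow_pos (Real.exp_pos _) n).ne') ?_
    rw [← norm_ne_zero_iff, norm_e]
    norm_num

/-- The involutive unitary `j` of the Kac system. -/
noncomputable def jOp (n : ℕ) (lam : ℝ) : Op (L2 (Pt n)) :=
  opOfFormula (jFormula n lam) (exists_j n lam)

/-- The function space `𝒜 = 𝒜̂`: Schwartz functions of `(x, y, r)` with compact support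
in `r`. -/
noncomputable def funAlg (n : ℕ) : Submodule ℂ (SchwartzMap (Pt n) ℂ) where
  carrier := {f | ∃ R : ℝ, ∀ p : Pt n, R < |p.2.2| → f p = 0}
  zero_mem' := ⟨0, fun _ _ => rfl⟩
  add_mem' := by
    rintro f g ⟨R, hR⟩ ⟨S, hS⟩
    refine ⟨max R S, fun p hp => ?_⟩
    simp [hR p ((le_max_left _ _).trans_lt hp), hS p ((le_max_right _ _).trans_lt hp)]
  smul_mem' := by
    rintro c f ⟨R, hR⟩
    exact ⟨R, fun p hp => by simp [hR p hp]⟩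

/-- `(L_f ξ)(x, y, r) = ∫ f(x̃, ỹ, r) ē[η_λ(r) β(x̃, y - ỹ)] ξ(x - x̃, y - ỹ, r) dx̃ dỹ`. -/
noncomputable def LFormula (n : ℕ) (lam : ℝ) (f : Pt n → ℂ) (ξ : Pt n → ℂ) (p : Pt n) : ℂ :=
  ∫ g : EuclideanSpace ℝ (Fin n) × EuclideanSpace ℝ (Fin n),
    f (g.1, g.2, p.2.2) * e (-(eta lam p.2.2 * ⟪g.1, p.2.1 - g.2⟫_ℝ)) *
      ξ (p.1 - g.1, p.2.1 - g.2, p.2.2)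

theorem exists_dominating (n : ℕ) (f : funAlg n) :
    ∃ h : EuclideanSpace ℝ (Fin n) × EuclideanSpace ℝ (Fin n) → ℝ, Integrable h ∧
      ∀ g r, ‖(f : SchwartzMap (Pt n) ℂ) (g.1, g.2, r)‖ ≤ h g := by
  obtain ⟨k, hk⟩ : ∃ k : ℕ, Module.finrank ℝ
      (EuclideanSpace ℝ (Fin n) × EuclideanSpace ℝ (Fin n)) < k := ⟨_, Nat.lt_succ_self _⟩
  have hC := SchwartzMap.one_add_le_sup_seminorm_apply (𝕜 := ℂ) (m := (k, 0)) (k := k) (n := 0)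
      le_rfl le_rfl (f : SchwartzMap (Pt n) ℂ)
  simp only [norm_iteratedFDeriv_zero] at hC
  set C := 2 ^ (k, 0).1 * ((Finset.Iic (k, 0)).sup fun m =>
    SchwartzMap.seminorm ℂ m.1 m.2) (f : SchwartzMap (Pt n) ℂ)
  refine ⟨fun g => C * (1 + ‖g‖) ^ (-(k : ℝ)),
    (integrable_one_add_norm (by exact_mod_cast hk)).const_mul C, ?_⟩
  · intro g r
    have h1 : ‖g‖ ≤ ‖((g.1, g.2, r) : Pt n)‖ := by
      rw [Prod.norm_def, Prod.norm_def, Prod.norm_def]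
      exact max_le_max le_rfl (le_max_left _ _)
    have h2 : (1 + ‖g‖) ^ k * ‖(f : SchwartzMap (Pt n) ℂ) (g.1, g.2, r)‖ ≤ C :=
      le_trans (by gcongr) (hC (g.1, g.2, r))
    simp only
    rw [Real.rpow_neg (by positivity), Real.rpow_natCast, ← div_eq_mul_inv,
      le_div_iff₀ (by positivity), mul_comm]
    exact h2

theorem measurePreserving_translate {n : ℕ}
    (g : EuclideanSpace ℝ (Fin n) × EuclideanSpace ℝ (Fin n)) :
    MeasurePreserving (fun p : Pt n => ((p.1 - g.1, p.2.1 - g.2, p.2.2) : Pt n))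
      volume volume := by
  have := measurePreserving_sub_right (volume : Measure (Pt n)) (g.1, g.2, 0)
  convert this using 2 with p
  simp [Prod.ext_iff]

/-- The kernel of `L_f`. -/
noncomputable def Lk (n : ℕ) (lam : ℝ) (f : funAlg n) (p : Pt n)
    (g : EuclideanSpace ℝ (Fin n) × EuclideanSpace ℝ (Fin n)) : ℂ :=
  (f : SchwartzMap (Pt n) ℂ) (g.1, g.2, p.2.2) * e (-(eta lam p.2.2 * ⟪g.1, p.2.1 - g.2⟫_ℝ))

theorem L_kernel (n : ℕ) (lam : ℝ) (f : funAlg n) :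
    Measurable (Function.uncurry (Lk n lam f)) := by
  have he := measurable_e
  have ht := measurable_eta lam
  have hf : Measurable (f : SchwartzMap (Pt n) ℂ) :=
    (f : SchwartzMap (Pt n) ℂ).continuous.measurable
  unfold Function.uncurry Lk
  fun_prop

theorem L_bound (n : ℕ) (lam : ℝ) (f : funAlg n)
    (h : EuclideanSpace ℝ (Fin n) × EuclideanSpace ℝ (Fin n) → ℝ)
    (hb : ∀ g r, ‖(f : SchwartzMap (Pt n) ℂ) (g.1, g.2, r)‖ ≤ h g) (p : Pt n)
    (g : EuclideanSpace ℝ (Fin n) × EuclideanSpace ℝ (Fin n)) : ‖Lk n lam f p g‖ ≤ h g := by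
  rw [Lk, norm_mul, norm_e, mul_one]
  exact hb g _

theorem exists_L (n : ℕ) (lam : ℝ) (f : funAlg n) : ∃ T : Op (L2 (Pt n)),
    ∀ ξ : L2 (Pt n), T ξ =ᵐ[volume] LFormula n lam (f : SchwartzMap (Pt n) ℂ) ξ := by
  obtain ⟨h, hh, hb⟩ := exists_dominating n f
  exact exists_integralOp (Lk n lam f) (fun p g => ((p.1 - g.1, p.2.1 - g.2, p.2.2) : Pt n)) h
    (L_kernel n lam f) (by unfold Function.uncurry; fun_prop) measurePreserving_translate hh (L_bound n lam f h hb)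

theorem L_integrable (n : ℕ) (lam : ℝ) (f : funAlg n) (ξ : L2 (Pt n)) :
    ∀ᵐ p : Pt n, Integrable fun g : EuclideanSpace ℝ (Fin n) × EuclideanSpace ℝ (Fin n) =>
      (f : SchwartzMap (Pt n) ℂ) (g.1, g.2, p.2.2) *
        e (-(eta lam p.2.2 * ⟪g.1, p.2.1 - g.2⟫_ℝ)) * ξ (p.1 - g.1, p.2.1 - g.2, p.2.2) := by
  obtain ⟨h, hh, hb⟩ := exists_dominating n f
  exact integrable_slice (Lk n lam f) (fun p g => ((p.1 - g.1, p.2.1 - g.2, p.2.2) : Pt n)) h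
    (L_kernel n lam f) (by unfold Function.uncurry; fun_prop) measurePreserving_translate hh (L_bound n lam f h hb) ξ

/-- The regular representation `f ↦ L_f` of `𝒜` on `ℋ`. -/
noncomputable def LRep (n : ℕ) (lam : ℝ) : funAlg n →ₗ[ℂ] Op (L2 (Pt n)) where
  toFun f := opOfFormula (LFormula n lam (f : SchwartzMap (Pt n) ℂ)) (exists_L n lam f)
  map_add' f f' := by
    ext1 ξ
    apply Lp.ext
    rw [_root_.add_apply]
    filter_upwards [opOfFormula_ae _ (exists_L n lam (f + f')) ξ,
      opOfFormula_ae _ (exists_L n lam f) ξ, opOfFormula_ae _ (exists_L n lam f') ξ,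
      Lp.coeFn_add (opOfFormula _ (exists_L n lam f) ξ) (opOfFormula _ (exists_L n lam f') ξ),
      L_integrable n lam f ξ, L_integrable n lam f' ξ] with p h1 h2 h3 h4 h5 h6
    rw [h1, h4, Pi.add_apply, h2, h3, LFormula, LFormula, LFormula, ← integral_add h5 h6]
    refine integral_congr_ae (ae_of_all _ fun g => ?_)
    simp only [Submodule.coe_add, _root_.add_apply]
    ring
  map_smul' c f := by
    ext1 ξ
    apply Lp.ext
    rw [RingHom.id_apply, _root_.smul_apply]
    filter_upwards [opOfFormula_ae _ (exists_L n lam (c • f)) ξ,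
      opOfFormula_ae _ (exists_L n lam f) ξ,
      Lp.coeFn_smul c (opOfFormula _ (exists_L n lam f) ξ)] with p h1 h2 h4
    rw [h1, h4, Pi.smul_apply, h2, LFormula, LFormula, smul_eq_mul, ← integral_const_mul]
    refine integral_congr_ae (ae_of_all _ fun g => ?_)
    simp only [Submodule.coe_smul, _root_.smul_apply, smul_eq_mul]
    ring

/-- `(λ_φ ξ)(x, y, r) = ∫ φ(e^{λr̃}x, e^{λr̃}y, r - r̃) ξ(x, y, r̃) dr̃`. -/
noncomputable def lamFormula (n : ℕ) (lam : ℝ) (φ : Pt n → ℂ) (ξ : Pt n → ℂ) (p : Pt n) : ℂ :=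
  ∫ s : ℝ, φ (Real.exp (lam * s) • p.1, Real.exp (lam * s) • p.2.1, p.2.2 - s) *
    ξ (p.1, p.2.1, s)

theorem exists_dominating' (n : ℕ) (f : funAlg n) :
    ∃ h : ℝ → ℝ, Integrable h ∧ ∀ x y s, ‖(f : SchwartzMap (Pt n) ℂ) (x, y, s)‖ ≤ h s := by
  obtain ⟨R, hR⟩ := f.2
  obtain ⟨C, hC⟩ : ∃ C, ∀ p : Pt n, ‖(f : SchwartzMap (Pt n) ℂ) p‖ ≤ C :=
    ⟨_, fun p => SchwartzMap.norm_le_seminorm ℂ (f : SchwartzMap (Pt n) ℂ) p⟩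
  refine ⟨(Set.Icc (-R) R).indicator fun _ => C,
    (integrable_indicator_iff measurableSet_Icc).2 (integrableOn_const (by simp)), ?_⟩
  intro x y s
  by_cases hs : s ∈ Set.Icc (-R) R
  · rw [Set.indicator_of_mem hs]
    exact hC _
  · rw [Set.indicator_of_notMem hs, hR (x, y, s), norm_zero]
    rw [Set.mem_Icc, ← abs_le, not_le] at hs
    exact hs

theorem measurePreserving_translate' {n : ℕ} (s : ℝ) :
    MeasurePreserving (fun p : Pt n => ((p.1, p.2.1, p.2.2 - s) : Pt n)) volume volume := by
  have := measurePreserving_sub_right (volume : Measure (Pt n)) (0, 0, s)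
  convert this using 2 with p
  simp [Prod.ext_iff]

theorem lam_kernel (n : ℕ) (lam : ℝ) (φ : funAlg n) :
    Measurable (Function.uncurry fun (p : Pt n) (s : ℝ) =>
      (φ : SchwartzMap (Pt n) ℂ) (Real.exp (lam * (p.2.2 - s)) • p.1,
        Real.exp (lam * (p.2.2 - s)) • p.2.1, s)) := by
  have hf : Measurable (φ : SchwartzMap (Pt n) ℂ) :=
    (φ : SchwartzMap (Pt n) ℂ).continuous.measurable
  unfold Function.uncurry
  fun_prop

theorem exists_lam (n : ℕ) (lam : ℝ) (φ : funAlg n) : ∃ T : Op (L2 (Pt n)),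
    ∀ ξ : L2 (Pt n), T ξ =ᵐ[volume] lamFormula n lam (φ : SchwartzMap (Pt n) ℂ) ξ := by
  obtain ⟨h, hh, hb⟩ := exists_dominating' n φ
  obtain ⟨T, hT⟩ := exists_integralOp _ (fun p s => ((p.1, p.2.1, p.2.2 - s) : Pt n)) h
    (lam_kernel n lam φ) (by unfold Function.uncurry; fun_prop) measurePreserving_translate' hh
    (fun p s => hb _ _ s)
  refine ⟨T, fun ξ => ?_⟩
  filter_upwards [hT ξ] with p hp
  rw [hp, lamFormula, ← integral_sub_left_eq_self _ volume p.2.2]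
  simp

theorem lam_integrable (n : ℕ) (lam : ℝ) (φ : funAlg n) (ξ : L2 (Pt n)) :
    ∀ᵐ p : Pt n, Integrable fun s : ℝ =>
      (φ : SchwartzMap (Pt n) ℂ) (Real.exp (lam * s) • p.1, Real.exp (lam * s) • p.2.1,
        p.2.2 - s) * ξ (p.1, p.2.1, s) := by
  obtain ⟨h, hh, hb⟩ := exists_dominating' n φ
  filter_upwards [integrable_slice _ (fun p s => ((p.1, p.2.1, p.2.2 - s) : Pt n)) h
    (lam_kernel n lam φ) (by unfold Function.uncurry; fun_prop) measurePreserving_translate' hh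
    (fun p s => hb _ _ s) ξ] with p hp
  have := hp.comp_sub_left p.2.2
  simpa using this

/-- The representation `φ ↦ λ_φ` of `𝒜̂` (with the opposite product) on `ℋ`. -/
noncomputable def lamRep (n : ℕ) (lam : ℝ) : funAlg n →ₗ[ℂ] Op (L2 (Pt n)) where
  toFun φ := opOfFormula (lamFormula n lam (φ : SchwartzMap (Pt n) ℂ)) (exists_lam n lam φ)
  map_add' f f' := by
    ext1 ξ
    apply Lp.ext
    rw [_root_.add_apply]
    filter_upwards [opOfFormula_ae _ (exists_lam n lam (f + f')) ξ,
      opOfFormula_ae _ (exists_lam n lam f) ξ, opOfFormula_ae _ (exists_lam n lam f') ξ,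
      Lp.coeFn_add (opOfFormula _ (exists_lam n lam f) ξ) (opOfFormula _ (exists_lam n lam f') ξ),
      lam_integrable n lam f ξ, lam_integrable n lam f' ξ] with p h1 h2 h3 h4 h5 h6
    rw [h1, h4, Pi.add_apply, h2, h3, lamFormula, lamFormula, lamFormula, ← integral_add h5 h6]
    refine integral_congr_ae (ae_of_all _ fun g => ?_)
    simp only [Submodule.coe_add, _root_.add_apply]
    ring
  map_smul' c f := by
    ext1 ξ
    apply Lp.ext
    rw [RingHom.id_apply, _root_.smul_apply]
    filter_upwards [opOfFormula_ae _ (exists_lam n lam (c • f)) ξ,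
      opOfFormula_ae _ (exists_lam n lam f) ξ,
      Lp.coeFn_smul c (opOfFormula _ (exists_lam n lam f) ξ)] with p h1 h2 h4
    rw [h1, h4, Pi.smul_apply, h2, lamFormula, lamFormula, smul_eq_mul, ← integral_const_mul]
    refine integral_congr_ae (ae_of_all _ fun g => ?_)
    simp only [Submodule.coe_smul, _root_.smul_apply, smul_eq_mul]
    ring

end Concrete

section CStar

variable {H : Type} [NormedAddCommGroup H] [InnerProductSpace ℂ H] [CompleteSpace H]

/-- The C*-algebra of operators on `H` generated by a set of operators. -/
noncomputable def cstarGen (s : Set (Op H)) : NonUnitalStarSubalgebra ℂ (Op H) :=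
  (NonUnitalStarAlgebra.adjoin ℂ s).topologicalClosure

/-- The multiplier algebra `M(C)` of a (nondegenerate) C*-algebra `C ⊆ B(H)`, realized inside
`B(H)`: the operators `m` with `m C ⊆ C` and `C m ⊆ C`. -/
noncomputable def multiplier (C : NonUnitalStarSubalgebra ℂ (Op H)) : StarSubalgebra ℂ (Op H) where
  carrier := {m | ∀ c ∈ C, m * c ∈ C ∧ c * m ∈ C}
  mul_mem' := fun {m m'} hm hm' c hc => by
    refine ⟨?_, ?_⟩
    · rw [mul_assoc]; exact (hm _ (hm' c hc).1).1
    · rw [← mul_assoc]; exact (hm' _ (hm c hc).2).2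
  add_mem' := fun {m m'} hm hm' c hc => by
    refine ⟨?_, ?_⟩
    · rw [add_mul]; exact add_mem (hm c hc).1 (hm' c hc).1
    · rw [mul_add]; exact add_mem (hm c hc).2 (hm' c hc).2
  algebraMap_mem' := fun r c hc => by
    rw [Algebra.algebraMap_eq_smul_one, smul_mul_assoc, mul_smul_comm, one_mul, mul_one]
    exact ⟨SMulMemClass.smul_mem r hc, SMulMemClass.smul_mem r hc⟩
  star_mem' := fun {m} hm c hc => by
    have h := hm (star c) (star_mem hc)
    refine ⟨?_, ?_⟩
    · have := star_mem h.2
      rwa [star_mul, star_star] at this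
    · have := star_mem h.1
      rwa [star_mul, star_star] at this

/-- Strict convergence `u i → m` with respect to the C*-algebra `C`. -/
def StrictTendsto {ι : Type} (C : NonUnitalStarSubalgebra ℂ (Op H)) (u : ι → Op H)
    (l : Filter ι) (m : Op H) : Prop :=
  ∀ c ∈ C, Tendsto (fun i => u i * c) l (nhds (m * c)) ∧
    Tendsto (fun i => c * u i) l (nhds (c * m))

end CStar

section CStarTensor

variable {α β : Type} [MeasureSpace α] [MeasureSpace β]
  [SigmaFinite (volume : Measure α)] [SigmaFinite (volume : Measure β)]

/-- The (minimal, i.e. spatial) tensor product of two C*-algebras of operators. -/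
noncomputable def minTensor (B : NonUnitalStarSubalgebra ℂ (Op (L2 α)))
    (C : NonUnitalStarSubalgebra ℂ (Op (L2 β))) :
    NonUnitalStarSubalgebra ℂ (Op (L2 (α × β))) :=
  cstarGen {T | ∃ b ∈ B, ∃ c ∈ C, T = opTensor b c}

/-- The right slices `(id ⊗ ω)(V)` of `V ∈ B(L²(α) ⊗ L²(β))`. The functional `ω` runs through
the predual `B(L²(β))_*`, i.e. `ω = ∑ᵢ ⟨uᵢ, · vᵢ⟩` with square-summable sequences of vectors. -/
def rightSlices (V : Op (L2 (α × β))) : Set (Op (L2 α)) :=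
  {a | ∃ u v : ℕ → L2 β, Summable (fun i => ‖u i‖ ^ 2) ∧ Summable (fun i => ‖v i‖ ^ 2) ∧
    ∀ ξ η : L2 α, ⟪ξ, a η⟫_ℂ = ∑' i, ⟪tmul ξ (u i), V (tmul η (v i))⟫_ℂ}

/-- The left slices `(ω ⊗ id)(V)` of `V ∈ B(L²(α) ⊗ L²(β))`, with `ω` in the predual of
`B(L²(α))`. -/
def leftSlices (V : Op (L2 (α × β))) : Set (Op (L2 β)) :=
  {a | ∃ u v : ℕ → L2 α, Summable (fun i => ‖u i‖ ^ 2) ∧ Summable (fun i => ‖v i‖ ^ 2) ∧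
    ∀ ξ η : L2 β, ⟪ξ, a η⟫_ℂ = ∑' i, ⟪tmul (u i) ξ, V (tmul (v i) η)⟫_ℂ}

/-- Let `B ⊆ B(L²(α))` and `C ⊆ B(L²(β))` be C*-algebras with comultiplications
`δB : B → M(B ⊗ B)` and `δC`, where `δC` is given on `M(C)`. The map `θ : B → M(C)` is a
C*-bialgebra homomorphism: a nondegenerate *-homomorphism with `(θ ⊗ θ) ∘ δB = δC ∘ θ`.
Here `Θ : M(B ⊗ B) → M(C ⊗ C)` is the extension of `θ ⊗ θ` to the multiplier algebra: since `θ`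
is nondegenerate, there is only one unital *-homomorphism with
`Θ(b ⊗ b') = θ(b) ⊗ θ(b')`. -/
structure IsBialgebraHom {B : NonUnitalStarSubalgebra ℂ (Op (L2 α))}
    {C : NonUnitalStarSubalgebra ℂ (Op (L2 β))}
    (δB : Op (L2 α) → Op (L2 (α × α))) (δC : Op (L2 β) → Op (L2 (β × β)))
    (θ : B →⋆ₙₐ[ℂ] multiplier C)
    (Θ : multiplier (minTensor B B) →⋆ₐ[ℂ] multiplier (minTensor C C)) : Prop where
  nondegenerate : ∀ c ∈ C, c ∈ closure
    (Submodule.span ℂ {x | ∃ (b : B) (d : C), x = (θ b : Op (L2 β)) * (d : Op (L2 β))} :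
      Set (Op (L2 β)))
  extension : ∀ (b b' : B) (h : opTensor (b : Op (L2 α)) b' ∈ multiplier (minTensor B B)),
    (Θ ⟨_, h⟩ : Op (L2 (β × β))) = opTensor (θ b : Op (L2 β)) (θ b')
  comul : ∀ b : B, ∃ h : δB b ∈ multiplier (minTensor B B),
    (Θ ⟨_, h⟩ : Op (L2 (β × β))) = δC (θ b)

end CStarTensor

section Legs

variable {α : Type} [MeasureSpace α] [SigmaFinite (volume : Measure α)]

/-- The flip `Σ` on `L²(α) ⊗ L²(α)`. -/
noncomputable def flip : Op (L2 (α × α)) :=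
  (Lp.compMeasurePreservingₗᵢ ℂ Prod.swap Measure.measurePreserving_swap).toContinuousLinearMap

theorem measurePreserving_middle :
    MeasurePreserving (fun p : (α × α) × (α × α) => ((p.1.1, p.2.1), (p.1.2, p.2.2)))
      volume volume := by
  have hA : MeasurePreserving (MeasurableEquiv.prodAssoc : (α × α) × (α × α) ≃ᵐ α × (α × (α × α)))
      volume volume := measurePreserving_prodAssoc volume volume volume
  have hB : MeasurePreserving (MeasurableEquiv.prodAssoc : (α × α) × α ≃ᵐ α × (α × α))
      volume volume := measurePreserving_prodAssoc volume volume volume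
  have hs : MeasurePreserving (Prod.map Prod.swap id : (α × α) × α → (α × α) × α)
      volume volume :=
    Measure.measurePreserving_swap.prod (MeasurePreserving.id _)
  have h1 := (hB.comp hs).comp (hB.symm _)
  have h2 : MeasurePreserving (Prod.map id
      ((MeasurableEquiv.prodAssoc ∘ Prod.map Prod.swap id) ∘ MeasurableEquiv.prodAssoc.symm) :
      α × (α × (α × α)) → α × (α × (α × α))) volume volume := (MeasurePreserving.id _).prod h1
  exact ((hA.symm _).comp h2).comp hA

/-- The flip `Σ₂₃` of the second and third legs of
`(L²(α) ⊗ L²(α)) ⊗ (L²(α) ⊗ L²(α))`. -/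
noncomputable def flip23 : Op (L2 ((α × α) × (α × α))) :=
  (Lp.compMeasurePreservingₗᵢ ℂ _ measurePreserving_middle).toContinuousLinearMap

/-- Leg numbering: `V₁₂`. -/
noncomputable def leg12 (V : Op (L2 (α × α))) : Op (L2 ((α × α) × (α × α))) := opTensor V 1

/-- Leg numbering: `V₁₃`. -/
noncomputable def leg13 (V : Op (L2 (α × α))) : Op (L2 ((α × α) × (α × α))) :=
  flip23 * opTensor V 1 * flip23

/-- Leg numbering: `V₂₄`. -/
noncomputable def leg24 (V : Op (L2 (α × α))) : Op (L2 ((α × α) × (α × α))) :=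
  flip23 * opTensor 1 V * flip23

end Legs

section Double

variable (n : ℕ) (lam : ℝ)

/-- `Û_A = Σ (j ⊗ 1) U_A (j ⊗ 1) Σ`. -/
noncomputable def UAhat : Op (L2 (Pt n × Pt n)) :=
  flip * opTensor (jOp n lam) 1 * UA n lam * opTensor (jOp n lam) 1 * flip

/-- `X = Σ Û_A* Σ`. -/
noncomputable def X : Op (L2 (Pt n × Pt n)) := flip * star (UAhat n lam) * flip

/-- `Y = Û_A = Σ X* Σ`. -/
noncomputable def Y : Op (L2 (Pt n × Pt n)) := UAhat n lam

/-- `Z = Y* (j ⊗ j) Y (j ⊗ j)`. -/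
noncomputable def Z : Op (L2 (Pt n × Pt n)) :=
  star (Y n lam) *
    (opTensor (jOp n lam) (jOp n lam) * Y n lam * opTensor (jOp n lam) (jOp n lam))

/-- `V_D = Z₁₂ Y₂₄ Z₁₂* X₁₃`. -/
noncomputable def VD : Op (L2 ((Pt n × Pt n) × (Pt n × Pt n))) :=
  leg12 (Z n lam) * leg24 (Y n lam) * star (leg12 (Z n lam)) * leg13 (X n lam)

/-- The C*-algebra `A`, generated by the left slices of `U_A`. -/
noncomputable def algA : NonUnitalStarSubalgebra ℂ (Op (L2 (Pt n))) :=
  cstarGen (leftSlices (UA n lam))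

/-- The C*-algebra `Â^op`, generated by the right slices of `X`. -/
noncomputable def algB : NonUnitalStarSubalgebra ℂ (Op (L2 (Pt n))) :=
  cstarGen (rightSlices (X n lam))

/-- The C*-algebra `A_D`, generated by the right slices of `V_D`. -/
noncomputable def algD : NonUnitalStarSubalgebra ℂ (Op (L2 (Pt n × Pt n))) :=
  cstarGen (rightSlices (VD n lam))

/-- The comultiplication of `A`: `Δ a = U_A (a ⊗ 1) U_A*`. -/
noncomputable def comulA (a : Op (L2 (Pt n))) : Op (L2 (Pt n × Pt n)) :=
  UA n lam * opTensor a 1 * star (UA n lam)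

/-- The comultiplication of `Â^op`: `Δ̂ b = X* (1 ⊗ b) X`. -/
noncomputable def comulB (b : Op (L2 (Pt n))) : Op (L2 (Pt n × Pt n)) :=
  star (X n lam) * opTensor 1 b * X n lam

/-- The comultiplication of `A_D`, `Δ_D x = V_D* (1 ⊗ 1 ⊗ x) V_D`, and by the same formula its
extension to `M(A_D)`. -/
noncomputable def comulD (x : Op (L2 (Pt n × Pt n))) : Op (L2 ((Pt n × Pt n) × (Pt n × Pt n))) :=
  star (VD n lam) * opTensor 1 x * VD n lam

/-- `π(a) = Z (1 ⊗ a) Z*`. -/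
noncomputable def piA : Op (L2 (Pt n)) →ₗ[ℂ] Op (L2 (Pt n × Pt n)) :=
  LinearMap.mulLeft ℂ (Z n lam) ∘ₗ LinearMap.mulRight ℂ (star (Z n lam)) ∘ₗ opTensorₗ 1

/-- `π'(b) = b ⊗ 1`. -/
noncomputable def piB : Op (L2 (Pt n)) →ₗ[ℂ] Op (L2 (Pt n × Pt n)) := opTensorₗ.flip 1

/-- `Π(φ ⊗ f) = π'(λ_φ) π(L_f)` on the algebraic tensor product `𝒜̂ ⊗ 𝒜`. -/
noncomputable def bigPi : funAlg n ⊗[ℂ] funAlg n →ₗ[ℂ] Op (L2 (Pt n × Pt n)) :=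
  TensorProduct.lift ((LinearMap.mul ℂ (Op (L2 (Pt n × Pt n)))).compl₁₂
    (piB n ∘ₗ lamRep n lam) (piA n lam ∘ₗ LRep n lam))

/-- `t i = ∑ φ₍₁₎ ⊗ φ₍₂₎` is a bounded net in the algebraic tensor product whose images under
`R ⊗ R` converge strictly to the multiplier `m` of `C`. -/
structure IsSweedlerNet {α : Type} [MeasureSpace α] [SigmaFinite (volume : Measure α)] {n : ℕ}
    (R : funAlg n →ₗ[ℂ] Op (L2 α)) (C : NonUnitalStarSubalgebra ℂ (Op (L2 (α × α))))
    (m : Op (L2 (α × α))) {ι : Type} (l : Filter ι) (t : ι → funAlg n ⊗[ℂ] funAlg n) : Prop where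
  bounded : ∃ K : ℝ, ∀ᶠ i in l, ‖tensorRep R R (t i)‖ ≤ K
  tendsto : StrictTendsto C (fun i => tensorRep R R (t i)) l m

end Double

end QDouble

open QDouble

set_option linter.unusedSectionVars false
set_option linter.unusedSimpArgs false
set_option linter.unreachableTactic false
set_option linter.unusedTactic false
set_option linter.unnecessarySeqFocus false
set_option synthInstance.maxSize 1000

/-! Every operator in the statement has one of two explicit shapes. The unitaries `U_A`, `j`, `X`,
`Y`, `Z` and `V_D*` are weighted compositions `ξ ↦ w · (ξ ∘ φ)` (`IsWC`). The operators `L_f`, `λ_φ`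
and their images under `π`, `π'` and the comultiplications are integral operators `∫ k(p, θ) ξ(φ(p,
θ)) dθ`, where `φ(·, θ)` preserves the measure and `k` is dominated by an integrable function of `θ`
(`IsInt`). Both shapes are stable under products and tensor products, and an intertwining relation
`V T = T' V'` follows from a pointwise identity of maps and weights (`mul_eq_mul_of_kernel`). The
operator identities thus become algebra with exponentials, inner products and the cocycle rule `η(r
+ s) = η(r) + e^{2λr} η(s)`.

The three C*-algebras are closed linear spans of explicit generators: `A` of the `L_u`, `Â^op` of
the `λ_u`, and `A_D` of the products `π(L_u) π'(λ_v)`, with test functions `u`, `v` (`algA_eq`,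
`algB_eq`, `algD_eq`). One mechanism gives all inclusions (`mem_of_kernel₃`): by Stone–Weierstrass,
an operator with a continuous compactly supported kernel is a norm limit of sums of operators whose
kernels are products of test functions of freely chosen coordinates. In one choice of coordinates
such a product integrates to a scalar multiple of a generator, in another it is the kernel of a
slice. For `A_D`, a slice of `V_D` by elementary tensors factors as `π(slice of Y) π'(slice of X)`
(`rslice_VD`), and the order of `π` and `π'` can be reversed (`piB_mul_piA_mem`), so that the span
of the products is an algebra closed under adjoints. The same mechanism shows that `Δ` and `Δ̂` take
values in multipliers (`comulA_mul_mem`, `comulB_mul_mem`).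

The homomorphisms `π ⊗ π` and `π' ⊗ π'` are spatial: `m ↦ (Z ⊗ Z) m₂₄ (Z ⊗ Z)*` and `m ↦ m₁₃`
(`ampA`, `ampB`). They are defined on all bounded operators, and nondegeneracy of `π` and `π'` makes
them preserve multipliers and bounded strict convergence (`IsExtension`). Compatibility for `π'` is
pure leg calculus, because `Z₁₂ Y₂₄ Z₁₂*` commutes with operators on the third leg (`comulD_piB`).
For `π`, both sides are computed on `L_u` and give the same integral operator (`comulD_piA`). The
essential computation there is the phase identity `wtV_mul_phP`.

The product formula for `Δ_D(Π(φ ⊗ f))` is multiplicativity of `Δ_D`. On algebraic tensors, `(Π ⊗ Π)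
∘ σ` is the product of the two amplifications (`tensorRep_bigPi`); hence the assertion about nets
says that amplifications and products respect bounded strict convergence. Nets exist because a
multiplier `m` is the strict limit of `m u` along a bounded approximate unit, and each `m u` can be
approximated in norm from the algebraic tensor product. -/

namespace QDouble

open scoped ComplexConjugate

/-! ### Elementary tensors and tensor products of operators -/

section DenseTensors

variable {α β : Type} [MeasureSpace α] [MeasureSpace β]
  [SigmaFinite (volume : Measure α)] [SigmaFinite (volume : Measure β)]

theorem norm_tmul (ξ : L2 α) (η : L2 β) : ‖tmul ξ η‖ = ‖ξ‖ * ‖η‖ := by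
  rw [← tensorMap_tmul, norm_tensorMap, TensorProduct.norm_tmul]

theorem tmul_zero_left (η : L2 β) : tmul (0 : L2 α) η = 0 := by
  rw [← tensorMap_tmul, TensorProduct.zero_tmul, map_zero]

theorem tmul_zero_right (ξ : L2 α) : tmul ξ (0 : L2 β) = 0 := by
  rw [← tensorMap_tmul, TensorProduct.tmul_zero, map_zero]

/-- A closed additive predicate on `L²(α × β)` that holds for elementary tensors holds
everywhere. -/
theorem tensor_induction {p : L2 (α × β) → Prop} (h : ∀ ξ η, p (tmul ξ η))
    (hadd : ∀ z w, p z → p w → p (z + w)) (hc : IsClosed {z | p z}) (z : L2 (α × β)) : p z := by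
  have : Set.range (tensorMap : L2 α ⊗[ℂ] L2 β →ₗ[ℂ] L2 (α × β)) ⊆ {z | p z} := by
    rintro _ ⟨t, rfl⟩
    induction t using TensorProduct.induction_on with
    | zero => simpa [tmul_zero_left] using h 0 0
    | add z z' h h' => rw [map_add]; exact hadd _ _ h h'
    | tmul ξ η => exact h ξ η
  have hd := (denseRange_tensorMap (α := α) (β := β)).closure_eq
  exact (hc.closure_subset_iff.2 this) (hd ▸ Set.mem_univ z)

/-- `ξ ↦ ξ ⊗ v`. -/
noncomputable def insRight (v : L2 β) : L2 α →L[ℂ] L2 (α × β) :=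
  LinearMap.mkContinuous ⟨⟨fun ξ => tmul ξ v, fun _ _ => tmul_add_left _ _ _⟩,
    fun _ _ => tmul_smul_left _ _ _⟩ ‖v‖ fun ξ => ((norm_tmul ξ v).trans (mul_comm _ _)).le

@[simp] theorem insRight_apply (v : L2 β) (ξ : L2 α) : insRight v ξ = tmul ξ v := rfl

/-- `η ↦ u ⊗ η`. -/
noncomputable def insLeft (u : L2 α) : L2 β →L[ℂ] L2 (α × β) :=
  LinearMap.mkContinuous ⟨⟨fun η => tmul u η, fun _ _ => tmul_add_right _ _ _⟩,
    fun _ _ => tmul_smul_right _ _ _⟩ ‖u‖ fun η => (norm_tmul u η).le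

theorem opTensor_mul (T T' : Op (L2 α)) (S S' : Op (L2 β)) :
    opTensor (T * T') (S * S') = opTensor T S * opTensor T' S' :=
  op_ext fun ξ η => by simp [opTensor_tmul]

theorem opTensor_one : opTensor (1 : Op (L2 α)) (1 : Op (L2 β)) = 1 :=
  op_ext fun ξ η => by simp [opTensor_tmul]

theorem inner_ext_tmul {z w : L2 (α × β)} (h : ∀ ξ η, ⟪tmul ξ η, z⟫_ℂ = ⟪tmul ξ η, w⟫_ℂ) :
    z = w := by
  refine ext_inner_left ℂ fun v => ?_
  refine tensor_induction (p := fun v => ⟪v, z⟫_ℂ = ⟪v, w⟫_ℂ) h ?_ ?_ v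
  · intro a b ha hb
    rw [inner_add_left, inner_add_left, ha, hb]
  · exact isClosed_eq (by fun_prop) (by fun_prop)

theorem star_opTensor (T : Op (L2 α)) (S : Op (L2 β)) :
    star (opTensor T S) = opTensor (star T) (star S) :=
  op_ext fun ξ η => inner_ext_tmul fun ξ' η' => by
    rw [ContinuousLinearMap.star_eq_adjoint, ContinuousLinearMap.adjoint_inner_right,
      opTensor_tmul, opTensor_tmul, inner_tmul, inner_tmul, ContinuousLinearMap.star_eq_adjoint,
      ContinuousLinearMap.star_eq_adjoint, ContinuousLinearMap.adjoint_inner_right,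
      ContinuousLinearMap.adjoint_inner_right]

theorem norm_opTensor_le (T : Op (L2 α)) (S : Op (L2 β)) : ‖opTensor T S‖ ≤ ‖T‖ * ‖S‖ := by
  refine LinearMap.opNorm_extendOfNorm_le denseRange_tensorMap (by positivity) fun z => ?_
  rw [LinearMap.comp_apply, norm_tensorMap, norm_tensorMap]
  exact norm_map_le T S z

@[simp] theorem opTensorₗ_apply (T : Op (L2 α)) (S : Op (L2 β)) :
    opTensorₗ T S = opTensor T S := rfl

end DenseTensors

/-! ### Weighted composition operators -/

section WComp

variable {α β : Type} [MeasureSpace α] [MeasureSpace β]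

/-- `T` is the weighted composition operator `ξ ↦ w · (ξ ∘ φ)`. -/
structure IsWC (T : Op (L2 α)) (w : α → ℂ) (φ : α → α) : Prop where
  meas : Measurable w
  qmp : Measure.QuasiMeasurePreserving φ volume volume
  apply : ∀ ξ : L2 α, T ξ =ᵐ[volume] fun p => w p * ξ (φ p)

theorem IsWC.congr {T : Op (L2 α)} {w w' : α → ℂ} {φ φ' : α → α} (h : IsWC T w φ)
    (hw : ∀ p, w p = w' p) (hφ : ∀ p, φ p = φ' p) : IsWC T w' φ' := by
  obtain rfl : w = w' := funext hw
  obtain rfl : φ = φ' := funext hφ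
  exact h

theorem IsWC.unique {T S : Op (L2 α)} {w : α → ℂ} {φ : α → α} (h : IsWC T w φ)
    (h' : IsWC S w φ) : T = S :=
  ContinuousLinearMap.ext fun ξ => Lp.ext ((h.apply ξ).trans (h'.apply ξ).symm)

theorem isWC_one : IsWC (1 : Op (L2 α)) (fun _ => 1) id :=
  ⟨measurable_const, .id _, fun ξ => by simp⟩

theorem IsWC.mul {T S : Op (L2 α)} {w v : α → ℂ} {φ ψ : α → α} (h : IsWC T w φ)
    (h' : IsWC S v ψ) : IsWC (T * S) (fun p => w p * v (φ p)) (fun p => ψ (φ p)) := by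
  refine ⟨h.meas.mul (h'.meas.comp h.qmp.measurable), h'.qmp.comp h.qmp, fun ξ => ?_⟩
  filter_upwards [h.apply (S ξ), h.qmp.ae (h'.apply ξ)] with p h1 h2
  rw [show (T * S) ξ = T (S ξ) from rfl, h1, h2, mul_assoc]

/-- Along an `L²`-convergent sequence, subsequences of both the vectors and their images converge
almost everywhere. Since `φ` pulls null sets back to null sets, the formula survives the limit. With
`tensor_induction` this makes it enough to check formulas on elementary tensors. -/
theorem isClosed_formula {T : Op (L2 α)} {w : α → ℂ} {φ : α → α}
    (hφ : Measure.QuasiMeasurePreserving φ (volume : Measure α) volume) :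
    IsClosed {ξ : L2 α | T ξ =ᵐ[volume] fun p => w p * ξ (φ p)} := by
  refine isClosed_of_closure_subset fun ξ hξ => ?_
  obtain ⟨x, hx, hlim⟩ := mem_closure_iff_seq_limit.1 hξ
  have h1 : TendstoInMeasure volume (fun n => (x n : α → ℂ)) atTop ξ :=
    tendstoInMeasure_of_tendsto_Lp hlim
  obtain ⟨a, ha, ha'⟩ := h1.exists_seq_tendsto_ae
  have h2 : TendstoInMeasure volume (fun n => (T (x (a n)) : α → ℂ)) atTop (T ξ) :=
    tendstoInMeasure_of_tendsto_Lp
      ((T.continuous.tendsto ξ).comp (hlim.comp ha.tendsto_atTop))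
  obtain ⟨b, hb, hb'⟩ := h2.exists_seq_tendsto_ae
  have h3 : ∀ᵐ p, ∀ n, T (x n) p = w p * x n (φ p) := ae_all_iff.2 hx
  filter_upwards [hb', hφ.ae ha', h3] with p h4 h5 h6
  refine tendsto_nhds_unique h4 ?_
  simp only [h6]
  exact (h5.comp hb.tendsto_atTop).const_mul _

variable [SigmaFinite (volume : Measure α)] [SigmaFinite (volume : Measure β)]

theorem isWC_of_tmul {T : Op (L2 (α × β))} {w : α × β → ℂ} {φ : α × β → α × β}
    (hw : Measurable w) (hφ : Measure.QuasiMeasurePreserving φ volume volume)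
    (h : ∀ ξ η, T (tmul ξ η) =ᵐ[volume] fun p => w p * (ξ (φ p).1 * η (φ p).2)) :
    IsWC T w φ := by
  refine ⟨hw, hφ, fun z => ?_⟩
  refine tensor_induction (p := fun ζ => T ζ =ᵐ[volume] fun p => w p * ζ (φ p)) (fun ξ η => ?_)
    (fun z z' hz hz' => ?_) (isClosed_formula hφ) z
  · filter_upwards [h ξ η, hφ.ae (tmul_ae ξ η)] with p h1 h2
    rw [h1, h2]
  · filter_upwards [hz, hz', Lp.coeFn_add (T z) (T z'), hφ.ae (Lp.coeFn_add z z')] with p h1 h2 h3 h4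
    rw [map_add, h3, h4, Pi.add_apply, Pi.add_apply, h1, h2, mul_add]

theorem IsWC.opTensor {T : Op (L2 α)} {S : Op (L2 β)} {w : α → ℂ} {v : β → ℂ} {φ : α → α}
    {ψ : β → β} (h : IsWC T w φ) (h' : IsWC S v ψ) :
    IsWC (opTensor T S) (fun p => w p.1 * v p.2) (fun p => (φ p.1, ψ p.2)) := by
  refine isWC_of_tmul ((h.meas.comp measurable_fst).mul (h'.meas.comp measurable_snd))
    (MeasureTheory.QuasiMeasurePreserving.prodMap h.qmp h'.qmp) fun ξ η => ?_
  filter_upwards [tmul_ae (T ξ) (S η), ae_fst (h.apply ξ), ae_snd (h'.apply η)] with p h1 h2 h3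
  rw [opTensor_tmul, h1, h2, h3]
  ring

theorem IsWC.opTensor_right {T : Op (L2 α)} {w : α → ℂ} {φ : α → α}
    (h : IsWC T w φ) : IsWC (QDouble.opTensor T (1 : Op (L2 β))) (fun p => w p.1)
      (fun p => (φ p.1, p.2)) :=
  (h.opTensor isWC_one).congr (fun _ => mul_one _) fun _ => rfl

theorem IsWC.opTensor_left {T : Op (L2 β)} {w : β → ℂ} {φ : β → β}
    (h : IsWC T w φ) : IsWC (QDouble.opTensor (1 : Op (L2 α)) T) (fun p => w p.2)
      (fun p => (p.1, φ p.2)) :=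
  (isWC_one.opTensor h).congr (fun _ => one_mul _) fun _ => rfl

theorem isWC_flip : IsWC (flip : Op (L2 (α × α))) (fun _ => 1) Prod.swap :=
  ⟨measurable_const, Measure.measurePreserving_swap.quasiMeasurePreserving, fun ξ => by
    simp only [one_mul]
    exact Lp.coeFn_compMeasurePreserving ξ Measure.measurePreserving_swap⟩

theorem isWC_flip23 : IsWC (flip23 : Op (L2 ((α × α) × (α × α)))) (fun _ => 1)
    (fun p => ((p.1.1, p.2.1), (p.1.2, p.2.2))) :=
  ⟨measurable_const, measurePreserving_middle.quasiMeasurePreserving, fun ξ => by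
    simp only [one_mul]
    exact Lp.coeFn_compMeasurePreserving ξ measurePreserving_middle⟩

theorem flip_tmul (ξ η : L2 α) : flip (tmul ξ η) = tmul η ξ := by
  apply Lp.ext
  filter_upwards [isWC_flip.apply (tmul ξ η), isWC_flip.qmp.ae (tmul_ae ξ η), tmul_ae η ξ]
    with p h1 h2 h3
  rw [h1, h2, h3, Prod.fst_swap, Prod.snd_swap]
  ring

theorem flip23_tmul (a b c d : L2 α) :
    flip23 (tmul (tmul a b) (tmul c d)) = tmul (tmul a c) (tmul b d) := by
  apply Lp.ext
  filter_upwards [isWC_flip23.apply (tmul (tmul a b) (tmul c d)),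
    isWC_flip23.qmp.ae (tmul_ae (tmul a b) (tmul c d)),
    isWC_flip23.qmp.ae (ae_fst (tmul_ae a b)),
    isWC_flip23.qmp.ae (ae_snd (tmul_ae c d)), tmul_ae (tmul a c) (tmul b d),
    ae_fst (tmul_ae a c), ae_snd (tmul_ae b d)]
    with p h1 h2 h3 h4 h5 h6 h7
  rw [h1, h2, h3, h4, h5, h6, h7]
  ring

theorem flip_mul_flip : (flip : Op (L2 (α × α))) * flip = 1 :=
  op_ext fun ξ η => by simp [flip_tmul]

theorem star_flip : star (flip : Op (L2 (α × α))) = flip :=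
  op_ext fun ξ η => inner_ext_tmul fun ξ' η' => by
    rw [ContinuousLinearMap.star_eq_adjoint, ContinuousLinearMap.adjoint_inner_right,
      flip_tmul, flip_tmul, inner_tmul, inner_tmul, mul_comm]

theorem flip23_mul_flip23 : (flip23 : Op (L2 ((α × α) × (α × α)))) * flip23 = 1 :=
  (isWC_flip23.mul isWC_flip23).congr (fun _ => mul_one _) (fun _ => rfl) |>.unique isWC_one

/-- Fourfold elementary tensors are reached by applying `tensor_induction` to the pair and then to
each factor; closedness of the partial predicates comes from continuity of the insertion maps. -/
theorem tensor4_induction {p : L2 ((α × α) × (α × α)) → Prop}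
    (h : ∀ a b c d, p (tmul (tmul a b) (tmul c d)))
    (hadd : ∀ z w, p z → p w → p (z + w)) (hc : IsClosed {z | p z}) (z) : p z := by
  have hcl : ∀ z, IsClosed {w : L2 (α × α) | p (tmul z w)} := fun z =>
    hc.preimage (insLeft (β := α × α) z).continuous
  have hcl' : ∀ w, IsClosed {z : L2 (α × α) | p (tmul z w)} := fun w =>
    hc.preimage (insRight (α := α × α) w).continuous
  refine tensor_induction (fun z w => ?_) hadd hc z
  refine tensor_induction (p := fun z => p (tmul z w)) (fun a b => ?_) (fun z z' h h' => ?_)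
    (hcl' w) z
  · refine tensor_induction (p := fun w => p (tmul (tmul a b) w)) (fun c d => h a b c d)
      (fun z z' h h' => ?_) (hcl _) w
    rw [tmul_add_right]; exact hadd _ _ h h'
  · rw [tmul_add_left]; exact hadd _ _ h h'

theorem star_flip23 : star (flip23 : Op (L2 ((α × α) × (α × α)))) = flip23 := by
  ext1 z
  refine ext_inner_left ℂ fun w => ?_
  rw [ContinuousLinearMap.star_eq_adjoint, ContinuousLinearMap.adjoint_inner_right]
  refine tensor4_induction (p := fun z => ⟪flip23 w, z⟫_ℂ = ⟪w, flip23 z⟫_ℂ) (fun a b c d => ?_)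
    (fun z z' h h' => ?_) (isClosed_eq (by fun_prop) (by fun_prop)) z
  · refine tensor4_induction (p := fun w => ⟪flip23 w, tmul (tmul a b) (tmul c d)⟫_ℂ =
      ⟪w, flip23 (tmul (tmul a b) (tmul c d))⟫_ℂ) (fun a' b' c' d' => ?_)
      (fun z z' h h' => ?_) (isClosed_eq (by fun_prop) (by fun_prop)) w
    · simp only [flip23_tmul, inner_tmul]; ring
    · rw [map_add, inner_add_left, inner_add_left, h, h']
  · rw [map_add, inner_add_right, inner_add_right, h, h']

theorem IsWC.leg13 {T : Op (L2 (α × α))} {w : α × α → ℂ} {φ : α × α → α × α}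
    (h : IsWC T w φ) : IsWC (leg13 T) (fun p => w (p.1.1, p.2.1))
      (fun p => (((φ (p.1.1, p.2.1)).1, p.1.2), ((φ (p.1.1, p.2.1)).2, p.2.2))) :=
  ((isWC_flip23.mul h.opTensor_right).mul isWC_flip23).congr (by simp) (by simp)

theorem IsWC.leg24 {T : Op (L2 (α × α))} {w : α × α → ℂ} {φ : α × α → α × α}
    (h : IsWC T w φ) : IsWC (leg24 T) (fun p => w (p.1.2, p.2.2))
      (fun p => ((p.1.1, (φ (p.1.2, p.2.2)).1), (p.2.1, (φ (p.1.2, p.2.2)).2))) :=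
  ((isWC_flip23.mul h.opTensor_left).mul isWC_flip23).congr (by simp) (by simp)

theorem IsWC.norm_apply {T : Op (L2 α)} {w : α → ℂ} {φ : α → α} (h : IsWC T w φ)
    (hn : ∀ g : α → ℝ≥0∞, Measurable g → ∫⁻ p, ‖w p‖ₑ ^ 2 * g (φ p) = ∫⁻ p, g p) (ξ : L2 α) :
    ‖T ξ‖ = ‖ξ‖ := by
  rw [Lp.norm_def, Lp.norm_def, eLpNorm_congr_ae (h.apply ξ),
    eLpNorm_eq_lintegral_rpow_enorm_toReal (by norm_num) (by norm_num),
    eLpNorm_eq_lintegral_rpow_enorm_toReal (by norm_num) (by norm_num)]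
  congr 2
  have := hn (fun p => ‖ξ p‖ₑ ^ 2) ((Lp.stronglyMeasurable ξ).measurable.enorm.pow_const 2)
  simpa [enorm_mul, mul_pow] using this

/-- An isometry has `T* T = 1`, so any right inverse is the adjoint. Adjoints of weighted
compositions are found this way: write down the inverse formula and verify one product. -/
theorem star_eq_of_isometry {H : Type} [NormedAddCommGroup H] [InnerProductSpace ℂ H]
    [CompleteSpace H] {T S : Op H} (hT : ∀ ξ, ‖T ξ‖ = ‖ξ‖) (h : T * S = 1) : star T = S := by
  have h1 : star T * T = 1 := by
    refine (ContinuousLinearMap.norm_map_iff_adjoint_comp_self T).1 hT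
  calc star T = star T * (T * S) := by rw [h, mul_one]
    _ = S := by rw [← mul_assoc, h1, one_mul]

theorem exists_isWC_of_mp {w : α → ℂ} {φ : α → α} (hw : Measurable w) (hw1 : ∀ p, ‖w p‖ = 1)
    (hφ : MeasurePreserving φ volume volume) :
    ∃ T : Op (L2 α), IsWC T w φ := by
  obtain ⟨T, hT⟩ := exists_wcomp w φ hw hφ.measurable (fun g hg => by
      simp only [← ofReal_norm, hw1]
      simpa using hφ.lintegral_comp hg) fun p h => by simpa [h] using hw1 p
  exact ⟨T, hw, hφ.quasiMeasurePreserving, hT⟩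

theorem IsWC.norm_apply_of_mp {T : Op (L2 α)} {w : α → ℂ} {φ : α → α} (h : IsWC T w φ)
    (hw1 : ∀ p, ‖w p‖ = 1) (hφ : MeasurePreserving φ volume volume) (ξ : L2 α) :
    ‖T ξ‖ = ‖ξ‖ :=
  h.norm_apply (fun g hg => by
      simp only [← ofReal_norm, hw1]
      simpa using hφ.lintegral_comp hg) ξ

end WComp

/-! ### Integral operators with measure preserving translations -/

section IntOp

variable {α β : Type} [MeasureSpace α] [MeasureSpace β]
  [SigmaFinite (volume : Measure α)] [SigmaFinite (volume : Measure β)]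
  {Θ Θ' : Type} [MeasureSpace Θ] [SigmaFinite (volume : Measure Θ)]
  [MeasureSpace Θ'] [SigmaFinite (volume : Measure Θ')]

/-- `T` is the integral operator `(T ξ)(p) = ∫ k(p, θ) ξ(φ(p, θ)) dθ`, with measure preserving
maps `φ(·, θ)` and a kernel dominated by an integrable function of `θ`. -/
structure IsInt (T : Op (L2 α)) (φ : α → Θ → α) (k : α → Θ → ℂ) : Prop where
  meas_map : Measurable (Function.uncurry φ)
  mp : ∀ θ, MeasurePreserving (fun p => φ p θ) volume volume
  meas : Measurable (Function.uncurry k)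
  dom : ∃ h : Θ → ℝ, Integrable h ∧ ∀ p θ, ‖k p θ‖ ≤ h θ
  apply : ∀ ξ : L2 α, T ξ =ᵐ[volume] fun p => ∫ θ, k p θ * ξ (φ p θ)

theorem exists_isInt {φ : α → Θ → α} {k : α → Θ → ℂ} (h1 : Measurable (Function.uncurry φ))
    (h2 : ∀ θ, MeasurePreserving (fun p => φ p θ) volume volume)
    (h3 : Measurable (Function.uncurry k))
    (h4 : ∃ h : Θ → ℝ, Integrable h ∧ ∀ p θ, ‖k p θ‖ ≤ h θ) :
    ∃ T : Op (L2 α), IsInt T φ k := by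
  obtain ⟨h, hh, hk⟩ := h4
  obtain ⟨T, hT⟩ := exists_integralOp k φ h h3 h1 h2 hh hk
  exact ⟨T, h1, h2, h3, ⟨h, hh, hk⟩, hT⟩

variable {T T' S : Op (L2 α)} {φ : α → Θ → α} {k k' : α → Θ → ℂ}

theorem IsInt.congr {φ' : α → Θ → α} (h : IsInt T φ k) (hφ : ∀ p θ, φ p θ = φ' p θ)
    (hk : ∀ p θ, k p θ = k' p θ) : IsInt T φ' k' := by
  obtain rfl : φ = φ' := funext₂ hφ
  obtain rfl : k = k' := funext₂ hk
  exact h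

theorem IsInt.unique (h : IsInt T φ k) (h' : IsInt T' φ k) : T = T' :=
  ContinuousLinearMap.ext fun ξ => Lp.ext ((h.apply ξ).trans (h'.apply ξ).symm)

/-- Operators given by kernels with the same integrals are equal. -/
theorem IsInt.eq_of_integral {φ' : α → Θ' → α} {k' : α → Θ' → ℂ} (h : IsInt T φ k)
    (h' : IsInt T' φ' k')
    (he : ∀ (ξ : α → ℂ) p, ∫ θ, k p θ * ξ (φ p θ) = ∫ θ, k' p θ * ξ (φ' p θ)) : T = T' :=
  ContinuousLinearMap.ext fun ξ => Lp.ext ((h.apply ξ).trans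
    (EventuallyEq.trans (ae_of_all _ fun p => he ξ p) (h'.apply ξ).symm))

theorem IsInt.integrable (h : IsInt T φ k) (ξ : L2 α) :
    ∀ᵐ p, Integrable fun θ => k p θ * ξ (φ p θ) := by
  obtain ⟨g, hg, hk⟩ := h.dom
  exact integrable_slice k φ g h.meas h.meas_map h.mp hg hk ξ

theorem IsInt.add (h : IsInt T φ k) (h' : IsInt T' φ k') :
    IsInt (T + T') φ (fun p θ => k p θ + k' p θ) := by
  obtain ⟨g, hg, hk⟩ := h.dom
  obtain ⟨g', hg', hk'⟩ := h'.dom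
  refine ⟨h.meas_map, h.mp, h.meas.add h'.meas, ⟨_, hg.add hg', fun p θ =>
    (norm_add_le _ _).trans (add_le_add (hk p θ) (hk' p θ))⟩, fun ξ => ?_⟩
  rw [_root_.add_apply]
  filter_upwards [Lp.coeFn_add (T ξ) (T' ξ), h.apply ξ, h'.apply ξ, h.integrable ξ,
    h'.integrable ξ] with p h1 h2 h3 h4 h5
  rw [h1, Pi.add_apply, h2, h3, ← integral_add h4 h5]
  simp only [add_mul]

theorem IsInt.smul (h : IsInt T φ k) (c : ℂ) : IsInt (c • T) φ (fun p θ => c * k p θ) := by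
  obtain ⟨g, hg, hk⟩ := h.dom
  refine ⟨h.meas_map, h.mp, h.meas.const_mul c, ⟨_, hg.const_mul ‖c‖, fun p θ => ?_⟩, fun ξ => ?_⟩
  · rw [norm_mul]
    exact mul_le_mul_of_nonneg_left (hk p θ) (norm_nonneg c)
  rw [_root_.smul_apply]
  filter_upwards [Lp.coeFn_smul c (T ξ), h.apply ξ] with p h1 h2
  rw [h1, Pi.smul_apply, h2, smul_eq_mul, ← integral_const_mul]
  simp only [mul_assoc]

theorem IsInt.sub (h : IsInt T φ k) (h' : IsInt T' φ k') :
    IsInt (T - T') φ (fun p θ => k p θ - k' p θ) := by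
  have := h.add (h'.smul (-1))
  rw [neg_one_smul, ← sub_eq_add_neg] at this
  exact this.congr (fun _ _ => rfl) (fun _ _ => by ring)

/-- This is Young's inequality: Cauchy–Schwarz in `θ` and invariance of the measure under each `φ(·,
θ)`, as in `lintegral_sq_le`. It is the only norm estimate needed for approximating kernels. -/
theorem IsInt.norm_le (h : IsInt T φ k) {g : Θ → ℝ} (hg : Integrable g) (g0 : ∀ θ, 0 ≤ g θ)
    (hk : ∀ p θ, ‖k p θ‖ ≤ g θ) : ‖T‖ ≤ ∫ θ, g θ := by
  refine ContinuousLinearMap.opNorm_le_bound _ (integral_nonneg g0) fun ξ => ?_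
  have hfin : (∫⁻ θ, ‖g θ‖ₑ) < ∞ := hg.2
  have hnorm : eLpNorm (T ξ) 2 volume ≤ (∫⁻ θ, ‖g θ‖ₑ) * eLpNorm ξ 2 volume := by
    rw [eLpNorm_congr_ae (h.apply ξ),
      eLpNorm_eq_lintegral_rpow_enorm_toReal (by norm_num) (by norm_num),
      eLpNorm_eq_lintegral_rpow_enorm_toReal (by norm_num) (by norm_num)]
    have h1 : ∫⁻ p, ‖∫ θ, k p θ * ξ (φ p θ)‖ₑ ^ 2 ≤
        (∫⁻ θ, ‖g θ‖ₑ) ^ 2 * ∫⁻ p, ‖ξ p‖ₑ ^ 2 :=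
      (lintegral_mono fun p => pow_le_pow_left' (enorm_integral_le_lintegral_enorm _) 2).trans
        (lintegral_sq_le k φ g h.meas_map h.mp hg hk ξ)
    have h2 := ENNReal.rpow_le_rpow h1 (z := 1 / 2) (by norm_num)
    rw [ENNReal.mul_rpow_of_nonneg _ _ (by norm_num)] at h2
    have h3 : ((∫⁻ θ, ‖g θ‖ₑ) ^ 2) ^ (1 / 2 : ℝ) = ∫⁻ θ, ‖g θ‖ₑ := by
      rw [← ENNReal.rpow_natCast, ← ENNReal.rpow_mul]; norm_num
    rw [h3] at h2
    simpa using h2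
  have hi : ∫ θ, g θ = (∫⁻ θ, ‖g θ‖ₑ).toReal := by
    rw [← integral_norm_eq_lintegral_enorm hg.1]
    exact integral_congr_ae (ae_of_all _ fun θ => (Real.norm_of_nonneg (g0 θ)).symm)
  rw [Lp.norm_def, Lp.norm_def, hi, ← ENNReal.toReal_mul]
  exact ENNReal.toReal_mono (ENNReal.mul_lt_top hfin (Lp.eLpNorm_lt_top ξ)).ne hnorm

theorem qmp_uncurry (h1 : Measurable (Function.uncurry φ))
    (h2 : ∀ θ, MeasurePreserving (fun p => φ p θ) volume volume) :
    Measure.QuasiMeasurePreserving (Function.uncurry φ) volume volume :=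
  QuasiMeasurePreserving.prod_of_left h1 (ae_of_all _ fun θ => (h2 θ).quasiMeasurePreserving)

theorem ae_ae_map (h1 : Measurable (Function.uncurry φ))
    (h2 : ∀ θ, MeasurePreserving (fun p => φ p θ) volume volume) {P : α → Prop}
    (h : ∀ᵐ a, P a) : ∀ᵐ p : α, ∀ᵐ θ : Θ, P (φ p θ) :=
  Measure.ae_ae_of_ae_prod ((qmp_uncurry h1 h2).ae h)

/-- Fubini for almost every `p`; the product of the two dominating functions dominates the new
kernel, so the parameter space of a product is the product of the parameter spaces. -/
theorem IsInt.mul {ψ : α → Θ' → α} {l : α → Θ' → ℂ} (h : IsInt T φ k) (h' : IsInt S ψ l) :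
    IsInt (T * S) (fun p (θ : Θ × Θ') => ψ (φ p θ.1) θ.2)
      (fun p θ => k p θ.1 * l (φ p θ.1) θ.2) := by
  have m1 := h.meas_map
  have m2 := h'.meas_map
  have m3 := h.meas
  have m4 := h'.meas
  have e1 : Measurable fun q : α × (Θ × Θ') => φ q.1 q.2.1 :=
    m1.comp (measurable_fst.prodMk (measurable_fst.comp measurable_snd))
  obtain ⟨g, hg, hk⟩ := h.dom
  obtain ⟨g', hg', hk'⟩ := h'.dom
  have a1 : Measurable (Function.uncurry fun p (θ : Θ × Θ') => ψ (φ p θ.1) θ.2) :=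
    m2.comp (e1.prodMk (measurable_snd.comp measurable_snd))
  have a2 : ∀ θ : Θ × Θ', MeasurePreserving (fun p => ψ (φ p θ.1) θ.2) volume volume :=
    fun θ => (h'.mp θ.2).comp (h.mp θ.1)
  have a3 : Measurable (Function.uncurry fun p (θ : Θ × Θ') => k p θ.1 * l (φ p θ.1) θ.2) :=
    (m3.comp (measurable_fst.prodMk (measurable_fst.comp measurable_snd))).mul
      (m4.comp (e1.prodMk (measurable_snd.comp measurable_snd)))
  have a4 : ∀ p (θ : Θ × Θ'), ‖k p θ.1 * l (φ p θ.1) θ.2‖ ≤ g θ.1 * g' θ.2 := fun p θ => by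
    rw [norm_mul]
    exact mul_le_mul (hk _ _) (hk' _ _) (norm_nonneg _) ((norm_nonneg _).trans (hk p _))
  refine ⟨a1, a2, a3, ⟨_, hg.mul_prod hg', a4⟩, fun ξ => ?_⟩
  have hI := integrable_slice _ _ _ a3 a1 a2 (hg.mul_prod hg') a4 ξ
  filter_upwards [h.apply (S ξ), ae_ae_map m1 h.mp (h'.apply ξ), hI] with p h1 h2 h3
  rw [show (T * S) ξ = T (S ξ) from rfl, h1]
  rw [Measure.volume_eq_prod] at h3 ⊢
  rw [integral_prod _ h3]
  refine integral_congr_ae ?_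
  filter_upwards [h2] with θ h4
  rw [h4, ← integral_const_mul]
  simp only [mul_assoc]

theorem IsInt.opTensor_left {T : Op (L2 β)} {φ : β → Θ → β} {k : β → Θ → ℂ} (h : IsInt T φ k) :
    IsInt (opTensor (1 : Op (L2 α)) T) (fun p θ => (p.1, φ p.2 θ)) (fun p θ => k p.2 θ) := by
  have m1 := h.meas_map
  have m3 := h.meas
  obtain ⟨g, hg, hk⟩ := h.dom
  have e : Measurable fun q : (α × β) × Θ => (q.1.2, q.2) := by fun_prop
  obtain ⟨V, hV⟩ := exists_isInt (α := α × β) (φ := fun p θ => (p.1, φ p.2 θ))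
    (k := fun p θ => k p.2 θ) ((measurable_fst.comp measurable_fst).prodMk (m1.comp e))
    (fun θ => (MeasurePreserving.id _).prod (h.mp θ)) (m3.comp e) ⟨g, hg, fun p θ => hk _ _⟩
  -- The integral operator with the expected kernel exists on its own; equality with the tensor
  -- product only has to be checked on elementary tensors.
  have : opTensor (1 : Op (L2 α)) T = V := op_ext fun ξ η => by
    apply Lp.ext
    rw [opTensor_tmul]
    filter_upwards [tmul_ae ((1 : Op (L2 α)) ξ) (T η), hV.apply (tmul ξ η), ae_snd (h.apply η),
      ae_ae_map hV.meas_map hV.mp (tmul_ae ξ η)] with p h1 h2 h3 h4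
    rw [h1, h2, h3, one_apply_eq_self, ← integral_const_mul]
    refine integral_congr_ae ?_
    filter_upwards [h4] with θ h5
    rw [h5]
    ring
  rwa [this]

theorem IsInt.opTensor_right (h : IsInt T φ k) :
    IsInt (opTensor T (1 : Op (L2 β))) (fun p θ => (φ p.1 θ, p.2)) (fun p θ => k p.1 θ) := by
  have m1 := h.meas_map
  have m3 := h.meas
  obtain ⟨g, hg, hk⟩ := h.dom
  have e : Measurable fun q : (α × β) × Θ => (q.1.1, q.2) := by fun_prop
  obtain ⟨V, hV⟩ := exists_isInt (α := α × β) (φ := fun p θ => (φ p.1 θ, p.2))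
    (k := fun p θ => k p.1 θ) ((m1.comp e).prodMk (measurable_snd.comp measurable_fst))
    (fun θ => (h.mp θ).prod (MeasurePreserving.id _)) (m3.comp e) ⟨g, hg, fun p θ => hk _ _⟩
  have : opTensor T (1 : Op (L2 β)) = V := op_ext fun ξ η => by
    apply Lp.ext
    rw [opTensor_tmul]
    filter_upwards [tmul_ae (T ξ) ((1 : Op (L2 β)) η), hV.apply (tmul ξ η), ae_fst (h.apply ξ),
      ae_ae_map hV.meas_map hV.mp (tmul_ae ξ η)] with p h1 h2 h3 h4
    rw [h1, h2, h3, one_apply_eq_self, ← integral_mul_const]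
    refine integral_congr_ae ?_
    filter_upwards [h4] with θ h5
    rw [h5]
    ring
  rwa [this]

theorem IsInt.opTensor {S : Op (L2 β)} {ψ : β → Θ' → β} {l : β → Θ' → ℂ} (h : IsInt T φ k)
    (h' : IsInt S ψ l) : IsInt (opTensor T S)
      (fun p (θ : Θ × Θ') => (φ p.1 θ.1, ψ p.2 θ.2)) (fun p θ => k p.1 θ.1 * l p.2 θ.2) := by
  have := h.opTensor_right (β := β) |>.mul (h'.opTensor_left (α := α))
  rwa [← opTensor_mul, mul_one, one_mul] at this

/-- For fixed `θ` the substitution `p ↦ ψ(p, θ)` moves the translation from one entry of the inner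
product to the other. Two applications of Fubini surround it. -/
theorem IsInt.adjoint {ψ : α → Θ → α} (h : IsInt T φ k) (hψ : Measurable (Function.uncurry ψ))
    (h1 : ∀ p θ, φ (ψ p θ) θ = p) (h2 : ∀ p θ, ψ (φ p θ) θ = p) :
    IsInt (star T) ψ (fun p θ => conj (k (ψ p θ) θ)) := by
  have m1 := h.meas_map
  have m3 := h.meas
  obtain ⟨g, hg, hk⟩ := h.dom
  have mψ : ∀ θ, Measurable fun p => ψ p θ := fun θ => hψ.comp measurable_prodMk_right
  let e : Θ → α ≃ᵐ α := fun θ => ⟨⟨fun p => φ p θ, fun p => ψ p θ, fun p => h2 p θ,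
    fun p => h1 p θ⟩, (h.mp θ).measurable, mψ θ⟩
  have hmp : ∀ θ, MeasurePreserving (fun p => ψ p θ) volume volume := fun θ =>
    MeasurePreserving.symm (e θ) (h.mp θ)
  have mk : Measurable fun q : α × Θ => k (ψ q.1 q.2) q.2 := m3.comp (hψ.prodMk measurable_snd)
  obtain ⟨V, hV⟩ := exists_isInt (α := α) (φ := ψ) (k := fun p θ => conj (k (ψ p θ) θ))
    hψ hmp (continuous_star.measurable.comp mk) ⟨g, hg, fun p θ => by
      rw [RCLike.norm_conj]; exact hk _ _⟩
  have hadj : ∀ ξ η, ⟪ξ, T η⟫_ℂ = ⟪V ξ, η⟫_ℂ := by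
    intro ξ η
    have sq : ∀ ξ : L2 α, Integrable fun p => ‖ξ p‖ ^ 2 := fun ξ =>
      (memLp_two_iff_integrable_sq_norm (Lp.aestronglyMeasurable ξ)).1 (Lp.memLp ξ)
    have hskew : MeasurePreserving (fun q : α × Θ => (φ q.1 q.2, q.2)) volume volume := by
      have := (MeasurePreserving.id (volume : Measure Θ)).skew_product
        (g := fun θ p => φ p θ) (m1.comp measurable_swap)
        (ae_of_all _ fun θ => (h.mp θ).map_eq)
      exact (Measure.measurePreserving_swap.comp this).comp Measure.measurePreserving_swap
    have i1 : Integrable (fun q : α × Θ => ‖ξ q.1‖ ^ 2 * g q.2) volume := (sq ξ).mul_prod hg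
    have i2 : Integrable (fun q : α × Θ => ‖η (φ q.1 q.2)‖ ^ 2 * g q.2) volume :=
      hskew.integrable_comp_of_integrable ((sq η).mul_prod hg)
    have meas : Measurable fun q : α × Θ => conj (ξ q.1) * (k q.1 q.2 * η (φ q.1 q.2)) :=
      (continuous_star.measurable.comp ((Lp.stronglyMeasurable ξ).measurable.comp
        measurable_fst)).mul (m3.mul ((Lp.stronglyMeasurable η).measurable.comp m1))
    -- Joint integrability: `|ξ| · |η ∘ φ| ≤ |ξ|² + |η ∘ φ|²`, and both squares are integrable
    -- against `g(θ)`, the second one because the skew map `(p, θ) ↦ (φ(p, θ), θ)` preserves the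
    -- measure.
    have hI : Integrable (fun q : α × Θ => conj (ξ q.1) * (k q.1 q.2 * η (φ q.1 q.2)))
        (volume.prod volume) := by
      refine (i1.add i2).mono' meas.aestronglyMeasurable (ae_of_all _ fun q => ?_)
      rw [norm_mul, norm_mul, RCLike.norm_conj, Pi.add_apply]
      have g0 := (norm_nonneg _).trans (hk q.1 q.2)
      calc ‖ξ q.1‖ * (‖k q.1 q.2‖ * ‖η (φ q.1 q.2)‖)
          ≤ ‖ξ q.1‖ * (g q.2 * ‖η (φ q.1 q.2)‖) := by gcongr; exact hk _ _
        _ ≤ _ := by nlinarith [sq_nonneg (‖ξ q.1‖ - ‖η (φ q.1 q.2)‖),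
                      sq_nonneg (‖ξ q.1‖ + ‖η (φ q.1 q.2)‖)]
    have hI' : Integrable (fun q : α × Θ => conj (ξ (ψ q.1 q.2)) * (k (ψ q.1 q.2) q.2 * η q.1))
        (volume.prod volume) := by
      have hskew' : MeasurePreserving (fun q : α × Θ => (ψ q.1 q.2, q.2)) volume volume := by
        have := (MeasurePreserving.id (volume : Measure Θ)).skew_product
          (g := fun θ p => ψ p θ) (hψ.comp measurable_swap)
          (ae_of_all _ fun θ => (hmp θ).map_eq)
        exact (Measure.measurePreserving_swap.comp this).comp Measure.measurePreserving_swap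
      have := hskew'.integrable_comp_of_integrable hI
      refine this.congr (ae_of_all _ fun q => ?_)
      simp only [Function.comp_apply, h1]
    calc ⟪ξ, T η⟫_ℂ = ∫ p, ∫ θ, conj (ξ p) * (k p θ * η (φ p θ)) := by
          rw [L2.inner_def]
          refine integral_congr_ae ?_
          filter_upwards [h.apply η] with p hp
          rw [hp, RCLike.inner_apply, mul_comm, integral_const_mul]
      _ = ∫ θ, ∫ p, conj (ξ p) * (k p θ * η (φ p θ)) := integral_integral_swap hI
      _ = ∫ θ, ∫ p, conj (ξ (ψ p θ)) * (k (ψ p θ) θ * η p) := by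
          refine integral_congr_ae (ae_of_all _ fun θ => ?_)
          have := (MeasurePreserving.symm (e θ) (h.mp θ)).integral_comp'
            (fun p => conj (ξ p) * (k p θ * η (φ p θ)))
          refine this.symm.trans (integral_congr_ae (ae_of_all _ fun p => ?_))
          show conj (ξ (ψ p θ)) * (k (ψ p θ) θ * η (φ (ψ p θ) θ)) = _
          rw [h1]
      _ = ∫ p, ∫ θ, conj (ξ (ψ p θ)) * (k (ψ p θ) θ * η p) := (integral_integral_swap hI').symm
      _ = ⟪V ξ, η⟫_ℂ := by
          rw [L2.inner_def]
          refine integral_congr_ae ?_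
          filter_upwards [hV.apply ξ] with p hp
          rw [hp, RCLike.inner_apply, ← integral_conj, ← integral_const_mul]
          refine integral_congr_ae (ae_of_all _ fun θ => ?_)
          simp only [map_mul, RCLike.conj_conj]
          ring
  have : star T = V := by
    rw [ContinuousLinearMap.star_eq_adjoint]
    exact ((ContinuousLinearMap.eq_adjoint_iff V T).2 fun ξ η => (hadj ξ η).symm).symm
  rwa [this]

/-- The tool for computing conjugates such as `Z (1 ⊗ L_u) Z*`. The conjugate `T'` is guessed as an
integral operator, and the relation is verified pointwise, without an explicit formula for the
inverse of `V`. -/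
theorem mul_eq_mul_of_kernel {V V' : Op (L2 α)} {w w' : α → ℂ} {φ φ' : α → α}
    {ψ ψ' : α → Θ → α} {k k' : α → Θ → ℂ} (hV : IsWC V w φ) (hT : IsInt T ψ k)
    (hT' : IsInt T' ψ' k') (hV' : IsWC V' w' φ') (h1 : ∀ p θ, ψ (φ p) θ = φ' (ψ' p θ))
    (h2 : ∀ p θ, w p * k (φ p) θ = k' p θ * w' (ψ' p θ)) : V * T = T' * V' := by
  ext1 ξ
  apply Lp.ext
  rw [show (V * T) ξ = V (T ξ) from rfl, show (T' * V') ξ = T' (V' ξ) from rfl]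
  filter_upwards [hV.apply (T ξ), hV.qmp.ae (hT.apply ξ), hT'.apply (V' ξ),
    ae_ae_map hT'.meas_map hT'.mp (hV'.apply ξ)] with p e1 e2 e3 e4
  rw [e1, e2, e3, ← integral_const_mul]
  refine integral_congr_ae ?_
  filter_upwards [e4] with θ e5
  rw [e5, h1, ← mul_assoc, h2, mul_assoc]

end IntOp

open scoped ContDiff

/-! ### Test functions -/

section Test

variable {X : Type} [NormedAddCommGroup X] [NormedSpace ℝ X]

/-- Smooth functions with compact support. -/
def IsTest (u : X → ℂ) : Prop := ContDiff ℝ ∞ u ∧ HasCompactSupport u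

theorem IsTest.continuous {u : X → ℂ} (h : IsTest u) : Continuous u := h.1.continuous

theorem IsTest.mul {u v : X → ℂ} (h : IsTest u) (h' : IsTest v) : IsTest (fun x => u x * v x) :=
  ⟨h.1.mul h'.1, h.2.mul_right⟩

theorem IsTest.smul {u : X → ℂ} (h : IsTest u) (c : ℂ) : IsTest (fun x => c * u x) :=
  ⟨contDiff_const.mul h.1, h.2.mul_left⟩

theorem IsTest.conj {u : X → ℂ} (h : IsTest u) : IsTest (fun x => conj (u x)) :=
  ⟨Complex.conjCLE.contDiff.comp h.1, h.2.comp_left (map_zero _)⟩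

variable [FiniteDimensional ℝ X]

theorem exists_test_eq_one {K : Set X} (hK : IsCompact K) :
    ∃ u : X → ℂ, IsTest u ∧ (∀ x ∈ K, u x = 1) ∧ ∀ x, ‖u x‖ ≤ 1 := by
  obtain ⟨R, hR⟩ := hK.isBounded.subset_closedBall 0
  let f : ContDiffBump (0 : X) := ⟨|R| + 1, |R| + 2, by positivity, by linarith⟩
  refine ⟨fun x => (f x : ℂ), ⟨Complex.ofRealCLM.contDiff.comp f.contDiff,
    f.hasCompactSupport.comp_left (g := fun t : ℝ => (t : ℂ)) Complex.ofReal_zero⟩,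
    fun x hx => ?_, fun x => ?_⟩
  · have : x ∈ Metric.closedBall (0 : X) f.rIn :=
      Metric.closedBall_subset_closedBall ((le_abs_self R).trans (by simp [f])) (hR hx)
    simp [f.one_of_mem_closedBall this]
  · rw [Complex.norm_real, Real.norm_of_nonneg f.nonneg]
    exact f.le_one

theorem exists_test_separating {x x' : X} (h : x ≠ x') :
    ∃ u : X → ℂ, IsTest u ∧ u x = 1 ∧ u x' = 0 := by
  have hd : 0 < dist x' x := dist_pos.2 h.symm
  let f : ContDiffBump x := ⟨dist x' x / 2, dist x' x, by positivity, by linarith⟩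
  refine ⟨fun x => (f x : ℂ), ⟨Complex.ofRealCLM.contDiff.comp f.contDiff,
    f.hasCompactSupport.comp_left (g := fun t : ℝ => (t : ℂ)) Complex.ofReal_zero⟩, ?_, ?_⟩
  · have : x ∈ Metric.closedBall x f.rIn := Metric.mem_closedBall_self f.rIn_pos.le
    simp [f.one_of_mem_closedBall this]
  · simp [f.zero_of_le_dist (x := x') le_rfl]

end Test

/-! ### Uniform approximation by products of test functions -/

section Approx

variable {X₁ X₂ X₃ : Type} [NormedAddCommGroup X₁] [NormedSpace ℝ X₁] [FiniteDimensional ℝ X₁]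
  [NormedAddCommGroup X₂] [NormedSpace ℝ X₂] [FiniteDimensional ℝ X₂]
  [NormedAddCommGroup X₃] [NormedSpace ℝ X₃] [FiniteDimensional ℝ X₃]
  {Y : Type} [TopologicalSpace Y] [T2Space Y]

/-- Products of test functions of the three coordinates `j₁`, `j₂`, `j₃`. -/
def testProducts (j₁ : Y → X₁) (j₂ : Y → X₂) (j₃ : Y → X₃) : Set (Y → ℂ) :=
  {f | ∃ u₁ u₂ u₃, IsTest u₁ ∧ IsTest u₂ ∧ IsTest u₃ ∧
    f = fun y => u₁ (j₁ y) * u₂ (j₂ y) * u₃ (j₃ y)}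

variable {j₁ : Y → X₁} {j₂ : Y → X₂} {j₃ : Y → X₃}

theorem span_testProducts_mul {f g : Y → ℂ}
    (hf : f ∈ Submodule.span ℂ (testProducts j₁ j₂ j₃))
    (hg : g ∈ Submodule.span ℂ (testProducts j₁ j₂ j₃)) :
    f * g ∈ Submodule.span ℂ (testProducts j₁ j₂ j₃) := by
  have := Submodule.mul_mem_mul hf hg
  rw [Submodule.span_mul_span] at this
  refine Submodule.span_mono ?_ this
  rintro _ ⟨_, ⟨u₁, u₂, u₃, h₁, h₂, h₃, rfl⟩, _, ⟨v₁, v₂, v₃, k₁, k₂, k₃, rfl⟩, rfl⟩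
  refine ⟨_, _, _, h₁.mul k₁, h₂.mul k₂, h₃.mul k₃, funext fun y => ?_⟩
  simp only [Pi.mul_apply]
  ring

theorem span_testProducts_star {f : Y → ℂ}
    (hf : f ∈ Submodule.span ℂ (testProducts j₁ j₂ j₃)) :
    star f ∈ Submodule.span ℂ (testProducts j₁ j₂ j₃) := by
  induction hf using Submodule.span_induction with
  | mem f hf =>
    obtain ⟨u₁, u₂, u₃, h₁, h₂, h₃, rfl⟩ := hf
    refine Submodule.subset_span ⟨_, _, _, h₁.conj, h₂.conj, h₃.conj, funext fun y => ?_⟩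
    simp
  | zero => simp
  | add f g _ _ hf hg => rw [star_add]; exact add_mem hf hg
  | smul c f _ hf => rw [star_smul]; exact Submodule.smul_mem _ _ hf

theorem span_testProducts_continuous (c₁ : Continuous j₁) (c₂ : Continuous j₂)
    (c₃ : Continuous j₃) {f : Y → ℂ} (hf : f ∈ Submodule.span ℂ (testProducts j₁ j₂ j₃)) :
    Continuous f := by
  induction hf using Submodule.span_induction with
  | mem f hf =>
    obtain ⟨u₁, u₂, u₃, h₁, h₂, h₃, rfl⟩ := hf
    exact ((h₁.continuous.comp c₁).mul (h₂.continuous.comp c₂)).mul (h₃.continuous.comp c₃)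
  | zero => exact continuous_const
  | add f g _ _ hf hg => exact hf.add hg
  | smul c f _ hf => exact hf.const_smul c

theorem exists_testProduct_eq_one (c₁ : Continuous j₁) (c₂ : Continuous j₂) (c₃ : Continuous j₃)
    {K : Set Y} (hK : IsCompact K) : ∃ f ∈ testProducts j₁ j₂ j₃, (∀ y ∈ K, f y = 1) ∧
      ∀ y, ‖f y‖ ≤ 1 := by
  obtain ⟨u₁, h₁, e₁, l₁⟩ := exists_test_eq_one (hK.image c₁)
  obtain ⟨u₂, h₂, e₂, l₂⟩ := exists_test_eq_one (hK.image c₂)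
  obtain ⟨u₃, h₃, e₃, l₃⟩ := exists_test_eq_one (hK.image c₃)
  refine ⟨_, ⟨u₁, u₂, u₃, h₁, h₂, h₃, rfl⟩, fun y hy => ?_, fun y => ?_⟩
  · simp [e₁ _ (Set.mem_image_of_mem _ hy), e₂ _ (Set.mem_image_of_mem _ hy),
      e₃ _ (Set.mem_image_of_mem _ hy)]
  · rw [norm_mul, norm_mul]
    exact mul_le_one₀ (mul_le_one₀ (l₁ _) (norm_nonneg _) (l₂ _)) (norm_nonneg _) (l₃ _)

/-- The left inverse `i` makes the three coordinates jointly injective, so distinct points differ in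
some coordinate. That factor separates them, while the other two factors are equal to 1 at both
points. -/
theorem exists_testProduct_separating (c₁ : Continuous j₁) (c₂ : Continuous j₂)
    (c₃ : Continuous j₃) {i : X₁ × X₂ × X₃ → Y} (hij : ∀ y, i (j₁ y, j₂ y, j₃ y) = y) {y y' : Y}
    (h : y ≠ y') : ∃ f ∈ testProducts j₁ j₂ j₃, f y ≠ f y' := by
  have hK : IsCompact ({y, y'} : Set Y) := (Set.toFinite _).isCompact
  obtain ⟨u₁, h₁, e₁, -⟩ := exists_test_eq_one (hK.image c₁)
  obtain ⟨u₂, h₂, e₂, -⟩ := exists_test_eq_one (hK.image c₂)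
  obtain ⟨u₃, h₃, e₃, -⟩ := exists_test_eq_one (hK.image c₃)
  have m : y ∈ ({y, y'} : Set Y) := by simp
  have m' : y' ∈ ({y, y'} : Set Y) := by simp
  have f₁ := e₁ _ (Set.mem_image_of_mem _ m)
  have f₂ := e₂ _ (Set.mem_image_of_mem _ m)
  have f₃ := e₃ _ (Set.mem_image_of_mem _ m)
  by_cases d₁ : j₁ y = j₁ y'
  · by_cases d₂ : j₂ y = j₂ y'
    · by_cases d₃ : j₃ y = j₃ y'
      · exact (h (by rw [← hij y, ← hij y', d₁, d₂, d₃])).elim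
      · obtain ⟨v, hv, v1, v0⟩ := exists_test_separating d₃
        exact ⟨_, ⟨u₁, u₂, v, h₁, h₂, hv, rfl⟩, by simp [v1, v0, f₁, f₂]⟩
    · obtain ⟨v, hv, v1, v0⟩ := exists_test_separating d₂
      exact ⟨_, ⟨u₁, v, u₃, h₁, hv, h₃, rfl⟩, by simp [v1, v0, f₁, f₃]⟩
  · obtain ⟨v, hv, v1, v0⟩ := exists_test_separating d₁
    exact ⟨_, ⟨v, u₂, u₃, hv, h₂, h₃, rfl⟩, by simp [v1, v0, f₂, f₃]⟩

/-- Continuous functions with compact support are uniform limits, with supports in a fixed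
compact set, of sums of products of test functions of the coordinates. -/
theorem exists_testProducts_approx (c₁ : Continuous j₁) (c₂ : Continuous j₂) (c₃ : Continuous j₃)
    {i : X₁ × X₂ × X₃ → Y} (hi : Continuous i) (hij : ∀ y, i (j₁ y, j₂ y, j₃ y) = y)
    {F : Y → ℂ} (hF : Continuous F) (hFc : HasCompactSupport F) :
    ∃ K : Set Y, IsCompact K ∧ (∀ y ∉ K, F y = 0) ∧ ∀ ε > 0,
      ∃ f ∈ Submodule.span ℂ (testProducts j₁ j₂ j₃), (∀ y ∉ K, f y = 0) ∧
        ∀ y, ‖F y - f y‖ ≤ ε := by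
  -- The cutoff `χ` is 1 on the support of `F`, so `F = χ F`. It is itself a product of test
  -- functions of the coordinates, hence vanishes off a compact set `K` that does not depend on `ε`.
  obtain ⟨χ, hχ, χ1, χle⟩ := exists_testProduct_eq_one c₁ c₂ c₃ hFc
  obtain ⟨K, hK, hχK⟩ : ∃ K : Set Y, IsCompact K ∧ ∀ y ∉ K, χ y = 0 := by
    obtain ⟨u₁, u₂, u₃, h₁, h₂, h₃, rfl⟩ := hχ
    refine ⟨_, (h₁.2.isCompact.prod (h₂.2.isCompact.prod h₃.2.isCompact)).image hi,
      fun y hy => ?_⟩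
    by_contra hne
    refine hy ⟨(j₁ y, j₂ y, j₃ y), ⟨subset_tsupport _ fun h => hne ?_,
      subset_tsupport _ fun h => hne ?_, subset_tsupport _ fun h => hne ?_⟩, hij y⟩ <;> simp [h]
  have hFχ : ∀ y, F y = χ y * F y := fun y => by
    by_cases hy : y ∈ tsupport F
    · rw [χ1 y hy, one_mul]
    · rw [image_eq_zero_of_notMem_tsupport hy, mul_zero]
  refine ⟨K, hK, fun y hy => by rw [hFχ, hχK y hy, zero_mul], fun ε hε => ?_⟩
  have : CompactSpace K := isCompact_iff_compactSpace.1 hK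
  -- Since `ρ = 1` on `K`, the restrictions to `K` contain the constants and form a unital star
  -- subalgebra, as the Stone–Weierstrass theorem requires.
  obtain ⟨ρ, hρ, ρ1, -⟩ := exists_testProduct_eq_one c₁ c₂ c₃ hK
  let A : StarSubalgebra ℂ C(K, ℂ) :=
    { carrier := {g | ∃ f ∈ Submodule.span ℂ (testProducts j₁ j₂ j₃), ∀ y : K, g y = f y}
      mul_mem' := by
        rintro g g' ⟨f, hf, e⟩ ⟨f', hf', e'⟩
        exact ⟨_, span_testProducts_mul hf hf', fun y => by simp [e, e']⟩
      add_mem' := by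
        rintro g g' ⟨f, hf, e⟩ ⟨f', hf', e'⟩
        exact ⟨_, add_mem hf hf', fun y => by simp [e, e']⟩
      algebraMap_mem' := fun c => ⟨c • ρ, Submodule.smul_mem _ _ (Submodule.subset_span hρ),
        fun y => by simp [ρ1 y y.2]⟩
      star_mem' := by
        rintro g ⟨f, hf, e⟩
        exact ⟨_, span_testProducts_star hf, fun y => by simp [e]⟩ }
  have hsep : A.SeparatesPoints := by
    intro y y' hne
    obtain ⟨f, hf, hfy⟩ := exists_testProduct_separating c₁ c₂ c₃ hij
      (Subtype.coe_injective.ne hne)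
    refine ⟨_, ⟨⟨fun z : K => f z, (span_testProducts_continuous c₁ c₂ c₃
      (Submodule.subset_span hf)).comp continuous_subtype_val⟩, ⟨f, Submodule.subset_span hf,
        fun _ => rfl⟩, rfl⟩, hfy⟩
  have htop := ContinuousMap.starSubalgebra_topologicalClosure_eq_top_of_separatesPoints A hsep
  let F' : C(K, ℂ) := ⟨fun z => F z, hF.comp continuous_subtype_val⟩
  have hmem : F' ∈ closure (A : Set C(K, ℂ)) := by
    rw [← StarSubalgebra.topologicalClosure_coe, htop]
    trivial
  obtain ⟨g, ⟨f, hf, hgf⟩, hg⟩ := Metric.mem_closure_iff.1 hmem ε hε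
  -- The approximation `f` is controlled on `K` only. Multiplication by `χ` restores the support
  -- condition and does not increase the error, because `F = χ F` and `|χ| ≤ 1`.
  refine ⟨χ * f, span_testProducts_mul (Submodule.subset_span hχ) hf,
    fun y hy => by rw [Pi.mul_apply, hχK y hy, zero_mul], fun y => ?_⟩
  by_cases hy : y ∈ K
  · rw [hFχ y, Pi.mul_apply, ← mul_sub, norm_mul]
    have h1 : ‖F y - f y‖ ≤ ε := by
      have := (ContinuousMap.dist_lt_iff hε).1 hg ⟨y, hy⟩
      rw [hgf, dist_eq_norm] at this
      exact this.le
    calc ‖χ y‖ * ‖F y - f y‖ ≤ 1 * ε := by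
          exact mul_le_mul (χle y) h1 (norm_nonneg _) zero_le_one
      _ = ε := one_mul ε
  · rw [hFχ, Pi.mul_apply, hχK y hy]
    simpa using hε.le

end Approx

/-! ### Closed subspaces and operators with compactly supported kernels -/

section Kernel

variable {X₁ X₂ X₃ : Type} [NormedAddCommGroup X₁] [NormedSpace ℝ X₁] [FiniteDimensional ℝ X₁]
  [NormedAddCommGroup X₂] [NormedSpace ℝ X₂] [FiniteDimensional ℝ X₂]
  [NormedAddCommGroup X₃] [NormedSpace ℝ X₃] [FiniteDimensional ℝ X₃]
  {α : Type} [MeasureSpace α] [SigmaFinite (volume : Measure α)]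
  {Θ Ω : Type} [MeasureSpace Θ] [SigmaFinite (volume : Measure Θ)] [TopologicalSpace Θ] [T2Space Θ]
  [OpensMeasurableSpace Θ]
  [IsFiniteMeasureOnCompacts (volume : Measure Θ)] [TopologicalSpace Ω] [T2Space Ω]
  [MeasurableSpace Ω] [OpensMeasurableSpace (Θ × Ω)]
  {φ : α → Θ → α} {c : α → Θ → ℂ} {κ : α → Ω} {F : Θ × Ω → ℂ}

theorem exists_isInt_of_compact (hφ : Measurable (Function.uncurry φ))
    (hφ' : ∀ θ, MeasurePreserving (fun p => φ p θ) volume volume) (hκ : Measurable κ)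
    (hc : Measurable (Function.uncurry c)) (hc1 : ∀ p θ, ‖c p θ‖ ≤ 1) (hF : Continuous F)
    {K : Set (Θ × Ω)} (hK : IsCompact K) (hFK : ∀ y ∉ K, F y = 0) {C : ℝ} (hC : ∀ y, ‖F y‖ ≤ C) :
    ∃ T : Op (L2 α), IsInt T φ (fun p θ => F (θ, κ p) * c p θ) ∧
      ‖T‖ ≤ C * (volume (Prod.fst '' K)).toReal := by
  have hK1 : IsCompact (Prod.fst '' K) := hK.image continuous_fst
  have hms : MeasurableSet (Prod.fst '' K) := hK1.isClosed.measurableSet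
  by_cases hC0 : 0 ≤ C
  -- A negative bound `C` can occur only when `Θ × Ω` is empty; then `K` is empty and the operator
  -- is zero.
  swap
  · have hFz : ∀ y, F y = 0 := fun y => (hC0 ((norm_nonneg _).trans (hC y))).elim
    by_cases hα : Nonempty (Θ × Ω)
    · obtain ⟨y⟩ := hα
      exact (hC0 ((norm_nonneg _).trans (hC y))).elim
    · have hK0 : K = ∅ := by
        ext y; exact (hα ⟨y⟩).elim
      have hF0 : F = fun _ => 0 := funext hFz
      obtain ⟨T, hT⟩ := exists_isInt (α := α) (k := fun p θ => F (θ, κ p) * c p θ) hφ hφ'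
        (by simp only [hF0, zero_mul]; exact measurable_const)
        ⟨fun _ => 0, integrable_zero _ _ _, fun p θ => by simp [hF0]⟩
      refine ⟨T, hT, ?_⟩
      have := hT.norm_le (g := fun _ => 0) (integrable_zero _ _ _) (fun _ => le_rfl)
        (fun p θ => by simp [hF0])
      simpa [hK0] using this
  have hg : Integrable ((Prod.fst '' K).indicator fun _ : Θ => C) :=
    (integrable_indicator_iff hms).2 (integrableOn_const hK1.measure_lt_top.ne)
  have hle : ∀ p θ, ‖F (θ, κ p) * c p θ‖ ≤ (Prod.fst '' K).indicator (fun _ : Θ => C) θ := by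
    intro p θ
    by_cases hθ : θ ∈ Prod.fst '' K
    · rw [Set.indicator_of_mem hθ, norm_mul]
      exact (mul_le_of_le_one_right (norm_nonneg _) (hc1 p θ)).trans (hC _)
    · rw [Set.indicator_of_notMem hθ, hFK _ fun h => hθ ⟨_, h, rfl⟩, zero_mul, norm_zero]
  obtain ⟨T, hT⟩ := exists_isInt (α := α) (k := fun p θ => F (θ, κ p) * c p θ) hφ hφ'
    ((hF.measurable.comp (measurable_snd.prodMk (hκ.comp measurable_fst))).mul hc) ⟨_, hg, hle⟩
  refine ⟨T, hT, (hT.norm_le hg (fun θ => Set.indicator_nonneg (fun _ _ => hC0) θ) hle).trans ?_⟩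
  rw [integral_indicator hms, setIntegral_const, smul_eq_mul, mul_comm]
  rfl

/-- An integral operator whose kernel is a continuous function with compact support of `θ` and
`κ(p)` is a limit of operators whose kernels are products of test functions of coordinates. -/
theorem mem_of_kernel₃ {M : Submodule ℂ (Op (L2 α))} (hM : IsClosed (M : Set (Op (L2 α))))
    {T : Op (L2 α)} (hT : IsInt T φ (fun p θ => F (θ, κ p) * c p θ)) (hκ : Measurable κ)
    (hc : Measurable (Function.uncurry c)) (hc1 : ∀ p θ, ‖c p θ‖ ≤ 1) (hF : Continuous F)
    (hFc : HasCompactSupport F) (j₁ : Θ × Ω → X₁) (j₂ : Θ × Ω → X₂) (j₃ : Θ × Ω → X₃)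
    (c₁ : Continuous j₁) (c₂ : Continuous j₂) (c₃ : Continuous j₃)
    (i : X₁ × X₂ × X₃ → Θ × Ω) (hi : Continuous i) (hij : ∀ y, i (j₁ y, j₂ y, j₃ y) = y)
    (hS : ∀ u₁ u₂ u₃, IsTest u₁ → IsTest u₂ → IsTest u₃ → ∀ S : Op (L2 α),
      IsInt S φ (fun p θ => u₁ (j₁ (θ, κ p)) * u₂ (j₂ (θ, κ p)) * u₃ (j₃ (θ, κ p)) * c p θ) →
        S ∈ M) : T ∈ M := by
  obtain ⟨K, hK, hFK, hK'⟩ := exists_testProducts_approx c₁ c₂ c₃ hi hij hF hFc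
  have key : ∀ f ∈ Submodule.span ℂ (testProducts j₁ j₂ j₃), ∃ S ∈ M,
      IsInt S φ (fun p θ => f (θ, κ p) * c p θ) := by
    intro f hf
    induction hf using Submodule.span_induction with
    | mem f hf =>
      have hcont := span_testProducts_continuous c₁ c₂ c₃ (Submodule.subset_span hf)
      obtain ⟨u₁, u₂, u₃, h₁, h₂, h₃, rfl⟩ := hf
      have hcomp : HasCompactSupport fun y => u₁ (j₁ y) * u₂ (j₂ y) * u₃ (j₃ y) := by
        refine HasCompactSupport.intro
          ((h₁.2.isCompact.prod (h₂.2.isCompact.prod h₃.2.isCompact)).image hi) fun y hy => ?_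
        by_contra hne
        refine hy ⟨(j₁ y, j₂ y, j₃ y), ⟨subset_tsupport _ fun h => hne ?_,
          subset_tsupport _ fun h => hne ?_, subset_tsupport _ fun h => hne ?_⟩, hij y⟩ <;> simp [h]
      obtain ⟨C, hC⟩ := hcont.bounded_above_of_compact_support hcomp
      obtain ⟨S, hS', -⟩ := exists_isInt_of_compact hT.meas_map hT.mp hκ hc hc1 hcont hcomp
        (fun y hy => image_eq_zero_of_notMem_tsupport (f := fun y => u₁ (j₁ y) * u₂ (j₂ y) *
          u₃ (j₃ y)) hy) hC
      exact ⟨S, hS _ _ _ h₁ h₂ h₃ S hS', hS'⟩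
    | zero =>
      refine ⟨0, zero_mem _, ?_⟩
      simpa using hT.smul 0
    | add f g _ _ hf hg =>
      obtain ⟨S, hS, h⟩ := hf
      obtain ⟨S', hS', h'⟩ := hg
      exact ⟨S + S', add_mem hS hS', (h.add h').congr (fun _ _ => rfl) fun _ _ => by
        simp only [Pi.add_apply]; ring⟩
    | smul a f _ hf =>
      obtain ⟨S, hS, h⟩ := hf
      exact ⟨a • S, M.smul_mem a hS, (h.smul a).congr (fun _ _ => rfl) fun _ _ => by
        simp only [Pi.smul_apply, smul_eq_mul]; ring⟩
  have : T ∈ closure (M : Set (Op (L2 α))) := by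
    refine Metric.mem_closure_iff.2 fun ε hε => ?_
    set v := (volume (Prod.fst '' K)).toReal
    have hv : 0 ≤ v := ENNReal.toReal_nonneg
    obtain ⟨f, hf, hfK, hfF⟩ := hK' (ε / (v + 1)) (by positivity)
    obtain ⟨S, hSM, hSf⟩ := key f hf
    refine ⟨S, hSM, ?_⟩
    -- The kernels of `T` and `S` differ by a function supported in the fixed set `K` and of size at
    -- most `ε / (v + 1)`, where `v` is the volume of the projection of `K`. Hence `‖T - S‖ ≤ ε v /
    -- (v + 1) < ε`.
    obtain ⟨D, hD, hDn⟩ := exists_isInt_of_compact (F := fun y => F y - f y) hT.meas_map hT.mp hκ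
      hc hc1 (hF.sub (span_testProducts_continuous c₁ c₂ c₃ hf)) hK
      (fun y hy => by rw [hFK y hy, hfK y hy, sub_zero]) hfF
    have : T - S = D := ((hT.sub hSf).congr (fun _ _ => rfl) fun _ _ => by ring).unique hD
    rw [dist_eq_norm, this]
    refine hDn.trans_lt ?_
    rw [div_mul_eq_mul_div, div_lt_iff₀ (by positivity)]
    nlinarith
  rwa [hM.closure_eq] at this

theorem mem_of_kernel₂ {M : Submodule ℂ (Op (L2 α))} (hM : IsClosed (M : Set (Op (L2 α))))
    {T : Op (L2 α)} (hT : IsInt T φ (fun p θ => F (θ, κ p) * c p θ)) (hκ : Measurable κ)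
    (hc : Measurable (Function.uncurry c)) (hc1 : ∀ p θ, ‖c p θ‖ ≤ 1) (hF : Continuous F)
    (hFc : HasCompactSupport F) (j₁ : Θ × Ω → X₁) (j₂ : Θ × Ω → X₂)
    (c₁ : Continuous j₁) (c₂ : Continuous j₂)
    (i : X₁ × X₂ → Θ × Ω) (hi : Continuous i) (hij : ∀ y, i (j₁ y, j₂ y) = y)
    (hS : ∀ u₁ u₂, IsTest u₁ → IsTest u₂ → ∀ S : Op (L2 α),
      IsInt S φ (fun p θ => u₁ (j₁ (θ, κ p)) * u₂ (j₂ (θ, κ p)) * c p θ) → S ∈ M) : T ∈ M := by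
  -- The third coordinate is a dummy, constantly 0; its test function contributes the scalar `u₃ 0`,
  -- which is absorbed into `u₂`.
  refine mem_of_kernel₃ hM hT hκ hc hc1 hF hFc j₁ j₂ (fun _ => (0 : ℝ)) c₁ c₂ continuous_const
    (fun q => i (q.1, q.2.1)) (by fun_prop) hij fun u₁ u₂ u₃ h₁ h₂ _ S hS' => ?_
  exact hS u₁ (fun x => u₃ 0 * u₂ x) h₁ (h₂.smul _) S
    (hS'.congr (fun _ _ => rfl) fun _ _ => by ring)

end Kernel

/-! ### Identities for the character `e` and the function `eta` -/

section Scalars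

theorem e_add (s t : ℝ) : e (s + t) = e s * e t := by
  rw [e, e, e, ← Complex.exp_add]
  congr 1
  push_cast
  ring

theorem e_zero : e 0 = 1 := by simp [e]

theorem conj_e (t : ℝ) : conj (e t) = e (-t) := by
  rw [e, e, ← Complex.exp_conj]
  congr 1
  simp only [map_mul, Complex.conj_ofReal, Complex.conj_I, Complex.ofReal_neg, map_ofNat]
  ring

theorem contDiff_e : ContDiff ℝ ∞ e := by
  have : e = fun t : ℝ => Complex.exp (2 * Real.pi * Complex.ofRealCLM t * Complex.I) := by
    funext t; rfl
  rw [this]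
  fun_prop

theorem continuous_e : Continuous e := contDiff_e.continuous

theorem continuous_eta (lam : ℝ) : Continuous (eta lam) := by
  unfold eta
  split_ifs <;> fun_prop

theorem eta_add (lam r s : ℝ) :
    eta lam (r + s) = eta lam r + Real.exp (lam * r) ^ 2 * eta lam s := by
  unfold eta
  split_ifs with h
  · simp [h]
  · have : Real.exp (2 * lam * (r + s)) = Real.exp (lam * r) ^ 2 * Real.exp (2 * lam * s) := by
      rw [← Real.exp_nat_mul, ← Real.exp_add]; congr 1; push_cast; ring
    have h2 : Real.exp (2 * lam * r) = Real.exp (lam * r) ^ 2 := by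
      rw [← Real.exp_nat_mul]; congr 1; push_cast; ring
    rw [this, h2]
    field_simp
    ring

theorem eta_zero (lam : ℝ) : eta lam 0 = 0 := by simp [eta]

theorem eta_neg (lam r : ℝ) : eta lam (-r) = -((Real.exp (lam * r))⁻¹ ^ 2 * eta lam r) := by
  have := eta_add lam (-r) r
  rw [neg_add_cancel, eta_zero, mul_neg, Real.exp_neg] at this
  linarith

theorem eta_sub (lam r s : ℝ) :
    eta lam (r - s) = eta lam r - (Real.exp (lam * r) * (Real.exp (lam * s))⁻¹) ^ 2 * eta lam s := by
  rw [sub_eq_add_neg, eta_add, eta_neg]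
  ring

/-- Symmetry of `eta_add` in `r` and `s`. It relates exponentials to `eta` without division by
`lam`, so most phase identities need no separate case `lam = 0`. -/
theorem eta_comm (lam r s : ℝ) :
    (Real.exp (lam * s) ^ 2 - 1) * eta lam r = (Real.exp (lam * r) ^ 2 - 1) * eta lam s := by
  have h1 := eta_add lam r s
  have h2 := eta_add lam s r
  rw [add_comm] at h2
  linarith

theorem weight_mul (n : ℕ) (c d s t : ℝ) : (((c ^ n : ℝ) : ℂ) * e s) * (((d ^ n : ℝ) : ℂ) * e t) =
    (((c * d) ^ n : ℝ) : ℂ) * e (s + t) := by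
  rw [e_add, mul_pow]
  push_cast
  ring

theorem weight_congr (n : ℕ) {c d s t : ℝ} (h : c = d) (h' : s = t) :
    ((c ^ n : ℝ) : ℂ) * e s = ((d ^ n : ℝ) : ℂ) * e t := by rw [h, h']

theorem weight_eq_e (n : ℕ) {c s t : ℝ} (h : c = 1) (h' : s = t) :
    ((c ^ n : ℝ) : ℂ) * e s = e t := by simp [h, h']

end Scalars

/-! ### Measure preserving and quasi-measure-preserving maps -/

section MeasurePreserving

variable {α β : Type} [MeasureSpace α] [MeasureSpace β]
  [SigmaFinite (volume : Measure α)] [SigmaFinite (volume : Measure β)]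

theorem mp_skew_right {f : α → β → β} (hf : Measurable (Function.uncurry f))
    (h : ∀ a, MeasurePreserving (f a) volume volume) :
    MeasurePreserving (fun p : α × β => (p.1, f p.1 p.2)) volume volume :=
  (MeasurePreserving.id (volume : Measure α)).skew_product hf (ae_of_all _ fun a => (h a).map_eq)

theorem mp_skew_left {f : β → α → α} (hf : Measurable (Function.uncurry f))
    (h : ∀ b, MeasurePreserving (f b) volume volume) :
    MeasurePreserving (fun p : α × β => (f p.2 p.1, p.2)) volume volume :=
  (Measure.measurePreserving_swap.comp (mp_skew_right hf h)).comp Measure.measurePreserving_swap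

theorem qmp_skew_left {f : β → α → α} (hf : Measurable (Function.uncurry f))
    (h : ∀ b, Measure.QuasiMeasurePreserving (f b) volume volume) :
    Measure.QuasiMeasurePreserving (fun p : α × β => (f p.2 p.1, p.2)) volume volume := by
  have hm : Measurable fun p : α × β => (f p.2 p.1, p.2) :=
    (hf.comp measurable_swap).prodMk measurable_snd
  refine ⟨hm, Measure.AbsolutelyContinuous.mk fun s hs h0 => ?_⟩
  rw [Measure.map_apply hm hs]
  have h1 : ∀ᵐ b : β, volume ((fun a => (a, b)) ⁻¹' s) = 0 := by
    rw [Measure.volume_eq_prod, Measure.prod_apply_symm hs,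
      lintegral_eq_zero_iff (measurable_measure_prodMk_right hs)] at h0
    exact h0
  rw [Measure.volume_eq_prod, Measure.prod_apply_symm (hm hs),
    lintegral_eq_zero_iff (measurable_measure_prodMk_right (hm hs))]
  filter_upwards [h1] with b hb
  exact (h b).preimage_null hb

/-- The weighted change of variables is applied to the indicator of a null set; the nowhere
vanishing weight does not affect null sets. -/
theorem qmp_of_lintegral {w : α → ℝ≥0∞} {φ : α → α} (hw : Measurable w) (hφ : Measurable φ)
    (hw0 : ∀ p, w p ≠ 0)
    (hn : ∀ g : α → ℝ≥0∞, Measurable g → ∫⁻ p, w p ^ 2 * g (φ p) = ∫⁻ p, g p) :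
    Measure.QuasiMeasurePreserving φ volume volume := by
  refine ⟨hφ, Measure.AbsolutelyContinuous.mk fun s hs h0 => ?_⟩
  rw [Measure.map_apply hφ hs]
  have h1 := hn (s.indicator 1) (measurable_one.indicator hs)
  have hm : Measurable fun p => w p ^ 2 * s.indicator (1 : α → ℝ≥0∞) (φ p) :=
    (hw.pow_const 2).mul ((measurable_one.indicator hs).comp hφ)
  rw [lintegral_indicator_one hs, h0, lintegral_eq_zero_iff hm] at h1
  refine measure_mono_null (fun p hp => ?_) (ae_iff.1 h1)
  simp only [Set.mem_ofPred_eq, Pi.zero_apply, mul_eq_zero, not_or]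
  exact ⟨pow_ne_zero 2 (hw0 p), by simp [Set.indicator_of_mem (show φ p ∈ s from hp)]⟩

theorem mp_translate {n : ℕ} (x y : EuclideanSpace ℝ (Fin n)) (s : ℝ) :
    MeasurePreserving (fun p : Pt n => ((p.1 + x, p.2.1 + y, p.2.2 + s) : Pt n)) volume volume :=
  measurePreserving_add_right (volume : Measure (Pt n)) (x, y, s)

end MeasurePreserving

/-! ### Explicit formulas for `U_A`, `j`, `X`, `Y` and `Z` -/

section Unitaries

variable (n : ℕ) (lam : ℝ)

theorem isWC_UA : IsWC (UA n lam)
    (fun p => ((Real.exp (-(lam * p.2.2.2)) ^ n : ℝ) : ℂ) *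
      e (-(eta lam p.2.2.2 * ⟪Real.exp (-(lam * p.2.2.2)) • p.1.1,
        p.2.2.1 - Real.exp (-(lam * p.2.2.2)) • p.1.2.1⟫_ℝ)))
    (fun p => ((Real.exp (-(lam * p.2.2.2)) • p.1.1, Real.exp (-(lam * p.2.2.2)) • p.1.2.1,
      p.1.2.2 + p.2.2.2), (p.2.1 - Real.exp (-(lam * p.2.2.2)) • p.1.1,
      p.2.2.1 - Real.exp (-(lam * p.2.2.2)) • p.1.2.1, p.2.2.2))) := by
  have he := measurable_e
  have ht := measurable_eta lam
  refine ⟨by fun_prop, ?_, fun ξ => opOfFormula_ae _ (exists_unitary n lam) ξ⟩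
  -- The map factors as a dilation and shift of the first point, with parameters from the second,
  -- followed by a translation of the second point by the new first one. Only the dilation changes
  -- the measure, by a positive factor.
  have h1 : ∀ b : Pt n, Measure.QuasiMeasurePreserving (fun a : Pt n =>
      ((Real.exp (-(lam * b.2.2)) • a.1, Real.exp (-(lam * b.2.2)) • a.2.1,
        a.2.2 + b.2.2) : Pt n)) volume volume := fun b =>
    qmp_of_lintegral (w := fun _ => ENNReal.ofReal (|Real.exp (-(lam * b.2.2))| ^ n))
      measurable_const (by fun_prop) (fun _ => (ENNReal.ofReal_pos.2 (by positivity)).ne')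
      fun g hg => lintegral_dilation (fun _ => Real.exp (-(lam * b.2.2))) (fun r => r + b.2.2)
        measurable_const (fun _ => (Real.exp_pos _).ne') (measurePreserving_add_right _ _) g hg
  have h2 : MeasurePreserving (fun p : Pt n × Pt n =>
      (p.1, ((p.2.1 - p.1.1, p.2.2.1 - p.1.2.1, p.2.2.2) : Pt n))) volume volume :=
    mp_skew_right (f := fun a b : Pt n => ((b.1 - a.1, b.2.1 - a.2.1, b.2.2) : Pt n))
      (by unfold Function.uncurry; fun_prop) fun a => by
        simpa [sub_eq_add_neg] using mp_translate (-a.1) (-a.2.1) 0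
  exact h2.quasiMeasurePreserving.comp (qmp_skew_left (f := fun b a : Pt n =>
    ((Real.exp (-(lam * b.2.2)) • a.1, Real.exp (-(lam * b.2.2)) • a.2.1,
      a.2.2 + b.2.2) : Pt n)) (by unfold Function.uncurry; fun_prop) h1)

theorem lintegral_j (g : Pt n → ℝ≥0∞) (hg : Measurable g) :
    ∫⁻ p : Pt n, ENNReal.ofReal (Real.exp (lam * p.2.2) ^ n) ^ 2 *
      g (-(Real.exp (lam * p.2.2) • p.1), -(Real.exp (lam * p.2.2) • p.2.1), -p.2.2) =
      ∫⁻ p, g p := by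
  rw [← lintegral_dilation (fun r => -Real.exp (lam * r)) (fun r => -r) (by fun_prop)
      (fun r => neg_ne_zero.2 (Real.exp_pos _).ne') (Measure.measurePreserving_neg volume) g hg]
  refine lintegral_congr fun p => ?_
  rw [abs_neg, abs_of_pos (Real.exp_pos _), neg_smul, neg_smul]

theorem isWC_j : IsWC (jOp n lam)
    (fun p => ((Real.exp (lam * p.2.2) ^ n : ℝ) : ℂ) * e (-(eta lam p.2.2 * ⟪p.1, p.2.1⟫_ℝ)))
    (fun p => (-(Real.exp (lam * p.2.2) • p.1), -(Real.exp (lam * p.2.2) • p.2.1), -p.2.2)) := by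
  have he := measurable_e
  have ht := measurable_eta lam
  exact ⟨by fun_prop, qmp_of_lintegral (by fun_prop) (by fun_prop)
    (fun p => (ENNReal.ofReal_pos.2 (by positivity)).ne') (lintegral_j n lam),
    fun ξ => opOfFormula_ae _ (exists_j n lam) ξ⟩

theorem jOp_mul_jOp : jOp n lam * jOp n lam = 1 := by
  refine (((isWC_j n lam).mul (isWC_j n lam)).congr (fun p => ?_) fun p => ?_).unique isWC_one
  · rw [weight_mul]
    refine (weight_congr n (d := 1) (t := 0) ?_ ?_).trans (by simp [e_zero])
    · simp [← Real.exp_add]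
    · simp only [inner_neg_left, inner_neg_right, real_inner_smul_left, real_inner_smul_right,
        eta_neg]
      field_simp
      ring
  · simp only [id, smul_neg, smul_smul, neg_neg, mul_neg, ← Real.exp_add, neg_add_cancel,
      Real.exp_zero, one_smul]

theorem norm_jOp (ξ : L2 (Pt n)) : ‖jOp n lam ξ‖ = ‖ξ‖ := by
  refine (isWC_j n lam).norm_apply (fun g hg => ?_) ξ
  rw [← lintegral_j n lam g hg]
  refine lintegral_congr fun p => ?_
  rw [← ofReal_norm, norm_mul, norm_e, mul_one, Complex.norm_real, norm_pow, Real.norm_eq_abs,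
    abs_of_pos (Real.exp_pos _)]

theorem star_jOp : star (jOp n lam) = jOp n lam :=
  star_eq_of_isometry (norm_jOp n lam) (jOp_mul_jOp n lam)

/-- The three dilation factors multiply to 1, so after conjugation by `j` only a unimodular weight
and a measure preserving map remain. That is why `X` and `Y` are easier to slice than `U_A`. -/
theorem isWC_conj_UA : IsWC (opTensor (jOp n lam) 1 * UA n lam * opTensor (jOp n lam) 1)
    (fun p => e (eta lam p.2.2.2 * ⟪Real.exp (lam * (p.1.2.2 - p.2.2.2)) • p.1.1, p.2.2.1⟫_ℝ))
    (fun p => ((p.1.1, p.1.2.1, p.1.2.2 - p.2.2.2),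
      (p.2.1 + Real.exp (lam * (p.1.2.2 - p.2.2.2)) • p.1.1,
        p.2.2.1 + Real.exp (lam * (p.1.2.2 - p.2.2.2)) • p.1.2.1, p.2.2.2))) := by
  refine ((((isWC_j n lam).opTensor_right).mul (isWC_UA n lam)).mul
    ((isWC_j n lam).opTensor_right)).congr (fun p => ?_) fun p => ?_
  · rw [weight_mul, weight_mul]
    refine weight_eq_e n ?_ ?_
    · simp only [← Real.exp_add]
      rw [← Real.exp_zero]
      congr 1
      ring
    · simp only [inner_add_left, inner_add_right, inner_sub_left, inner_sub_right, inner_neg_left,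
        inner_neg_right, real_inner_smul_left, real_inner_smul_right, eta_add, eta_sub, eta_neg,
        mul_add, mul_sub, mul_neg, Real.exp_add, Real.exp_sub, Real.exp_neg]
      field_simp
      linear_combination (-⟪p.1.1, p.1.2.1⟫_ℝ) * eta_comm lam p.1.2.2 p.2.2.2
  · simp only [Prod.mk.injEq, smul_add, smul_sub, smul_neg, smul_smul, mul_add, mul_sub, mul_neg,
      Real.exp_add, Real.exp_sub, Real.exp_neg]
    refine ⟨⟨?_, ?_, ?_⟩, ?_, ?_, ?_⟩ <;> first | trivial | ring1 | (match_scalars <;> field_simp <;> ring1)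

theorem mp_conj_UA : MeasurePreserving (fun p : Pt n × Pt n =>
    (((p.1.1, p.1.2.1, p.1.2.2 - p.2.2.2) : Pt n),
      ((p.2.1 + Real.exp (lam * (p.1.2.2 - p.2.2.2)) • p.1.1,
        p.2.2.1 + Real.exp (lam * (p.1.2.2 - p.2.2.2)) • p.1.2.1, p.2.2.2) : Pt n)))
    volume volume := by
  have h1 : MeasurePreserving (fun p : Pt n × Pt n =>
      (((p.1.1, p.1.2.1, p.1.2.2 - p.2.2.2) : Pt n), p.2)) volume volume :=
    mp_skew_left (f := fun b a : Pt n => ((a.1, a.2.1, a.2.2 - b.2.2) : Pt n))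
      (by unfold Function.uncurry; fun_prop) fun b => by
        simpa [sub_eq_add_neg] using mp_translate 0 0 (-b.2.2)
  have h2 : MeasurePreserving (fun p : Pt n × Pt n =>
      (p.1, ((p.2.1 + Real.exp (lam * p.1.2.2) • p.1.1,
        p.2.2.1 + Real.exp (lam * p.1.2.2) • p.1.2.1, p.2.2.2) : Pt n))) volume volume :=
    mp_skew_right (f := fun a b : Pt n => ((b.1 + Real.exp (lam * a.2.2) • a.1,
        b.2.1 + Real.exp (lam * a.2.2) • a.2.1, b.2.2) : Pt n))
      (by unfold Function.uncurry; fun_prop) fun a => by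
        simpa using mp_translate (Real.exp (lam * a.2.2) • a.1) (Real.exp (lam * a.2.2) • a.2.1) 0
  exact h2.comp h1

theorem mp_X : MeasurePreserving (fun p : Pt n × Pt n =>
    (((p.1.1, p.1.2.1, p.1.2.2 + p.2.2.2) : Pt n),
      ((p.2.1 - Real.exp (lam * p.1.2.2) • p.1.1,
        p.2.2.1 - Real.exp (lam * p.1.2.2) • p.1.2.1, p.2.2.2) : Pt n)))
    volume volume := by
  have h1 : MeasurePreserving (fun p : Pt n × Pt n =>
      (((p.1.1, p.1.2.1, p.1.2.2 + p.2.2.2) : Pt n), p.2)) volume volume :=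
    mp_skew_left (f := fun b a : Pt n => ((a.1, a.2.1, a.2.2 + b.2.2) : Pt n))
      (by unfold Function.uncurry; fun_prop) fun b => by
        simpa using mp_translate 0 0 b.2.2
  have h2 : MeasurePreserving (fun p : Pt n × Pt n =>
      (p.1, ((p.2.1 - Real.exp (lam * p.1.2.2) • p.1.1,
        p.2.2.1 - Real.exp (lam * p.1.2.2) • p.1.2.1, p.2.2.2) : Pt n))) volume volume :=
    mp_skew_right (f := fun a b : Pt n => ((b.1 - Real.exp (lam * a.2.2) • a.1,
        b.2.1 - Real.exp (lam * a.2.2) • a.2.1, b.2.2) : Pt n))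
      (by unfold Function.uncurry; fun_prop) fun a => by
        simpa [sub_eq_add_neg] using
          mp_translate (-(Real.exp (lam * a.2.2) • a.1)) (-(Real.exp (lam * a.2.2) • a.2.1)) 0
  exact h1.comp h2

/-- The two flips in `Û_A` cancel against the two in the definition of `X`. -/
theorem X_eq : X n lam = star (opTensor (jOp n lam) 1 * UA n lam * opTensor (jOp n lam) 1) := by
  have : X n lam = flip * star (flip * (opTensor (jOp n lam) 1 * UA n lam *
      opTensor (jOp n lam) 1) * flip) * flip := by
    simp only [X, UAhat, mul_assoc]
  rw [this, star_mul, star_mul, star_flip]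
  generalize star (opTensor (jOp n lam) 1 * UA n lam * opTensor (jOp n lam) 1) = T
  calc flip * (flip * (T * flip)) * flip = (flip * flip) * T * (flip * flip) := by
        simp only [mul_assoc]
    _ = T := by rw [flip_mul_flip, one_mul, mul_one]

theorem norm_conj_UA (ξ : L2 (Pt n × Pt n)) :
    ‖(opTensor (jOp n lam) 1 * UA n lam * opTensor (jOp n lam) 1 : Op (L2 (Pt n × Pt n))) ξ‖ = ‖ξ‖ :=
  (isWC_conj_UA n lam).norm_apply_of_mp (fun _ => norm_e _) (mp_conj_UA n lam) ξ

/-- The inverse of the map in `isWC_conj_UA` and the matching inverse phase define a candidate `S`;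
one product computation identifies it with the adjoint through `star_eq_of_isometry`. -/
theorem isWC_X : IsWC (X n lam)
    (fun p => e (-(eta lam p.2.2.2 * ⟪Real.exp (lam * p.1.2.2) • p.1.1,
      p.2.2.1 - Real.exp (lam * p.1.2.2) • p.1.2.1⟫_ℝ)))
    (fun p => ((p.1.1, p.1.2.1, p.1.2.2 + p.2.2.2),
      (p.2.1 - Real.exp (lam * p.1.2.2) • p.1.1,
        p.2.2.1 - Real.exp (lam * p.1.2.2) • p.1.2.1, p.2.2.2))) := by
  have he := measurable_e
  have ht := measurable_eta lam
  obtain ⟨S, hS⟩ := exists_isWC_of_mp (w := fun p : Pt n × Pt n =>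
    e (-(eta lam p.2.2.2 * ⟪Real.exp (lam * p.1.2.2) • p.1.1,
      p.2.2.1 - Real.exp (lam * p.1.2.2) • p.1.2.1⟫_ℝ))) (by fun_prop) (fun _ => norm_e _)
    (mp_X n lam)
  have : star (opTensor (jOp n lam) 1 * UA n lam * opTensor (jOp n lam) 1) = S := by
    refine star_eq_of_isometry (norm_conj_UA n lam) ?_
    refine (((isWC_conj_UA n lam).mul hS).congr (fun p => ?_) fun p => ?_).unique isWC_one
    · rw [← e_add, ← e_zero]
      congr 1
      simp only [inner_add_left, inner_add_right, inner_sub_left, inner_sub_right, inner_neg_left,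
        inner_neg_right, real_inner_smul_left, real_inner_smul_right, eta_add, eta_sub, eta_neg,
        mul_add, mul_sub, mul_neg, Real.exp_add, Real.exp_sub, Real.exp_neg]
      field_simp
      ring
    · have : p = ((p.1.1, p.1.2.1, p.1.2.2), (p.2.1, p.2.2.1, p.2.2.2)) := rfl
      rw [id, this]
      simp only [Prod.mk.injEq, smul_add, smul_sub, smul_neg, smul_smul, mul_add, mul_sub, mul_neg,
        Real.exp_add, Real.exp_sub, Real.exp_neg]
      refine ⟨⟨?_, ?_, ?_⟩, ?_, ?_, ?_⟩ <;> first | trivial | ring1 | (match_scalars <;> field_simp <;> ring1)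
  rwa [X_eq, this]

theorem norm_X (ξ : L2 (Pt n × Pt n)) : ‖X n lam ξ‖ = ‖ξ‖ :=
  (isWC_X n lam).norm_apply_of_mp (fun _ => norm_e _) (mp_X n lam) ξ

theorem star_X : star (X n lam) =
    opTensor (jOp n lam) 1 * UA n lam * opTensor (jOp n lam) 1 := by
  rw [X_eq, star_star]

theorem isWC_star_X : IsWC (star (X n lam))
    (fun p => e (eta lam p.2.2.2 * ⟪Real.exp (lam * (p.1.2.2 - p.2.2.2)) • p.1.1, p.2.2.1⟫_ℝ))
    (fun p => ((p.1.1, p.1.2.1, p.1.2.2 - p.2.2.2),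
      (p.2.1 + Real.exp (lam * (p.1.2.2 - p.2.2.2)) • p.1.1,
        p.2.2.1 + Real.exp (lam * (p.1.2.2 - p.2.2.2)) • p.1.2.1, p.2.2.2))) := by
  rw [star_X]
  exact isWC_conj_UA n lam

theorem star_mul_self_of_isometry {H : Type} [NormedAddCommGroup H] [InnerProductSpace ℂ H]
    [CompleteSpace H] {T : Op H} (hT : ∀ ξ, ‖T ξ‖ = ‖ξ‖) : star T * T = 1 :=
  (ContinuousLinearMap.norm_map_iff_adjoint_comp_self T).1 hT

theorem X_mem_unitary : X n lam ∈ unitary (Op (L2 (Pt n × Pt n))) := by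
  refine Unitary.mem_iff.2 ⟨star_mul_self_of_isometry (norm_X n lam), ?_⟩
  have := star_mul_self_of_isometry (norm_conj_UA n lam)
  rwa [← star_X, star_star] at this

theorem flip_mem_unitary : (flip : Op (L2 (Pt n × Pt n))) ∈ unitary (Op (L2 (Pt n × Pt n))) :=
  Unitary.mem_iff.2 ⟨by rw [star_flip, flip_mul_flip], by rw [star_flip, flip_mul_flip]⟩

theorem Y_eq : Y n lam = flip * star (X n lam) * flip := by
  rw [star_X]
  simp only [Y, UAhat, mul_assoc]

theorem star_Y : star (Y n lam) = flip * X n lam * flip := by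
  rw [Y_eq, star_mul, star_mul, star_flip, star_star, mul_assoc]

theorem Y_mem_unitary : Y n lam ∈ unitary (Op (L2 (Pt n × Pt n))) := by
  rw [Y_eq]
  exact mul_mem (mul_mem (flip_mem_unitary n) (Unitary.star_mem (X_mem_unitary n lam)))
    (flip_mem_unitary n)

theorem jOp_mem_unitary : jOp n lam ∈ unitary (Op (L2 (Pt n))) :=
  Unitary.mem_iff.2 ⟨by rw [star_jOp, jOp_mul_jOp], by rw [star_jOp, jOp_mul_jOp]⟩

theorem opTensor_mem_unitary {α β : Type} [MeasureSpace α] [MeasureSpace β]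
    [SigmaFinite (volume : Measure α)] [SigmaFinite (volume : Measure β)]
    {T : Op (L2 α)} {S : Op (L2 β)} (hT : T ∈ unitary (Op (L2 α)))
    (hS : S ∈ unitary (Op (L2 β))) : opTensor T S ∈ unitary (Op (L2 (α × β))) := by
  refine Unitary.mem_iff.2 ⟨?_, ?_⟩
  · rw [star_opTensor, ← opTensor_mul, Unitary.star_mul_self_of_mem hT,
      Unitary.star_mul_self_of_mem hS, opTensor_one]
  · rw [star_opTensor, ← opTensor_mul, Unitary.mul_star_self_of_mem hT,
      Unitary.mul_star_self_of_mem hS, opTensor_one]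

theorem Z_mem_unitary : Z n lam ∈ unitary (Op (L2 (Pt n × Pt n))) :=
  have hj := opTensor_mem_unitary (jOp_mem_unitary n lam) (jOp_mem_unitary n lam)
  mul_mem (Unitary.star_mem (Y_mem_unitary n lam)) (mul_mem (mul_mem hj (Y_mem_unitary n lam)) hj)

theorem UA_eq : UA n lam = opTensor (jOp n lam) 1 * star (X n lam) * opTensor (jOp n lam) 1 := by
  have h : opTensor (jOp n lam) (1 : Op (L2 (Pt n))) * opTensor (jOp n lam) 1 = 1 := by
    rw [← opTensor_mul, jOp_mul_jOp, one_mul, opTensor_one]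
  rw [star_X]
  calc UA n lam = (opTensor (jOp n lam) (1 : Op (L2 (Pt n))) * opTensor (jOp n lam) 1) * UA n lam *
        (opTensor (jOp n lam) (1 : Op (L2 (Pt n))) * opTensor (jOp n lam) 1) := by
          rw [h, one_mul, mul_one]
    _ = _ := by simp only [mul_assoc]

theorem UA_mem_unitary : UA n lam ∈ unitary (Op (L2 (Pt n × Pt n))) := by
  have hj := opTensor_mem_unitary (jOp_mem_unitary n lam) (one_mem (unitary (Op (L2 (Pt n)))))
  rw [UA_eq]
  exact mul_mem (mul_mem hj (Unitary.star_mem (X_mem_unitary n lam))) hj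

theorem isWC_Y : IsWC (Y n lam)
    (fun p => e (eta lam p.1.2.2 * ⟪Real.exp (lam * (p.2.2.2 - p.1.2.2)) • p.2.1, p.1.2.1⟫_ℝ))
    (fun p => ((p.1.1 + Real.exp (lam * (p.2.2.2 - p.1.2.2)) • p.2.1,
        p.1.2.1 + Real.exp (lam * (p.2.2.2 - p.1.2.2)) • p.2.2.1, p.1.2.2),
      (p.2.1, p.2.2.1, p.2.2.2 - p.1.2.2))) := by
  rw [Y_eq]
  exact ((isWC_flip.mul (isWC_star_X n lam)).mul isWC_flip).congr (by simp) (by simp)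

theorem isWC_star_Y : IsWC (star (Y n lam))
    (fun p => e (-(eta lam p.1.2.2 * ⟪Real.exp (lam * p.2.2.2) • p.2.1,
      p.1.2.1 - Real.exp (lam * p.2.2.2) • p.2.2.1⟫_ℝ)))
    (fun p => ((p.1.1 - Real.exp (lam * p.2.2.2) • p.2.1,
        p.1.2.1 - Real.exp (lam * p.2.2.2) • p.2.2.1, p.1.2.2),
      (p.2.1, p.2.2.1, p.2.2.2 + p.1.2.2))) := by
  rw [star_Y]
  exact ((isWC_flip.mul (isWC_X n lam)).mul isWC_flip).congr (by simp) (by simp)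

theorem isWC_conj_Y : IsWC
    (opTensor (jOp n lam) (jOp n lam) * Y n lam * opTensor (jOp n lam) (jOp n lam))
    (fun p => ((Real.exp (lam * p.1.2.2) ^ n : ℝ) : ℂ) * e (eta lam p.1.2.2 * ⟪p.1.1, p.2.2.1⟫_ℝ))
    (fun p => ((p.1.1 + p.2.1, p.1.2.1 + p.2.2.1, p.1.2.2),
      (Real.exp (lam * p.1.2.2) • p.2.1, Real.exp (lam * p.1.2.2) • p.2.2.1,
        p.2.2.2 - p.1.2.2))) := by
  have hj := (isWC_j n lam).opTensor (isWC_j n lam)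
  refine ((hj.mul (isWC_Y n lam)).mul hj).congr (fun p => ?_) fun p => ?_
  · rw [weight_mul, weight_mul, show ∀ a b c : ℂ, a * b * c = a * c * b by intros; ring,
      weight_mul, mul_assoc, ← e_add]
    refine weight_congr n ?_ ?_
    · simp only [← Real.exp_add]
      congr 1
      ring
    · simp only [inner_add_left, inner_add_right, inner_sub_left, inner_sub_right, inner_neg_left,
        inner_neg_right, real_inner_smul_left, real_inner_smul_right, eta_add, eta_sub, eta_neg,
        mul_add, mul_sub, mul_neg, Real.exp_add, Real.exp_sub, Real.exp_neg]
      field_simp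
      ring
  · simp only [Prod.mk.injEq, smul_add, smul_sub, smul_neg, smul_smul, mul_add, mul_sub, mul_neg,
      Real.exp_add, Real.exp_sub, Real.exp_neg]
    refine ⟨⟨?_, ?_, ?_⟩, ?_, ?_, ?_⟩ <;> first | trivial | ring1 | (match_scalars <;> field_simp <;> ring1)

/-- The shifts of the `r`-coordinates in `Y*` and in `(j ⊗ j) Y (j ⊗ j)` cancel. Therefore `Z`
leaves both `r`-coordinates fixed and acts linearly on the remaining ones, which keeps `π(L_f)`
computable. -/
theorem isWC_Z : IsWC (Z n lam)
    (fun p => ((Real.exp (lam * p.1.2.2) ^ n : ℝ) : ℂ) * e (eta lam p.1.2.2 *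
      (⟪p.1.1 - Real.exp (lam * p.2.2.2) • p.2.1, p.2.2.1⟫_ℝ - Real.exp (lam * p.2.2.2) *
        ⟪p.2.1, p.1.2.1 - Real.exp (lam * p.2.2.2) • p.2.2.1⟫_ℝ)))
    (fun p => ((p.1.1 + (1 - Real.exp (lam * p.2.2.2)) • p.2.1,
        p.1.2.1 + (1 - Real.exp (lam * p.2.2.2)) • p.2.2.1, p.1.2.2),
      (Real.exp (lam * p.1.2.2) • p.2.1, Real.exp (lam * p.1.2.2) • p.2.2.1, p.2.2.2))) := by
  refine ((isWC_star_Y n lam).mul (isWC_conj_Y n lam)).congr (fun p => ?_) fun p => ?_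
  · rw [mul_left_comm, ← e_add]
    refine weight_congr n rfl ?_
    simp only [inner_add_left, inner_add_right, inner_sub_left, inner_sub_right, inner_neg_left,
      inner_neg_right, real_inner_smul_left, real_inner_smul_right, eta_add, eta_sub, eta_neg,
      mul_add, mul_sub, mul_neg, Real.exp_add, Real.exp_sub, Real.exp_neg]
    ring
  · simp only [Prod.mk.injEq, smul_add, smul_sub, smul_neg, smul_smul, mul_add, mul_sub, mul_neg,
      Real.exp_add, Real.exp_sub, Real.exp_neg]
    refine ⟨⟨?_, ?_, ?_⟩, ?_, ?_, ?_⟩ <;> first | trivial | ring1 | (match_scalars <;> field_simp <;> ring1)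

end Unitaries

/-! ### Slices of operators by vector functionals -/

section Slices

variable {α β : Type} [MeasureSpace α] [MeasureSpace β]
  [SigmaFinite (volume : Measure α)] [SigmaFinite (volume : Measure β)]

/-- The slice `(id ⊗ ω)(V)` with `ω = ⟨u, · v⟩`. -/
noncomputable def rslice (u v : L2 β) (V : Op (L2 (α × β))) : Op (L2 α) :=
  (insRight u).adjoint ∘L V ∘L insRight v

theorem inner_rslice (u v : L2 β) (V : Op (L2 (α × β))) (ξ η : L2 α) :
    ⟪ξ, rslice u v V η⟫_ℂ = ⟪tmul ξ u, V (tmul η v)⟫_ℂ := by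
  simp only [rslice, ContinuousLinearMap.comp_apply, ContinuousLinearMap.adjoint_inner_right,
    insRight_apply]

theorem op_ext_inner {H : Type} [NormedAddCommGroup H] [InnerProductSpace ℂ H] {T S : Op H}
    (h : ∀ ξ η, ⟪ξ, T η⟫_ℂ = ⟪ξ, S η⟫_ℂ) : T = S :=
  ContinuousLinearMap.ext fun η => ext_inner_left ℂ fun ξ => h ξ η

theorem norm_insRight_le (v : L2 β) : ‖(insRight v : L2 α →L[ℂ] L2 (α × β))‖ ≤ ‖v‖ :=
  ContinuousLinearMap.opNorm_le_bound _ (norm_nonneg v) fun ξ =>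
    ((norm_tmul ξ v).trans (mul_comm _ _)).le

theorem norm_rslice_le (u v : L2 β) (V : Op (L2 (α × β))) :
    ‖rslice u v V‖ ≤ ‖u‖ * ‖V‖ * ‖v‖ := by
  have h1 := ContinuousLinearMap.opNorm_comp_le (insRight u : L2 α →L[ℂ] _).adjoint
    (V ∘L insRight v)
  have h2 := ContinuousLinearMap.opNorm_comp_le V (insRight v)
  rw [LinearIsometryEquiv.norm_map] at h1
  calc ‖rslice u v V‖ ≤ ‖(insRight u : L2 α →L[ℂ] _)‖ * (‖V‖ * ‖(insRight v : L2 α →L[ℂ] _)‖) :=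
        h1.trans (mul_le_mul_of_nonneg_left h2 (norm_nonneg _))
    _ ≤ ‖u‖ * (‖V‖ * ‖v‖) := by
        gcongr
        · exact norm_insRight_le u
        · exact norm_insRight_le v
    _ = _ := by ring

theorem continuous_insRight :
    Continuous fun v : L2 β => (insRight v : L2 α →L[ℂ] L2 (α × β)) :=
  AddMonoidHomClass.continuous_of_bound
    (AddMonoidHom.mk' (fun v : L2 β => (insRight v : L2 α →L[ℂ] L2 (α × β))) fun _ _ =>
      ContinuousLinearMap.ext fun _ => tmul_add_right _ _ _) 1 fun v =>
        (norm_insRight_le v).trans (one_mul _).symm.le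

theorem continuous_rslice_left (v : L2 β) (V : Op (L2 (α × β))) :
    Continuous fun u => rslice u v V :=
  ((ContinuousLinearMap.adjoint (𝕜 := ℂ)).continuous.comp continuous_insRight).clm_comp
    continuous_const

theorem continuous_rslice_right (u : L2 β) (V : Op (L2 (α × β))) :
    Continuous fun v => rslice u v V :=
  continuous_const.clm_comp (continuous_const.clm_comp continuous_insRight)

theorem rslice_add_left (u u' v : L2 β) (V : Op (L2 (α × β))) :
    rslice (u + u') v V = rslice u v V + rslice u' v V :=
  op_ext_inner fun ξ η => by
    rw [_root_.add_apply, inner_add_right]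
    simp only [inner_rslice, tmul_add_right, inner_add_left]

theorem rslice_add_right (u v v' : L2 β) (V : Op (L2 (α × β))) :
    rslice u (v + v') V = rslice u v V + rslice u v' V :=
  op_ext_inner fun ξ η => by
    rw [_root_.add_apply, inner_add_right]
    simp only [inner_rslice, tmul_add_right, map_add, inner_add_right]

theorem rslice_mem (u v : L2 β) (V : Op (L2 (α × β))) : rslice u v V ∈ rightSlices V := by
  refine ⟨fun i => if i = 0 then u else 0, fun i => if i = 0 then v else 0, ?_, ?_, fun ξ η => ?_⟩
  · exact summable_of_ne_finset_zero (s := {0}) fun i hi => by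
      simp [Finset.notMem_singleton.1 hi]
  · exact summable_of_ne_finset_zero (s := {0}) fun i hi => by
      simp [Finset.notMem_singleton.1 hi]
  · rw [tsum_eq_single 0 fun i hi => by simp [hi, tmul_zero_right], inner_rslice]
    simp

/-- A normal functional is a sum of vector functionals, and the corresponding series of slices
converges absolutely in norm. A closed subspace thus needs to contain only the slices `rslice u v
V`. -/
theorem mem_of_mem_rightSlices {M : Submodule ℂ (Op (L2 α))}
    (hM : IsClosed (M : Set (Op (L2 α)))) {V : Op (L2 (α × β))}
    (h : ∀ u v, rslice u v V ∈ M) {a : Op (L2 α)} (ha : a ∈ rightSlices V) : a ∈ M := by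
  obtain ⟨u, v, hu, hv, ha⟩ := ha
  have hs : Summable fun i => rslice (u i) (v i) V := by
    refine Summable.of_norm_bounded (((hu.add hv).div_const 2).mul_right ‖V‖) fun i => ?_
    refine (norm_rslice_le _ _ _).trans ?_
    -- The bound is `‖u‖ ‖v‖ ≤ (‖u‖² + ‖v‖²) / 2`, multiplied by `‖V‖`.
    nlinarith [sq_nonneg (‖u i‖ - ‖v i‖), norm_nonneg V,
      mul_nonneg (norm_nonneg V) (sq_nonneg (‖u i‖ - ‖v i‖))]
  have : a = ∑' i, rslice (u i) (v i) V := by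
    refine op_ext_inner fun ξ η => ?_
    rw [ha]
    have h1 := (hs.hasSum.mapL (ContinuousLinearMap.apply ℂ (L2 α) η)).mapL (innerSL ℂ ξ)
    simp only [ContinuousLinearMap.apply_apply, innerSL_apply_apply, inner_rslice] at h1
    exact h1.tsum_eq
  rw [this]
  refine hM.mem_of_tendsto hs.hasSum (Eventually.of_forall fun s => sum_mem fun i _ => h _ _)

theorem rslice_mem_of_dense {M : Submodule ℂ (Op (L2 α))}
    (hM : IsClosed (M : Set (Op (L2 α)))) {V : Op (L2 (α × β))} {D : Set (L2 β)} (hD : Dense D)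
    (h : ∀ u ∈ D, ∀ v ∈ D, rslice u v V ∈ M) (u v) : rslice u v V ∈ M :=
  hD.induction (fun u hu => hD.induction (fun v hv => h u hu v hv)
    (hM.preimage (continuous_rslice_right _ _)) v) (hM.preimage (continuous_rslice_left _ _)) u

theorem star_rslice (u v : L2 β) (V : Op (L2 (α × β))) :
    star (rslice u v V) = rslice v u (star V) :=
  op_ext_inner fun ξ η => by
    rw [ContinuousLinearMap.star_eq_adjoint, ContinuousLinearMap.adjoint_inner_right,
      ContinuousLinearMap.star_eq_adjoint, inner_rslice, ContinuousLinearMap.adjoint_inner_right,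
      ← inner_conj_symm, inner_rslice, inner_conj_symm]

theorem rslice_mul_right (u v : L2 β) (V : Op (L2 (α × β))) (S : Op (L2 α)) :
    rslice u v (V * opTensor S 1) = rslice u v V * S :=
  op_ext_inner fun ξ η => by
    rw [inner_rslice, show (V * opTensor S 1 : Op (L2 (α × β))) (tmul η v) =
      V (opTensor S 1 (tmul η v)) from rfl, opTensor_tmul, one_apply_eq_self,
      show (rslice u v V * S : Op (L2 α)) η = rslice u v V (S η) from rfl, inner_rslice]

theorem rslice_mul_left (u v : L2 β) (V : Op (L2 (α × β))) (S : Op (L2 α)) :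
    rslice u v (opTensor S 1 * V) = S * rslice u v V := by
  have := congrArg star (rslice_mul_right v u (star V) (star S))
  rw [star_rslice, star_mul, star_mul, star_rslice, star_star, star_opTensor, star_star,
    star_one] at this
  exact this

/-- Operators on the sliced leg are absorbed into the vectors. Consequently, multiplying by a
unitary such as `1 ⊗ j` does not change the set of slices. -/
theorem rslice_conj_one (u v : L2 β) (V : Op (L2 (α × β))) (S T : Op (L2 β)) :
    rslice u v (opTensor 1 S * V * opTensor 1 T) = rslice (star S u) (T v) V :=
  op_ext_inner fun ξ η => by
    rw [inner_rslice, inner_rslice]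
    have h1 : (opTensor (1 : Op (L2 α)) T) (tmul η v) = tmul η (T v) := opTensor_tmul _ _ _ _
    have h2 : (star (opTensor (1 : Op (L2 α)) S)) (tmul ξ u) = tmul ξ (star S u) := by
      rw [star_opTensor, opTensor_tmul, star_one]; rfl
    rw [← h1, ← h2, ContinuousLinearMap.star_eq_adjoint,
      ContinuousLinearMap.adjoint_inner_left]
    rfl

theorem leftSlices_eq {α : Type} [MeasureSpace α] [SigmaFinite (volume : Measure α)]
    (V : Op (L2 (α × α))) : leftSlices V = rightSlices (flip * V * flip) := by
  have key : ∀ u v ξ η : L2 α, ⟪tmul u ξ, V (tmul v η)⟫_ℂ =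
      ⟪tmul ξ u, (flip * V * flip : Op (L2 (α × α))) (tmul η v)⟫_ℂ := by
    intro u v ξ η
    have h := ContinuousLinearMap.adjoint_inner_left (flip : Op (L2 (α × α)))
      (V (flip (tmul η v))) (tmul ξ u)
    rw [← ContinuousLinearMap.star_eq_adjoint, star_flip, flip_tmul, flip_tmul] at h
    rw [h, ← flip_tmul η v]
    rfl
  ext a
  constructor
  · rintro ⟨u, v, hu, hv, h⟩
    exact ⟨u, v, hu, hv, fun ξ η => by simp only [h, key]⟩
  · rintro ⟨u, v, hu, hv, h⟩
    exact ⟨u, v, hu, hv, fun ξ η => by simp only [h, key]⟩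

/-- A slice of a weighted composition operator is an integral operator. -/
theorem rslice_eq_of_isInt {V : Op (L2 (α × β))} {w : α × β → ℂ} {φ : α × β → α × β}
    (hV : IsWC V w φ) {u v : β → ℂ} (hu : MemLp u 2 volume) (hv : MemLp v 2 volume)
    {S : Op (L2 α)} {ψ : α → β → α} {k : α → β → ℂ} (hS : IsInt S ψ k)
    (hψ : ∀ a b, ψ a b = (φ (a, b)).1)
    (hk : ∀ a b, k a b = conj (u b) * w (a, b) * v (φ (a, b)).2) :
    rslice (hu.toLp u) (hv.toLp v) V = S := by
  refine op_ext_inner fun ξ η => ?_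
  have hI := L2.integrable_inner (𝕜 := ℂ) (tmul ξ (hu.toLp u)) (V (tmul η (hv.toLp v)))
  have hae : (fun q => ⟪tmul ξ (hu.toLp u) q, V (tmul η (hv.toLp v)) q⟫_ℂ) =ᵐ[volume]
      fun q : α × β => conj (ξ q.1) * (k q.1 q.2 * η (ψ q.1 q.2)) := by
    filter_upwards [tmul_ae ξ (hu.toLp u), hV.apply (tmul η (hv.toLp v)),
      hV.qmp.ae (tmul_ae η (hv.toLp v)), ae_snd hu.coeFn_toLp,
      hV.qmp.ae (ae_snd hv.coeFn_toLp)] with q h1 h2 h3 h4 h5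
    rw [h1, h2, h3, h4, h5, hk, hψ, RCLike.inner_apply, map_mul]
    ring
  rw [inner_rslice, L2.inner_def, L2.inner_def, integral_congr_ae hae]
  rw [integrable_congr hae] at hI
  rw [Measure.volume_eq_prod] at hI ⊢
  rw [integral_prod _ hI]
  refine integral_congr_ae ?_
  filter_upwards [hS.apply η] with p hp
  rw [hp, RCLike.inner_apply, integral_const_mul, mul_comm]

end Slices

/-! ### Slices of leg products -/

section Legs

variable {α : Type} [MeasureSpace α] [SigmaFinite (volume : Measure α)]

theorem adjoint_insRight_tmul (u ξ η : L2 α) :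
    (insRight u : L2 α →L[ℂ] L2 (α × α)).adjoint (tmul ξ η) = ⟪u, η⟫_ℂ • ξ := by
  refine ext_inner_left ℂ fun ζ => ?_
  rw [ContinuousLinearMap.adjoint_inner_right, insRight_apply, inner_tmul, inner_smul_right,
    mul_comm]

/-- Here `A` occupies legs 2 and 4 and `B` occupies legs 1 and 3. For `A = a₁ ⊗ a₂` and `B = b₁ ⊗
b₂` both sides are `⟨u, b₂⟩ ⟨a₂, v⟩ ⟨ζ ⊗ a₁, S (b₁ ⊗ η)⟩`; density and continuity do the rest. -/
theorem inner_legs (u v ζ η : L2 α) (S : Op (L2 (α × α))) (A B : L2 (α × α)) :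
    ⟪flip23 (tmul (tmul ζ u) A), opTensor S 1 (flip23 (tmul B (tmul η v)))⟫_ℂ =
      ⟪tmul ζ ((insRight v : L2 α →L[ℂ] L2 (α × α)).adjoint A), S (tmul
        ((insRight u : L2 α →L[ℂ] L2 (α × α)).adjoint B) η)⟫_ℂ := by
  have c1 : ∀ z : L2 (α × α), Continuous fun w : L2 (α × α) => tmul z w := fun z =>
    (insLeft (β := α × α) z).continuous
  have c2 : ∀ w : L2 (α × α), Continuous fun z : L2 (α × α) => tmul z w := fun w =>
    (insRight (α := α × α) w).continuous
  have c3 : ∀ z : L2 α, Continuous fun w : L2 α => tmul z w := fun z =>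
    (insLeft (β := α) z).continuous
  have c4 : ∀ w : L2 α, Continuous fun z : L2 α => tmul z w := fun w =>
    (insRight (α := α) w).continuous
  refine tensor_induction (p := fun A => ⟪flip23 (tmul (tmul ζ u) A),
    opTensor S 1 (flip23 (tmul B (tmul η v)))⟫_ℂ = ⟪tmul ζ ((insRight v : L2 α →L[ℂ]
      L2 (α × α)).adjoint A), S (tmul ((insRight u : L2 α →L[ℂ] L2 (α × α)).adjoint B) η)⟫_ℂ)
    (fun a₁ a₂ => ?_) (fun z w hz hw => ?_) ?_ A
  · refine tensor_induction (p := fun B => ⟪flip23 (tmul (tmul ζ u) (tmul a₁ a₂)),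
      opTensor S 1 (flip23 (tmul B (tmul η v)))⟫_ℂ = ⟪tmul ζ ((insRight v : L2 α →L[ℂ]
        L2 (α × α)).adjoint (tmul a₁ a₂)), S (tmul ((insRight u : L2 α →L[ℂ]
          L2 (α × α)).adjoint B) η)⟫_ℂ)
      (fun b₁ b₂ => ?_) (fun z w hz hw => ?_) ?_ B
    · rw [flip23_tmul, flip23_tmul, opTensor_tmul, inner_tmul, adjoint_insRight_tmul,
        adjoint_insRight_tmul, tmul_smul_right, tmul_smul_left, map_smul, inner_smul_left,
        inner_smul_right, one_apply_eq_self, inner_tmul, inner_conj_symm]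
      ring
    · simp only [tmul_add_left, map_add, inner_add_right, hz, hw]
    · refine isClosed_eq (continuous_const.inner ?_) (continuous_const.inner ?_)
      · exact (opTensor S 1).continuous.comp (flip23.continuous.comp (c2 _))
      · exact S.continuous.comp ((c4 η).comp (ContinuousLinearMap.continuous _))
  · simp only [tmul_add_right, map_add, inner_add_left, hz, hw]
  · refine isClosed_eq (Continuous.inner ?_ continuous_const) (Continuous.inner ?_ continuous_const)
    · exact flip23.continuous.comp (c1 _)
    · exact (c3 ζ).comp (ContinuousLinearMap.continuous _)

theorem star_leg24 (V : Op (L2 (α × α))) : star (leg24 V) = leg24 (star V) := by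
  simp only [leg24, star_mul, star_flip23, star_opTensor, star_one, mul_assoc]

theorem leg13_tmul (V : Op (L2 (α × α))) (a b c d : L2 α) :
    leg13 V (tmul (tmul a b) (tmul c d)) = flip23 (tmul (V (tmul a c)) (tmul b d)) := by
  rw [show leg13 V (tmul (tmul a b) (tmul c d)) =
    flip23 (opTensor V 1 (flip23 (tmul (tmul a b) (tmul c d)))) from rfl, flip23_tmul,
    opTensor_tmul, one_apply_eq_self]

theorem leg24_tmul (V : Op (L2 (α × α))) (a b c d : L2 α) :
    leg24 V (tmul (tmul a b) (tmul c d)) = flip23 (tmul (tmul a c) (V (tmul b d))) := by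
  rw [show leg24 V (tmul (tmul a b) (tmul c d)) =
    flip23 (opTensor 1 V (flip23 (tmul (tmul a b) (tmul c d)))) from rfl, flip23_tmul,
    opTensor_tmul, one_apply_eq_self]

/-- The slices of `V₂₄ S₁₂ W₁₃` are products of slices. -/
theorem rslice_legs (u u' v v' : L2 α) (V S W : Op (L2 (α × α))) :
    rslice (tmul u u') (tmul v v') (leg24 V * opTensor S 1 * leg13 W) =
      opTensor 1 (rslice u' v' V) * S * opTensor (rslice u v W) 1 := by
  refine op_ext fun η₁ η₂ => inner_ext_tmul fun ζ₁ ζ₂ => ?_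
  rw [inner_rslice]
  calc _ = ⟪star (leg24 V) (tmul (tmul ζ₁ ζ₂) (tmul u u')),
        opTensor S 1 (leg13 W (tmul (tmul η₁ η₂) (tmul v v')))⟫_ℂ := by
          rw [ContinuousLinearMap.star_eq_adjoint, ContinuousLinearMap.adjoint_inner_left]; rfl
    _ = ⟪tmul ζ₁ ((rslice u' v' V).adjoint ζ₂), S (tmul (rslice u v W η₁) η₂)⟫_ℂ := by
          rw [star_leg24, leg24_tmul, leg13_tmul, inner_legs]
          have : (rslice u' v' V).adjoint = rslice v' u' (star V) := by
            rw [← star_rslice]; rfl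
          rw [this]
          rfl
    _ = ⟪star (opTensor 1 (rslice u' v' V)) (tmul ζ₁ ζ₂), S (opTensor (rslice u v W) 1
          (tmul η₁ η₂))⟫_ℂ := by
          rw [star_opTensor, opTensor_tmul, opTensor_tmul, star_one]; rfl
    _ = _ := by
          rw [ContinuousLinearMap.star_eq_adjoint, ContinuousLinearMap.adjoint_inner_left]; rfl

end Legs

/-! ### Continuous functions with compact support -/

section Support

/-- Continuous functions with compact support. -/
def IsCc {X : Type} [TopologicalSpace X] (F : X → ℂ) : Prop := Continuous F ∧ HasCompactSupport F

theorem IsTest.isCc {X : Type} [NormedAddCommGroup X] [NormedSpace ℝ X] {u : X → ℂ}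
    (h : IsTest u) : IsCc u := ⟨h.continuous, h.2⟩

variable {X X' Y : Type} [TopologicalSpace X] [TopologicalSpace X'] [TopologicalSpace Y]
  [T2Space X] [T2Space X'] [T2Space Y]

theorem IsCc.prod {u : X → ℂ} {v : X' → ℂ} (hu : IsCc u) (hv : IsCc v) :
    IsCc fun p : X × X' => u p.1 * v p.2 := by
  refine ⟨(hu.1.comp continuous_fst).mul (hv.1.comp continuous_snd),
    HasCompactSupport.intro (hu.2.isCompact.prod hv.2.isCompact) fun p hp => ?_⟩
  by_contra hne
  exact hp ⟨subset_tsupport _ fun h => hne (by simp [h]),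
    subset_tsupport _ fun h => hne (by simp [h])⟩

/-- The pullback of `F ∈ C_c` along a map with a continuous left inverse, times a continuous
function. -/
theorem IsCc.comp_mul {u : X → ℂ} (hu : IsCc u) {j : Y → X} (hj : Continuous j) {i : X → Y}
    (hi : Continuous i) (hij : ∀ y, i (j y) = y) {c : Y → ℂ} (hc : Continuous c) :
    IsCc fun y => u (j y) * c y := by
  refine ⟨(hu.1.comp hj).mul hc, HasCompactSupport.intro (hu.2.isCompact.image hi) fun y hy => ?_⟩
  by_contra hne
  exact hy ⟨j y, subset_tsupport _ fun h => hne (by simp [h]), hij y⟩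

theorem IsCc.comp {u : X → ℂ} (hu : IsCc u) {j : Y → X} (hj : Continuous j) {i : X → Y}
    (hi : Continuous i) (hij : ∀ y, i (j y) = y) : IsCc fun y => u (j y) := by
  simpa using hu.comp_mul hj hi hij (c := fun _ => 1) continuous_const

theorem IsCc.conj {u : X → ℂ} (hu : IsCc u) : IsCc fun x => conj (u x) :=
  ⟨Complex.continuous_conj.comp hu.1, hu.2.comp_left (map_zero _)⟩

theorem IsCc.memLp {α : Type} [TopologicalSpace α] [MeasureSpace α] [OpensMeasurableSpace α]
    [SecondCountableTopology α] [IsFiniteMeasureOnCompacts (volume : Measure α)] {u : α → ℂ}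
    (hu : IsCc u) : MemLp u 2 volume :=
  hu.1.memLp_of_hasCompactSupport hu.2

end Support

/-! ### Closed linear spans and generated C*-algebras -/

section CStarGen

variable {H : Type} [NormedAddCommGroup H] [InnerProductSpace ℂ H] [CompleteSpace H]

theorem subset_cstarGen (s : Set (Op H)) : s ⊆ cstarGen s :=
  (NonUnitalStarAlgebra.subset_adjoin ℂ s).trans
    (NonUnitalStarSubalgebra.le_topologicalClosure _)

theorem isClosed_cstarGen (s : Set (Op H)) : IsClosed (cstarGen s : Set (Op H)) :=
  NonUnitalStarSubalgebra.isClosed_topologicalClosure _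

/-- The closed linear span of a set of operators. -/
noncomputable def clSpan (s : Set (Op H)) : Submodule ℂ (Op H) :=
  (Submodule.span ℂ s).topologicalClosure

theorem subset_clSpan (s : Set (Op H)) : s ⊆ clSpan s :=
  Submodule.subset_span.trans (Submodule.le_topologicalClosure _)

theorem isClosed_clSpan (s : Set (Op H)) : IsClosed (clSpan s : Set (Op H)) :=
  Submodule.isClosed_topologicalClosure _

theorem clSpan_le {s : Set (Op H)} {M : Submodule ℂ (Op H)} (hM : IsClosed (M : Set (Op H)))
    (h : s ⊆ M) : clSpan s ≤ M :=
  Submodule.topologicalClosure_minimal _ (Submodule.span_le.2 h) hM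

/-- Multiplication by a fixed operator is linear and continuous, so the condition extends from
generators to closed spans one factor at a time. -/
theorem clSpan_mul_mem {s : Set (Op H)} {M : Submodule ℂ (Op H)} (hM : IsClosed (M : Set (Op H)))
    {S T : Op H} (hS : S ∈ clSpan s) {t : Set (Op H)} (hT : T ∈ clSpan t)
    (h : ∀ x ∈ s, ∀ y ∈ t, x * y ∈ M) : S * T ∈ M := by
  have h1 : ∀ x ∈ s, x * T ∈ M := fun x hx =>
    clSpan_le (M := M.comap (LinearMap.mulLeft ℂ x)) (hM.preimage (continuous_const_mul x))
      (fun y hy => h x hx y hy) hT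
  exact clSpan_le (M := M.comap (LinearMap.mulRight ℂ T)) (hM.preimage (continuous_mul_const T))
    (fun x hx => h1 x hx) hS

theorem clSpan_star_mem {s : Set (Op H)} {M : Submodule ℂ (Op H)} (hM : IsClosed (M : Set (Op H)))
    {S : Op H} (hS : S ∈ clSpan s) (h : ∀ x ∈ s, star x ∈ M) : star S ∈ M := by
  let N : Submodule ℂ (Op H) :=
    { carrier := {x | star x ∈ M}
      add_mem' := fun {a b} ha hb => by
        simp only [Set.mem_ofPred_eq, star_add] at *; exact add_mem ha hb
      zero_mem' := by simp
      smul_mem' := fun c x hx => by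
        simp only [Set.mem_ofPred_eq, star_smul] at *; exact M.smul_mem _ hx }
  exact clSpan_le (M := N) (hM.preimage continuous_star) h hS

/-- A closed subspace that is closed under products and adjoints and contains `s` contains the
C*-algebra generated by `s`. -/
theorem cstarGen_subset {s t : Set (Op H)} (hs : s ⊆ clSpan t)
    (hmul : ∀ x ∈ t, ∀ y ∈ t, x * y ∈ clSpan t) (hstar : ∀ x ∈ t, star x ∈ clSpan t) :
    (cstarGen s : Set (Op H)) ⊆ clSpan t := by
  let B : NonUnitalStarSubalgebra ℂ (Op H) :=
    { clSpan t with
      mul_mem' := fun hx hy => clSpan_mul_mem (isClosed_clSpan t) hx hy hmul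
      star_mem' := fun hx => clSpan_star_mem (isClosed_clSpan t) hx hstar }
  exact NonUnitalStarSubalgebra.topologicalClosure_minimal
    (t := B) _ (NonUnitalStarAlgebra.adjoin_le hs) (isClosed_clSpan t)

theorem clSpan_subset_cstarGen {s t : Set (Op H)} (ht : t ⊆ cstarGen s) :
    (clSpan t : Set (Op H)) ⊆ cstarGen s := by
  have := clSpan_le (M := (cstarGen s).toNonUnitalSubalgebra.toSubmodule) (isClosed_cstarGen s) ht
  exact this

end CStarGen

/-! ### Changes of variables -/

section Integrals

/-- The space of points `(x, y)`. -/
abbrev Pl (n : ℕ) : Type := EuclideanSpace ℝ (Fin n) × EuclideanSpace ℝ (Fin n)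

/-- No integrability is assumed: the shear is a measure preserving measurable equivalence, and the
product formula holds unconditionally. The identity therefore applies to kernels times an arbitrary
function `ξ`, as `IsInt.eq_of_integral` demands. -/
theorem integral_shear {G : Type} [NormedAddCommGroup G] [MeasureSpace G] [BorelSpace G]
    [SecondCountableTopology G] [SigmaFinite (volume : Measure G)]
    [(volume : Measure G).IsAddLeftInvariant] (a b : G → ℂ) :
    ∫ x : G × G, a x.1 * b (x.1 + x.2) = (∫ x, a x) * ∫ x, b x := by
  have h : MeasurePreserving (MeasurableEquiv.shearAddRight G) (volume : Measure (G × G)) volume :=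
    measurePreserving_prod_add volume volume
  have := h.integral_comp' (fun x => a x.1 * b x.2)
  rw [Measure.volume_eq_prod, integral_prod_mul] at this
  exact this

variable {n : ℕ}

theorem integral_Pt_mul (a : Pl n → ℂ) (b : ℝ → ℂ) :
    ∫ p : Pt n, a (p.1, p.2.1) * b p.2.2 = (∫ q, a q) * ∫ r, b r := by
  have h : MeasurePreserving (MeasurableEquiv.prodAssoc : Pl n × ℝ ≃ᵐ Pt n) volume volume :=
    measurePreserving_prodAssoc volume volume volume
  rw [← h.integral_comp', ← integral_prod_mul]
  rfl

/-- The variables `x` and `y` each contribute a Jacobian `e^{nλr}`. Written as a measurable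
equivalence that pushes the weighted measure forward to Lebesgue measure, the substitution needs no
hypothesis on `G`. -/
theorem integral_dilation (lam : ℝ) (G : Pt n → ℂ) :
    ∫ p : Pt n, ((Real.exp (lam * p.2.2) ^ (2 * n) : ℝ) : ℂ) *
      G (Real.exp (lam * p.2.2) • p.1, Real.exp (lam * p.2.2) • p.2.1, p.2.2) = ∫ p, G p := by
  let D : Pt n ≃ᵐ Pt n :=
    { toFun := fun p => (Real.exp (lam * p.2.2) • p.1, Real.exp (lam * p.2.2) • p.2.1, p.2.2)
      invFun := fun p => (Real.exp (-(lam * p.2.2)) • p.1, Real.exp (-(lam * p.2.2)) • p.2.1, p.2.2)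
      left_inv := fun p => by simp [smul_smul, ← Real.exp_add]
      right_inv := fun p => by simp [smul_smul, ← Real.exp_add]
      measurable_toFun := by simp only [Equiv.coe_fn_mk]; fun_prop
      measurable_invFun := by simp only [Equiv.coe_fn_symm_mk]; fun_prop }
  let J : Pt n → ℝ≥0∞ := fun p => ENNReal.ofReal (Real.exp (lam * p.2.2) ^ (2 * n))
  have hJ : Measurable J := by fun_prop
  have hD : MeasurePreserving D (volume.withDensity J) volume := by
    refine ⟨D.measurable, Measure.ext fun s hs => ?_⟩
    rw [Measure.map_apply D.measurable hs, withDensity_apply _ (D.measurable hs),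
      ← lintegral_indicator (D.measurable hs), ← lintegral_indicator_one hs,
      ← lintegral_dilation (fun r => Real.exp (lam * r)) id (by fun_prop)
        (fun r => (Real.exp_pos _).ne') (MeasurePreserving.id _) _ (measurable_one.indicator hs)]
    refine lintegral_congr fun p => ?_
    rw [← ENNReal.ofReal_pow (by positivity), abs_of_pos (Real.exp_pos _), ← pow_mul, mul_comm n 2]
    change _ = _ * s.indicator 1 (D p)
    by_cases hp : D p ∈ s
    · rw [Set.indicator_of_mem (show p ∈ D ⁻¹' s from hp),
        Set.indicator_of_mem (show _ ∈ s from hp), Pi.one_apply, mul_one]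
    · rw [Set.indicator_of_notMem (show p ∉ D ⁻¹' s from hp),
        Set.indicator_of_notMem (show _ ∉ s from hp), mul_zero]
  rw [← hD.integral_comp' G, integral_withDensity_eq_integral_toReal_smul hJ
    (ae_of_all _ fun p => ENNReal.ofReal_lt_top)]
  refine integral_congr_ae (ae_of_all _ fun p => ?_)
  simp only [J]
  rw [ENNReal.toReal_ofReal (by positivity), Complex.real_smul]
  rfl

theorem integral_dilation_mul (lam : ℝ) (a : Pl n → ℂ) (b : ℝ → ℂ) :
    ∫ p : Pt n, a (Real.exp (lam * p.2.2) • p.1, Real.exp (lam * p.2.2) • p.2.1) * b p.2.2 =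
      (∫ q, a q) * ∫ r, ((Real.exp (lam * r) ^ (2 * n) : ℝ) : ℂ)⁻¹ * b r := by
  rw [← integral_Pt_mul, ← integral_dilation lam (fun p => a (p.1, p.2.1) *
    (((Real.exp (lam * p.2.2) ^ (2 * n) : ℝ) : ℂ)⁻¹ * b p.2.2))]
  refine integral_congr_ae (ae_of_all _ fun p => ?_)
  have : ((Real.exp (lam * p.2.2) ^ (2 * n) : ℝ) : ℂ) ≠ 0 := by
    exact_mod_cast (pow_pos (Real.exp_pos _) _).ne'
  simp only
  field_simp

theorem exists_test_integral {X : Type} [NormedAddCommGroup X] [NormedSpace ℝ X]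
    [FiniteDimensional ℝ X] [MeasureSpace X] [BorelSpace X]
    [Measure.IsAddHaarMeasure (volume : Measure X)] {g : X → ℝ} (hg : Continuous g)
    (hg0 : ∀ x, 0 < g x) : ∃ u : X → ℂ, IsTest u ∧ ∫ x, (g x : ℂ) * u x = 1 := by
  let f : ContDiffBump (0 : X) := ⟨1, 2, one_pos, one_lt_two⟩
  have hpos : 0 < ∫ x, g x * f x := by
    refine Continuous.integral_pos_of_hasCompactSupport_nonneg_nonzero (x := 0)
      (hg.mul f.continuous) f.hasCompactSupport.mul_left (fun x => mul_nonneg (hg0 x).le f.nonneg) ?_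
    have h1 : f 0 = 1 := f.one_of_mem_closedBall (by simp [f])
    rw [h1, mul_one]
    exact (hg0 0).ne'
  refine ⟨fun x => ((∫ x, g x * f x : ℝ) : ℂ)⁻¹ * (f x : ℂ), IsTest.smul
    ⟨Complex.ofRealCLM.contDiff.comp f.contDiff, f.hasCompactSupport.comp_left
      (g := fun t : ℝ => (t : ℂ)) Complex.ofReal_zero⟩ _, ?_⟩
  have : ∀ x, (g x : ℂ) * (((∫ x, g x * f x : ℝ) : ℂ)⁻¹ * (f x : ℂ)) =
      ((∫ x, g x * f x : ℝ) : ℂ)⁻¹ * ((g x * f x : ℝ) : ℂ) := fun x => by push_cast; ring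
  simp only [this]
  rw [integral_const_mul, integral_complex_ofReal, inv_mul_cancel₀]
  exact_mod_cast hpos.ne'

end Integrals

/-! ### The algebra `A` as a closed span of operators `L_u` -/

section AlgA

variable (n : ℕ) (lam : ℝ)

/-- The phase in the formula for `L_f`. -/
noncomputable def phA (p : Pt n) (g : Pl n) : ℂ := e (-(eta lam p.2.2 * ⟪g.1, p.2.1 - g.2⟫_ℝ))

/-- The translation in the formula for `L_f`. -/
def mapA (p : Pt n) (g : Pl n) : Pt n := (p.1 - g.1, p.2.1 - g.2, p.2.2)

/-- The operators `L_u` with a test function `u`. -/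
def genA : Set (Op (L2 (Pt n))) :=
  {T | ∃ u : Pt n → ℂ, IsTest u ∧
    IsInt T (mapA n) (fun p g => u (g.1, g.2, p.2.2) * phA n lam p g)}

theorem measurable_phA : Measurable (Function.uncurry (phA n lam)) := by
  have he := measurable_e
  have ht := measurable_eta lam
  unfold Function.uncurry phA
  fun_prop

theorem measurable_mapA : Measurable (Function.uncurry (mapA n)) := by
  unfold Function.uncurry mapA
  fun_prop

theorem mp_mapA (g : Pl n) : MeasurePreserving (fun p => mapA n p g) volume volume :=
  measurePreserving_translate g

theorem norm_phA (p : Pt n) (g : Pl n) : ‖phA n lam p g‖ ≤ 1 := (norm_e _).le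

variable {n lam}

/-- With coordinates `(x, y)` and `r`, a product of test functions is again a test function.
Continuity and compact support hence suffice, which spares smoothness checks below. -/
theorem mem_clSpan_genA_of_isCc {F : Pt n → ℂ} (hF : IsCc F) {T : Op (L2 (Pt n))}
    (hT : IsInt T (mapA n) (fun p g => F (g.1, g.2, p.2.2) * phA n lam p g)) :
    T ∈ clSpan (genA n lam) := by
  have hF' : IsCc fun y : Pl n × ℝ => F (y.1.1, y.1.2, y.2) :=
    hF.comp (i := fun p : Pt n => ((p.1, p.2.1), p.2.2)) (by fun_prop) (by fun_prop) fun _ => rfl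
  refine mem_of_kernel₂ (isClosed_clSpan _) (κ := fun p : Pt n => p.2.2)
    (F := fun y : Pl n × ℝ => F (y.1.1, y.1.2, y.2)) hT (by fun_prop) (measurable_phA n lam)
    (norm_phA n lam) hF'.1 hF'.2 Prod.fst Prod.snd continuous_fst continuous_snd id
    continuous_id (fun _ => rfl) fun u₁ u₂ h₁ h₂ S hS => subset_clSpan _ ⟨fun p =>
      u₁ (p.1, p.2.1) * u₂ p.2.2, ⟨?_, ?_⟩, hS⟩
  · have := h₁.1
    have := h₂.1
    fun_prop
  · exact ((h₁.isCc.prod h₂.isCc).comp (j := fun p : Pt n => ((p.1, p.2.1), p.2.2))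
      (i := fun y : Pl n × ℝ => (y.1.1, y.1.2, y.2)) (by fun_prop) (by fun_prop) fun _ => rfl).2

theorem exists_isInt_of_isCc {α Θ Ω : Type} [MeasureSpace α] [SigmaFinite (volume : Measure α)]
    [MeasureSpace Θ] [SigmaFinite (volume : Measure Θ)] [TopologicalSpace Θ] [T2Space Θ]
    [OpensMeasurableSpace Θ] [IsFiniteMeasureOnCompacts (volume : Measure Θ)]
    [TopologicalSpace Ω] [T2Space Ω] [MeasurableSpace Ω] [OpensMeasurableSpace (Θ × Ω)]
    {φ : α → Θ → α} {c : α → Θ → ℂ} {κ : α → Ω} {F : Θ × Ω → ℂ} (hF : IsCc F)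
    (hφ : Measurable (Function.uncurry φ))
    (hφ' : ∀ θ, MeasurePreserving (fun p => φ p θ) volume volume) (hκ : Measurable κ)
    (hc : Measurable (Function.uncurry c)) (hc1 : ∀ p θ, ‖c p θ‖ ≤ 1) :
    ∃ T : Op (L2 α), IsInt T φ (fun p θ => F (θ, κ p) * c p θ) := by
  obtain ⟨C, hC⟩ := hF.1.bounded_above_of_compact_support hF.2
  obtain ⟨T, hT, -⟩ := exists_isInt_of_compact hφ hφ' hκ hc hc1 hF.1 hF.2.isCompact
    (fun y hy => image_eq_zero_of_notMem_tsupport hy) hC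
  exact ⟨T, hT⟩

theorem exists_isInt_A {F : Pt n → ℂ} (hF : IsCc F) : ∃ T : Op (L2 (Pt n)),
    IsInt T (mapA n) (fun p g => F (g.1, g.2, p.2.2) * phA n lam p g) := by
  have hF' : IsCc fun y : Pl n × ℝ => F (y.1.1, y.1.2, y.2) :=
    hF.comp (i := fun p : Pt n => ((p.1, p.2.1), p.2.2)) (by fun_prop) (by fun_prop) fun _ => rfl
  exact exists_isInt_of_isCc (κ := fun p : Pt n => p.2.2) hF' (measurable_mapA n) (mp_mapA n)
    (by fun_prop) (measurable_phA n lam) (norm_phA n lam)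

/-- The product translates by `g + h`, and its two phases combine to the phase at `g + h` times a
cocycle that depends only on `g`, `h` and `r`. In the coordinates `g` and `(g + h, r)` a product
kernel `u₁(g) u₂(g + h, r)` integrates, by a shear, to `(∫ u₁) L_{u₂}`. -/
theorem genA_mul_mem {S T : Op (L2 (Pt n))} (hS : S ∈ genA n lam) (hT : T ∈ genA n lam) :
    S * T ∈ clSpan (genA n lam) := by
  obtain ⟨u, hu, hS⟩ := hS
  obtain ⟨v, hv, hT⟩ := hT
  have he := continuous_e
  have ht := continuous_eta lam
  have he' := measurable_e
  have ht' := measurable_eta lam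
  have hF : IsCc fun y : (Pl n × Pl n) × ℝ => u (y.1.1.1, y.1.1.2, y.2) * v (y.1.2.1, y.1.2.2, y.2) *
      e (-(eta lam y.2 * ⟪y.1.1.1, y.1.2.2⟫_ℝ)) :=
    (hu.isCc.prod hv.isCc).comp_mul
      (j := fun y : (Pl n × Pl n) × ℝ => ((y.1.1.1, y.1.1.2, y.2), (y.1.2.1, y.1.2.2, y.2)))
      (by fun_prop) (i := fun z => (((z.1.1, z.1.2.1), (z.2.1, z.2.2.1)), z.1.2.2)) (by fun_prop)
      (fun _ => rfl) (by fun_prop)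
  refine mem_of_kernel₂ (isClosed_clSpan _) (κ := fun p : Pt n => p.2.2)
    (φ := fun p (θ : Pl n × Pl n) => mapA n p (θ.1 + θ.2))
    (c := fun p (θ : Pl n × Pl n) => phA n lam p (θ.1 + θ.2))
    ((hS.mul hT).congr (fun p θ => ?_) (fun p θ => ?_)) (by fun_prop) ?_
    (fun _ _ => norm_phA n lam _ _) hF.1 hF.2
    (fun y => y.1.1) (fun y => (((y.1.1 + y.1.2).1, (y.1.1 + y.1.2).2, y.2) : Pt n))
    (by fun_prop) (by fun_prop) (fun z => ((z.1, (z.2.1, z.2.2.1) - z.1), z.2.2.2))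
    (by fun_prop) (fun y => by simp [Prod.ext_iff]) ?_
  · simp only [mapA, Prod.fst_add, Prod.snd_add, sub_sub]
  · simp only [mapA, phA, Prod.fst_add, Prod.snd_add]
    rw [mul_mul_mul_comm, ← e_add, mul_assoc (_ * _), ← e_add]
    congr 2
    simp only [inner_add_left, inner_add_right, inner_sub_left, inner_sub_right]
    ring
  · simp only [phA]
    unfold Function.uncurry
    fun_prop
  · intro u₁ u₂ h₁ h₂ R hR
    obtain ⟨R', hR'⟩ := exists_isInt_A (lam := lam) h₂.isCc
    have : R = (∫ g, u₁ g) • R' := by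
      refine hR.eq_of_integral (hR'.smul _) fun ξ p => ?_
      have := integral_shear u₁ (fun g : Pl n => u₂ (g.1, g.2, p.2.2) * phA n lam p g *
        ξ (mapA n p g))
      simp only [mul_assoc] at this ⊢
      rw [integral_const_mul, ← this]
    rw [this]
    exact Submodule.smul_mem _ _ (subset_clSpan _ ⟨u₂, h₂, hR'⟩)

theorem integral_neg_Pl (G : Pl n → ℂ) : ∫ g, G (-g) = ∫ g, G g := by
  have h := Measure.measurePreserving_neg (volume : Measure (EuclideanSpace ℝ (Fin n)))
  have : MeasurePreserving (MeasurableEquiv.neg (Pl n)) volume volume := h.prod h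
  exact this.integral_comp' G

/-- After `g ↦ -g` the adjoint of `L_u` is `L_F` with `F(x, y, r) = conj (u(-x, -y, r)) ē[η(r) β(x,
y)]`. -/
theorem genA_star_mem {S : Op (L2 (Pt n))} (hS : S ∈ genA n lam) :
    star S ∈ clSpan (genA n lam) := by
  obtain ⟨u, hu, hS⟩ := hS
  have he := continuous_e
  have ht := continuous_eta lam
  have hF : IsCc fun p : Pt n => conj (u (-p.1, -p.2.1, p.2.2)) *
      e (-(eta lam p.2.2 * ⟪p.1, p.2.1⟫_ℝ)) :=
    hu.isCc.conj.comp_mul (j := fun p : Pt n => ((-p.1, -p.2.1, p.2.2) : Pt n)) (by fun_prop)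
      (i := fun p : Pt n => ((-p.1, -p.2.1, p.2.2) : Pt n)) (by fun_prop) (fun p => by simp)
      (by fun_prop)
  obtain ⟨T, hT⟩ := exists_isInt_A (lam := lam) hF
  have h := hS.adjoint (ψ := fun p g => ((p.1 + g.1, p.2.1 + g.2, p.2.2) : Pt n))
    (by unfold Function.uncurry; fun_prop) (fun p g => by simp [mapA]) (fun p g => by simp [mapA])
  have : star S = T := by
    refine h.eq_of_integral hT fun ξ p => ?_
    rw [← integral_neg_Pl]
    refine integral_congr_ae (ae_of_all _ fun g => ?_)
    simp only [mapA, phA, Prod.fst_neg, Prod.snd_neg, map_mul, conj_e, ← sub_eq_add_neg]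
    rw [mul_assoc (conj _) (e _) (e _), ← e_add]
    congr 3
    simp only [inner_neg_left, inner_sub_right, inner_neg_right]
    ring
  rw [this]
  exact mem_clSpan_genA_of_isCc hF hT

theorem dense_test {α : Type} [NormedAddCommGroup α] [NormedSpace ℝ α] [FiniteDimensional ℝ α]
    [MeasureSpace α] [BorelSpace α] [IsFiniteMeasureOnCompacts (volume : Measure α)] :
    Dense {f : L2 α | ∃ (u : α → ℂ) (h : MemLp u 2 volume), IsTest u ∧ f = h.toLp u} := by
  have := Lp.dense_hasCompactSupport_contDiff (μ := (volume : Measure α)) (F := ℂ) (p := 2)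
    (by norm_num)
  refine this.mono ?_
  rintro f ⟨u, hu, h1, h2⟩
  have hm : MemLp u 2 volume := IsCc.memLp ⟨h2.continuous, h1⟩
  refine ⟨u, hm, ⟨h2, h1⟩, Lp.ext (hu.trans hm.coeFn_toLp.symm)⟩

/-- The kernel of a slice of `Y*`. -/
theorem rslice_star_Y {u v : Pt n → ℂ} (hu : IsTest u) (hv : IsTest v) {S : Op (L2 (Pt n))}
    (hS : IsInt S (fun (p p' : Pt n) => mapA n p (Real.exp (lam * p'.2.2) • (p'.1, p'.2.1)))
      (fun (p p' : Pt n) => conj (u p') * v (p'.1, p'.2.1, p'.2.2 + p.2.2) *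
        phA n lam p (Real.exp (lam * p'.2.2) • (p'.1, p'.2.1)))) :
    rslice (hu.isCc.memLp.toLp u) (hv.isCc.memLp.toLp v) (star (Y n lam)) = S :=
  rslice_eq_of_isInt (isWC_star_Y n lam) _ _ hS (fun a b => by simp [mapA])
    (fun a b => by simp only [phA, Prod.smul_mk]; ring)

theorem measurable_dilMapA : Measurable (Function.uncurry fun (p p' : Pt n) =>
    mapA n p (Real.exp (lam * p'.2.2) • (p'.1, p'.2.1))) := by
  unfold Function.uncurry mapA
  fun_prop

theorem measurable_dilPhA : Measurable (Function.uncurry fun (p p' : Pt n) =>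
    phA n lam p (Real.exp (lam * p'.2.2) • (p'.1, p'.2.1))) := by
  have he := measurable_e
  have ht := measurable_eta lam
  unfold Function.uncurry phA
  fun_prop

/-- Slices of `Y*` are integrals over a full point `p'` whose translation part is dilated by
`e^{λr'}`. Undoing the dilation separates the variable `r'`, which contributes only the scalar with
Jacobian `e^{-2nλr'}`. -/
theorem isInt_dilA {f : Pt n → ℂ} {δ : ℝ → ℂ} {S T : Op (L2 (Pt n))}
    (hT : IsInt T (mapA n) (fun p g => f (g.1, g.2, p.2.2) * phA n lam p g))
    (hS : IsInt S (fun (p p' : Pt n) => mapA n p (Real.exp (lam * p'.2.2) • (p'.1, p'.2.1)))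
      (fun (p p' : Pt n) => f (Real.exp (lam * p'.2.2) • p'.1, Real.exp (lam * p'.2.2) • p'.2.1, p.2.2) *
        δ p'.2.2 * phA n lam p (Real.exp (lam * p'.2.2) • (p'.1, p'.2.1)))) :
    S = (∫ r, ((Real.exp (lam * r) ^ (2 * n) : ℝ) : ℂ)⁻¹ * δ r) • T := by
  refine hS.eq_of_integral (hT.smul _) fun ξ p => ?_
  have := integral_dilation_mul lam (fun g : Pl n => f (g.1, g.2, p.2.2) * phA n lam p g *
    ξ (mapA n p g)) δ
  simp only [mul_assoc (∫ _, _)]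
  rw [integral_const_mul, mul_comm, ← this]
  refine integral_congr_ae (ae_of_all _ fun p' => ?_)
  simp only [Prod.smul_mk]
  ring

/-- For test vectors the kernel is a compactly supported function of `p'` and `r`. The coordinates
`(e^{λr'}x', e^{λr'}y', r)` and `r'` bring product kernels into the form of `isInt_dilA`. -/
theorem rslice_star_Y_mem (u v : L2 (Pt n)) :
    rslice u v (star (Y n lam)) ∈ clSpan (genA n lam) := by
  refine rslice_mem_of_dense (isClosed_clSpan _) dense_test ?_ u v
  rintro _ ⟨u, -, hu, rfl⟩ _ ⟨v, -, hv, rfl⟩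
  have hF : IsCc fun y : Pt n × ℝ => conj (u y.1) * v (y.1.1, y.1.2.1, y.1.2.2 + y.2) :=
    (hu.isCc.conj.prod hv.isCc).comp
      (j := fun y : Pt n × ℝ => (y.1, ((y.1.1, y.1.2.1, y.1.2.2 + y.2) : Pt n))) (by fun_prop)
      (i := fun z => (z.1, z.2.2.2 - z.1.2.2)) (by fun_prop) (fun y => by simp)
  obtain ⟨S, hS⟩ := exists_isInt_of_isCc (κ := fun p : Pt n => p.2.2) hF
    (measurable_dilMapA (lam := lam)) (fun _ => mp_mapA n _) (by fun_prop)
    (measurable_dilPhA (lam := lam)) (fun _ _ => norm_phA n lam _ _)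
  rw [rslice_star_Y hu hv hS]
  refine mem_of_kernel₂ (isClosed_clSpan _) hS (by fun_prop) measurable_dilPhA
    (fun _ _ => norm_phA n lam _ _) hF.1 hF.2
    (fun y => ((Real.exp (lam * y.1.2.2) • y.1.1, Real.exp (lam * y.1.2.2) • y.1.2.1, y.2) : Pt n))
    (fun y => y.1.2.2) (by fun_prop) (by fun_prop)
    (fun z => ((Real.exp (-(lam * z.2)) • z.1.1, Real.exp (-(lam * z.2)) • z.1.2.1, z.2), z.1.2.2))
    (by fun_prop) (fun y => by simp [smul_smul, ← Real.exp_add]) fun u₁ u₂ h₁ h₂ R hR => ?_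
  obtain ⟨R', hR'⟩ := exists_isInt_A (lam := lam) h₁.isCc
  rw [isInt_dilA (δ := u₂) hR' hR]
  exact Submodule.smul_mem _ _ (subset_clSpan _ ⟨u₁, h₁, hR'⟩)

/-- Every closed subspace that contains the slices of `Y*` contains the operators `L_u`. -/
theorem genA_subset {N : Submodule ℂ (Op (L2 (Pt n)))} (hN : IsClosed (N : Set (Op (L2 (Pt n)))))
    (h : ∀ u v, rslice u v (star (Y n lam)) ∈ N) : genA n lam ⊆ N := by
  rintro T ⟨f, hf, hT⟩
  -- The function `δ` is normalized so that the scalar in `isInt_dilA` equals 1. This presents `L_f`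
  -- as an integral over `p'`.
  obtain ⟨δ, hδ, hδ1⟩ := exists_test_integral (X := ℝ)
    (g := fun r => (Real.exp (lam * r) ^ (2 * n))⁻¹)
    ((by fun_prop : Continuous fun r => Real.exp (lam * r) ^ (2 * n)).inv₀ fun r => by positivity)
    (fun r => by positivity)
  have hF : IsCc fun y : Pt n × ℝ => f (Real.exp (lam * y.1.2.2) • y.1.1,
      Real.exp (lam * y.1.2.2) • y.1.2.1, y.2) * δ y.1.2.2 :=
    (hf.isCc.prod hδ.isCc).comp (j := fun y : Pt n × ℝ => (((Real.exp (lam * y.1.2.2) • y.1.1,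
      Real.exp (lam * y.1.2.2) • y.1.2.1, y.2) : Pt n), y.1.2.2)) (by fun_prop)
      (i := fun z => ((Real.exp (-(lam * z.2)) • z.1.1, Real.exp (-(lam * z.2)) • z.1.2.1, z.2),
        z.1.2.2)) (by fun_prop) (fun y => by simp [smul_smul, ← Real.exp_add])
  obtain ⟨S, hS⟩ := exists_isInt_of_isCc (κ := fun p : Pt n => p.2.2) hF
    (measurable_dilMapA (lam := lam)) (fun _ => mp_mapA n _) (by fun_prop)
    (measurable_dilPhA (lam := lam)) (fun _ _ => norm_phA n lam _ _)
  have hST := isInt_dilA (δ := δ) hT hS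
  simp only [← Complex.ofReal_inv] at hST
  rw [hδ1, one_smul] at hST
  rw [← hST]
  -- The same operator in the coordinates `p'` and `(x', y', r' + r)`: now each product kernel is
  -- exactly the kernel of a slice of `Y*`.
  refine mem_of_kernel₂ hN hS (by fun_prop) measurable_dilPhA
    (fun _ _ => norm_phA n lam _ _) hF.1 hF.2 (fun y => y.1)
    (fun y => ((y.1.1, y.1.2.1, y.1.2.2 + y.2) : Pt n)) (by fun_prop) (by fun_prop)
    (fun z => (z.1, z.2.2.2 - z.1.2.2)) (by fun_prop) (fun y => by simp) fun u v hu hv R hR => ?_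
  have := rslice_star_Y hu.conj hv (hR.congr (fun _ _ => rfl) fun p p' => by
    rw [Complex.conj_conj])
  rw [← this]
  exact h _ _

/-- Flipping the legs turns left slices into right slices and `U_A` into `(1 ⊗ j) Y (1 ⊗ j)`. -/
theorem leftSlices_UA : leftSlices (UA n lam) =
    rightSlices (opTensor 1 (jOp n lam) * Y n lam * opTensor 1 (jOp n lam)) := by
  rw [leftSlices_eq, UA_eq, Y_eq]
  have h1 : flip * opTensor (jOp n lam) 1 = opTensor 1 (jOp n lam) * flip :=
    op_ext fun ξ η => by simp [flip_tmul, opTensor_tmul]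
  have h2 : opTensor (jOp n lam) 1 * flip = flip * opTensor 1 (jOp n lam) :=
    op_ext fun ξ η => by simp [flip_tmul, opTensor_tmul]
  congr 1
  calc flip * (opTensor (jOp n lam) 1 * star (X n lam) * opTensor (jOp n lam) 1) * flip =
        (flip * opTensor (jOp n lam) 1) * star (X n lam) * (opTensor (jOp n lam) 1 * flip) := by
        simp only [mul_assoc]
    _ = _ := by rw [h1, h2]; simp only [mul_assoc]

theorem algA_eq : (algA n lam : Set (Op (L2 (Pt n)))) = clSpan (genA n lam) := by
  have hY : ∀ u v, rslice u v (Y n lam) ∈ clSpan (genA n lam) := fun u v => by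
    have := clSpan_star_mem (isClosed_clSpan _) (rslice_star_Y_mem (lam := lam) v u)
      fun x hx => genA_star_mem hx
    rwa [star_rslice, star_star] at this
  refine Set.Subset.antisymm (cstarGen_subset (fun a ha => ?_) (fun x hx y hy => genA_mul_mem hx hy)
    (fun x hx => genA_star_mem hx)) (clSpan_subset_cstarGen ?_)
  · rw [leftSlices_UA] at ha
    refine mem_of_mem_rightSlices (isClosed_clSpan _) (fun u v => ?_) ha
    rw [rslice_conj_one]
    exact hY _ _
  · refine genA_subset (N := (cstarGen (leftSlices (UA n lam))).toNonUnitalSubalgebra.toSubmodule)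
      (isClosed_cstarGen _) fun u v => ?_
    -- Because `j² = 1`, the slice of `(1 ⊗ j) Y (1 ⊗ j)` by `j v` and `j u` is the slice of `Y` by
    -- `v` and `u`; its adjoint is the required slice of `Y*`.
    have hj : ∀ w, jOp n lam (jOp n lam w) = w := fun w =>
      congrArg (fun T : Op (L2 (Pt n)) => T w) (jOp_mul_jOp n lam)
    have h1 : rslice v u (Y n lam) ∈ cstarGen (leftSlices (UA n lam)) := by
      refine subset_cstarGen _ ?_
      rw [leftSlices_UA]
      have := rslice_mem (jOp n lam v) (jOp n lam u)
        (opTensor 1 (jOp n lam) * Y n lam * opTensor 1 (jOp n lam))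
      rwa [rslice_conj_one, star_jOp, hj, hj] at this
    have h2 := star_mem h1
    rwa [star_rslice] at h2

theorem mem_algA_iff {a : Op (L2 (Pt n))} : a ∈ algA n lam ↔ a ∈ clSpan (genA n lam) :=
  Set.ext_iff.1 algA_eq a

/-- A closed subspace that contains the slices of `Y` contains `A`. -/
theorem mem_of_mem_algA {N : Submodule ℂ (Op (L2 (Pt n)))}
    (hN : IsClosed (N : Set (Op (L2 (Pt n))))) (h : ∀ u v, rslice u v (Y n lam) ∈ N)
    {a : Op (L2 (Pt n))} (ha : a ∈ algA n lam) : a ∈ N := by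
  have := mem_algA_iff.1 (star_mem ha)
  rw [← star_star a]
  refine clSpan_star_mem hN this fun x hx => ?_
  have := genA_subset (N := clSpan {x | ∃ u v, x = rslice u v (star (Y n lam))})
    (isClosed_clSpan _) (fun u v => subset_clSpan _ ⟨u, v, rfl⟩) hx
  refine clSpan_star_mem hN this ?_
  rintro _ ⟨u, v, rfl⟩
  rw [star_rslice, star_star]
  exact h v u

end AlgA

/-! ### The operators `L_f` with Schwartz functions -/

section FunAlg

variable {n : ℕ} {lam : ℝ}

theorem IsTest.exists_funAlg {u : Pt n → ℂ} (hu : IsTest u) :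
    ∃ f : funAlg n, ∀ p, (f : SchwartzMap (Pt n) ℂ) p = u p := by
  refine ⟨⟨hu.2.toSchwartzMap hu.1, ?_⟩, fun p => rfl⟩
  obtain ⟨R, hR⟩ := hu.2.isCompact.isBounded.subset_closedBall 0
  refine ⟨R, fun p hp => image_eq_zero_of_notMem_tsupport (f := u) fun h => ?_⟩
  have h1 := hR h
  rw [mem_closedBall_zero_iff] at h1
  have h2 : |p.2.2| ≤ ‖p‖ := (norm_snd_le p.2).trans (norm_snd_le p)
  linarith

theorem isInt_LRep (f : funAlg n) : IsInt (LRep n lam f) (mapA n)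
    (fun p g => (f : SchwartzMap (Pt n) ℂ) (g.1, g.2, p.2.2) * phA n lam p g) := by
  obtain ⟨h, hh, hb⟩ := exists_dominating n f
  exact ⟨measurable_mapA n, mp_mapA n, L_kernel n lam f, ⟨h, hh, L_bound n lam f h hb⟩,
    fun ξ => opOfFormula_ae _ (exists_L n lam f) ξ⟩

/-- The support of `f` is already compact in `r`, so only `(x, y)` has to be cut off. The error is
at most `∫ |1 - χ_k| h`, which tends to 0 by dominated convergence, where `h` dominates `f`
uniformly in `r`. -/
theorem LRep_mem (f : funAlg n) : LRep n lam f ∈ algA n lam := by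
  rw [mem_algA_iff]
  obtain ⟨h, hh, hb⟩ := exists_dominating n f
  obtain ⟨R, hR⟩ := f.2
  have hf : Continuous (f : SchwartzMap (Pt n) ℂ) := (f : SchwartzMap (Pt n) ℂ).continuous
  have h0 : ∀ g, 0 ≤ h g := fun g => (norm_nonneg _).trans (hb g 0)
  obtain ⟨δ, hδ, hδ1, -⟩ := exists_test_eq_one (isCompact_Icc (a := -R) (b := R))
  choose χ hχ hχ1 hχle using fun k : ℕ => exists_test_eq_one
    (isCompact_closedBall (0 : Pl n) k)
  have hF : ∀ k, IsCc fun p : Pt n => χ k (p.1, p.2.1) * δ p.2.2 *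
      (f : SchwartzMap (Pt n) ℂ) p := fun k =>
    ((hχ k).isCc.prod hδ.isCc).comp_mul (j := fun p : Pt n => ((p.1, p.2.1), p.2.2))
      (i := fun y => (y.1.1, y.1.2, y.2)) (by fun_prop) (by fun_prop) (fun _ => rfl) hf
  choose T hT using fun k => exists_isInt_A (lam := lam) (hF k)
  have hm : ∀ k, AEStronglyMeasurable (fun g => ‖1 - χ k g‖ * h g) volume := fun k =>
    ((continuous_const.sub (hχ k).continuous).norm.aestronglyMeasurable).mul hh.1
  have hle : ∀ k g, ‖1 - χ k g‖ * h g ≤ 2 * h g := fun k g => by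
    refine mul_le_mul_of_nonneg_right ((norm_sub_le _ _).trans ?_) (h0 g)
    rw [norm_one]
    linarith [hχle k g]
  have hbound : ∀ k, ‖LRep n lam f - T k‖ ≤ ∫ g, ‖1 - χ k g‖ * h g := fun k => by
    refine ((isInt_LRep f).sub (hT k)).norm_le ((hh.const_mul 2).mono' (hm k)
      (ae_of_all _ fun g => ?_)) (fun g => mul_nonneg (norm_nonneg _) (h0 g)) fun p g => ?_
    · rw [Real.norm_of_nonneg (mul_nonneg (norm_nonneg _) (h0 g))]
      exact hle k g
    · rw [← sub_mul, norm_mul]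
      refine (mul_le_of_le_one_right (norm_nonneg _) (norm_phA n lam p g)).trans ?_
      dsimp only
      by_cases hr : R < |p.2.2|
      · rw [hR (g.1, g.2, p.2.2) hr, mul_zero, sub_zero, norm_zero]
        exact mul_nonneg (norm_nonneg _) (h0 g)
      · rw [hδ1 _ (abs_le.1 (not_lt.1 hr)), mul_one, ← one_sub_mul, norm_mul]
        exact mul_le_mul_of_nonneg_left (hb g _) (norm_nonneg _)
  have hlim : Tendsto (fun k => ∫ g, ‖1 - χ k g‖ * h g) atTop (nhds 0) := by
    have := tendsto_integral_of_dominated_convergence (f := fun _ : Pl n => (0 : ℝ))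
      (F := fun k g => ‖1 - χ k g‖ * h g) (fun g => 2 * h g) hm (hh.const_mul 2)
      (fun k => ae_of_all _ fun g => by
        rw [Real.norm_of_nonneg (mul_nonneg (norm_nonneg _) (h0 g))]
        exact hle k g) (ae_of_all _ fun g => ?_)
    · simpa using this
    · refine tendsto_const_nhds.congr' ?_
      filter_upwards [eventually_ge_atTop ⌈‖g‖⌉₊] with k hk
      rw [hχ1 k g (by simpa using Nat.ceil_le.1 hk)]
      simp
  refine (isClosed_clSpan _).mem_of_tendsto (b := atTop) (f := T) ?_
    (Eventually.of_forall fun k => mem_clSpan_genA_of_isCc (hF k) (hT k))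
  rw [tendsto_iff_norm_sub_tendsto_zero]
  refine squeeze_zero (fun _ => norm_nonneg _) (fun k => ?_) hlim
  rw [norm_sub_rev]
  exact hbound k

end FunAlg

/-! ### The algebra `Â^op` as a closed span of operators `λ_u` -/

section AlgB

variable (n : ℕ) (lam : ℝ)

/-- The translation in the formula for `λ_φ`. -/
def mapB (p : Pt n) (s : ℝ) : Pt n := (p.1, p.2.1, p.2.2 - s)

/-- The point `e^{λr}(x, y)`. -/
noncomputable def dilB (p : Pt n) : Pl n := Real.exp (lam * p.2.2) • (p.1, p.2.1)

/-- The kernel in the formula for `λ_φ`. -/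
noncomputable def kerB (u : Pt n → ℂ) (w : Pl n) (s : ℝ) : ℂ :=
  u (Real.exp (-(lam * s)) • w.1, Real.exp (-(lam * s)) • w.2, s)

/-- The operators `λ_u` with a test function `u`. -/
def genB : Set (Op (L2 (Pt n))) :=
  {T | ∃ u : Pt n → ℂ, IsTest u ∧ IsInt T (mapB n) (fun p s => kerB n lam u (dilB n lam p) s)}

theorem measurable_mapB : Measurable (Function.uncurry (mapB n)) := by
  unfold Function.uncurry mapB
  fun_prop

theorem mp_mapB (s : ℝ) : MeasurePreserving (fun p => mapB n p s) volume volume :=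
  measurePreserving_translate' s

theorem measurable_dilB : Measurable (dilB n lam) := by
  unfold dilB
  fun_prop

variable {n lam}

/-- The kernel of `λ_φ` depends on the point only through `w = e^{λr}(x, y)`, and translation in `r`
rescales `w`. This makes `w` the natural parameter for composing kernels. -/
theorem dilB_mapB (p : Pt n) (s : ℝ) :
    dilB n lam (mapB n p s) = Real.exp (-(lam * s)) • dilB n lam p := by
  simp only [dilB, mapB, smul_smul, ← Real.exp_add]
  congr 2
  ring

theorem IsCc.kerB {F : Pt n → ℂ} (hF : IsCc F) :
    IsCc fun y : ℝ × Pl n => kerB n lam F y.2 y.1 :=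
  hF.comp (j := fun y : ℝ × Pl n =>
    ((Real.exp (-(lam * y.1)) • y.2.1, Real.exp (-(lam * y.1)) • y.2.2, y.1) : Pt n))
    (i := fun p => (p.2.2, (Real.exp (lam * p.2.2) • p.1, Real.exp (lam * p.2.2) • p.2.1)))
    (by fun_prop) (by fun_prop) (fun y => by simp [smul_smul, ← Real.exp_add])

theorem exists_isInt_B {F : Pt n → ℂ} (hF : IsCc F) : ∃ T : Op (L2 (Pt n)),
    IsInt T (mapB n) (fun p s => kerB n lam F (dilB n lam p) s) := by
  obtain ⟨T, hT⟩ := exists_isInt_of_isCc (hF.kerB (lam := lam)) (measurable_mapB n) (mp_mapB n)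
    (measurable_dilB n lam) (c := fun _ _ => 1) measurable_const (fun _ _ => norm_one.le)
  exact ⟨T, hT.congr (fun _ _ => rfl) fun _ _ => mul_one _⟩

theorem mem_clSpan_genB_of_isCc {F : Pt n → ℂ} (hF : IsCc F) {T : Op (L2 (Pt n))}
    (hT : IsInt T (mapB n) (fun p s => kerB n lam F (dilB n lam p) s)) :
    T ∈ clSpan (genB n lam) := by
  refine mem_of_kernel₂ (isClosed_clSpan _) (c := fun _ _ => 1)
    (hT.congr (fun _ _ => rfl) fun p s => (mul_one (kerB n lam F (dilB n lam p) s)).symm)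
    (measurable_dilB n lam) measurable_const (fun _ _ => norm_one.le) (hF.kerB (lam := lam)).1
    (hF.kerB (lam := lam)).2 (fun y => Real.exp (-(lam * y.1)) • y.2) Prod.fst
    (by fun_prop) continuous_fst (fun y => (y.2, Real.exp (lam * y.2) • y.1)) (by fun_prop)
    (fun y => by simp [smul_smul, ← Real.exp_add])
    fun u₁ u₂ h₁ h₂ S hS => subset_clSpan _ ⟨fun p => u₁ (p.1, p.2.1) * u₂ p.2.2, ⟨?_, ?_⟩,
      hS.congr (fun _ _ => rfl) fun p s => mul_one _⟩
  · have := h₁.1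
    have := h₂.1
    fun_prop
  · exact ((h₁.isCc.prod h₂.isCc).comp (j := fun p : Pt n => ((p.1, p.2.1), p.2.2))
      (i := fun y : Pl n × ℝ => (y.1.1, y.1.2, y.2)) (by fun_prop) (by fun_prop) fun _ => rfl).2

/-- The composed kernel is `u(e^{-λs}w, s) v(e^{-λ(s+t)}w, t)`. In the coordinates `s` and
`(e^{-λ(s+t)}w, s + t)` a product kernel integrates, by a shear, to `(∫ u₁) λ_{u₂}`. -/
theorem genB_mul_mem {S T : Op (L2 (Pt n))} (hS : S ∈ genB n lam) (hT : T ∈ genB n lam) :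
    S * T ∈ clSpan (genB n lam) := by
  obtain ⟨u, hu, hS⟩ := hS
  obtain ⟨v, hv, hT⟩ := hT
  have hF : IsCc fun y : (ℝ × ℝ) × Pl n =>
      kerB n lam u y.2 y.1.1 * kerB n lam v (Real.exp (-(lam * y.1.1)) • y.2) y.1.2 :=
    (hu.isCc.prod hv.isCc).comp
      (j := fun y : (ℝ × ℝ) × Pl n => (((Real.exp (-(lam * y.1.1)) • y.2.1,
        Real.exp (-(lam * y.1.1)) • y.2.2, y.1.1) : Pt n),
        ((Real.exp (-(lam * y.1.2)) • Real.exp (-(lam * y.1.1)) • y.2.1,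
        Real.exp (-(lam * y.1.2)) • Real.exp (-(lam * y.1.1)) • y.2.2, y.1.2) : Pt n)))
      (by fun_prop) (i := fun z => ((z.1.2.2, z.2.2.2), (Real.exp (lam * z.1.2.2) • z.1.1,
        Real.exp (lam * z.1.2.2) • z.1.2.1))) (by fun_prop)
      (fun y => by simp [smul_smul, ← Real.exp_add])
  refine mem_of_kernel₂ (isClosed_clSpan _) (κ := dilB n lam)
    (φ := fun p (θ : ℝ × ℝ) => mapB n p (θ.1 + θ.2)) (c := fun p (θ : ℝ × ℝ) => 1)
    ((hS.mul hT).congr (fun p θ => ?_) (fun p θ => ?_)) (measurable_dilB n lam) measurable_const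
    (fun _ _ => norm_one.le) hF.1 hF.2
    (fun y => y.1.1) (fun y => (((Real.exp (-(lam * (y.1.1 + y.1.2))) • y.2).1,
      (Real.exp (-(lam * (y.1.1 + y.1.2))) • y.2).2, y.1.1 + y.1.2) : Pt n))
    (by fun_prop) (by fun_prop) (fun z => ((z.1, z.2.2.2 - z.1), (Real.exp (lam * z.2.2.2) • z.2.1,
      Real.exp (lam * z.2.2.2) • z.2.2.1)))
    (by fun_prop) (fun y => by simp [smul_smul, ← Real.exp_add]) ?_
  · simp only [mapB, sub_sub]
  · rw [dilB_mapB, mul_one]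
  · intro u₁ u₂ h₁ h₂ R hR
    obtain ⟨R', hR'⟩ := exists_isInt_B (lam := lam) h₂.isCc
    have : R = (∫ g, u₁ g) • R' := by
      refine hR.eq_of_integral (hR'.smul _) fun ξ p => ?_
      have := integral_shear u₁ (fun s : ℝ => kerB n lam u₂ (dilB n lam p) s * ξ (mapB n p s))
      simp only [mul_assoc, mul_one, one_mul] at this ⊢
      rw [integral_const_mul, ← this]
      rfl
    rw [this]
    exact Submodule.smul_mem _ _ (subset_clSpan _ ⟨u₂, h₂, hR'⟩)

/-- After `s ↦ -s` the adjoint of `λ_u` is `λ_F` with `F(x, y, s) = conj (u(e^{λs}x, e^{λs}y, -s))`.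
-/
theorem genB_star_mem {S : Op (L2 (Pt n))} (hS : S ∈ genB n lam) :
    star S ∈ clSpan (genB n lam) := by
  obtain ⟨u, hu, hS⟩ := hS
  have hF : IsCc fun p : Pt n => conj (u (Real.exp (lam * p.2.2) • p.1,
      Real.exp (lam * p.2.2) • p.2.1, -p.2.2)) :=
    hu.isCc.conj.comp (j := fun p : Pt n => ((Real.exp (lam * p.2.2) • p.1,
      Real.exp (lam * p.2.2) • p.2.1, -p.2.2) : Pt n)) (by fun_prop)
      (i := fun p : Pt n => ((Real.exp (lam * p.2.2) • p.1,
      Real.exp (lam * p.2.2) • p.2.1, -p.2.2) : Pt n)) (by fun_prop)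
      (fun p => by simp [smul_smul, ← Real.exp_add])
  obtain ⟨T, hT⟩ := exists_isInt_B (lam := lam) hF
  have h := hS.adjoint (ψ := fun p s => ((p.1, p.2.1, p.2.2 + s) : Pt n))
    (by unfold Function.uncurry; fun_prop) (fun p g => by simp [mapB]) (fun p g => by simp [mapB])
  have : star S = T := by
    refine h.eq_of_integral hT fun ξ p => ?_
    rw [← integral_neg_eq_self _ volume]
    refine integral_congr_ae (ae_of_all _ fun g => ?_)
    simp only [mapB, dilB, kerB, ← sub_eq_add_neg, Prod.smul_mk, smul_smul, ← Real.exp_add]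
    have h1 : -(lam * -g) + lam * (p.2.2 - g) = lam * p.2.2 := by ring
    have h2 : lam * g + (-(lam * g) + lam * p.2.2) = lam * p.2.2 := by ring
    rw [h1, h2]
  rw [this]
  exact mem_clSpan_genB_of_isCc hF hT

/-- The phase in the formula for `X`. -/
noncomputable def phX (lam : ℝ) (w : Pl n) (p' : Pt n) : ℂ :=
  e (-(eta lam p'.2.2 * ⟪w.1, p'.2.1 - w.2⟫_ℝ))

theorem continuous_phX : Continuous fun y : Pt n × Pl n => phX lam y.2 y.1 := by
  have he := continuous_e
  have ht := continuous_eta lam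
  unfold phX
  fun_prop

theorem norm_phX (w : Pl n) (p' : Pt n) : ‖phX lam w p'‖ ≤ 1 := (norm_e _).le

theorem measurable_phX_dilB :
    Measurable (Function.uncurry fun (p p' : Pt n) => phX lam (dilB n lam p) p') := by
  have he := measurable_e
  have ht := measurable_eta lam
  unfold Function.uncurry phX dilB
  fun_prop

/-- The kernel of a slice of `X`. -/
theorem rslice_X {u v : Pt n → ℂ} (hu : IsTest u) (hv : IsTest v) {S : Op (L2 (Pt n))}
    (hS : IsInt S (fun (p p' : Pt n) => mapB n p (-p'.2.2))
      (fun (p p' : Pt n) => conj (u p') * v (p'.1 - (dilB n lam p).1, p'.2.1 - (dilB n lam p).2,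
        p'.2.2) * phX lam (dilB n lam p) p')) :
    rslice (hu.isCc.memLp.toLp u) (hv.isCc.memLp.toLp v) (X n lam) = S :=
  rslice_eq_of_isInt (isWC_X n lam) _ _ hS (fun a b => by simp [mapB])
    (fun a b => by simp only [phX, dilB, Prod.smul_mk]; ring)

theorem measurable_negMapB : Measurable (Function.uncurry fun (p p' : Pt n) =>
    mapB n p (-p'.2.2)) := by
  unfold Function.uncurry mapB
  fun_prop

/-- In a slice of `X` the translation involves only `s = -r'`, so the variables `x'` and `y'`
integrate out to a scalar. -/
theorem isInt_negB {f : Pt n → ℂ} {δ : Pl n → ℂ} {S T : Op (L2 (Pt n))}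
    (hT : IsInt T (mapB n) (fun p s => kerB n lam f (dilB n lam p) s))
    (hS : IsInt S (fun (p p' : Pt n) => mapB n p (-p'.2.2))
      (fun (p p' : Pt n) => δ (p'.1, p'.2.1) * kerB n lam f (dilB n lam p) (-p'.2.2))) :
    S = (∫ q, δ q) • T := by
  refine hS.eq_of_integral (hT.smul _) fun ξ p => ?_
  have := integral_Pt_mul δ (fun s => kerB n lam f (dilB n lam p) (-s) * ξ (mapB n p (-s)))
  simp only [mul_assoc] at this ⊢
  rw [integral_const_mul, this, integral_neg_eq_self
    (fun s => kerB n lam f (dilB n lam p) s * ξ (mapB n p s)) volume]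

theorem IsCc.mul_kerB {δ : Pl n → ℂ} {f : Pt n → ℂ} (hδ : IsCc δ) (hf : IsCc f) :
    IsCc fun y : Pt n × Pl n => δ (y.1.1, y.1.2.1) * QDouble.kerB n lam f y.2 (-y.1.2.2) :=
  (hδ.prod hf).comp (j := fun y : Pt n × Pl n => ((y.1.1, y.1.2.1),
      ((Real.exp (-(lam * -y.1.2.2)) • y.2.1, Real.exp (-(lam * -y.1.2.2)) • y.2.2,
        -y.1.2.2) : Pt n))) (by fun_prop)
      (i := fun z => ((z.1.1, z.1.2, -z.2.2.2), Real.exp (lam * z.2.2.2) • z.2.1,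
        Real.exp (lam * z.2.2.2) • z.2.2.1)) (by fun_prop)
      (fun y => by simp [smul_smul, ← Real.exp_add])

theorem rslice_X_mem (u v : L2 (Pt n)) : rslice u v (X n lam) ∈ clSpan (genB n lam) := by
  refine rslice_mem_of_dense (isClosed_clSpan _) dense_test ?_ u v
  rintro _ ⟨u, -, hu, rfl⟩ _ ⟨v, -, hv, rfl⟩
  have hF : IsCc fun y : Pt n × Pl n => conj (u y.1) *
      v (y.1.1 - y.2.1, y.1.2.1 - y.2.2, y.1.2.2) * phX lam y.2 y.1 :=
    (hu.isCc.conj.prod hv.isCc).comp_mul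
      (j := fun y : Pt n × Pl n => (y.1, ((y.1.1 - y.2.1, y.1.2.1 - y.2.2, y.1.2.2) : Pt n)))
      (by fun_prop) (i := fun z => (z.1, z.1.1 - z.2.1, z.1.2.1 - z.2.2.1)) (by fun_prop)
      (fun y => by simp) continuous_phX
  obtain ⟨S, hS⟩ := exists_isInt_of_isCc (κ := dilB n lam) hF
    (measurable_negMapB) (fun _ => mp_mapB n _) (measurable_dilB n lam)
    (c := fun _ _ => 1) measurable_const (fun _ _ => norm_one.le)
  rw [rslice_X hu hv (hS.congr (fun _ _ => rfl) fun _ _ => mul_one _)]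
  refine mem_of_kernel₂ (isClosed_clSpan _) hS (measurable_dilB n lam) measurable_const
    (fun _ _ => norm_one.le) hF.1 hF.2 (fun y => (y.1.1, y.1.2.1))
    (fun y => ((Real.exp (-(lam * -y.1.2.2)) • y.2.1, Real.exp (-(lam * -y.1.2.2)) • y.2.2,
      -y.1.2.2) : Pt n)) (by fun_prop) (by fun_prop)
    (fun z => ((z.1.1, z.1.2, -z.2.2.2), Real.exp (lam * z.2.2.2) • z.2.1,
        Real.exp (lam * z.2.2.2) • z.2.2.1)) (by fun_prop)
      (fun y => by simp [smul_smul, ← Real.exp_add]) fun u₁ u₂ h₁ h₂ R hR => ?_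
  obtain ⟨R', hR'⟩ := exists_isInt_B (lam := lam) h₂.isCc
  rw [isInt_negB (δ := u₁) hR' (hR.congr (fun _ _ => rfl) fun _ _ => mul_one _)]
  exact Submodule.smul_mem _ _ (subset_clSpan _ ⟨u₂, h₂, hR'⟩)

/-- Every closed subspace that contains the slices of `X` contains the operators `λ_u`. -/
theorem genB_subset {N : Submodule ℂ (Op (L2 (Pt n)))} (hN : IsClosed (N : Set (Op (L2 (Pt n)))))
    (h : ∀ u v, rslice u v (X n lam) ∈ N) : genB n lam ⊆ N := by
  rintro T ⟨f, hf, hT⟩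
  obtain ⟨δ, hδ, hδ1⟩ := exists_test_integral (X := Pl n) (g := fun _ => 1) continuous_const
    (fun _ => one_pos)
  -- The conjugate phase is put into the kernel in advance. It cancels against the phase of `X`, so
  -- the same operator is `λ_f` and has a kernel of the form (compactly supported) times (phase of
  -- `X`), ready for comparison with slices.
  have hF : IsCc fun y : Pt n × Pl n => δ (y.1.1, y.1.2.1) * kerB n lam f y.2 (-y.1.2.2) *
      conj (phX lam y.2 y.1) := by
    refine ⟨(hδ.isCc.mul_kerB hf.isCc).1.mul (Complex.continuous_conj.comp continuous_phX),
      (hδ.isCc.mul_kerB hf.isCc).2.mul_right⟩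
  obtain ⟨S, hS⟩ := exists_isInt_of_isCc (κ := dilB n lam) hF
    (measurable_negMapB) (fun _ => mp_mapB n _) (measurable_dilB n lam)
    measurable_phX_dilB (fun _ _ => norm_phX _ _)
  have hS' : IsInt S (fun (p p' : Pt n) => mapB n p (-p'.2.2))
      (fun (p p' : Pt n) => δ (p'.1, p'.2.1) * kerB n lam f (dilB n lam p) (-p'.2.2)) :=
    hS.congr (fun _ _ => rfl) fun p p' => by
      dsimp only
      rw [mul_assoc, phX, conj_e, ← e_add, neg_add_cancel, e_zero, mul_one]
  have hST := isInt_negB (δ := δ) hT hS'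
  simp only [Complex.ofReal_one, one_mul] at hδ1
  rw [hδ1, one_smul] at hST
  rw [← hST]
  refine mem_of_kernel₂ hN hS (measurable_dilB n lam) measurable_phX_dilB
    (fun _ _ => norm_phX _ _) hF.1 hF.2 (fun y => y.1)
    (fun y => ((y.1.1 - y.2.1, y.1.2.1 - y.2.2, y.1.2.2) : Pt n)) (by fun_prop) (by fun_prop)
    (fun z => (z.1, z.1.1 - z.2.1, z.1.2.1 - z.2.2.1)) (by fun_prop)
    (fun y => by simp) fun u v hu hv R hR => ?_
  have hR' : IsInt R (fun (p p' : Pt n) => mapB n p (-p'.2.2))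
      (fun (p p' : Pt n) => conj (conj (u p')) * v (p'.1 - (dilB n lam p).1,
        p'.2.1 - (dilB n lam p).2, p'.2.2) * phX lam (dilB n lam p) p') :=
    hR.congr (fun _ _ => rfl) fun p p' => by rw [Complex.conj_conj]
  rw [← rslice_X hu.conj hv hR']
  exact h _ _

theorem algB_eq : (algB n lam : Set (Op (L2 (Pt n)))) = clSpan (genB n lam) := by
  refine Set.Subset.antisymm (cstarGen_subset (fun a ha => ?_) (fun x hx y hy => genB_mul_mem hx hy)
    (fun x hx => genB_star_mem hx)) (clSpan_subset_cstarGen ?_)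
  · exact mem_of_mem_rightSlices (isClosed_clSpan _) rslice_X_mem ha
  · exact genB_subset (N := (cstarGen (rightSlices (X n lam))).toNonUnitalSubalgebra.toSubmodule)
      (isClosed_cstarGen _) fun u v => subset_cstarGen _ (rslice_mem u v _)

theorem mem_algB_iff {a : Op (L2 (Pt n))} : a ∈ algB n lam ↔ a ∈ clSpan (genB n lam) :=
  Set.ext_iff.1 algB_eq a

/-- A closed subspace that contains the slices of `X` contains `Â^op`. -/
theorem mem_of_mem_algB {N : Submodule ℂ (Op (L2 (Pt n)))}
    (hN : IsClosed (N : Set (Op (L2 (Pt n))))) (h : ∀ u v, rslice u v (X n lam) ∈ N)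
    {a : Op (L2 (Pt n))} (ha : a ∈ algB n lam) : a ∈ N :=
  clSpan_le hN (genB_subset hN h) (mem_algB_iff.1 ha)

theorem isInt_lamRep (φ : funAlg n) : IsInt (lamRep n lam φ) (mapB n)
    (fun p s => kerB n lam (φ : SchwartzMap (Pt n) ℂ) (dilB n lam p) s) := by
  obtain ⟨h, hh, hb⟩ := exists_dominating' n φ
  have : IsInt (lamRep n lam φ) (mapB n) (fun p s => (φ : SchwartzMap (Pt n) ℂ)
      (Real.exp (lam * (p.2.2 - s)) • p.1, Real.exp (lam * (p.2.2 - s)) • p.2.1, s)) := by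
    refine ⟨measurable_mapB n, mp_mapB n, lam_kernel n lam φ, ⟨h, hh, fun _ _ => hb _ _ _⟩,
      fun ξ => ?_⟩
    filter_upwards [opOfFormula_ae _ (exists_lam n lam φ) ξ] with p hp
    refine hp.trans ?_
    rw [lamFormula, ← integral_sub_left_eq_self _ volume p.2.2]
    simp [mapB]
  refine this.congr (fun _ _ => rfl) fun p s => ?_
  have : lam * (p.2.2 - s) = -(lam * s) + lam * p.2.2 := by ring
  simp only [kerB, dilB, Prod.smul_mk, smul_smul, ← Real.exp_add, this]

/-- The integration variable stays in `[-R, R]`, so the norm is controlled by the supremum of `φ`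
times the length of that interval. A Schwartz function vanishes at infinity and is uniformly close
to its cutoff `χ φ`. -/
theorem lamRep_mem (φ : funAlg n) : lamRep n lam φ ∈ algB n lam := by
  rw [mem_algB_iff]
  obtain ⟨R, hR⟩ := φ.2
  have hf : Continuous (φ : SchwartzMap (Pt n) ℂ) := (φ : SchwartzMap (Pt n) ℂ).continuous
  rw [← SetLike.mem_coe, ← (isClosed_clSpan _).closure_eq]
  refine Metric.mem_closure_iff.2 fun ε hε => ?_
  set v : ℝ := ∫ s : ℝ, (Set.Icc (-R) R).indicator (fun _ => (1 : ℝ)) s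
  have hv : 0 ≤ v := integral_nonneg fun s => Set.indicator_nonneg (fun _ _ => zero_le_one) s
  have hi : Integrable ((Set.Icc (-R) R).indicator fun _ => (1 : ℝ)) :=
    (integrable_indicator_iff measurableSet_Icc).2 (integrableOn_const (by simp))
  have hε' : 0 < ε / (v + 1) / 2 := by positivity
  have h0 := (φ : SchwartzMap (Pt n) ℂ).toZeroAtInfty.zero_at_infty'
  obtain ⟨K, hK, hKφ⟩ := mem_cocompact.1 (h0 (Metric.ball_mem_nhds 0 hε'))
  obtain ⟨χ, hχ, hχ1, hχle⟩ := exists_test_eq_one hK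
  have hF : IsCc fun p => χ p * (φ : SchwartzMap (Pt n) ℂ) p :=
    ⟨hχ.continuous.mul hf, hχ.2.mul_right⟩
  obtain ⟨T, hT⟩ := exists_isInt_B (lam := lam) hF
  refine ⟨T, mem_clSpan_genB_of_isCc hF hT, ?_⟩
  rw [dist_eq_norm]
  have hp : ∀ p, ‖(φ : SchwartzMap (Pt n) ℂ) p - χ p * (φ : SchwartzMap (Pt n) ℂ) p‖ ≤
      ε / (v + 1) := fun p => by
    by_cases hp : p ∈ K
    · rw [hχ1 p hp, one_mul, sub_self, norm_zero]
      positivity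
    · have h1 : ‖(φ : SchwartzMap (Pt n) ℂ) p‖ < ε / (v + 1) / 2 := by
        simpa using hKφ hp
      rw [← one_sub_mul, norm_mul]
      have h2 : ‖1 - χ p‖ ≤ 2 := (norm_sub_le _ _).trans (by rw [norm_one]; linarith [hχle p])
      nlinarith [norm_nonneg (1 - χ p), norm_nonneg ((φ : SchwartzMap (Pt n) ℂ) p)]
  have hle := ((isInt_lamRep (lam := lam) φ).sub hT).norm_le (hi.const_mul (ε / (v + 1)))
    (fun s => mul_nonneg (by positivity) (Set.indicator_nonneg (fun _ _ => zero_le_one) s))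
    fun p s => ?_
  · refine hle.trans_lt ?_
    rw [integral_const_mul, div_mul_eq_mul_div, div_lt_iff₀ (by positivity)]
    nlinarith
  · simp only [kerB]
    by_cases hs : s ∈ Set.Icc (-R) R
    · rw [Set.indicator_of_mem hs, mul_one]
      exact hp _
    · rw [Set.indicator_of_notMem hs, mul_zero, hR (_, _, s), mul_zero, sub_zero, norm_zero]
      rwa [Set.mem_Icc, ← abs_le, not_le] at hs

end AlgB

/-! ### The homomorphisms `π` and `π'` -/

section PiA

variable (n : ℕ) (lam : ℝ)

theorem piB_apply (T : Op (L2 (Pt n))) : piB n T = opTensor T 1 := rfl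

theorem piA_apply (T : Op (L2 (Pt n))) :
    piA n lam T = Z n lam * (opTensor 1 T * star (Z n lam)) := rfl

theorem piA_mul_Z (T : Op (L2 (Pt n))) : piA n lam T * Z n lam = Z n lam * opTensor 1 T := by
  rw [piA_apply, mul_assoc, mul_assoc, Unitary.star_mul_self_of_mem (Z_mem_unitary n lam), mul_one]

theorem piA_mul (S T : Op (L2 (Pt n))) : piA n lam (S * T) = piA n lam S * piA n lam T := by
  rw [piA_apply n lam T, ← mul_assoc, ← mul_assoc, piA_mul_Z, piA_apply,
    show opTensor (1 : Op (L2 (Pt n))) (S * T) = opTensor 1 S * opTensor 1 T by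
      rw [← opTensor_mul, one_mul]]
  simp only [mul_assoc]

theorem star_piA (T : Op (L2 (Pt n))) : star (piA n lam T) = piA n lam (star T) := by
  simp only [piA_apply, star_mul, star_star, star_opTensor, star_one, mul_assoc]

theorem piB_mul (S T : Op (L2 (Pt n))) : piB n (S * T) = piB n S * piB n T := by
  simp only [piB_apply, ← opTensor_mul, one_mul]

theorem star_piB (T : Op (L2 (Pt n))) : star (piB n T) = piB n (star T) := by
  simp only [piB_apply, star_opTensor, star_one]

theorem continuous_opTensor_right {α β : Type} [MeasureSpace α] [MeasureSpace β]
    [SigmaFinite (volume : Measure α)] [SigmaFinite (volume : Measure β)] (T : Op (L2 α)) :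
    Continuous fun S : Op (L2 β) => opTensor T S :=
  AddMonoidHomClass.continuous_of_bound (opTensorₗ (β := β) T) ‖T‖ fun S => norm_opTensor_le T S

theorem continuous_opTensor_left {α β : Type} [MeasureSpace α] [MeasureSpace β]
    [SigmaFinite (volume : Measure α)] [SigmaFinite (volume : Measure β)] (S : Op (L2 β)) :
    Continuous fun T : Op (L2 α) => opTensor T S :=
  AddMonoidHomClass.continuous_of_bound ((opTensorₗ (α := α)).flip S) ‖S‖ fun T =>
    (norm_opTensor_le T S).trans (mul_comm _ _).le

theorem continuous_piA : Continuous (piA n lam) :=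
  (continuous_const_mul _).comp ((continuous_mul_const _).comp (continuous_opTensor_right 1))

theorem continuous_piB : Continuous (piB n) := continuous_opTensor_left 1

/-- The phase in the formula for `π(L_f)`. -/
noncomputable def phP (a b : Pt n) (g : Pl n) : ℂ :=
  e (eta lam a.2.2 * (⟪a.1, Real.exp (-(lam * a.2.2)) • g.2⟫_ℝ - Real.exp (lam * b.2.2) *
      ⟪Real.exp (-(lam * a.2.2)) • g.1, a.2.1 + (1 - Real.exp (lam * b.2.2)) •
        Real.exp (-(lam * a.2.2)) • g.2⟫_ℝ) +
    -(eta lam b.2.2 * ⟪Real.exp (-(lam * a.2.2)) • g.1,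
      b.2.1 - Real.exp (-(lam * a.2.2)) • g.2⟫_ℝ))

/-- The translation in the formula for `π(L_f)`. -/
noncomputable def mapP (a b : Pt n) (g : Pl n) : Pt n × Pt n :=
  ((a.1 + (1 - Real.exp (lam * b.2.2)) • Real.exp (-(lam * a.2.2)) • g.1,
    a.2.1 + (1 - Real.exp (lam * b.2.2)) • Real.exp (-(lam * a.2.2)) • g.2, a.2.2),
    (b.1 - Real.exp (-(lam * a.2.2)) • g.1, b.2.1 - Real.exp (-(lam * a.2.2)) • g.2, b.2.2))

variable {n lam}

theorem mp_shift {h₁ h₂ : ℝ → EuclideanSpace ℝ (Fin n)} (m₁ : Measurable h₁) (m₂ : Measurable h₂) :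
    MeasurePreserving (fun p : Pt n => ((p.1 + h₁ p.2.2, p.2.1 + h₂ p.2.2, p.2.2) : Pt n))
      volume volume := by
  have h1 : MeasurePreserving (fun p : Pt n => ((p.1 + h₁ p.2.2, p.2) : Pt n)) volume volume :=
    mp_skew_left (f := fun (b : EuclideanSpace ℝ (Fin n) × ℝ) a => a + h₁ b.2)
      (by unfold Function.uncurry; fun_prop) fun b => measurePreserving_add_right _ _
  have h2 : MeasurePreserving (fun q : EuclideanSpace ℝ (Fin n) × ℝ => (q.1 + h₂ q.2, q.2))
      volume volume :=
    mp_skew_left (f := fun (b : ℝ) a => a + h₂ b) (by unfold Function.uncurry; fun_prop)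
      fun b => measurePreserving_add_right _ _
  exact ((MeasurePreserving.id volume).prod h2).comp h1

theorem mp_mapP (g : Pl n) : MeasurePreserving (fun p : Pt n × Pt n => mapP n lam p.1 p.2 g)
    volume volume := by
  have h1 : MeasurePreserving (fun p : Pt n × Pt n =>
      (((p.1.1 + (1 - Real.exp (lam * p.2.2.2)) • Real.exp (-(lam * p.1.2.2)) • g.1,
        p.1.2.1 + (1 - Real.exp (lam * p.2.2.2)) • Real.exp (-(lam * p.1.2.2)) • g.2,
        p.1.2.2) : Pt n), p.2)) volume volume :=
    mp_skew_left (f := fun b a : Pt n =>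
      ((a.1 + (1 - Real.exp (lam * b.2.2)) • Real.exp (-(lam * a.2.2)) • g.1,
        a.2.1 + (1 - Real.exp (lam * b.2.2)) • Real.exp (-(lam * a.2.2)) • g.2, a.2.2) : Pt n))
      (by unfold Function.uncurry; fun_prop) fun b =>
      mp_shift (h₁ := fun r => (1 - Real.exp (lam * b.2.2)) • Real.exp (-(lam * r)) • g.1)
        (h₂ := fun r => (1 - Real.exp (lam * b.2.2)) • Real.exp (-(lam * r)) • g.2)
        (by fun_prop) (by fun_prop)
  have h2 : MeasurePreserving (fun p : Pt n × Pt n =>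
      (p.1, ((p.2.1 - Real.exp (-(lam * p.1.2.2)) • g.1,
        p.2.2.1 - Real.exp (-(lam * p.1.2.2)) • g.2, p.2.2.2) : Pt n))) volume volume :=
    mp_skew_right (f := fun a b : Pt n => ((b.1 - Real.exp (-(lam * a.2.2)) • g.1,
        b.2.1 - Real.exp (-(lam * a.2.2)) • g.2, b.2.2) : Pt n))
      (by unfold Function.uncurry; fun_prop) fun a => by
        simpa [sub_eq_add_neg] using
          mp_translate (-(Real.exp (-(lam * a.2.2)) • g.1)) (-(Real.exp (-(lam * a.2.2)) • g.2)) 0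
  exact h1.comp h2

theorem measurable_mapP : Measurable (Function.uncurry fun (p : Pt n × Pt n) (g : Pl n) =>
    mapP n lam p.1 p.2 g) := by
  unfold Function.uncurry mapP
  fun_prop

theorem measurable_phP : Measurable (Function.uncurry fun (p : Pt n × Pt n) (g : Pl n) =>
    phP n lam p.1 p.2 g) := by
  have he := measurable_e
  have ht := measurable_eta lam
  unfold Function.uncurry phP
  fun_prop

theorem norm_phP (a b : Pt n) (g : Pl n) : ‖phP n lam a b g‖ ≤ 1 := (norm_e _).le

/-- The weight in the formula for `Z`. -/
noncomputable def wtZ (n : ℕ) (lam : ℝ) (p : Pt n × Pt n) : ℂ :=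
  ((Real.exp (lam * p.1.2.2) ^ n : ℝ) : ℂ) * e (eta lam p.1.2.2 *
    (⟪p.1.1 - Real.exp (lam * p.2.2.2) • p.2.1, p.2.2.1⟫_ℝ - Real.exp (lam * p.2.2.2) *
      ⟪p.2.1, p.1.2.1 - Real.exp (lam * p.2.2.2) • p.2.2.1⟫_ℝ))

/-- The map in the formula for `Z`. -/
noncomputable def mapZ (n : ℕ) (lam : ℝ) (p : Pt n × Pt n) : Pt n × Pt n :=
  ((p.1.1 + (1 - Real.exp (lam * p.2.2.2)) • p.2.1,
      p.1.2.1 + (1 - Real.exp (lam * p.2.2.2)) • p.2.2.1, p.1.2.2),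
    (Real.exp (lam * p.1.2.2) • p.2.1, Real.exp (lam * p.1.2.2) • p.2.2.1, p.2.2.2))

theorem isWC_Z' : IsWC (Z n lam) (wtZ n lam) (mapZ n lam) := isWC_Z n lam

/-- This relation is what determines `mapP`: it is the translation `mapA` of the second point,
transported through the coordinate change of `Z`. -/
theorem mapZ_mapP (p : Pt n × Pt n) (g : Pl n) :
    mapZ n lam (mapP n lam p.1 p.2 g) = ((mapZ n lam p).1, mapA n (mapZ n lam p).2 g) := by
  simp only [mapA, mapP, mapZ, Prod.mk.injEq, smul_add, smul_sub, smul_neg, smul_smul, mul_add,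
    mul_sub, mul_neg, Real.exp_add, Real.exp_sub, Real.exp_neg]
  refine ⟨⟨?_, ?_, ?_⟩, ?_, ?_, ?_⟩ <;>
    first | trivial | ring1 | (match_scalars <;> field_simp <;> ring1)

/-- The companion of `mapZ_mapP` for the phases. The real weights agree on both sides since `mapP`
fixes the `r`-coordinates; the exponents differ by a multiple of `eta_comm`. -/
theorem wtZ_mul_phA (p : Pt n × Pt n) (g : Pl n) : wtZ n lam p * phA n lam (mapZ n lam p).2 g =
    phP n lam p.1 p.2 g * wtZ n lam (mapP n lam p.1 p.2 g) := by
  simp only [phA, phP, mapP, mapZ, wtZ]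
  rw [mul_assoc, mul_left_comm (e _), ← e_add, ← e_add]
  congr 2
  simp only [inner_add_left, inner_add_right, inner_sub_left, inner_sub_right, inner_neg_left,
    inner_neg_right, real_inner_smul_left, real_inner_smul_right,
    mul_add, mul_sub, mul_neg, Real.exp_add, Real.exp_sub, Real.exp_neg]
  field_simp
  linear_combination (Real.exp (lam * p.1.2.2) * ⟪g.1, p.2.2.1⟫_ℝ - ⟪g.1, g.2⟫_ℝ) *
    eta_comm lam p.1.2.2 p.2.2.2

/-- The operators `π(L_f)` are integral operators. -/
theorem isInt_piA {F : Pt n → ℂ} (hF : Measurable F) {S : Op (L2 (Pt n))}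
    (hS : IsInt S (mapA n) (fun p g => F (g.1, g.2, p.2.2) * phA n lam p g)) :
    IsInt (piA n lam S) (fun p g => mapP n lam p.1 p.2 g)
      (fun p g => F (g.1, g.2, p.2.2.2) * phP n lam p.1 p.2 g) := by
  obtain ⟨h, hh, hb⟩ := hS.dom
  obtain ⟨T, hT⟩ := exists_isInt (φ := fun (p : Pt n × Pt n) g => mapP n lam p.1 p.2 g)
    (k := fun p g => F (g.1, g.2, p.2.2.2) * phP n lam p.1 p.2 g) measurable_mapP mp_mapP
    (Measurable.mul (by fun_prop) measurable_phP) ⟨h, hh, fun p g => by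
      -- The phases are unimodular, so the bound for the kernel of `S` at any point with this
      -- `r`-coordinate is a bound for `F` itself.
      have := hb (0, 0, p.2.2.2) g
      rw [norm_mul] at this ⊢
      rw [phA, norm_e, mul_one] at this
      rw [phP, norm_e, mul_one]
      exact this⟩
  have key : Z n lam * opTensor 1 S = T * Z n lam := by
    refine mul_eq_mul_of_kernel isWC_Z' hS.opTensor_left hT isWC_Z'
      (fun p g => (mapZ_mapP p g).symm) (fun p g => ?_)
    rw [mul_left_comm, wtZ_mul_phA, mul_assoc]
    rfl
  have : piA n lam S = T := by
    rw [piA_apply, ← mul_assoc, key, mul_assoc, Unitary.mul_star_self_of_mem (Z_mem_unitary n lam),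
      mul_one]
  rwa [this]

end PiA

/-! ### Extending membership from generators to closed spans -/

section Closed

variable {H K : Type} [NormedAddCommGroup H] [InnerProductSpace ℂ H] [CompleteSpace H]
  [NormedAddCommGroup K] [InnerProductSpace ℂ K] [CompleteSpace K]

/-- The subspace of all `x` with `f(x) y ∈ M`. -/
noncomputable def mulRightComap (M : Submodule ℂ (Op K)) (f : Op H →ₗ[ℂ] Op K) (y : Op K) :
    Submodule ℂ (Op H) := M.comap (LinearMap.mulRight ℂ y ∘ₗ f)

theorem mem_mulRightComap {M : Submodule ℂ (Op K)} {f : Op H →ₗ[ℂ] Op K} {y : Op K} {x : Op H} :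
    x ∈ mulRightComap M f y ↔ f x * y ∈ M := Iff.rfl

theorem isClosed_mulRightComap {M : Submodule ℂ (Op K)} (hM : IsClosed (M : Set (Op K)))
    {f : Op H →ₗ[ℂ] Op K} (hf : Continuous f) (y : Op K) :
    IsClosed (mulRightComap M f y : Set (Op H)) :=
  hM.preimage ((continuous_mul_const y).comp hf)

/-- The subspace of all `x` with `y f(x) ∈ M`. -/
noncomputable def mulLeftComap (M : Submodule ℂ (Op K)) (f : Op H →ₗ[ℂ] Op K) (y : Op K) :
    Submodule ℂ (Op H) := M.comap (LinearMap.mulLeft ℂ y ∘ₗ f)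

theorem mem_mulLeftComap {M : Submodule ℂ (Op K)} {f : Op H →ₗ[ℂ] Op K} {y : Op K} {x : Op H} :
    x ∈ mulLeftComap M f y ↔ y * f x ∈ M := Iff.rfl

theorem isClosed_mulLeftComap {M : Submodule ℂ (Op K)} (hM : IsClosed (M : Set (Op K)))
    {f : Op H →ₗ[ℂ] Op K} (hf : Continuous f) (y : Op K) :
    IsClosed (mulLeftComap M f y : Set (Op H)) :=
  hM.preimage ((continuous_const_mul y).comp hf)

theorem map_mul_map_mem {H' : Type} [NormedAddCommGroup H'] [InnerProductSpace ℂ H']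
    [CompleteSpace H'] {M : Submodule ℂ (Op K)} (hM : IsClosed (M : Set (Op K)))
    {f : Op H →ₗ[ℂ] Op K} (hf : Continuous f) {g : Op H' →ₗ[ℂ] Op K} (hg : Continuous g)
    {s : Set (Op H)} {t : Set (Op H')} (h : ∀ x ∈ s, ∀ y ∈ t, f x * g y ∈ M) {a : Op H}
    (ha : a ∈ clSpan s) {b : Op H'} (hb : b ∈ clSpan t) : f a * g b ∈ M := by
  refine mem_mulRightComap.1 (clSpan_le (isClosed_mulRightComap hM hf (g b)) (fun x hx => ?_) ha)
  exact mem_mulRightComap.2 (mem_mulLeftComap.1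
    (clSpan_le (isClosed_mulLeftComap hM hg (f x)) (fun y hy => h x hx y hy) hb))

theorem mul_mem_of_clSpan {M : Submodule ℂ (Op K)} (hM : IsClosed (M : Set (Op K))) (a : Op K)
    {s : Set (Op K)} (h : ∀ x ∈ s, a * x ∈ M) {x : Op K} (hx : x ∈ clSpan s) : a * x ∈ M :=
  mem_mulLeftComap.1 (clSpan_le (isClosed_mulLeftComap (f := LinearMap.id) hM continuous_id a)
    (fun x hx => h x hx) hx)

theorem mul_mem_of_clSpan_right {M : Submodule ℂ (Op K)} (hM : IsClosed (M : Set (Op K)))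
    (a : Op K) {s : Set (Op K)} (h : ∀ x ∈ s, x * a ∈ M) {x : Op K} (hx : x ∈ clSpan s) :
    x * a ∈ M :=
  mem_mulRightComap.1 (clSpan_le (isClosed_mulRightComap (f := LinearMap.id) hM continuous_id a)
    (fun x hx => h x hx) hx)

end Closed

/-! ### The algebra `A_D` as a closed span of products -/

section AlgD

variable (n : ℕ) (lam : ℝ)

/-- The products `π(L_u) π'(λ_v)`. -/
def genD : Set (Op (L2 (Pt n × Pt n))) :=
  {x | ∃ S ∈ genA n lam, ∃ T ∈ genB n lam, x = piA n lam S * piB n T}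

variable {n lam}

theorem piA_mul_piB_mem {a b : Op (L2 (Pt n))} (ha : a ∈ clSpan (genA n lam))
    (hb : b ∈ clSpan (genB n lam)) : piA n lam a * piB n b ∈ clSpan (genD n lam) :=
  map_mul_map_mem (M := clSpan (genD n lam)) (isClosed_clSpan _) (continuous_piA n lam)
    (continuous_piB n) (fun S hS T hT => subset_clSpan (genD n lam) ⟨S, hS, T, hT, rfl⟩) ha hb

theorem integral_prodPt (G : Pl n × ℝ → ℂ) :
    ∫ y, G y = ∫ p : Pt n, G ((p.1, p.2.1), p.2.2) := by
  have h : MeasurePreserving (MeasurableEquiv.prodAssoc : Pl n × ℝ ≃ᵐ Pt n) volume volume :=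
    measurePreserving_prodAssoc volume volume volume
  rw [← h.integral_comp']
  rfl

theorem integral_prodPt' (G : ℝ × Pl n → ℂ) :
    ∫ y, G y = ∫ p : Pt n, G (p.2.2, (p.1, p.2.1)) := by
  rw [← integral_prodPt (fun y => G (y.2, y.1))]
  have h : MeasurePreserving (MeasurableEquiv.prodComm : Pl n × ℝ ≃ᵐ ℝ × Pl n) volume volume :=
    Measure.measurePreserving_swap
  rw [← h.integral_comp']
  rfl

/-- Translating the first `r`-coordinate by `s` is compensated by rescaling `g`, up to a phase that
depends only on `s`, `g`, `dilB a` and the `r`-coordinate of `b`. The extra phase can be absorbed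
into the compactly supported part of a kernel. -/
theorem phP_mapB (a b : Pt n) (g : Pl n) (s : ℝ) :
    phP n lam (mapB n a s) b (Real.exp (-(lam * s)) • g) =
      e (eta lam (-s) * (⟪(dilB n lam a).1, g.2⟫_ℝ - Real.exp (lam * b.2.2) *
        ⟪g.1, (dilB n lam a).2 + (1 - Real.exp (lam * b.2.2)) • g.2⟫_ℝ)) * phP n lam a b g := by
  simp only [phP, mapB, dilB, Prod.smul_fst, Prod.smul_snd]
  rw [← e_add]
  congr 1
  simp only [inner_add_left, inner_add_right, inner_sub_left, inner_sub_right, inner_neg_left,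
    inner_neg_right, real_inner_smul_left, real_inner_smul_right, eta_add, eta_sub, eta_neg,
    mul_add, mul_sub, mul_neg, Real.exp_add, Real.exp_sub, Real.exp_neg]
  field_simp
  ring

/-- The exchange relation behind the algebra structure of `A_D`. After the substitution `g ↦
e^{-λs}g` the product has the translations and the phase of `π(L) π'(λ)`. With `w = dilB` of the
first point and `ρ` the second `r`-coordinate, the coordinates `(g, ρ)` and `(e^{-λs}(w + (1 -
e^{λρ})g), s)` turn product kernels into kernels of `π(L_{u₁}) π'(λ_{u₂})`. -/
theorem piB_mul_piA_mem {S T : Op (L2 (Pt n))} (hS : S ∈ genA n lam) (hT : T ∈ genB n lam) :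
    piB n T * piA n lam S ∈ clSpan (genD n lam) := by
  obtain ⟨u, hu, hS⟩ := hS
  obtain ⟨v, hv, hT⟩ := hT
  have he := continuous_e
  have ht := continuous_eta lam
  have hF : IsCc fun y : Pt n × (Pl n × ℝ) =>
      v (Real.exp (-(lam * y.1.2.2)) • y.2.1.1, Real.exp (-(lam * y.1.2.2)) • y.2.1.2, y.1.2.2) *
      u (Real.exp (-(lam * y.1.2.2)) • y.1.1, Real.exp (-(lam * y.1.2.2)) • y.1.2.1, y.2.2) *
      (((Real.exp (-lam * y.1.2.2) ^ (2 * n) : ℝ) : ℂ) *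
        e (eta lam (-y.1.2.2) * (⟪y.2.1.1, y.1.2.1⟫_ℝ - Real.exp (lam * y.2.2) *
        ⟪y.1.1, y.2.1.2 + (1 - Real.exp (lam * y.2.2)) • y.1.2.1⟫_ℝ))) :=
    (hv.isCc.prod hu.isCc).comp_mul (j := fun y : Pt n × (Pl n × ℝ) =>
      (((Real.exp (-(lam * y.1.2.2)) • y.2.1.1, Real.exp (-(lam * y.1.2.2)) • y.2.1.2,
        y.1.2.2) : Pt n), ((Real.exp (-(lam * y.1.2.2)) • y.1.1,
          Real.exp (-(lam * y.1.2.2)) • y.1.2.1, y.2.2) : Pt n))) (by fun_prop)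
      (i := fun z => ((Real.exp (lam * z.1.2.2) • z.2.1, Real.exp (lam * z.1.2.2) • z.2.2.1,
        z.1.2.2), ((Real.exp (lam * z.1.2.2) • z.1.1, Real.exp (lam * z.1.2.2) • z.1.2.1),
        z.2.2.2))) (by fun_prop) (fun y => by simp [smul_smul, ← Real.exp_add]) (by fun_prop)
  have m1 : Measurable (Function.uncurry fun (p : Pt n × Pt n) (y : Pt n) =>
      (((mapP n lam p.1 p.2 (y.1, y.2.1)).1.1, (mapP n lam p.1 p.2 (y.1, y.2.1)).1.2.1,
        p.1.2.2 - y.2.2), (mapP n lam p.1 p.2 (y.1, y.2.1)).2)) := by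
    unfold Function.uncurry mapP
    fun_prop
  have m2 : ∀ y : Pt n, MeasurePreserving (fun p : Pt n × Pt n =>
      ((((mapP n lam p.1 p.2 (y.1, y.2.1)).1.1, (mapP n lam p.1 p.2 (y.1, y.2.1)).1.2.1,
        p.1.2.2 - y.2.2) : Pt n), (mapP n lam p.1 p.2 (y.1, y.2.1)).2)) volume volume := fun y =>
    ((mp_mapB n y.2.2).prod (MeasurePreserving.id _)).comp (mp_mapP (lam := lam) (y.1, y.2.1))
  have m3 : Measurable (Function.uncurry fun (p : Pt n × Pt n) (y : Pt n) =>
      phP n lam p.1 p.2 (y.1, y.2.1)) := by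
    have he := measurable_e
    have ht := measurable_eta lam
    unfold Function.uncurry phP
    fun_prop
  obtain ⟨R, hR⟩ := exists_isInt_of_isCc (κ := fun p : Pt n × Pt n => (dilB n lam p.1, p.2.2.2)) hF
    m1 m2 (by have := measurable_dilB n lam; fun_prop) m3 (fun _ _ => norm_phP _ _ _)
  have hBA := (hT.opTensor_right (β := Pt n)).mul (isInt_piA hu.continuous.measurable hS)
  have hBA' : piB n T * piA n lam S = R := by
    refine hBA.eq_of_integral hR fun ξ p => ?_
    -- The substitution `g ↦ e^{-λs}g`; its Jacobian `e^{-2nλs}` is the real factor included in the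
    -- kernel of `R`.
    rw [integral_prodPt', ← integral_dilation (-lam)]
    refine integral_congr_ae (ae_of_all _ fun y => ?_)
    have h1 := phP_mapB (lam := lam) p.1 p.2 (y.1, y.2.1) y.2.2
    simp only [Prod.smul_mk, neg_mul] at h1 ⊢
    rw [h1]
    have h2 : mapP n lam (mapB n p.1 y.2.2) p.2 (Real.exp (-(lam * y.2.2)) • y.1,
        Real.exp (-(lam * y.2.2)) • y.2.1) =
        (((mapP n lam p.1 p.2 (y.1, y.2.1)).1.1, (mapP n lam p.1 p.2 (y.1, y.2.1)).1.2.1,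
        p.1.2.2 - y.2.2), (mapP n lam p.1 p.2 (y.1, y.2.1)).2) := by
      have : -(lam * (p.1.2.2 - y.2.2)) + -(lam * y.2.2) = -(lam * p.1.2.2) := by ring
      simp only [mapP, mapB, smul_smul, mul_assoc, ← Real.exp_add, this]
    rw [h2]
    simp only [kerB]
    ring
  rw [hBA']
  refine mem_of_kernel₂ (isClosed_clSpan _) hR (by have := measurable_dilB n lam; fun_prop) m3
    (fun _ _ => norm_phP _ _ _) hF.1 hF.2 (fun y => ((y.1.1, y.1.2.1, y.2.2) : Pt n))
    (fun y => ((Real.exp (-(lam * y.1.2.2)) •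
        (y.2.1.1 + (1 - Real.exp (lam * y.2.2)) • y.1.1), Real.exp (-(lam * y.1.2.2)) •
        (y.2.1.2 + (1 - Real.exp (lam * y.2.2)) • y.1.2.1), y.1.2.2) : Pt n))
    (by fun_prop) (by fun_prop)
    (fun z => ((z.1.1, z.1.2.1, z.2.2.2), ((Real.exp (lam * z.2.2.2) • z.2.1 -
      (1 - Real.exp (lam * z.1.2.2)) • z.1.1, Real.exp (lam * z.2.2.2) • z.2.2.1 -
      (1 - Real.exp (lam * z.1.2.2)) • z.1.2.1), z.1.2.2))) (by fun_prop)
    (fun y => by simp [smul_smul, ← mul_assoc, ← Real.exp_add]) fun u₁ u₂ h₁ h₂ V hV => ?_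
  obtain ⟨S', hS'⟩ := exists_isInt_A (lam := lam) h₁.isCc
  obtain ⟨T', hT'⟩ := exists_isInt_B (lam := lam) h₂.isCc
  have hAB := (isInt_piA h₁.continuous.measurable hS').mul (hT'.opTensor_right (β := Pt n))
  have : V = piA n lam S' * piB n T' := by
    refine hV.eq_of_integral hAB fun ξ p => ?_
    rw [integral_prodPt]
    refine integral_congr_ae (ae_of_all _ fun y => ?_)
    have h3 : dilB n lam (mapP n lam p.1 p.2 (y.1, y.2.1)).1 =
        ((dilB n lam p.1).1 + (1 - Real.exp (lam * p.2.2.2)) • y.1,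
          (dilB n lam p.1).2 + (1 - Real.exp (lam * p.2.2.2)) • y.2.1) := by
      simp only [mapP, dilB, Prod.smul_mk, smul_add, Prod.mk.injEq, smul_smul, Real.exp_neg]
      constructor <;> (match_scalars <;> field_simp)
    simp only [kerB, h3, mapB]
    simp only [mapP]
    ring
  rw [this]
  exact subset_clSpan _ ⟨S', ⟨u₁, h₁, hS'⟩, T', ⟨u₂, h₂, hT'⟩, rfl⟩

theorem piB_mul_piA_mem_clSpan {a b : Op (L2 (Pt n))} (ha : a ∈ clSpan (genA n lam))
    (hb : b ∈ clSpan (genB n lam)) : piB n b * piA n lam a ∈ clSpan (genD n lam) :=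
  map_mul_map_mem (isClosed_clSpan _) (continuous_piB n) (continuous_piA n lam)
    (fun _ hT _ hS => piB_mul_piA_mem hS hT) hb ha

theorem piA_mul_mem {a : Op (L2 (Pt n))} (ha : a ∈ clSpan (genA n lam))
    {x : Op (L2 (Pt n × Pt n))} (hx : x ∈ clSpan (genD n lam)) :
    piA n lam a * x ∈ clSpan (genD n lam) := by
  refine mul_mem_of_clSpan (isClosed_clSpan _) _ ?_ hx
  rintro _ ⟨S, hS, T, hT, rfl⟩
  rw [← mul_assoc, ← piA_mul]
  exact piA_mul_piB_mem (clSpan_mul_mem (isClosed_clSpan _) ha (subset_clSpan _ hS)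
    fun x hx y hy => genA_mul_mem hx hy) (subset_clSpan _ hT)

theorem mul_piB_mem {b : Op (L2 (Pt n))} (hb : b ∈ clSpan (genB n lam))
    {x : Op (L2 (Pt n × Pt n))} (hx : x ∈ clSpan (genD n lam)) :
    x * piB n b ∈ clSpan (genD n lam) := by
  refine mul_mem_of_clSpan_right (isClosed_clSpan _) _ ?_ hx
  rintro _ ⟨S, hS, T, hT, rfl⟩
  rw [mul_assoc, ← piB_mul]
  exact piA_mul_piB_mem (subset_clSpan _ hS) (clSpan_mul_mem (isClosed_clSpan _)
    (subset_clSpan _ hT) hb fun x hx y hy => genB_mul_mem hx hy)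

theorem genD_mul_mem {x y : Op (L2 (Pt n × Pt n))} (hx : x ∈ genD n lam) (hy : y ∈ genD n lam) :
    x * y ∈ clSpan (genD n lam) := by
  obtain ⟨S, hS, T, hT, rfl⟩ := hx
  obtain ⟨S', hS', T', hT', rfl⟩ := hy
  rw [show piA n lam S * piB n T * (piA n lam S' * piB n T') =
    piA n lam S * (piB n T * piA n lam S' * piB n T') by simp only [mul_assoc]]
  exact piA_mul_mem (subset_clSpan _ hS)
    (mul_piB_mem (subset_clSpan _ hT') (piB_mul_piA_mem hS' hT))

theorem genD_star_mem {x : Op (L2 (Pt n × Pt n))} (hx : x ∈ genD n lam) :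
    star x ∈ clSpan (genD n lam) := by
  obtain ⟨S, hS, T, hT, rfl⟩ := hx
  rw [star_mul, star_piA, star_piB]
  exact piB_mul_piA_mem_clSpan (genA_star_mem hS) (genB_star_mem hT)

/-- The left factor `Z₁₂` acts on unsliced legs and comes out of the slice. The remaining product
`Y₂₄ Z₁₂* X₁₃` factors by `rslice_legs`, because `Y` and `X` use different sliced legs. -/
theorem rslice_VD (u u' v v' : L2 (Pt n)) : rslice (tmul u u') (tmul v v') (VD n lam) =
    piA n lam (rslice u' v' (Y n lam)) * piB n (rslice u v (X n lam)) := by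
  have h1 : VD n lam = opTensor (Z n lam) 1 *
      (leg24 (Y n lam) * opTensor (star (Z n lam)) 1 * leg13 (X n lam)) := by
    rw [VD, leg12, star_opTensor, star_one]
    simp only [mul_assoc]
  rw [h1, rslice_mul_left, rslice_legs, piA_apply, piB_apply]
  simp only [mul_assoc]

theorem rslice_mem_of_tmul {α β γ : Type} [MeasureSpace α] [MeasureSpace β] [MeasureSpace γ]
    [SigmaFinite (volume : Measure α)] [SigmaFinite (volume : Measure β)]
    [SigmaFinite (volume : Measure γ)] {M : Submodule ℂ (Op (L2 α))}
    (hM : IsClosed (M : Set (Op (L2 α)))) {V : Op (L2 (α × (β × γ)))}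
    (h : ∀ u u' v v', rslice (tmul u u') (tmul v v') V ∈ M) (u v) : rslice u v V ∈ M := by
  refine tensor_induction (p := fun u => rslice u v V ∈ M) (fun u u' => ?_)
    (fun z w hz hw => ?_) (hM.preimage (continuous_rslice_left _ _)) u
  · refine tensor_induction (p := fun v => rslice (tmul u u') v V ∈ M) (fun v v' => h _ _ _ _)
      (fun z w hz hw => ?_) (hM.preimage (continuous_rslice_right _ _)) v
    rw [rslice_add_right]
    exact add_mem hz hw
  · rw [rslice_add_left]
    exact add_mem hz hw

theorem mem_algA_rslice (u v : L2 (Pt n)) : rslice u v (Y n lam) ∈ clSpan (genA n lam) := by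
  have := clSpan_star_mem (isClosed_clSpan _) (rslice_star_Y_mem (lam := lam) v u)
    fun x hx => genA_star_mem hx
  rwa [star_rslice, star_star] at this

theorem algD_eq : (algD n lam : Set (Op (L2 (Pt n × Pt n)))) = clSpan (genD n lam) := by
  refine Set.Subset.antisymm (cstarGen_subset (fun a ha => ?_) (fun x hx y hy => genD_mul_mem hx hy)
    (fun x hx => genD_star_mem hx)) (clSpan_subset_cstarGen ?_)
  · refine mem_of_mem_rightSlices (isClosed_clSpan _) (fun u v => ?_) ha
    refine rslice_mem_of_tmul (isClosed_clSpan _) (fun u u' v v' => ?_) u v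
    rw [rslice_VD]
    exact piA_mul_piB_mem (mem_algA_rslice _ _) (rslice_X_mem _ _)
  · rintro _ ⟨S, hS, T, hT, rfl⟩
    -- The subspace `M` contains every `π(slice of Y) π'(slice of X)`. The two slices vary
    -- independently and span `A` and `Â^op` densely, so each factor can be replaced by an arbitrary
    -- element.
    let M := (cstarGen (rightSlices (VD n lam))).toNonUnitalSubalgebra.toSubmodule
    have hM : IsClosed (M : Set (Op (L2 (Pt n × Pt n)))) := isClosed_cstarGen _
    refine mem_mulRightComap.1 (mem_of_mem_algA (isClosed_mulRightComap hM (continuous_piA n lam)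
      (piB n T)) (fun u' v' => mem_mulRightComap.2 ?_) (mem_algA_iff.2 (subset_clSpan _ hS)))
    refine mem_mulLeftComap.1 (mem_of_mem_algB (isClosed_mulLeftComap hM (continuous_piB n) _)
      (fun u v => mem_mulLeftComap.2 ?_) (mem_algB_iff.2 (subset_clSpan _ hT)))
    have := subset_cstarGen _ (rslice_mem (tmul u u') (tmul v v') (VD n lam))
    rwa [rslice_VD] at this

theorem mem_algD_iff {a : Op (L2 (Pt n × Pt n))} :
    a ∈ algD n lam ↔ a ∈ clSpan (genD n lam) :=
  Set.ext_iff.1 algD_eq a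

end AlgD

/-! ### Generators of minimal tensor products -/

section MinTensor

variable {α β : Type} [MeasureSpace α] [MeasureSpace β]
  [SigmaFinite (volume : Measure α)] [SigmaFinite (volume : Measure β)]

/-- The elementary tensors of operators in two sets. -/
def tensorGen (s : Set (Op (L2 α))) (t : Set (Op (L2 β))) : Set (Op (L2 (α × β))) :=
  {x | ∃ S ∈ s, ∃ T ∈ t, x = opTensor S T}

theorem opTensor_eq_mul (S : Op (L2 α)) (T : Op (L2 β)) :
    opTensor S T = opTensorₗ.flip (1 : Op (L2 β)) S * opTensorₗ (1 : Op (L2 α)) T := by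
  rw [LinearMap.flip_apply, opTensorₗ_apply, opTensorₗ_apply, ← opTensor_mul, one_mul, mul_one]

theorem opTensor_mem {M : Submodule ℂ (Op (L2 (α × β)))}
    (hM : IsClosed (M : Set (Op (L2 (α × β))))) {s : Set (Op (L2 α))} {t : Set (Op (L2 β))}
    (h : ∀ S ∈ s, ∀ T ∈ t, opTensor S T ∈ M) {b : Op (L2 α)} {c : Op (L2 β)}
    (hb : b ∈ clSpan s) (hc : c ∈ clSpan t) : opTensor b c ∈ M := by
  rw [opTensor_eq_mul]
  refine map_mul_map_mem hM (f := opTensorₗ.flip (1 : Op (L2 β)))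
    (g := opTensorₗ (1 : Op (L2 α))) (continuous_opTensor_left 1)
    (continuous_opTensor_right 1) (fun S hS T hT => ?_) hb hc
  rw [← opTensor_eq_mul]
  exact h S hS T hT

theorem mem_minTensor_iff {B : NonUnitalStarSubalgebra ℂ (Op (L2 α))}
    {C : NonUnitalStarSubalgebra ℂ (Op (L2 β))} {s : Set (Op (L2 α))} {t : Set (Op (L2 β))}
    (hB : ∀ {b}, b ∈ B ↔ b ∈ clSpan s) (hC : ∀ {c}, c ∈ C ↔ c ∈ clSpan t)
    {x : Op (L2 (α × β))} : x ∈ minTensor B C ↔ x ∈ clSpan (tensorGen s t) := by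
  have h1 : ∀ {b c}, b ∈ B → c ∈ C → opTensor b c ∈ clSpan (tensorGen s t) := fun hb hc =>
    opTensor_mem (isClosed_clSpan _) (fun S hS T hT => subset_clSpan (tensorGen s t)
      ⟨S, hS, T, hT, rfl⟩) (hB.1 hb) (hC.1 hc)
  have hs : ∀ {b}, b ∈ s → b ∈ B := fun hb => hB.2 (subset_clSpan _ hb)
  have ht : ∀ {c}, c ∈ t → c ∈ C := fun hc => hC.2 (subset_clSpan _ hc)
  constructor
  · intro hx
    refine cstarGen_subset ?_ ?_ ?_ hx
    · rintro _ ⟨b, hb, c, hc, rfl⟩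
      exact h1 hb hc
    · rintro _ ⟨b, hb, c, hc, rfl⟩ _ ⟨b', hb', c', hc', rfl⟩
      rw [← opTensor_mul]
      exact h1 (mul_mem (hs hb) (hs hb')) (mul_mem (ht hc) (ht hc'))
    · rintro _ ⟨b, hb, c, hc, rfl⟩
      rw [star_opTensor]
      exact h1 (star_mem (hs hb)) (star_mem (ht hc))
  · intro hx
    refine clSpan_subset_cstarGen ?_ hx
    rintro _ ⟨b, hb, c, hc, rfl⟩
    exact subset_cstarGen _ ⟨b, hs hb, c, ht hc, rfl⟩

theorem opTensor_mem_minTensor {B : NonUnitalStarSubalgebra ℂ (Op (L2 α))}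
    {C : NonUnitalStarSubalgebra ℂ (Op (L2 β))} {b : Op (L2 α)} {c : Op (L2 β)} (hb : b ∈ B)
    (hc : c ∈ C) : opTensor b c ∈ minTensor B C :=
  subset_cstarGen _ ⟨b, hb, c, hc, rfl⟩

end MinTensor

/-! ### Multiplier criteria -/

section Multiplier

variable {H K : Type} [NormedAddCommGroup H] [InnerProductSpace ℂ H] [CompleteSpace H]
  [NormedAddCommGroup K] [InnerProductSpace ℂ K] [CompleteSpace K]

/-- Right multiplication by `m` is the adjoint of left multiplication by `m*`, and `C` is closed
under adjoints. -/
theorem mem_multiplier_of_left {C : NonUnitalStarSubalgebra ℂ (Op H)} {m : Op H}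
    (h : ∀ c ∈ C, m * c ∈ C) (h' : ∀ c ∈ C, star m * c ∈ C) : m ∈ multiplier C := fun c hc => by
  refine ⟨h c hc, ?_⟩
  have := star_mem (h' _ (star_mem hc))
  rwa [star_mul, star_star, star_star] at this

/-- A linear map with values in the multipliers on a generating set has values in the
multipliers. -/
theorem map_mem_multiplier {B : NonUnitalStarSubalgebra ℂ (Op H)}
    {C : NonUnitalStarSubalgebra ℂ (Op K)} {δ : Op H →ₗ[ℂ] Op K} (hδ : Continuous δ)
    (hstar : ∀ a, star (δ a) = δ (star a)) {s : Set (Op H)} {t : Set (Op K)}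
    (hB : ∀ {b}, b ∈ B ↔ b ∈ clSpan s) (hC : ∀ {c}, c ∈ C ↔ c ∈ clSpan t)
    (h : ∀ x ∈ s, ∀ y ∈ t, δ x * y ∈ clSpan t) {b : Op H} (hb : b ∈ B) :
    δ b ∈ multiplier C := by
  have h1 : ∀ {b}, b ∈ B → ∀ c ∈ C, δ b * c ∈ C := fun {b} hb c hc =>
    hC.2 (map_mul_map_mem (g := LinearMap.id) (isClosed_clSpan t) hδ continuous_id h (hB.1 hb)
      (hC.1 hc))
  refine mem_multiplier_of_left (h1 hb) ?_
  rw [hstar]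
  exact h1 (star_mem hb)

end Multiplier

/-! ### The comultiplications as continuous linear maps -/

section ComulLinear

variable (n : ℕ) (lam : ℝ)

/-- The comultiplication of `A` as a linear map. -/
noncomputable def comulAₗ : Op (L2 (Pt n)) →ₗ[ℂ] Op (L2 (Pt n × Pt n)) :=
  LinearMap.mulRight ℂ (star (UA n lam)) ∘ₗ LinearMap.mulLeft ℂ (UA n lam) ∘ₗ opTensorₗ.flip 1

/-- The comultiplication of `Â^op` as a linear map. -/
noncomputable def comulBₗ : Op (L2 (Pt n)) →ₗ[ℂ] Op (L2 (Pt n × Pt n)) :=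
  LinearMap.mulRight ℂ (X n lam) ∘ₗ LinearMap.mulLeft ℂ (star (X n lam)) ∘ₗ opTensorₗ 1

theorem continuous_comulAₗ : Continuous (comulAₗ n lam) :=
  (continuous_mul_const _).comp ((continuous_const_mul _).comp (continuous_opTensor_left 1))

theorem continuous_comulBₗ : Continuous (comulBₗ n lam) :=
  (continuous_mul_const _).comp ((continuous_const_mul _).comp (continuous_opTensor_right 1))

theorem star_comulA (a : Op (L2 (Pt n))) : star (comulA n lam a) = comulA n lam (star a) := by
  simp only [comulA, star_mul, star_star, star_opTensor, star_one, mul_assoc]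

theorem star_comulB (a : Op (L2 (Pt n))) : star (comulB n lam a) = comulB n lam (star a) := by
  simp only [comulB, star_mul, star_star, star_opTensor, star_one, mul_assoc]

end ComulLinear

/-- A shear by an arbitrary measurable function of the first variable. It integrates out the
parameter that `Δ(L_u)` or `Δ̂(λ_u)` adds simultaneously to both legs. -/
theorem integral_mul_shear {Y G : Type} [MeasureSpace Y] [SigmaFinite (volume : Measure Y)]
    [NormedAddCommGroup G] [MeasureSpace G] [BorelSpace G]
    [SecondCountableTopology G] [SigmaFinite (volume : Measure G)]
    [(volume : Measure G).IsAddLeftInvariant] {f : Y → G} (hf : Measurable f) (a : Y → ℂ)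
    (b : G → ℂ) : ∫ x : Y × G, a x.1 * b (f x.1 + x.2) = (∫ x, a x) * ∫ x, b x := by
  have h : MeasurePreserving (fun x : Y × G => (x.1, f x.1 + x.2)) volume volume :=
    mp_skew_right (f := fun y x => f y + x) (by unfold Function.uncurry; fun_prop)
      fun y => measurePreserving_add_left _ _
  have he : MeasurableEmbedding (fun x : Y × G => (x.1, f x.1 + x.2)) :=
    (⟨⟨fun x : Y × G => (x.1, f x.1 + x.2), fun x : Y × G => (x.1, -f x.1 + x.2),
      fun x => by simp, fun x => by simp⟩, by simp only [Equiv.coe_fn_mk]; fun_prop, by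
        simp only [Equiv.coe_fn_symm_mk]; fun_prop⟩ : Y × G ≃ᵐ Y × G).measurableEmbedding
  have := h.integral_comp he (fun x => a x.1 * b x.2)
  rw [this, Measure.volume_eq_prod, integral_prod_mul]

/-! ### The comultiplication of `A` -/

section ComulA

variable {n : ℕ} {lam : ℝ}

/-- A single parameter `g` translates both legs, dilated by `e^{λr'}` on the first, and `u` is
evaluated at `r + r'`. The formula is verified as `U_A (L_u ⊗ 1) = T U_A`. -/
theorem isInt_comulA {u : Pt n → ℂ} (hu : Measurable u) {S : Op (L2 (Pt n))}
    (hS : IsInt S (mapA n) (fun p g => u (g.1, g.2, p.2.2) * phA n lam p g)) :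
    IsInt (comulA n lam S)
      (fun p g => (mapA n p.1 (Real.exp (lam * p.2.2.2) • g), mapA n p.2 g))
      (fun p g => u (g.1, g.2, p.1.2.2 + p.2.2.2) *
        (phA n lam p.1 (Real.exp (lam * p.2.2.2) • g) * phA n lam p.2 g)) := by
  obtain ⟨h, hh, hb⟩ := hS.dom
  have he := measurable_e
  have ht := measurable_eta lam
  obtain ⟨T, hT⟩ := exists_isInt
    (φ := fun (p : Pt n × Pt n) (g : Pl n) =>
      (mapA n p.1 (Real.exp (lam * p.2.2.2) • g), mapA n p.2 g))
    (k := fun (p : Pt n × Pt n) (g : Pl n) => u (g.1, g.2, p.1.2.2 + p.2.2.2) *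
        (phA n lam p.1 (Real.exp (lam * p.2.2.2) • g) * phA n lam p.2 g))
    (by unfold Function.uncurry mapA; fun_prop)
    (fun g => by
      have h1 : MeasurePreserving (fun p : Pt n × Pt n =>
          (mapA n p.1 (Real.exp (lam * p.2.2.2) • g), p.2)) volume volume :=
        mp_skew_left (f := fun b a : Pt n => mapA n a (Real.exp (lam * b.2.2) • g))
          (by unfold Function.uncurry mapA; fun_prop) fun b => mp_mapA n _
      exact h1.comp ((MeasurePreserving.id volume).prod (mp_mapA n g)))
    (by unfold Function.uncurry phA; fun_prop) ⟨h, hh, fun p g => by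
      have := hb (0, 0, p.1.2.2 + p.2.2.2) g
      rw [norm_mul, phA, norm_e, mul_one] at this
      rw [norm_mul, norm_mul, phA, phA, norm_e, norm_e, mul_one, mul_one]
      exact this⟩
  have key : UA n lam * opTensor S 1 = T * UA n lam := by
    refine mul_eq_mul_of_kernel (isWC_UA n lam) hS.opTensor_right hT (isWC_UA n lam)
      (fun p g => ?_) (fun p g => ?_)
    · simp only [mapA, Prod.smul_fst, Prod.smul_snd, Prod.mk.injEq, smul_add, smul_sub, smul_neg,
        smul_smul, mul_add, mul_sub, mul_neg, Real.exp_add, Real.exp_sub, Real.exp_neg]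
      refine ⟨⟨?_, ?_, ?_⟩, ?_, ?_, ?_⟩ <;>
        first | trivial | ring1 | (match_scalars <;> field_simp <;> ring1)
    · simp only [phA, mapA, Prod.smul_fst, Prod.smul_snd]
      rw [show ∀ a b c d : ℂ, a * b * (c * d) = c * (a * (b * d)) by intros; ring, ← e_add,
        show ∀ a b c d f : ℂ, a * (b * c) * (d * f) = a * (d * (b * (c * f))) by intros; ring,
        ← e_add, ← e_add]
      congr 3
      simp only [inner_add_left, inner_add_right, inner_sub_left, inner_sub_right, inner_neg_left,
        inner_neg_right, real_inner_smul_left, real_inner_smul_right, eta_add, eta_sub, eta_neg,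
        mul_add, mul_sub, mul_neg, Real.exp_add, Real.exp_sub, Real.exp_neg]
      field_simp
      linear_combination (Real.exp (lam * p.2.2.2) ^ 2 * ⟪g.1, g.2⟫_ℝ -
        Real.exp (lam * p.2.2.2) * ⟪g.1, p.1.2.1⟫_ℝ) * eta_comm lam p.2.2.2 p.1.2.2
  have : comulA n lam S = T := by
    rw [comulA, key, mul_assoc, Unitary.mul_star_self_of_mem (UA_mem_unitary n lam), mul_one]
  rwa [this]

theorem phA_mul_phA (p : Pt n) (g h : Pl n) : phA n lam p g * phA n lam (mapA n p g) h =
    e (-(eta lam p.2.2 * ⟪g.1, h.2⟫_ℝ)) * phA n lam p (g + h) := by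
  simp only [phA, mapA, Prod.fst_add, Prod.snd_add]
  rw [← e_add, ← e_add]
  congr 1
  simp only [inner_add_left, inner_add_right, inner_sub_left, inner_sub_right]
  ring

theorem mapA_mapA (p : Pt n) (g h : Pl n) : mapA n (mapA n p g) h = mapA n p (g + h) := by
  simp only [mapA, Prod.fst_add, Prod.snd_add, sub_sub]

/-- Each leg composes its translations as in `genA_mul_mem`. In the coordinates `g`, `(e^{λr'}g + h,
r)` and `(g + k, r')` a product kernel is sheared to a scalar multiple of `L_{v₁} ⊗ L_{v₂}`. The
factor `x` supplies the compactness that `Δ(L_u)` lacks. -/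
theorem comulA_mul_mem {S : Op (L2 (Pt n))} (hS : S ∈ genA n lam) {x : Op (L2 (Pt n × Pt n))}
    (hx : x ∈ tensorGen (genA n lam) (genA n lam)) :
    comulA n lam S * x ∈ clSpan (tensorGen (genA n lam) (genA n lam)) := by
  obtain ⟨u, hu, hS⟩ := hS
  obtain ⟨S₁, ⟨u₁, hu₁, hS₁⟩, S₂, ⟨u₂, hu₂, hS₂⟩, rfl⟩ := hx
  have he := continuous_e
  have ht := continuous_eta lam
  have hF : IsCc fun y : (Pl n × (Pl n × Pl n)) × (ℝ × ℝ) =>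
      u (y.1.1.1, y.1.1.2, y.2.1 + y.2.2) * (u₁ (y.1.2.1.1, y.1.2.1.2, y.2.1) *
        u₂ (y.1.2.2.1, y.1.2.2.2, y.2.2)) *
        (e (-(eta lam y.2.1 * ⟪(Real.exp (lam * y.2.2) • y.1.1).1, y.1.2.1.2⟫_ℝ)) *
          e (-(eta lam y.2.2 * ⟪y.1.1.1, y.1.2.2.2⟫_ℝ))) :=
    (hu.isCc.prod (hu₁.isCc.prod hu₂.isCc)).comp_mul
      (j := fun y : (Pl n × (Pl n × Pl n)) × (ℝ × ℝ) =>
        (((y.1.1.1, y.1.1.2, y.2.1 + y.2.2) : Pt n), (((y.1.2.1.1, y.1.2.1.2, y.2.1) : Pt n),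
          ((y.1.2.2.1, y.1.2.2.2, y.2.2) : Pt n)))) (by fun_prop)
      (i := fun z => (((z.1.1, z.1.2.1), ((z.2.1.1, z.2.1.2.1), (z.2.2.1, z.2.2.2.1))),
        (z.2.1.2.2, z.2.2.2.2))) (by fun_prop) (fun _ => rfl) (by fun_prop)
  refine mem_of_kernel₃ (isClosed_clSpan _) (κ := fun p : Pt n × Pt n => (p.1.2.2, p.2.2.2))
    (φ := fun p (θ : Pl n × (Pl n × Pl n)) =>
      (mapA n p.1 (Real.exp (lam * p.2.2.2) • θ.1 + θ.2.1), mapA n p.2 (θ.1 + θ.2.2)))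
    (c := fun p (θ : Pl n × (Pl n × Pl n)) =>
      phA n lam p.1 (Real.exp (lam * p.2.2.2) • θ.1 + θ.2.1) * phA n lam p.2 (θ.1 + θ.2.2))
    (((isInt_comulA hu.continuous.measurable hS).mul (hS₁.opTensor hS₂)).congr
      (fun p θ => ?_) (fun p θ => ?_)) (by fun_prop) ?_
    (fun _ _ => ?_) hF.1 hF.2 (fun y => y.1.1)
    (fun y => (((Real.exp (lam * y.2.2) • y.1.1 + y.1.2.1).1,
      (Real.exp (lam * y.2.2) • y.1.1 + y.1.2.1).2, y.2.1) : Pt n))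
    (fun y => (((y.1.1 + y.1.2.2).1, (y.1.1 + y.1.2.2).2, y.2.2) : Pt n))
    (by fun_prop) (by fun_prop) (by fun_prop)
    (fun z => ((z.1, ((z.2.1.1, z.2.1.2.1) - Real.exp (lam * z.2.2.2.2) • z.1,
      (z.2.2.1, z.2.2.2.1) - z.1)), (z.2.1.2.2, z.2.2.2.2)))
    (by fun_prop) (fun y => by simp [Prod.ext_iff]) ?_
  · simp only [mapA_mapA]
  · dsimp only
    rw [show ∀ a b c d f g h : ℂ, a * (b * c) * (d * f * (g * h)) =
      a * (d * g) * ((b * f) * (c * h)) by intros; ring, phA_mul_phA, phA_mul_phA]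
    simp only [mapA]
    ring
  · have he := measurable_e
    have ht := measurable_eta lam
    unfold Function.uncurry phA
    fun_prop
  · rw [norm_mul]
    exact mul_le_one₀ (norm_phA n lam _ _) (norm_nonneg _) (norm_phA n lam _ _)
  · intro v v₁ v₂ hv hv₁ hv₂ R hR
    obtain ⟨R₁, hR₁⟩ := exists_isInt_A (lam := lam) hv₁.isCc
    obtain ⟨R₂, hR₂⟩ := exists_isInt_A (lam := lam) hv₂.isCc
    have h1 : (volume : Measure (Pl n)).IsAddLeftInvariant := inferInstance
    have h2 : (volume : Measure (Pl n × Pl n)).IsAddLeftInvariant :=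
      Measure.prod.instIsAddLeftInvariant
    have : R = (∫ g, v g) • opTensor R₁ R₂ := by
      refine hR.eq_of_integral ((hR₁.opTensor hR₂).smul _) fun ξ p => ?_
      have := integral_mul_shear (f := fun g : Pl n => (Real.exp (lam * p.2.2.2) • g, g))
        (by fun_prop) v (fun θ : Pl n × Pl n => v₁ (θ.1.1, θ.1.2, p.1.2.2) * phA n lam p.1 θ.1 *
        (v₂ (θ.2.1, θ.2.2, p.2.2.2) * phA n lam p.2 θ.2) * ξ (mapA n p.1 θ.1, mapA n p.2 θ.2))
      simp only [mul_assoc (∫ _, _)]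
      rw [integral_const_mul, ← this]
      refine integral_congr_ae (ae_of_all _ fun θ => ?_)
      simp only [Prod.fst_add, Prod.snd_add]
      ring
    rw [this]
    exact Submodule.smul_mem _ _ (subset_clSpan _ ⟨R₁, ⟨v₁, hv₁, hR₁⟩, R₂, ⟨v₂, hv₂, hR₂⟩, rfl⟩)

theorem comulA_mem {a : Op (L2 (Pt n))} (ha : a ∈ algA n lam) :
    comulA n lam a ∈ multiplier (minTensor (algA n lam) (algA n lam)) :=
  map_mem_multiplier (B := algA n lam) (δ := comulAₗ n lam) (continuous_comulAₗ n lam)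
    (star_comulA n lam)
    mem_algA_iff (mem_minTensor_iff mem_algA_iff mem_algA_iff)
    (fun _ hx _ hy => comulA_mul_mem hx hy) ha

end ComulA

/-! ### The comultiplication of `Â^op` -/

section ComulB

variable {n : ℕ} {lam : ℝ}

/-- Through `X*` the parameter `w` of `λ_u` becomes the sum of the parameters of the two legs, and
both legs are shifted by the same `s`. What remains of the phases is a cocycle in the two
parameters. -/
theorem isInt_comulB {u : Pt n → ℂ} (hu : Measurable u) {S : Op (L2 (Pt n))}
    (hS : IsInt S (mapB n) (fun p s => kerB n lam u (dilB n lam p) s)) :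
    IsInt (comulB n lam S) (fun p s => (mapB n p.1 s, mapB n p.2 s))
      (fun p s => kerB n lam u (dilB n lam p.1 + dilB n lam p.2) s *
        e (-(eta lam (-s) * ⟪(dilB n lam p.1).1, (dilB n lam p.2).2⟫_ℝ))) := by
  obtain ⟨h, hh, hb⟩ := hS.dom
  have he := measurable_e
  have ht := measurable_eta lam
  obtain ⟨T, hT⟩ := exists_isInt
    (φ := fun (p : Pt n × Pt n) s => (mapB n p.1 s, mapB n p.2 s))
    (k := fun (p : Pt n × Pt n) s => kerB n lam u (dilB n lam p.1 + dilB n lam p.2) s *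
        e (-(eta lam (-s) * ⟪(dilB n lam p.1).1, (dilB n lam p.2).2⟫_ℝ)))
    (by unfold Function.uncurry mapB; fun_prop)
    (fun s => (mp_mapB n s).prod (mp_mapB n s))
    (by unfold Function.uncurry kerB dilB; fun_prop) ⟨h, hh, fun p s => by
      have := hb ((dilB n lam p.1 + dilB n lam p.2).1, (dilB n lam p.1 + dilB n lam p.2).2, 0) s
      rw [norm_mul, norm_e, mul_one]
      simpa [dilB] using this⟩
  have key : star (X n lam) * opTensor 1 S = T * star (X n lam) := by
    refine mul_eq_mul_of_kernel (isWC_star_X n lam) hS.opTensor_left hT (isWC_star_X n lam)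
      (fun p s => ?_) (fun p s => ?_)
    · simp only [mapB, Prod.mk.injEq, smul_add, smul_sub, smul_neg,
        smul_smul, mul_add, mul_sub, mul_neg, Real.exp_add, Real.exp_sub, Real.exp_neg]
      refine ⟨⟨?_, ?_, ?_⟩, ?_, ?_, ?_⟩ <;>
        first | trivial | ring1 | (match_scalars <;> field_simp <;> ring1)
    · have h1 : dilB n lam (p.2.1 + Real.exp (lam * (p.1.2.2 - p.2.2.2)) • p.1.1,
          p.2.2.1 + Real.exp (lam * (p.1.2.2 - p.2.2.2)) • p.1.2.1, p.2.2.2) =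
          dilB n lam p.1 + dilB n lam p.2 := by
        simp only [dilB, Prod.smul_mk, Prod.mk_add_mk, smul_add, smul_smul, ← Real.exp_add]
        rw [show lam * p.2.2.2 + lam * (p.1.2.2 - p.2.2.2) = lam * p.1.2.2 by ring, add_comm,
          add_comm (_ • p.2.2.1)]
      simp only [h1]
      rw [mul_comm, mul_assoc, ← e_add]
      congr 2
      simp only [mapB, dilB, Prod.smul_mk, inner_add_left, inner_add_right, inner_sub_left,
        inner_sub_right, inner_neg_left, inner_neg_right, real_inner_smul_left,
        real_inner_smul_right, eta_add, eta_sub, eta_neg,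
        mul_add, mul_sub, mul_neg, Real.exp_add, Real.exp_sub, Real.exp_neg]
      field_simp
      ring
  have : comulB n lam S = T := by
    rw [comulB, key, mul_assoc, Unitary.star_mul_self_of_mem (X_mem_unitary n lam), mul_one]
  rwa [this]

theorem kerB_smul (u : Pt n → ℂ) (w : Pl n) (s t : ℝ) :
    kerB n lam u (Real.exp (-(lam * s)) • w) t = u (Real.exp (-(lam * (s + t))) • w.1,
      Real.exp (-(lam * (s + t))) • w.2, t) := by
  simp only [kerB, Prod.smul_fst, Prod.smul_snd, smul_smul, ← Real.exp_add]
  rw [show -(lam * t) + -(lam * s) = -(lam * (s + t)) by ring]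

/-- As for `A`, now with shifts `s + t₁` and `s + t₂` on the two legs. The coordinates are `s` and,
for each leg, `(e^{-λ(s+tᵢ)}wᵢ, s + tᵢ)`; a shear then integrates out `s`. -/
theorem comulB_mul_mem {S : Op (L2 (Pt n))} (hS : S ∈ genB n lam) {x : Op (L2 (Pt n × Pt n))}
    (hx : x ∈ tensorGen (genB n lam) (genB n lam)) :
    comulB n lam S * x ∈ clSpan (tensorGen (genB n lam) (genB n lam)) := by
  obtain ⟨u, hu, hS⟩ := hS
  obtain ⟨S₁, ⟨u₁, hu₁, hS₁⟩, S₂, ⟨u₂, hu₂, hS₂⟩, rfl⟩ := hx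
  have he := continuous_e
  have ht := continuous_eta lam
  have hF : IsCc fun y : (ℝ × (ℝ × ℝ)) × (Pl n × Pl n) =>
      kerB n lam u (y.2.1 + y.2.2) y.1.1 *
        (u₁ (Real.exp (-(lam * (y.1.1 + y.1.2.1))) • y.2.1.1,
          Real.exp (-(lam * (y.1.1 + y.1.2.1))) • y.2.1.2, y.1.2.1) *
        u₂ (Real.exp (-(lam * (y.1.1 + y.1.2.2))) • y.2.2.1,
          Real.exp (-(lam * (y.1.1 + y.1.2.2))) • y.2.2.2, y.1.2.2)) *
        e (-(eta lam (-y.1.1) * ⟪y.2.1.1, y.2.2.2⟫_ℝ)) :=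
    (hu.isCc.prod (hu₁.isCc.prod hu₂.isCc)).comp_mul
      (j := fun y : (ℝ × (ℝ × ℝ)) × (Pl n × Pl n) =>
        (((Real.exp (-(lam * y.1.1)) • (y.2.1 + y.2.2).1,
          Real.exp (-(lam * y.1.1)) • (y.2.1 + y.2.2).2, y.1.1) : Pt n),
        (((Real.exp (-(lam * (y.1.1 + y.1.2.1))) • y.2.1.1,
          Real.exp (-(lam * (y.1.1 + y.1.2.1))) • y.2.1.2, y.1.2.1) : Pt n),
        ((Real.exp (-(lam * (y.1.1 + y.1.2.2))) • y.2.2.1,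
          Real.exp (-(lam * (y.1.1 + y.1.2.2))) • y.2.2.2, y.1.2.2) : Pt n)))) (by fun_prop)
      (i := fun z => ((z.1.2.2, (z.2.1.2.2, z.2.2.2.2)),
        ((Real.exp (lam * (z.1.2.2 + z.2.1.2.2)) • z.2.1.1,
          Real.exp (lam * (z.1.2.2 + z.2.1.2.2)) • z.2.1.2.1),
         (Real.exp (lam * (z.1.2.2 + z.2.2.2.2)) • z.2.2.1,
          Real.exp (lam * (z.1.2.2 + z.2.2.2.2)) • z.2.2.2.1)))) (by fun_prop)
      (fun y => by simp [smul_smul, ← Real.exp_add]) (by fun_prop)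
  have hκ : Measurable fun p : Pt n × Pt n => (dilB n lam p.1, dilB n lam p.2) := by
    have := measurable_dilB n lam
    fun_prop
  refine mem_of_kernel₃ (isClosed_clSpan _)
    (κ := fun p : Pt n × Pt n => (dilB n lam p.1, dilB n lam p.2))
    (φ := fun p (θ : ℝ × (ℝ × ℝ)) => (mapB n p.1 (θ.1 + θ.2.1), mapB n p.2 (θ.1 + θ.2.2)))
    (c := fun p (θ : ℝ × (ℝ × ℝ)) => 1)
    (((isInt_comulB hu.continuous.measurable hS).mul (hS₁.opTensor hS₂)).congr
      (fun p θ => ?_) (fun p θ => ?_)) hκ measurable_const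
    (fun _ _ => norm_one.le) hF.1 hF.2 (fun y => y.1.1)
    (fun y => ((Real.exp (-(lam * (y.1.1 + y.1.2.1))) • y.2.1.1,
          Real.exp (-(lam * (y.1.1 + y.1.2.1))) • y.2.1.2, y.1.1 + y.1.2.1) : Pt n))
    (fun y => ((Real.exp (-(lam * (y.1.1 + y.1.2.2))) • y.2.2.1,
          Real.exp (-(lam * (y.1.1 + y.1.2.2))) • y.2.2.2, y.1.1 + y.1.2.2) : Pt n))
    (by fun_prop) (by fun_prop) (by fun_prop)
    (fun z => ((z.1, (z.2.1.2.2 - z.1, z.2.2.2.2 - z.1)),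
        ((Real.exp (lam * z.2.1.2.2) • z.2.1.1, Real.exp (lam * z.2.1.2.2) • z.2.1.2.1),
         (Real.exp (lam * z.2.2.2.2) • z.2.2.1, Real.exp (lam * z.2.2.2.2) • z.2.2.2.1))))
    (by fun_prop) (fun y => by simp [smul_smul, ← Real.exp_add]) ?_
  · simp only [mapB, sub_sub]
  · dsimp only
    rw [dilB_mapB, dilB_mapB, kerB_smul, kerB_smul]
    ring
  · intro v v₁ v₂ hv hv₁ hv₂ R hR
    obtain ⟨R₁, hR₁⟩ := exists_isInt_B (lam := lam) hv₁.isCc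
    obtain ⟨R₂, hR₂⟩ := exists_isInt_B (lam := lam) hv₂.isCc
    have : R = (∫ g, v g) • opTensor R₁ R₂ := by
      refine hR.eq_of_integral ((hR₁.opTensor hR₂).smul _) fun ξ p => ?_
      have := integral_mul_shear (f := fun g : ℝ => (g, g))
        (by fun_prop) v (fun θ : ℝ × ℝ => kerB n lam v₁ (dilB n lam p.1) θ.1 *
        kerB n lam v₂ (dilB n lam p.2) θ.2 * ξ (mapB n p.1 θ.1, mapB n p.2 θ.2))
      simp only [mul_assoc (∫ _, _)]
      rw [integral_const_mul, ← this]
      refine integral_congr_ae (ae_of_all _ fun θ => ?_)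
      simp only [Prod.fst_add, Prod.snd_add, kerB]
      ring
    rw [this]
    exact Submodule.smul_mem _ _ (subset_clSpan _ ⟨R₁, ⟨v₁, hv₁, hR₁⟩, R₂, ⟨v₂, hv₂, hR₂⟩, rfl⟩)

theorem comulB_mem {a : Op (L2 (Pt n))} (ha : a ∈ algB n lam) :
    comulB n lam a ∈ multiplier (minTensor (algB n lam) (algB n lam)) :=
  map_mem_multiplier (B := algB n lam) (δ := comulBₗ n lam) (continuous_comulBₗ n lam)
    (star_comulB n lam)
    mem_algB_iff (mem_minTensor_iff mem_algB_iff mem_algB_iff)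
    (fun _ hx _ hy => comulB_mul_mem hx hy) ha

end ComulB

/-! ### Algebra of leg numbering -/

section LegAlgebra

variable {α : Type} [MeasureSpace α] [SigmaFinite (volume : Measure α)]

theorem op4_ext {S T : Op (L2 ((α × α) × (α × α)))}
    (h : ∀ a b c d, S (tmul (tmul a b) (tmul c d)) = T (tmul (tmul a b) (tmul c d))) : S = T :=
  ContinuousLinearMap.ext fun z => tensor4_induction (p := fun z => S z = T z) h
    (fun z w hz hw => by rw [map_add, map_add, hz, hw])
    (isClosed_eq S.continuous T.continuous) z

theorem flip23_mul_opTensor (A B C D : Op (L2 α)) :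
    flip23 * opTensor (opTensor A B) (opTensor C D) =
      opTensor (opTensor A C) (opTensor B D) * flip23 :=
  op4_ext fun a b c d => by
    simp only [mul_apply_eq_comp, opTensor_tmul, flip23_tmul]

theorem flip23_conj_opTensor (A B C D : Op (L2 α)) :
    flip23 * opTensor (opTensor A B) (opTensor C D) * flip23 =
      opTensor (opTensor A C) (opTensor B D) := by
  rw [flip23_mul_opTensor, mul_assoc, flip23_mul_flip23, mul_one]

theorem flip23_cancel (S : Op (L2 ((α × α) × (α × α)))) : flip23 * (flip23 * S) = S := by
  rw [← mul_assoc, flip23_mul_flip23, one_mul]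

theorem leg13_mul (S T : Op (L2 (α × α))) : leg13 (S * T) = leg13 S * leg13 T := by
  simp only [leg13, mul_assoc, flip23_cancel]
  rw [← mul_assoc (opTensor S 1), ← opTensor_mul, one_mul]

theorem leg24_mul (S T : Op (L2 (α × α))) : leg24 (S * T) = leg24 S * leg24 T := by
  simp only [leg24, mul_assoc, flip23_cancel]
  rw [← mul_assoc (opTensor 1 S), ← opTensor_mul, one_mul]

theorem star_leg13 (V : Op (L2 (α × α))) : star (leg13 V) = leg13 (star V) := by
  simp only [leg13, star_mul, star_flip23, star_opTensor, star_one, mul_assoc]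

theorem leg13_opTensor (S T : Op (L2 α)) :
    leg13 (opTensor S T) = opTensor (opTensor S 1) (opTensor T 1) := by
  rw [leg13, ← opTensor_one, flip23_conj_opTensor]

theorem leg24_opTensor (S T : Op (L2 α)) :
    leg24 (opTensor S T) = opTensor (opTensor 1 S) (opTensor 1 T) := by
  rw [leg24, ← opTensor_one, flip23_conj_opTensor]

theorem leg13_mul_leg24 (S T : Op (L2 (α × α))) : leg13 S * leg24 T = leg24 T * leg13 S := by
  simp only [leg13, leg24, mul_assoc, flip23_cancel]
  rw [← mul_assoc (opTensor S 1), ← mul_assoc (opTensor 1 T), ← opTensor_mul, ← opTensor_mul]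
  simp only [one_mul, mul_one]

theorem IsInt.leg24 {Θ : Type} [MeasureSpace Θ] [SigmaFinite (volume : Measure Θ)]
    {T : Op (L2 (α × α))} {φ : α × α → Θ → α × α} {k : α × α → Θ → ℂ} (h : IsInt T φ k) :
    IsInt (leg24 T)
      (fun p θ => ((p.1.1, (φ (p.1.2, p.2.2) θ).1), (p.2.1, (φ (p.1.2, p.2.2) θ).2)))
      (fun p θ => k (p.1.2, p.2.2) θ) := by
  have m1 := h.meas_map
  have m3 := h.meas
  obtain ⟨g, hg, hk⟩ := h.dom
  have e : Measurable fun q : ((α × α) × (α × α)) × Θ => ((q.1.1.2, q.1.2.2), q.2) := by fun_prop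
  have m2 := m1.comp e
  have hm : MeasurePreserving (fun p : (α × α) × (α × α) => ((p.1.1, p.2.1), (p.1.2, p.2.2)))
    volume volume := measurePreserving_middle
  obtain ⟨V, hV⟩ := exists_isInt (α := (α × α) × (α × α))
    (φ := fun p θ => ((p.1.1, (φ (p.1.2, p.2.2) θ).1), (p.2.1, (φ (p.1.2, p.2.2) θ).2)))
    (k := fun p θ => k (p.1.2, p.2.2) θ)
    ((by fun_prop : Measurable fun q : ((α × α) × (α × α)) × Θ => q.1.1.1).prodMk
      (measurable_fst.comp m2) |>.prodMk
      ((by fun_prop : Measurable fun q : ((α × α) × (α × α)) × Θ => q.1.2.1).prodMk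
      (measurable_snd.comp m2)))
    (fun θ => (hm.comp ((MeasurePreserving.id _).prod (h.mp θ))).comp hm)
    (m3.comp e) ⟨g, hg, fun p θ => hk _ _⟩
  have key : flip23 * QDouble.opTensor 1 T = V * flip23 :=
    mul_eq_mul_of_kernel isWC_flip23 h.opTensor_left hV isWC_flip23 (fun p θ => rfl)
      (fun p θ => by rw [one_mul, mul_one])
  have : QDouble.leg24 T = V := by
    rw [QDouble.leg24, key, mul_assoc, flip23_mul_flip23, mul_one]
  rwa [this]

end LegAlgebra

/-! ### Compatibility of `π` and `π'` with `Δ_D` -/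

section ComulD

variable {n : ℕ} {lam : ℝ}

theorem eta_eq_div (h : lam ≠ 0) (r : ℝ) :
    eta lam r = (Real.exp (lam * r) ^ 2 - 1) / (2 * lam) := by
  rw [eta, if_neg h, ← Real.exp_nat_mul]
  congr 3
  push_cast
  ring

/-- The map in the formula for `Δ_D(π(L_f))`. -/
noncomputable def mapR (n : ℕ) (lam : ℝ) (p : (Pt n × Pt n) × (Pt n × Pt n)) (g : Pl n) :
    (Pt n × Pt n) × (Pt n × Pt n) :=
  (mapP n lam p.1.1 p.1.2 (Real.exp (lam * p.2.2.2.2) • g), mapP n lam p.2.1 p.2.2 g)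

/-- The phase in the formula for `Δ_D(π(L_f))`. -/
noncomputable def phR (n : ℕ) (lam : ℝ) (p : (Pt n × Pt n) × (Pt n × Pt n)) (g : Pl n) : ℂ :=
  phP n lam p.1.1 p.1.2 (Real.exp (lam * p.2.2.2.2) • g) * phP n lam p.2.1 p.2.2 g

theorem exists_isInt_R {u : Pt n → ℂ} (hu : Measurable u) {S : Op (L2 (Pt n))}
    (hS : IsInt S (mapA n) (fun p g => u (g.1, g.2, p.2.2) * phA n lam p g)) :
    ∃ R : Op (L2 ((Pt n × Pt n) × (Pt n × Pt n))), IsInt R (mapR n lam)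
      (fun p g => u (g.1, g.2, p.1.2.2.2 + p.2.2.2.2) * phR n lam p g) := by
  obtain ⟨h, hh, hb⟩ := hS.dom
  have he := measurable_e
  have ht := measurable_eta lam
  refine exists_isInt (by unfold Function.uncurry mapR mapP; fun_prop) (fun g => ?_)
    (by unfold Function.uncurry phR phP; fun_prop) ⟨h, hh, fun p g => ?_⟩
  · have h1 : MeasurePreserving (fun p : (Pt n × Pt n) × (Pt n × Pt n) =>
        (mapP n lam p.1.1 p.1.2 (Real.exp (lam * p.2.2.2.2) • g), p.2)) volume volume :=
      mp_skew_left (f := fun b a : Pt n × Pt n =>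
        mapP n lam a.1 a.2 (Real.exp (lam * b.2.2.2) • g))
        (by unfold Function.uncurry mapP; fun_prop) fun b => mp_mapP _
    exact h1.comp ((MeasurePreserving.id volume).prod (mp_mapP g))
  · have := hb (0, 0, p.1.2.2.2 + p.2.2.2.2) g
    rw [norm_mul, phA, norm_e, mul_one] at this
    rw [norm_mul, phR, norm_mul, phP, phP, norm_e, norm_e, mul_one, mul_one]
    exact this

/-- The relations for `Z` are applied to legs 1, 2 and to legs 3, 4 separately. The dilation factor
linking the two pairs involves only the `r`-coordinate of leg 4, which `Z` does not change. -/
theorem ZZ_mul_leg24 {u : Pt n → ℂ} (hu : Measurable u) {S : Op (L2 (Pt n))}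
    {R : Op (L2 ((Pt n × Pt n) × (Pt n × Pt n)))}
    (hS : IsInt S (mapA n) (fun p g => u (g.1, g.2, p.2.2) * phA n lam p g))
    (hR : IsInt R (mapR n lam)
      (fun p g => u (g.1, g.2, p.1.2.2.2 + p.2.2.2.2) * phR n lam p g)) :
    opTensor (Z n lam) (Z n lam) * leg24 (comulA n lam S) =
      R * opTensor (Z n lam) (Z n lam) := by
  have hZ := (isWC_Z' (n := n) (lam := lam)).opTensor (isWC_Z' (n := n) (lam := lam))
  refine mul_eq_mul_of_kernel hZ (isInt_comulA hu hS).leg24 hR hZ (fun p g => ?_) (fun p g => ?_)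
  · simp only [mapR, mapZ_mapP]
    rfl
  · dsimp only
    rw [show ∀ a b c d f : ℂ, a * b * (c * (d * f)) = c * ((a * d) * (b * f)) by intros; ring]
    rw [wtZ_mul_phA]
    have := wtZ_mul_phA (n := n) (lam := lam) p.2 g
    simp only [mapZ] at this ⊢
    rw [this]
    simp only [phR, mapR]
    ring

/-- The map in the formula for `V_D*`. -/
noncomputable def mapV (n : ℕ) (lam : ℝ) (p : (Pt n × Pt n) × (Pt n × Pt n)) :
    (Pt n × Pt n) × (Pt n × Pt n) :=
  (mapP n lam (p.1.1.1, p.1.1.2.1, p.1.1.2.2 - p.2.1.2.2) p.1.2 (dilB n lam p.2.2),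
    ((p.2.1.1 + Real.exp (lam * (p.1.1.2.2 - p.2.1.2.2)) • p.1.1.1,
        p.2.1.2.1 + Real.exp (lam * (p.1.1.2.2 - p.2.1.2.2)) • p.1.1.2.1, p.2.1.2.2),
      (p.2.2.1, p.2.2.2.1, p.2.2.2.2 + p.1.2.2.2)))

/-- The weight in the formula for `V_D*`. -/
noncomputable def wtV (n : ℕ) (lam : ℝ) (p : (Pt n × Pt n) × (Pt n × Pt n)) : ℂ :=
  e (eta lam p.2.1.2.2 * ⟪Real.exp (lam * (p.1.1.2.2 - p.2.1.2.2)) • p.1.1.1, p.2.1.2.1⟫_ℝ) *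
    phP n lam (p.1.1.1, p.1.1.2.1, p.1.1.2.2 - p.2.1.2.2) p.1.2 (dilB n lam p.2.2)

/-- On leg 2, `Y*` acts as the translation `mapA` with the phase `phA`, for the parameter `dilB` of
leg 4. Conjugation by `Z₁₂` therefore replaces them by `mapP` and `phP`, by the relations already
used for `π(L_f)`. -/
theorem isWC_conj_leg24 : IsWC (leg12 (Z n lam) * leg24 (star (Y n lam)) * star (leg12 (Z n lam)))
    (fun p => phP n lam p.1.1 p.1.2 (dilB n lam p.2.2))
    (fun p => (mapP n lam p.1.1 p.1.2 (dilB n lam p.2.2),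
      (p.2.1, (p.2.2.1, p.2.2.2.1, p.2.2.2.2 + p.1.2.2.2)))) := by
  have he := measurable_e
  have ht := measurable_eta lam
  have h1 : MeasurePreserving (fun p : (Pt n × Pt n) × (Pt n × Pt n) =>
      (mapP n lam p.1.1 p.1.2 (dilB n lam p.2.2), p.2)) volume volume :=
    mp_skew_left (f := fun b a : Pt n × Pt n => mapP n lam a.1 a.2 (dilB n lam b.2))
      (by unfold Function.uncurry mapP dilB; fun_prop) fun b => mp_mapP _
  have h2 : MeasurePreserving (fun p : (Pt n × Pt n) × (Pt n × Pt n) =>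
      (p.1, (p.2.1, ((p.2.2.1, p.2.2.2.1, p.2.2.2.2 + p.1.2.2.2) : Pt n)))) volume volume :=
    mp_skew_right (f := fun a b : Pt n × Pt n =>
      (b.1, ((b.2.1, b.2.2.1, b.2.2.2 + a.2.2.2) : Pt n)))
      (by unfold Function.uncurry; fun_prop) fun a => (MeasurePreserving.id volume).prod
        (by simpa using mp_translate (0 : EuclideanSpace ℝ (Fin n)) 0 a.2.2.2)
  obtain ⟨Q, hQ⟩ := exists_isWC_of_mp (w := fun p : (Pt n × Pt n) × (Pt n × Pt n) =>
    phP n lam p.1.1 p.1.2 (dilB n lam p.2.2)) (by unfold phP dilB; fun_prop) (fun _ => norm_e _)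
    (h2.comp h1)
  have hZ : IsWC (leg12 (Z n lam)) _ _ := (isWC_Z' (n := n) (lam := lam)).opTensor_right
  have key : leg12 (Z n lam) * leg24 (star (Y n lam)) = Q * leg12 (Z n lam) := by
    refine (((hZ.mul (isWC_star_Y n lam).leg24).congr (fun p => ?_) fun p => ?_)).unique
      (hQ.mul hZ)
    · have := wtZ_mul_phA (lam := lam) p.1 (dilB n lam p.2.2)
      simp only [phA, dilB, Prod.smul_mk] at this
      simp only [Function.comp_apply, Prod.map_apply, id_eq, dilB, Prod.smul_mk]
      exact this
    · simp only [Function.comp_apply, Prod.map_apply, id_eq]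
      rw [mapZ_mapP]
      rfl
  rw [key, mul_assoc, leg12, star_opTensor, ← opTensor_mul, star_one, one_mul,
    Unitary.mul_star_self_of_mem (Z_mem_unitary n lam), opTensor_one, mul_one]
  exact hQ

theorem star_VD : star (VD n lam) = leg13 (star (X n lam)) *
    (leg12 (Z n lam) * leg24 (star (Y n lam)) * star (leg12 (Z n lam))) := by
  simp only [VD, star_mul, star_star, star_leg13, star_leg24, mul_assoc]

theorem isWC_star_VD : IsWC (star (VD n lam)) (wtV n lam) (mapV n lam) := by
  rw [star_VD]
  exact (((isWC_star_X n lam).leg13).mul isWC_conj_leg24).congr (fun _ => rfl) fun _ => rfl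

theorem VD_mem_unitary : VD n lam ∈ unitary (Op (L2 ((Pt n × Pt n) × (Pt n × Pt n)))) := by
  have hf : (flip23 : Op (L2 ((Pt n × Pt n) × (Pt n × Pt n)))) ∈ unitary _ := by
    rw [Unitary.mem_iff, star_flip23]
    exact ⟨flip23_mul_flip23, flip23_mul_flip23⟩
  have hZ : leg12 (Z n lam) ∈ unitary (Op (L2 ((Pt n × Pt n) × (Pt n × Pt n)))) :=
    opTensor_mem_unitary (Z_mem_unitary n lam) (one_mem _)
  exact mul_mem (mul_mem (mul_mem hZ (mul_mem (mul_mem hf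
    (opTensor_mem_unitary (one_mem _) (Y_mem_unitary n lam))) hf)) (Unitary.star_mem hZ))
    (mul_mem (mul_mem hf (opTensor_mem_unitary (X_mem_unitary n lam) (one_mem _))) hf)

theorem mapV_mapR (p : (Pt n × Pt n) × (Pt n × Pt n)) (g : Pl n) :
    mapV n lam (mapR n lam p g) =
      ((mapV n lam p).1, mapP n lam (mapV n lam p).2.1 (mapV n lam p).2.2 g) := by
  simp only [mapP, mapR, mapV, dilB, Prod.smul_fst, Prod.smul_snd, Prod.mk.injEq, smul_add,
    smul_sub, smul_neg, smul_smul, mul_add,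
    mul_sub, mul_neg, Real.exp_add, Real.exp_sub, Real.exp_neg]
  refine ⟨⟨⟨?_, ?_, ?_⟩, ?_, ?_, ?_⟩, ⟨?_, ?_, ?_⟩, ?_⟩ <;>
    first | trivial | ring1 | (match_scalars <;> field_simp <;> ring1)

/-- The computation that makes `π` compatible with the comultiplications: together with `mapV_mapR`
it says that `V_D*` intertwines `1 ⊗ π(L_u)` with the integral operator obtained from `(π ⊗ π)(Δ
L_u)`. -/
theorem wtV_mul_phP (p : (Pt n × Pt n) × (Pt n × Pt n)) (g : Pl n) :
    wtV n lam p * phP n lam (mapV n lam p).2.1 (mapV n lam p).2.2 g =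
      phR n lam p g * wtV n lam (mapR n lam p g) := by
  obtain ⟨⟨⟨x₁, y₁, r₁⟩, ⟨x₂, y₂, r₂⟩⟩, ⟨⟨x₃, y₃, r₃⟩, ⟨x₄, y₄, r₄⟩⟩⟩ := p
  obtain ⟨a, b⟩ := g
  simp only [wtV, phP, phR, mapV, mapR, mapP, dilB, Prod.smul_mk]
  rw [← e_add, ← e_add, ← e_add, ← e_add, ← e_add]
  congr 1
  simp only [inner_add_left, inner_add_right, inner_sub_left, inner_sub_right, inner_neg_left,
    inner_neg_right, real_inner_smul_left, real_inner_smul_right, eta_add, eta_sub, eta_neg,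
    mul_add, mul_sub, mul_neg, Real.exp_add, Real.exp_sub, Real.exp_neg]
  -- Several values of `eta` occur together here. For `lam ≠ 0` they are eliminated in favour of
  -- exponentials, which leaves a rational identity; for `lam = 0` all exponentials are 1.
  by_cases h : lam = 0
  · subst h
    simp only [zero_mul, Real.exp_zero]
    ring
  · simp only [eta_eq_div h]
    field_simp
    ring

theorem star_VD_mul {u : Pt n → ℂ} (hu : Measurable u) {S : Op (L2 (Pt n))}
    {R : Op (L2 ((Pt n × Pt n) × (Pt n × Pt n)))}
    (hS : IsInt S (mapA n) (fun p g => u (g.1, g.2, p.2.2) * phA n lam p g))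
    (hR : IsInt R (mapR n lam)
      (fun p g => u (g.1, g.2, p.1.2.2.2 + p.2.2.2.2) * phR n lam p g)) :
    star (VD n lam) * opTensor 1 (piA n lam S) = R * star (VD n lam) := by
  refine mul_eq_mul_of_kernel isWC_star_VD (isInt_piA hu hS).opTensor_left hR isWC_star_VD
    (fun p g => (mapV_mapR p g).symm) (fun p g => ?_)
  rw [mul_left_comm, wtV_mul_phP, mul_assoc, show (mapV n lam p).2.2.2.2 =
    p.1.2.2.2 + p.2.2.2.2 from add_comm _ _]

variable (n lam)

/-- The homomorphism `π ⊗ π`. -/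
noncomputable def ampA :
    Op (L2 (Pt n × Pt n)) →⋆ₐ[ℂ] Op (L2 ((Pt n × Pt n) × (Pt n × Pt n))) where
  toFun m := opTensor (Z n lam) (Z n lam) * leg24 m * star (opTensor (Z n lam) (Z n lam))
  map_one' := by
    rw [leg24, opTensor_one, mul_one, flip23_mul_flip23, mul_one]
    exact Unitary.mul_star_self_of_mem (opTensor_mem_unitary (Z_mem_unitary n lam)
      (Z_mem_unitary n lam))
  map_zero' := by
    rw [leg24, ← opTensorₗ_apply 1, map_zero, mul_zero, zero_mul, mul_zero, zero_mul]
  map_mul' S T := by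
    have h := Unitary.star_mul_self_of_mem (opTensor_mem_unitary (Z_mem_unitary n lam)
      (Z_mem_unitary n lam))
    rw [leg24_mul, show ∀ a b c d : Op (L2 ((Pt n × Pt n) × (Pt n × Pt n))),
      a * b * d * (a * c * d) = a * b * (d * a) * c * d by intros; simp only [mul_assoc], h, mul_one]
    simp only [mul_assoc]
  map_add' S T := by
    simp only [leg24, ← opTensorₗ_apply, map_add, mul_add, add_mul]
  commutes' c := by
    rw [Algebra.algebraMap_eq_smul_one, Algebra.algebraMap_eq_smul_one, leg24, ← opTensorₗ_apply 1,
      map_smul, opTensorₗ_apply, opTensor_one, mul_smul_comm, smul_mul_assoc, mul_one,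
      flip23_mul_flip23, mul_smul_comm, smul_mul_assoc, mul_one,
      Unitary.mul_star_self_of_mem (opTensor_mem_unitary (Z_mem_unitary n lam)
      (Z_mem_unitary n lam))]
  map_star' S := by simp only [star_mul, star_star, star_leg24, mul_assoc]

/-- The homomorphism `π' ⊗ π'`. -/
noncomputable def ampB :
    Op (L2 (Pt n × Pt n)) →⋆ₐ[ℂ] Op (L2 ((Pt n × Pt n) × (Pt n × Pt n))) where
  toFun m := leg13 m
  map_one' := by rw [leg13, opTensor_one, mul_one, flip23_mul_flip23]
  map_zero' := by
    rw [leg13, ← opTensorₗ_apply, map_zero, LinearMap.zero_apply, mul_zero, zero_mul]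
  map_mul' := leg13_mul
  map_add' S T := by
    simp only [leg13, ← opTensorₗ_apply, map_add, LinearMap.add_apply, mul_add, add_mul]
  commutes' c := by
    rw [Algebra.algebraMap_eq_smul_one, Algebra.algebraMap_eq_smul_one, leg13, ← opTensorₗ_apply,
      map_smul, LinearMap.smul_apply, opTensorₗ_apply, opTensor_one, mul_smul_comm,
      smul_mul_assoc, mul_one, flip23_mul_flip23]
  map_star' S := (star_leg13 S).symm

theorem ampA_opTensor (a b : Op (L2 (Pt n))) :
    ampA n lam (opTensor a b) = opTensor (piA n lam a) (piA n lam b) := by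
  change opTensor (Z n lam) (Z n lam) * leg24 (opTensor a b) *
    star (opTensor (Z n lam) (Z n lam)) = _
  rw [leg24_opTensor, star_opTensor, ← opTensor_mul, ← opTensor_mul, piA_apply, piA_apply,
    mul_assoc, mul_assoc]

theorem ampB_opTensor (a b : Op (L2 (Pt n))) :
    ampB n (opTensor a b) = opTensor (piB n a) (piB n b) :=
  leg13_opTensor a b

/-- The comultiplication of `A_D` as a linear map. -/
noncomputable def comulDₗ :
    Op (L2 (Pt n × Pt n)) →ₗ[ℂ] Op (L2 ((Pt n × Pt n) × (Pt n × Pt n))) :=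
  LinearMap.mulRight ℂ (VD n lam) ∘ₗ LinearMap.mulLeft ℂ (star (VD n lam)) ∘ₗ opTensorₗ 1

theorem continuous_comulDₗ : Continuous (comulDₗ n lam) :=
  (continuous_mul_const _).comp ((continuous_const_mul _).comp (continuous_opTensor_right 1))

theorem comulD_mul (x y : Op (L2 (Pt n × Pt n))) :
    comulD n lam (x * y) = comulD n lam x * comulD n lam y := by
  have h := Unitary.mul_star_self_of_mem (VD_mem_unitary (n := n) (lam := lam))
  simp only [comulD]
  rw [show ∀ a b c d : Op (L2 ((Pt n × Pt n) × (Pt n × Pt n))),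
      d * b * a * (d * c * a) = d * b * (a * d) * c * a by intros; simp only [mul_assoc], h, mul_one,
      mul_assoc _ (opTensor 1 x), ← opTensor_mul, one_mul]

variable {n lam}

/-- The homomorphism `π` is compatible with the comultiplications. -/
theorem comulD_piA {a : Op (L2 (Pt n))} (ha : a ∈ algA n lam) :
    comulD n lam (piA n lam a) = ampA n lam (comulA n lam a) := by
  -- Both sides are linear and norm continuous in `a`, so equality has to be verified for `a = L_u`
  -- only. There each side is the conjugate that equals the common operator `R`.
  have hc : IsClosed ((LinearMap.eqLocus (comulDₗ n lam ∘ₗ piA n lam)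
      ((ampA n lam).toAlgHom.toLinearMap ∘ₗ comulAₗ n lam) : Submodule ℂ (Op (L2 (Pt n)))) :
      Set (Op (L2 (Pt n)))) :=
    isClosed_eq ((continuous_comulDₗ n lam).comp (continuous_piA n lam))
      ((map_continuous (ampA n lam)).comp (continuous_comulAₗ n lam))
  refine clSpan_le hc ?_ (mem_algA_iff.1 ha)
  rintro S ⟨u, hu, hS⟩
  obtain ⟨R, hR⟩ := exists_isInt_R hu.continuous.measurable hS
  change comulD n lam (piA n lam S) = opTensor (Z n lam) (Z n lam) * leg24 (comulA n lam S) *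
    star (opTensor (Z n lam) (Z n lam))
  rw [ZZ_mul_leg24 hu.continuous.measurable hS hR, mul_assoc,
    Unitary.mul_star_self_of_mem (opTensor_mem_unitary (Z_mem_unitary n lam)
      (Z_mem_unitary n lam)), mul_one, comulD, star_VD_mul hu.continuous.measurable hS hR, mul_assoc,
    Unitary.star_mul_self_of_mem VD_mem_unitary, mul_one]

/-- The homomorphism `π'` is compatible with the comultiplications. -/
theorem comulD_piB (b : Op (L2 (Pt n))) :
    comulD n lam (piB n b) = ampB n (comulB n lam b) := by
  change _ = leg13 (star (X n lam) * opTensor 1 b * X n lam)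
  have h1 : opTensor 1 (piB n b) = leg13 (opTensor 1 b) := by
    rw [leg13_opTensor, opTensor_one, piB_apply]
  have h2 : leg12 (Z n lam) * leg13 (opTensor 1 b) = leg13 (opTensor 1 b) * leg12 (Z n lam) := by
    rw [← h1, leg12, ← opTensor_mul, ← opTensor_mul]
    simp only [mul_one, one_mul]
  have h3 : star (leg12 (Z n lam)) * leg13 (opTensor 1 b) =
      leg13 (opTensor 1 b) * star (leg12 (Z n lam)) := by
    rw [← h1, leg12, star_opTensor, star_one, ← opTensor_mul, ← opTensor_mul]
    simp only [mul_one, one_mul]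
  have hZ := Unitary.mul_star_self_of_mem (opTensor_mem_unitary (Z_mem_unitary n lam)
    (one_mem (unitary (Op (L2 (Pt n × Pt n))))))
  have hZ' := Unitary.star_mul_self_of_mem (opTensor_mem_unitary (Z_mem_unitary n lam)
    (one_mem (unitary (Op (L2 (Pt n × Pt n))))))
  change leg12 (Z n lam) * star (leg12 (Z n lam)) = 1 at hZ
  change star (leg12 (Z n lam)) * leg12 (Z n lam) = 1 at hZ'
  have hY : leg24 (star (Y n lam)) * leg24 (Y n lam) = 1 := by
    rw [← leg24_mul, Unitary.star_mul_self_of_mem (Y_mem_unitary n lam), leg24, opTensor_one,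
      mul_one, flip23_mul_flip23]
  -- The conjugated `Y*` lives on legs 1, 2 and 4 and commutes with `b` on leg 3. It therefore
  -- cancels inside `V_D* (1 ⊗ 1 ⊗ b ⊗ 1) V_D`, and only `X₁₃` remains.
  have key : (leg12 (Z n lam) * leg24 (star (Y n lam)) * star (leg12 (Z n lam))) *
      leg13 (opTensor 1 b) = leg13 (opTensor 1 b) *
      (leg12 (Z n lam) * leg24 (star (Y n lam)) * star (leg12 (Z n lam))) := by
    rw [mul_assoc, h3, mul_assoc, ← mul_assoc (leg24 _), ← leg13_mul_leg24, ← mul_assoc,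
      ← mul_assoc, h2]
    simp only [mul_assoc]
  have hV : VD n lam = leg12 (Z n lam) * leg24 (Y n lam) * star (leg12 (Z n lam)) *
    leg13 (X n lam) := rfl
  have hQ : (leg12 (Z n lam) * leg24 (star (Y n lam)) * star (leg12 (Z n lam))) *
      (leg12 (Z n lam) * leg24 (Y n lam) * star (leg12 (Z n lam))) = 1 := by
    rw [show ∀ a b c d : Op (L2 ((Pt n × Pt n) × (Pt n × Pt n))),
      a * b * d * (a * c * d) = a * b * (d * a) * c * d by intros; simp only [mul_assoc], hZ',
      mul_one, mul_assoc (leg12 _), hY, mul_one, hZ]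
  rw [comulD, h1, star_VD, hV, mul_assoc (leg13 (star (X n lam))), key, leg13_mul, leg13_mul,
    show ∀ a b c d f : Op (L2 ((Pt n × Pt n) × (Pt n × Pt n))),
      a * (b * c) * (d * f) = a * b * (c * d) * f by intros; simp only [mul_assoc], hQ, mul_one]

end ComulD

/-! ### Approximate units -/

section ApproxUnit

theorem exists_isApproximateUnit (A : Type) [NonUnitalCStarAlgebra A] :
    ∃ l : Filter A, l.IsApproximateUnit ∧ ∀ᶠ x in l, ‖x‖ ≤ 1 := by
  let _ := CStarAlgebra.spectralOrder A
  have := CStarAlgebra.spectralOrderedRing A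
  have h := CStarAlgebra.increasingApproximateUnit A
  exact ⟨_, h.toIsApproximateUnit, h.eventually_norm⟩

variable {H : Type} [NormedAddCommGroup H] [InnerProductSpace ℂ H] [CompleteSpace H]

theorem exists_approxUnit {C : NonUnitalStarSubalgebra ℂ (Op H)} (hC : IsClosed (C : Set (Op H))) :
    ∃ l : Filter (Op H), l.NeBot ∧ (∀ᶠ u in l, u ∈ C ∧ ‖u‖ ≤ 1) ∧
      ∀ c ∈ C, Tendsto (fun u => u * c) l (nhds c) ∧ Tendsto (fun u => c * u) l (nhds c) := by
  have : IsClosed (C : Set (Op H)) := hC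
  obtain ⟨l, hl, h1⟩ := exists_isApproximateUnit C
  have := hl.neBot
  refine ⟨l.map Subtype.val, inferInstance, ?_, fun c hc => ⟨?_, ?_⟩⟩
  · rw [eventually_map]
    filter_upwards [h1] with u hu
    exact ⟨u.2, hu⟩
  · rw [tendsto_map'_iff]
    exact (continuous_subtype_val.tendsto _).comp (hl.tendsto_mul_right ⟨c, hc⟩)
  · rw [tendsto_map'_iff]
    exact (continuous_subtype_val.tendsto _).comp (hl.tendsto_mul_left ⟨c, hc⟩)

end ApproxUnit

/-! ### Strict convergence of bounded nets -/

section Strict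

variable {H : Type} [NormedAddCommGroup H] [InnerProductSpace ℂ H] [CompleteSpace H]
  {ι : Type} {l : Filter ι}

/-- Boundedness makes the set of good `y` closed: `y` is replaced by a nearby `z`, at a cost of at
most `(|K| + ‖m‖) ‖y - z‖`. -/
theorem tendsto_mul_of_clSpan {u : ι → Op H} {m : Op H} {s : Set (Op H)} {K : ℝ}
    (hK : ∀ᶠ i in l, ‖u i‖ ≤ K) (h : ∀ y ∈ s, Tendsto (fun i => u i * y) l (nhds (m * y)))
    {y : Op H} (hy : y ∈ clSpan s) : Tendsto (fun i => u i * y) l (nhds (m * y)) := by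
  let M : Submodule ℂ (Op H) :=
    { carrier := {y | Tendsto (fun i => u i * y) l (nhds (m * y))}
      add_mem' := fun {a b} ha hb => by
        have := Tendsto.add ha hb
        simpa only [mul_add, Set.mem_ofPred_eq] using this
      zero_mem' := by simp [tendsto_const_nhds]
      smul_mem' := fun c x hx => by
        have := Tendsto.const_smul hx c
        simpa only [mul_smul_comm, Set.mem_ofPred_eq] using this }
  have hM : IsClosed (M : Set (Op H)) := by
    refine isClosed_of_closure_subset fun y hy => ?_
    change Tendsto (fun i => u i * y) l (nhds (m * y))
    rw [Metric.tendsto_nhds]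
    intro ε hε
    have hpos : 0 < |K| + ‖m‖ + 1 := by positivity
    obtain ⟨z, hz, hyz⟩ := Metric.mem_closure_iff.1 hy (ε / 2 / (|K| + ‖m‖ + 1)) (by positivity)
    have hz' : Tendsto (fun i => u i * z) l (nhds (m * z)) := hz
    filter_upwards [hK, Metric.tendsto_nhds.1 hz' (ε / 2) (by positivity)] with i h1 h2
    rw [dist_eq_norm] at h2 hyz ⊢
    have e : u i * y - m * y = (u i * z - m * z) + (u i * (y - z) - m * (y - z)) := by
      simp only [mul_sub]
      abel
    have b1 : ‖u i * (y - z)‖ ≤ |K| * ‖y - z‖ := (norm_mul_le _ _).trans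
      (mul_le_mul_of_nonneg_right (h1.trans (le_abs_self K)) (norm_nonneg _))
    have b2 : ‖m * (y - z)‖ ≤ ‖m‖ * ‖y - z‖ := norm_mul_le _ _
    have b3 : (|K| + ‖m‖ + 1) * ‖y - z‖ < ε / 2 := by
      rw [mul_comm]
      exact (lt_div_iff₀ hpos).1 hyz
    calc ‖u i * y - m * y‖ ≤ ‖u i * z - m * z‖ + (‖u i * (y - z)‖ + ‖m * (y - z)‖) := by
          rw [e]
          exact (norm_add_le _ _).trans (add_le_add_right (norm_sub_le _ _) _)
      _ < ε := by nlinarith [norm_nonneg (y - z)]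
  exact clSpan_le hM h hy

theorem StrictTendsto.of_left {C : NonUnitalStarSubalgebra ℂ (Op H)} {u : ι → Op H} {m : Op H}
    (h : ∀ c ∈ C, Tendsto (fun i => u i * c) l (nhds (m * c)))
    (h' : ∀ c ∈ C, Tendsto (fun i => star (u i) * c) l (nhds (star m * c))) :
    StrictTendsto C u l m := fun c hc => by
  refine ⟨h c hc, ?_⟩
  have := (continuous_star.tendsto _).comp (h' _ (star_mem hc))
  simpa only [Function.comp_def, star_mul, star_star] using this

theorem StrictTendsto.star {C : NonUnitalStarSubalgebra ℂ (Op H)} {u : ι → Op H} {m : Op H}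
    (h : StrictTendsto C u l m) : StrictTendsto C (fun i => star (u i)) l (star m) :=
  fun c hc => by
  obtain ⟨h1, h2⟩ := h _ (star_mem hc)
  have h1' := (continuous_star.tendsto _).comp h1
  have h2' := (continuous_star.tendsto _).comp h2
  simp only [Function.comp_def, star_mul, star_star] at h1' h2'
  exact ⟨h2', h1'⟩

/-- Bounded strictly convergent nets can be multiplied. -/
theorem StrictTendsto.mul {C : NonUnitalStarSubalgebra ℂ (Op H)} {u v : ι → Op H} {m k : Op H}
    (hu : StrictTendsto C u l m) (hv : StrictTendsto C v l k) {K : ℝ}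
    (hK : ∀ᶠ i in l, ‖u i‖ ≤ K) (hK' : ∀ᶠ i in l, ‖v i‖ ≤ K) (hm : m ∈ multiplier C)
    (hk : k ∈ multiplier C) : StrictTendsto C (fun i => u i * v i) l (m * k) := by
  have key : ∀ {u v : ι → Op H} {m k : Op H}, StrictTendsto C u l m → StrictTendsto C v l k →
      (∀ᶠ i in l, ‖u i‖ ≤ K) → k ∈ multiplier C → ∀ c ∈ C,
      Tendsto (fun i => u i * v i * c) l (nhds (m * k * c)) := by
    intro u v m k hu hv hK hk c hc
    have h1 := (hu _ (hk c hc).1).1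
    -- The splitting is `u_i v_i c = u_i (v_i c - k c) + u_i (k c)`. The first term tends to 0 by
    -- boundedness of `u_i`, the second converges because `k c` lies in `C`.
    have h2 : Tendsto (fun i => u i * (v i * c - k * c)) l (nhds 0) := by
      have h3 := (tendsto_iff_norm_sub_tendsto_zero.1 (hv c hc).1).const_mul |K|
      rw [mul_zero] at h3
      refine squeeze_zero_norm' ?_ h3
      filter_upwards [hK] with i hi
      exact (norm_mul_le _ _).trans
        (mul_le_mul_of_nonneg_right (hi.trans (le_abs_self K)) (norm_nonneg _))
    have h3 := h2.add h1
    rw [zero_add, ← mul_assoc] at h3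
    refine h3.congr fun i => ?_
    rw [mul_sub, mul_assoc]
    abel
  refine StrictTendsto.of_left (key hu hv hK hk) ?_
  simp only [star_mul]
  exact key hv.star hu.star (by simpa only [norm_star] using hK') (star_mem hm)

end Strict

/-! ### Extension of homomorphisms to multiplier algebras -/

section Extension

variable {α β : Type} [MeasureSpace α] [MeasureSpace β]
  [SigmaFinite (volume : Measure α)] [SigmaFinite (volume : Measure β)]
  {B : NonUnitalStarSubalgebra ℂ (Op (L2 α))} {C : NonUnitalStarSubalgebra ℂ (Op (L2 β))}

/-- A nondegenerate linear map `θ : B → M(C)` and a homomorphism `Θ` that extends `θ ⊗ θ`. -/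
structure IsExtension (B : NonUnitalStarSubalgebra ℂ (Op (L2 α)))
    (C : NonUnitalStarSubalgebra ℂ (Op (L2 β))) (θ : Op (L2 α) →ₗ[ℂ] Op (L2 β))
    (Θ : Op (L2 (α × α)) →⋆ₐ[ℂ] Op (L2 (β × β))) : Prop where
  isClosed_dom : IsClosed (B : Set (Op (L2 α)))
  isClosed_cod : IsClosed (C : Set (Op (L2 β)))
  mul_mem : ∀ b ∈ B, ∀ c ∈ C, θ b * c ∈ C
  nondegenerate : ∀ c ∈ C, c ∈ clSpan {x | ∃ b ∈ B, ∃ d ∈ C, x = θ b * d}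
  apply : ∀ b b', Θ (opTensor b b') = opTensor (θ b) (θ b')

variable {θ : Op (L2 α) →ₗ[ℂ] Op (L2 β)} {Θ : Op (L2 (α × α)) →⋆ₐ[ℂ] Op (L2 (β × β))}

theorem mem_clSpan_self {H : Type} [NormedAddCommGroup H] [InnerProductSpace ℂ H]
    [CompleteSpace H] {C : NonUnitalStarSubalgebra ℂ (Op H)} (hC : IsClosed (C : Set (Op H)))
    {c : Op H} : c ∈ C ↔ c ∈ clSpan (C : Set (Op H)) :=
  ⟨fun h => subset_clSpan _ h, fun h =>
    clSpan_le (M := C.toNonUnitalSubalgebra.toSubmodule) hC (fun _ h => h) h⟩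

theorem isClosed_minTensor (B : NonUnitalStarSubalgebra ℂ (Op (L2 α)))
    (C : NonUnitalStarSubalgebra ℂ (Op (L2 β))) :
    IsClosed (minTensor B C : Set (Op (L2 (α × β)))) := isClosed_cstarGen _

/-- The set of all `Θ(b ⊗ b') (d ⊗ d')` spans a dense subspace. -/
theorem IsExtension.mem_clSpan (h : IsExtension B C θ Θ) {y : Op (L2 (β × β))}
    (hy : y ∈ minTensor C C) :
    y ∈ clSpan {x | ∃ b ∈ minTensor B B, ∃ d ∈ minTensor C C, x = Θ b * d} := by
  have h1 := (mem_minTensor_iff (mem_clSpan_self h.isClosed_cod)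
    (mem_clSpan_self h.isClosed_cod)).1 hy
  refine clSpan_le (isClosed_clSpan _) ?_ h1
  rintro _ ⟨c, hc, c', hc', rfl⟩
  refine opTensor_mem (isClosed_clSpan _) ?_ (h.nondegenerate c hc) (h.nondegenerate c' hc')
  rintro _ ⟨b, hb, d, hd, rfl⟩ _ ⟨b', hb', d', hd', rfl⟩
  rw [opTensor_mul, ← h.apply]
  exact subset_clSpan _ ⟨_, opTensor_mem_minTensor hb hb', _, opTensor_mem_minTensor hd hd', rfl⟩

theorem IsExtension.map_mul_mem (h : IsExtension B C θ Θ) {b : Op (L2 (α × α))}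
    (hb : b ∈ minTensor B B) {y : Op (L2 (β × β))} (hy : y ∈ minTensor C C) :
    Θ b * y ∈ minTensor C C := by
  have hC : ∀ {y : Op (L2 (β × β))}, y ∈ minTensor C C ↔ y ∈ clSpan (tensorGen (C : Set _) C) :=
    mem_minTensor_iff (mem_clSpan_self h.isClosed_cod) (mem_clSpan_self h.isClosed_cod)
  have hB := (mem_minTensor_iff (mem_clSpan_self h.isClosed_dom)
    (mem_clSpan_self h.isClosed_dom)).1 hb
  have hgen : ∀ x ∈ tensorGen (B : Set (Op (L2 α))) B, ∀ z ∈ tensorGen (C : Set (Op (L2 β))) C,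
      Θ x * z ∈ clSpan (tensorGen (C : Set (Op (L2 β))) C) := by
    rintro _ ⟨b, hb, b', hb', rfl⟩ _ ⟨c, hc, c', hc', rfl⟩
    rw [h.apply, ← opTensor_mul]
    exact subset_clSpan _ ⟨_, h.mul_mem b hb c hc, _, h.mul_mem b' hb' c' hc', rfl⟩
  have hΘ : Continuous (Θ : Op (L2 (α × α)) →ₗ[ℂ] Op (L2 (β × β))) := map_continuous Θ
  exact hC.2 (map_mul_map_mem (f := (Θ : Op (L2 (α × α)) →ₗ[ℂ] Op (L2 (β × β))))
    (g := LinearMap.id) (isClosed_clSpan _) hΘ continuous_id hgen hB (hC.1 hy))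

/-- On the dense span of the elements `Θ(b) d` one has `Θ(m) Θ(b) d = Θ(m b) d`, and `m b` is again
in `B ⊗ B`. Nondegeneracy of `θ` supplies the density. -/
theorem IsExtension.map_mem_multiplier (h : IsExtension B C θ Θ) {m : Op (L2 (α × α))}
    (hm : m ∈ multiplier (minTensor B B)) : Θ m ∈ multiplier (minTensor C C) := by
  have key : ∀ {m}, m ∈ multiplier (minTensor B B) → ∀ y ∈ minTensor C C,
      Θ m * y ∈ minTensor C C := by
    intro m hm y hy
    refine mul_mem_of_clSpan (M := (minTensor C C).toNonUnitalSubalgebra.toSubmodule)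
      (isClosed_minTensor C C) _ ?_ (h.mem_clSpan hy)
    rintro _ ⟨b, hb, d, hd, rfl⟩
    rw [← mul_assoc, ← map_mul]
    exact h.map_mul_mem (hm b hb).1 hd
  refine mem_multiplier_of_left (key hm) ?_
  rw [← map_star]
  exact key (star_mem hm)

theorem IsExtension.norm_map_le (Θ : Op (L2 (α × α)) →⋆ₐ[ℂ] Op (L2 (β × β)))
    (m : Op (L2 (α × α))) : ‖Θ m‖ ≤ ‖m‖ :=
  NonUnitalStarAlgHom.norm_apply_le Θ m

/-- On the vectors `Θ(b) d` the claim is norm convergence `Θ(u_i b) d → Θ(m b) d`, and `Θ` is norm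
continuous. Since `Θ` is contractive the net stays bounded, and `tendsto_mul_of_clSpan` extends the
convergence to all of `C ⊗ C`. -/
theorem IsExtension.strictTendsto (h : IsExtension B C θ Θ) {ι : Type} {l : Filter ι}
    {u : ι → Op (L2 (α × α))} {m : Op (L2 (α × α))} (hu : StrictTendsto (minTensor B B) u l m)
    {K : ℝ} (hK : ∀ᶠ i in l, ‖u i‖ ≤ K) :
    StrictTendsto (minTensor C C) (fun i => Θ (u i)) l (Θ m) := by
  have key : ∀ {u : ι → Op (L2 (α × α))} {m : Op (L2 (α × α))},
      StrictTendsto (minTensor B B) u l m → (∀ᶠ i in l, ‖u i‖ ≤ K) → ∀ y ∈ minTensor C C,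
      Tendsto (fun i => Θ (u i) * y) l (nhds (Θ m * y)) := by
    intro u m hu hK y hy
    refine tendsto_mul_of_clSpan (K := K) ?_ ?_ (h.mem_clSpan hy)
    · filter_upwards [hK] with i hi using (IsExtension.norm_map_le Θ _).trans hi
    · rintro _ ⟨b, hb, d, hd, rfl⟩
      have h1 := ((map_continuous Θ).tendsto _).comp (hu b hb).1
      have h2 := h1.mul_const d
      simp only [Function.comp_def, map_mul, mul_assoc] at h2
      exact h2
  refine StrictTendsto.of_left (key hu hK) ?_
  simp only [← map_star]
  exact key hu.star (by simpa only [norm_star] using hK)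

/-- The restriction of `Θ` to the multiplier algebras. -/
noncomputable def IsExtension.multiplierHom (h : IsExtension B C θ Θ) :
    multiplier (minTensor B B) →⋆ₐ[ℂ] multiplier (minTensor C C) :=
  (Θ.comp (multiplier (minTensor B B)).subtype).codRestrict (multiplier (minTensor C C))
    fun m => h.map_mem_multiplier m.2

end Extension

/-! ### Nets in the algebraic tensor product -/

section Nets

variable {α : Type} [MeasureSpace α] [SigmaFinite (volume : Measure α)] {n : ℕ}

/-- Multipliers are strict limits of bounded nets in the algebraic tensor product. -/
theorem exists_isSweedlerNet {R : funAlg n →ₗ[ℂ] Op (L2 α)}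
    {C : NonUnitalStarSubalgebra ℂ (Op (L2 (α × α)))} (hC : IsClosed (C : Set (Op (L2 (α × α)))))
    (hd : ∀ c ∈ C, ∀ ε > 0, ∃ t, ‖tensorRep R R t - c‖ < ε) {m : Op (L2 (α × α))}
    (hm : m ∈ multiplier C) :
    ∃ (ι : Type) (l : Filter ι) (t : ι → funAlg n ⊗[ℂ] funAlg n), l.NeBot ∧
      IsSweedlerNet R C m l t := by
  obtain ⟨l, hl, h1, h2⟩ := exists_approxUnit hC
  -- The index is a pair `(u, ε)` with `u` from a bounded approximate unit and `ε` tending to 0 from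
  -- above; `t (u, ε)` is chosen within `ε` of `m u`. Off the relevant indices the value 0 is
  -- irrelevant.
  have hex : ∀ p : Op (L2 (α × α)) × ℝ, ∃ t, p.1 ∈ C → 0 < p.2 →
      ‖tensorRep R R t - m * p.1‖ < p.2 := fun p => by
    by_cases hp : p.1 ∈ C ∧ 0 < p.2
    · obtain ⟨t, ht⟩ := hd _ (hm _ hp.1).1 _ hp.2
      exact ⟨t, fun _ _ => ht⟩
    · exact ⟨0, fun h h' => (hp ⟨h, h'⟩).elim⟩
  choose t ht using hex
  let L : Filter (Op (L2 (α × α)) × ℝ) := l ×ˢ nhdsWithin 0 (Set.Ioi 0)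
  have hL : Tendsto Prod.snd L (nhds 0) :=
    (tendsto_snd (f := l) (g := nhdsWithin (0 : ℝ) (Set.Ioi 0))).mono_right nhdsWithin_le_nhds
  have e1 : ∀ᶠ p in L, p.1 ∈ C ∧ ‖p.1‖ ≤ 1 := tendsto_fst.eventually h1
  have e2 : ∀ᶠ p in L, 0 < p.2 := tendsto_snd.eventually self_mem_nhdsWithin
  have e3 : ∀ᶠ p in L, p.2 < 1 := hL.eventually (gt_mem_nhds one_pos)
  have hdiff : Tendsto (fun p => tensorRep R R (t p) - m * p.1) L (nhds 0) := by
    refine squeeze_zero_norm' ?_ hL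
    filter_upwards [e1, e2] with p hp hp'
    exact (ht p hp.1 hp').le
  refine ⟨_, L, t, inferInstance, ⟨‖m‖ + 1, ?_⟩, fun c hc => ⟨?_, ?_⟩⟩
  · filter_upwards [e1, e2, e3] with p hp hp' hp''
    calc ‖tensorRep R R (t p)‖ = ‖(tensorRep R R (t p) - m * p.1) + m * p.1‖ := by
          rw [sub_add_cancel]
      _ ≤ ‖tensorRep R R (t p) - m * p.1‖ + ‖m * p.1‖ := norm_add_le _ _
      _ ≤ 1 + ‖m‖ * ‖p.1‖ := add_le_add ((ht p hp.1 hp').le.trans hp''.le) (norm_mul_le _ _)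
      _ ≤ ‖m‖ + 1 := by nlinarith [norm_nonneg m, hp.2]
  · have a1 := hdiff.mul_const c
    have a2 := ((h2 c hc).1.comp (tendsto_fst (f := l)
      (g := nhdsWithin (0 : ℝ) (Set.Ioi 0)))).const_mul m
    have a3 := a1.add a2
    rw [zero_mul, zero_add] at a3
    refine a3.congr fun p => ?_
    simp only [Function.comp_apply, sub_mul, mul_assoc, sub_add_cancel]
  · have a1 := hdiff.const_mul c
    have a2 := (h2 _ (hm c hc).2).2.comp (tendsto_fst (f := l)
      (g := nhdsWithin (0 : ℝ) (Set.Ioi 0)))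
    have a3 := a1.add a2
    rw [mul_zero, zero_add] at a3
    refine a3.congr fun p => ?_
    simp only [Function.comp_apply, mul_sub, mul_assoc, sub_add_cancel]

theorem IsSweedlerNet.comp {R : funAlg n →ₗ[ℂ] Op (L2 α)}
    {C : NonUnitalStarSubalgebra ℂ (Op (L2 (α × α)))} {m : Op (L2 (α × α))} {ι κ : Type}
    {l : Filter ι} {l' : Filter κ} {t : ι → funAlg n ⊗[ℂ] funAlg n}
    (h : IsSweedlerNet R C m l t) {f : κ → ι} (hf : Tendsto f l' l) :
    IsSweedlerNet R C m l' (t ∘ f) := by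
  obtain ⟨K, hK⟩ := h.bounded
  exact ⟨⟨K, hf.eventually hK⟩, fun c hc =>
    ⟨(h.tendsto c hc).1.comp hf, (h.tendsto c hc).2.comp hf⟩⟩

theorem exists_tensorRep_near {R : funAlg n →ₗ[ℂ] Op (L2 α)}
    {B : NonUnitalStarSubalgebra ℂ (Op (L2 α))} {s : Set (Op (L2 α))}
    (hB : ∀ {b}, b ∈ B ↔ b ∈ clSpan s) (hs : ∀ b ∈ s, ∃ f, R f = b) {c : Op (L2 (α × α))}
    (hc : c ∈ minTensor B B) {ε : ℝ} (hε : 0 < ε) : ∃ t, ‖tensorRep R R t - c‖ < ε := by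
  have h1 := (mem_minTensor_iff hB hB).1 hc
  have h2 : clSpan (tensorGen s s) ≤ (LinearMap.range (tensorRep R R)).topologicalClosure := by
    refine clSpan_le (Submodule.isClosed_topologicalClosure _) ?_
    rintro _ ⟨S, hS, T, hT, rfl⟩
    obtain ⟨f, rfl⟩ := hs S hS
    obtain ⟨g, rfl⟩ := hs T hT
    exact Submodule.le_topologicalClosure _ ⟨f ⊗ₜ g, rfl⟩
  obtain ⟨_, ⟨t, rfl⟩, ht⟩ := Metric.mem_closure_iff.1 (h2 h1) ε hε
  refine ⟨t, ?_⟩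
  rwa [dist_eq_norm, norm_sub_rev] at ht

end Nets

/-! ### Bialgebra homomorphisms from extensions -/

section ExtensionHom

variable {α β : Type} [MeasureSpace α] [MeasureSpace β]
  [SigmaFinite (volume : Measure α)] [SigmaFinite (volume : Measure β)]
  {B : NonUnitalStarSubalgebra ℂ (Op (L2 α))} {C : NonUnitalStarSubalgebra ℂ (Op (L2 β))}
  {θ : Op (L2 α) →ₗ[ℂ] Op (L2 β)} {Θ : Op (L2 (α × α)) →⋆ₐ[ℂ] Op (L2 (β × β))}

theorem IsExtension.mem_multiplier (h : IsExtension B C θ Θ)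
    (hstar : ∀ a, star (θ a) = θ (star a)) {b : Op (L2 α)} (hb : b ∈ B) : θ b ∈ multiplier C :=
  mem_multiplier_of_left (h.mul_mem b hb) (by rw [hstar]; exact h.mul_mem _ (star_mem hb))

/-- The homomorphism `B → M(C)` given by `θ`. -/
noncomputable def IsExtension.hom (h : IsExtension B C θ Θ) (hmul : ∀ a b, θ (a * b) = θ a * θ b)
    (hstar : ∀ a, star (θ a) = θ (star a)) : B →⋆ₙₐ[ℂ] multiplier C where
  toFun b := ⟨θ b, h.mem_multiplier hstar b.2⟩
  map_smul' c b := Subtype.ext (map_smul θ c (b : Op (L2 α)))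
  map_zero' := Subtype.ext (map_zero θ)
  map_add' a b := Subtype.ext (map_add θ (a : Op (L2 α)) b)
  map_mul' a b := Subtype.ext (hmul a b)
  map_star' a := Subtype.ext (hstar a).symm

theorem IsExtension.isBialgebraHom (h : IsExtension B C θ Θ)
    (hmul : ∀ a b, θ (a * b) = θ a * θ b) (hstar : ∀ a, star (θ a) = θ (star a))
    {δB : Op (L2 α) → Op (L2 (α × α))} {δC : Op (L2 β) → Op (L2 (β × β))}
    (hδ : ∀ b ∈ B, δB b ∈ multiplier (minTensor B B)) (hcomm : ∀ b ∈ B, δC (θ b) = Θ (δB b)) :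
    IsBialgebraHom δB δC (h.hom hmul hstar) h.multiplierHom where
  nondegenerate c hc := by
    have := h.nondegenerate c hc
    rw [show {x | ∃ b ∈ B, ∃ d ∈ C, x = θ b * d} = {x | ∃ (b : B) (d : C),
      x = (h.hom hmul hstar b : Op (L2 β)) * (d : Op (L2 β))} from Set.ext fun x =>
      ⟨fun ⟨b, hb, d, hd, e⟩ => ⟨⟨b, hb⟩, ⟨d, hd⟩, e⟩, fun ⟨b, d, e⟩ => ⟨b, b.2, d, d.2, e⟩⟩]
      at this
    exact this
  extension b b' _ := h.apply b b'
  comul b := ⟨hδ b b.2, (hcomm b b.2).symm⟩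

end ExtensionHom

/-! ### Assembly of the main theorem -/

section Main

variable {n : ℕ} {lam : ℝ}

/-- Nondegeneracy comes from an approximate unit `u` of `A`: the element `π(S) π'(T)` is the limit
of `π(u) π(S) π'(T)`. -/
theorem isExtension_piA : IsExtension (algA n lam) (algD n lam) (piA n lam) (ampA n lam) where
  isClosed_dom := isClosed_cstarGen _
  isClosed_cod := isClosed_cstarGen _
  mul_mem b hb c hc := mem_algD_iff.2 (piA_mul_mem (mem_algA_iff.1 hb) (mem_algD_iff.1 hc))
  nondegenerate c hc := by
    refine clSpan_le (isClosed_clSpan _) ?_ (mem_algD_iff.1 hc)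
    rintro x ⟨S, hS, T, hT, rfl⟩
    obtain ⟨l, hl, h1, h2⟩ := exists_approxUnit (C := algA n lam) (isClosed_cstarGen _)
    have hlim := (((continuous_piA n lam).tendsto S).comp
      (h2 S (mem_algA_iff.2 (subset_clSpan _ hS))).1).mul_const (piB n T)
    refine (isClosed_clSpan _).mem_of_tendsto hlim ?_
    filter_upwards [h1] with u hu
    rw [Function.comp_apply, piA_mul, mul_assoc]
    exact subset_clSpan _ ⟨u, hu.1, _, mem_algD_iff.2 (subset_clSpan _ ⟨S, hS, T, hT, rfl⟩), rfl⟩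
  apply := ampA_opTensor n lam

/-- The generators of `A_D` carry `π'` on the right. Taking adjoints puts it on the left, and an
approximate unit of `Â^op` then works as it does for `π`. -/
theorem isExtension_piB : IsExtension (algB n lam) (algD n lam) (piB n) (ampB n) where
  isClosed_dom := isClosed_cstarGen _
  isClosed_cod := isClosed_cstarGen _
  mul_mem b hb c hc := by
    rw [← star_star (piB n b * c), star_mul, star_piB]
    exact star_mem (mem_algD_iff.2 (mul_piB_mem (mem_algB_iff.1 (star_mem hb))
      (mem_algD_iff.1 (star_mem hc))))
  nondegenerate c hc := by
    rw [← star_star c]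
    refine clSpan_star_mem (isClosed_clSpan _) (mem_algD_iff.1 (star_mem hc)) ?_
    rintro x ⟨S, hS, T, hT, rfl⟩
    rw [star_mul, star_piA, star_piB]
    have hS' := clSpan_star_mem (isClosed_clSpan _) (subset_clSpan _ hS)
      fun x hx => genA_star_mem hx
    have hT' := clSpan_star_mem (isClosed_clSpan _) (subset_clSpan _ hT)
      fun x hx => genB_star_mem hx
    obtain ⟨l, hl, h1, h2⟩ := exists_approxUnit (C := algB n lam) (isClosed_cstarGen _)
    have hlim := (((continuous_piB n).tendsto (star T)).comp
      (h2 _ (mem_algB_iff.2 hT')).1).mul_const (piA n lam (star S))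
    refine (isClosed_clSpan _).mem_of_tendsto hlim ?_
    filter_upwards [h1] with u hu
    rw [Function.comp_apply, piB_mul, mul_assoc]
    exact subset_clSpan _ ⟨u, hu.1, _, mem_algD_iff.2 (piB_mul_piA_mem_clSpan hS' hT'), rfl⟩
  apply := ampB_opTensor n

theorem exists_LRep_eq {S : Op (L2 (Pt n))} (hS : S ∈ genA n lam) : ∃ f, LRep n lam f = S := by
  obtain ⟨u, hu, hS⟩ := hS
  obtain ⟨f, hf⟩ := hu.exists_funAlg
  exact ⟨f, (isInt_LRep f).unique (hS.congr (fun _ _ => rfl) fun _ _ => by rw [hf])⟩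

theorem exists_lamRep_eq {S : Op (L2 (Pt n))} (hS : S ∈ genB n lam) : ∃ f, lamRep n lam f = S := by
  obtain ⟨u, hu, hS⟩ := hS
  obtain ⟨f, hf⟩ := hu.exists_funAlg
  exact ⟨f, (isInt_lamRep f).unique (hS.congr (fun _ _ => rfl) fun _ _ => by
    simp only [kerB, hf])⟩

/-- The absence of a twist: `π'(λ_φ) π(L_f) ⊗ π'(λ_φ') π(L_f')` factors directly as a product of two
elementary tensors, so no `π` has to be moved past a `π'`. -/
theorem tensorRep_bigPi (t s : funAlg n ⊗[ℂ] funAlg n) :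
    tensorRep (bigPi n lam) (bigPi n lam)
      (TensorProduct.tensorTensorTensorComm ℂ _ _ _ _ (t ⊗ₜ[ℂ] s)) =
    ampB n (tensorRep (lamRep n lam) (lamRep n lam) t) *
      ampA n lam (tensorRep (LRep n lam) (LRep n lam) s) := by
  induction t using TensorProduct.induction_on with
  | zero => simp
  | add t t' h h' => simp only [TensorProduct.add_tmul, map_add, h, h', add_mul]
  | tmul φ φ' =>
    induction s using TensorProduct.induction_on with
    | zero => simp
    | add s s' h h' => simp only [TensorProduct.tmul_add, map_add, h, h', mul_add]
    | tmul f f' =>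
      rw [TensorProduct.tensorTensorTensorComm_tmul]
      change opTensor (piB n (lamRep n lam φ) * piA n lam (LRep n lam f))
        (piB n (lamRep n lam φ') * piA n lam (LRep n lam f')) =
        ampB n (opTensor (lamRep n lam φ) (lamRep n lam φ')) *
          ampA n lam (opTensor (LRep n lam f) (LRep n lam f'))
      rw [ampA_opTensor, ampB_opTensor, opTensor_mul]

theorem comulD_bigPi (φ f : funAlg n) : comulD n lam (bigPi n lam (φ ⊗ₜ[ℂ] f)) =
    ampB n (comulB n lam (lamRep n lam φ)) * ampA n lam (comulA n lam (LRep n lam f)) := by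
  rw [← comulD_piA (LRep_mem f), ← comulD_piB (lam := lam), ← comulD_mul]
  rfl

end Main

end QDouble

theorem mainTheorem9 (n : ℕ) (lam : ℝ) :
    ∃ (p : algA n lam →⋆ₙₐ[ℂ] multiplier (algD n lam))
      (p' : algB n lam →⋆ₙₐ[ℂ] multiplier (algD n lam))
      (P : multiplier (minTensor (algA n lam) (algA n lam)) →⋆ₐ[ℂ]
        multiplier (minTensor (algD n lam) (algD n lam)))
      (P' : multiplier (minTensor (algB n lam) (algB n lam)) →⋆ₐ[ℂ]
        multiplier (minTensor (algD n lam) (algD n lam))),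
      -- `p` and `p'` are the maps `π` and `π'`
      (∀ a, (p a : Op (L2 (Pt n × Pt n))) =
        piA n lam a) ∧
      (∀ b, (p' b : Op (L2 (Pt n × Pt n))) =
        piB n b) ∧
      -- they are C*-bialgebra homomorphisms, and `P = π ⊗ π`, `P' = π' ⊗ π'`
      IsBialgebraHom (comulA n lam) (comulD n lam) p P ∧
      IsBialgebraHom (comulB n lam) (comulD n lam) p' P' ∧
      ∀ φ f : funAlg n,
        lamRep n lam φ ∈ algB n lam ∧ LRep n lam f ∈ algA n lam ∧
        ∃ (hφ : comulB n lam (lamRep n lam φ) ∈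
            multiplier (minTensor (algB n lam) (algB n lam)))
          (hf : comulA n lam (LRep n lam f) ∈
            multiplier (minTensor (algA n lam) (algA n lam))),
          -- `Δ_D(Π(φ ⊗ f)) = (π' ⊗ π')(Δ̂φ) (π ⊗ π)(Δf)`
          comulD n lam (bigPi n lam (φ ⊗ₜ[ℂ] f)) =
            (P' ⟨_, hφ⟩ * P ⟨_, hf⟩ :
              multiplier (minTensor (algD n lam) (algD n lam))) ∧
          -- `Δ_D(Π(φ ⊗ f)) = (Π ⊗ Π)(∑ φ₍₁₎ ⊗ f₍₁₎ ⊗ φ₍₂₎ ⊗ f₍₂₎)`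
          (∃ (ι : Type) (l : Filter ι) (t s : ι → funAlg n ⊗[ℂ] funAlg n),
            l.NeBot ∧
            IsSweedlerNet (lamRep n lam)
              (minTensor (algB n lam) (algB n lam))
              (comulB n lam (lamRep n lam φ)) l t ∧
            IsSweedlerNet (LRep n lam)
              (minTensor (algA n lam) (algA n lam))
              (comulA n lam (LRep n lam f)) l s) ∧
          ∀ (ι : Type) (l : Filter ι) (t s : ι → funAlg n ⊗[ℂ] funAlg n),
            IsSweedlerNet (lamRep n lam)
              (minTensor (algB n lam) (algB n lam))
              (comulB n lam (lamRep n lam φ)) l t →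
            IsSweedlerNet (LRep n lam)
              (minTensor (algA n lam) (algA n lam))
              (comulA n lam (LRep n lam f)) l s →
            StrictTendsto
              (minTensor (algD n lam) (algD n lam))
              (fun i => tensorRep (bigPi n lam) (bigPi n lam)
                (TensorProduct.tensorTensorTensorComm ℂ _ _ _ _ (t i ⊗ₜ[ℂ] s i))) l
              (comulD n lam (bigPi n lam (φ ⊗ₜ[ℂ] f))) := by
  have hA := isExtension_piA (n := n) (lam := lam)
  have hB := isExtension_piB (n := n) (lam := lam)
  refine ⟨hA.hom (piA_mul n lam) (star_piA n lam), hB.hom (piB_mul n) (star_piB n),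
    hA.multiplierHom, hB.multiplierHom, fun _ => rfl, fun _ => rfl,
    hA.isBialgebraHom _ _ (fun _ => comulA_mem) (fun _ => comulD_piA),
    hB.isBialgebraHom _ _ (fun _ => comulB_mem) (fun b _ => comulD_piB b), fun φ f => ?_⟩
  have hφ := comulB_mem (lamRep_mem (lam := lam) φ)
  have hf := comulA_mem (LRep_mem (lam := lam) f)
  refine ⟨lamRep_mem φ, LRep_mem f, hφ, hf, comulD_bigPi φ f, ?_, ?_⟩
  · obtain ⟨ι, l, t, hl, ht⟩ := exists_isSweedlerNet (R := lamRep n lam) (isClosed_minTensor _ _)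
      (fun c hc ε hε => exists_tensorRep_near mem_algB_iff (fun _ => exists_lamRep_eq) hc hε) hφ
    obtain ⟨κ, k, s, hk, hs⟩ := exists_isSweedlerNet (R := LRep n lam) (isClosed_minTensor _ _)
      (fun c hc ε hε => exists_tensorRep_near mem_algA_iff (fun _ => exists_LRep_eq) hc hε) hf
    -- The two nets have unrelated index sets; the product filter gives them a common one.
    exact ⟨ι × κ, l ×ˢ k, _, _, inferInstance, ht.comp tendsto_fst, hs.comp tendsto_snd⟩
  · intro ι l t s ht hs
    obtain ⟨K, hK⟩ := ht.bounded
    obtain ⟨K', hK'⟩ := hs.bounded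
    rw [comulD_bigPi]
    simp only [tensorRep_bigPi]
    refine (hB.strictTendsto ht.tendsto hK).mul (hA.strictTendsto hs.tendsto hK')
      (K := max K K') ?_ ?_ (hB.map_mem_multiplier hφ) (hA.map_mem_multiplier hf)
    · filter_upwards [hK] with i hi
      exact (IsExtension.norm_map_le _ _).trans (hi.trans (le_max_left _ _))
    · filter_upwards [hK'] with i hi
      exact (IsExtension.norm_map_le _ _).trans (hi.trans (le_max_right _ _))
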